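/- Let $K$ be an algebraically closed field of characteristic $2$. **Triangulation quivers.** A triangulation quiver $(Q,f)$ is a finite connected quiver $Q=(Q_0,Q_1,s,t)$ with at least two vertices, such that every vertex is the source of exactly two arrows and the target of exactly two arrows, together with a permutation $f$ of $Q_1$ with $t(\alpha)=s(f(\alpha))$ for all $\alpha\in Q_1$ and $f^3=\mathrm{id}$. (These are exactly the quivers attached to directed triangulated compact connected surfaces, with or without boundary.) For $\alpha\in Q_1$ let $\bar\alpha\ne\alpha$ be the other arrow with source $s(\alpha)$, let $g(\alpha)=\overline{f(\alpha)}$, and let $n_\alpha$ be the size of the $g$-orbit of $\alpha$. A weight function $m_\bullet$ and a parameter function $c_\bullet$ assign to each $g$-orbit a positive integer and a non-zero element of $K$; write $m_\alpha, c_\alpha$ for the values at the orbit of $\alpha$. The arrow $\alpha$ is virtual if $m_\alpha n_\alpha=2$. It is required that $m_\alpha n_\alpha\ge 2$ for all $\alpha$, that $m_\alpha n_\alpha\ge 3$ if $\bar\alpha$ is virtual and not a loop, and that $m_\alpha n_\alpha\ge 4$ if $\bar\alpha$ is a virtual loop. A border loop is an arrow $\alpha$ with $f(\alpha)=\alpha$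 (it is a loop); the border $\partial(Q,f)$ is the set of vertices $s(\alpha)$ of border loops $\alpha$, and a border function is a map $b_\bullet:\partial(Q,f)\to K$. **The algebras.** Paths are written from left to right. Put $A_\alpha=\alpha g(\alpha)\cdots g^{m_\alpha n_\alpha-2}(\alpha)$ and $B_\alpha=\alpha g(\alpha)\cdots g^{m_\alpha n_\alpha-1}(\alpha)$. The algebra $\Lambda(Q,f,m_\bullet,c_\bullet,b_\bullet)$ is the quotient of the path algebra $KQ$ by the ideal generated by: 1. $\alpha f(\alpha)-c_{\bar\alpha}A_{\bar\alpha}$ for all arrows $\alpha$ that are not border loops; 2. $\alpha^2-c_{\bar\alpha}A_{\bar\alpha}-b_{s(\alpha)}B_{\bar\alpha}$ for all border loops $\alpha$; 3. $\alpha f(\alpha)g(f(\alpha))$ for all arrows $\alpha$, except if $f^2(\alpha)$ is virtual, or $f(\bar\alpha)$ is virtual and $m_{\bar\alpha}=1$, $n_{\bar\alpha}=3$; 4. $\alpha g(\alpha)f(g(\alpha))$ for all arrows $\alpha$, except if $f(\alpha)$ is virtual, or $f^2(\alpha)$ is virtual and $m_{f(\alpha)}=1$, $n_{f(\alpha)}=3$.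 If the border is non-empty, this is called a socle deformed weighted surface algebra. A weighted surface algebra is an algebra $\Lambda(Q,f,m_\bullet,c_\bullet)=\Lambda(Q,f,m_\bullet,c_\bullet,0)$, for any triangulation quiver $(Q,f)$ (the border may be empty) and any such $m_\bullet,c_\bullet$. For an integer $t\ge 4$ and $b\in K$ let $Q(2\mathcal B)_3^t(b)$ be the quotient of the path algebra of the quiver with vertices $1,2$, loops $\alpha$ at $1$ and $\eta$ at $2$, and arrows $\beta:1\to 2$, $\gamma:2\to 1$, by the relations $$\alpha\beta=\beta\eta,\quad \eta\gamma=\gamma\alpha,\quad \alpha^2=\beta\gamma+b\alpha^3,\quad \gamma\beta=\eta^{t-1},\quad \alpha^4=0,\quad \eta^{t+1}=0,\quad \gamma\alpha^2=0,\quad \alpha^2\beta=0.$$ **Theorem.** Let $\Lambda=\Lambda(Q,f,m_\bullet,c_\bullet,b_\bullet)$ be a socle deformed weighted surface algebra over $K$ with $b_\bullet\neq 0$. All isomorphisms are isomorphisms of $K$-algebras. (i) If $|Q_0|\ge 3$, then $\Lambda$ is not isomorphic to any weighted surface algebra. (ii) If $|Q_0|=2$, then $\Lambda$ is isomorphic to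 a weighted surface algebra if and only if $\Lambda\cong Q(2\mathcal B)_3^t(b)$ for some even $t\ge 4$ and some $b\in K\setminus\{0\}$. -/

import Mathlib

/-! ## Path algebras -/

/-- The defining relations of the path algebra of the quiver with vertices `V`, arrows `E`, sources
`src` and targets `tgt`: the vertices are pairwise orthogonal idempotents with sum `1`, and an arrow
`a` satisfies `e_{src a} a = a = a e_{tgt a}`. Paths are written from left to right. -/
inductive PathRel (K : Type*) [Field K] {V E : Type*} [Fintype V] (src tgt : E → V) :
    FreeAlgebra K (V ⊕ E) → FreeAlgebra K (V ⊕ E) → Prop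
  | idem (v : V) : PathRel K src tgt
      (FreeAlgebra.ι K (Sum.inl v) * FreeAlgebra.ι K (Sum.inl v)) (FreeAlgebra.ι K (Sum.inl v))
  | orth (u v : V) (h : u ≠ v) : PathRel K src tgt
      (FreeAlgebra.ι K (Sum.inl u) * FreeAlgebra.ι K (Sum.inl v)) 0
  | one : PathRel K src tgt (∑ v : V, FreeAlgebra.ι K (Sum.inl v)) 1
  | source (a : E) : PathRel K src tgt
      (FreeAlgebra.ι K (Sum.inl (src a)) * FreeAlgebra.ι K (Sum.inr a)) (FreeAlgebra.ι K (Sum.inr a))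
  | target (a : E) : PathRel K src tgt
      (FreeAlgebra.ι K (Sum.inr a) * FreeAlgebra.ι K (Sum.inl (tgt a))) (FreeAlgebra.ι K (Sum.inr a))

/-- The path algebra `K Q` of a quiver with finitely many vertices. -/
abbrev PathAlgebra (K : Type*) [Field K] {V E : Type*} [Fintype V] (src tgt : E → V) :=
  RingQuot (PathRel K src tgt)

/-- The arrow `a` as an element of the path algebra. -/
noncomputable def PathAlgebra.arrow (K : Type*) [Field K] {V E : Type*} [Fintype V]
    (src tgt : E → V) (a : E) : PathAlgebra K src tgt :=
  RingQuot.mkAlgHom K (PathRel K src tgt) (FreeAlgebra.ι K (Sum.inr a))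

/-! ## Triangulation quivers -/

/-- A triangulation quiver: a connected 2-regular quiver with at least two vertices (finiteness
of the set of vertices is assumed where it is used, and then there are finitely many arrows),
with a permutation `f` of the arrows such that `f a` starts where `a` ends and `f ^ 3 = 1`. -/
structure TriangulationQuiver (V E : Type*) where
  src : E → V
  tgt : E → V
  two_out : ∀ v, {a | src a = v}.ncard = 2
  two_in : ∀ v, {a | tgt a = v}.ncard = 2
  connected : ∀ u v, Relation.EqvGen (fun x y => ∃ a, src a = x ∧ tgt a = y) u v
  two_vertices : ∃ u v : V, u ≠ v
  f : Equiv.Perm E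
  src_f : ∀ a, src (f a) = tgt a
  f_cubed : f ^ 3 = 1

namespace TriangulationQuiver

theorem exists_bar {V E : Type*} (Q : TriangulationQuiver V E) (a : E) :
    ∃ b, b ≠ a ∧ Q.src b = Q.src a := by
  obtain ⟨x, y, hxy, h⟩ := Set.ncard_eq_two.mp (Q.two_out (Q.src a))
  have hx : x ∈ {c | Q.src c = Q.src a} := by rw [h]; simp
  have hy : y ∈ {c | Q.src c = Q.src a} := by rw [h]; simp
  by_cases hax : x = a
  · exact ⟨y, fun hya => hxy (hax.trans hya.symm), hy⟩
  · exact ⟨x, hax, hx⟩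

/-- `bar a` is the arrow different from `a` with the same source (unique by 2-regularity). -/
noncomputable def bar {V E : Type*} (Q : TriangulationQuiver V E) (a : E) : E :=
  Classical.choose (Q.exists_bar a)

theorem bar_ne {V E : Type*} (Q : TriangulationQuiver V E) (a : E) : Q.bar a ≠ a :=
  (Classical.choose_spec (Q.exists_bar a)).1

theorem src_bar {V E : Type*} (Q : TriangulationQuiver V E) (a : E) :
    Q.src (Q.bar a) = Q.src a :=
  (Classical.choose_spec (Q.exists_bar a)).2

/-- The permutation `g` of the arrows: `g a` is the arrow other than `f a` that starts where
`a` ends. -/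
noncomputable def g {V E : Type*} (Q : TriangulationQuiver V E) (a : E) : E :=
  Q.bar (Q.f a)

/-- The length `n_a` of the `g`-orbit of `a`. -/
noncomputable def n {V E : Type*} (Q : TriangulationQuiver V E) (a : E) : ℕ :=
  Function.minimalPeriod Q.g a

/-- A weight function: a positive integer for each `g`-orbit of arrows (that is, a function of
arrows invariant under `g`), subject to the three lower bounds on `m_a n_a`. -/
structure WeightFunction {V E : Type*} (Q : TriangulationQuiver V E) where
  m : E → ℕ
  m_g : ∀ a, m (Q.g a) = m a
  m_pos : ∀ a, 0 < m a
  two_le : ∀ a, 2 ≤ m a * Q.n a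
  three_le : ∀ a, m (Q.bar a) * Q.n (Q.bar a) = 2 → Q.src (Q.bar a) ≠ Q.tgt (Q.bar a) →
    3 ≤ m a * Q.n a
  four_le : ∀ a, m (Q.bar a) * Q.n (Q.bar a) = 2 → Q.src (Q.bar a) = Q.tgt (Q.bar a) →
    4 ≤ m a * Q.n a

/-- A parameter function: a non-zero scalar for each `g`-orbit of arrows. -/
structure ParameterFunction {V E : Type*} (Q : TriangulationQuiver V E)
    (K : Type*) [Field K] where
  c : E → K
  c_g : ∀ a, c (Q.g a) = c a
  c_ne : ∀ a, c a ≠ 0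

/-- The border: the sources of the border loops, i.e. of the arrows fixed by `f`
(these are loops, as `src a = src (f a) = tgt a`). -/
def border {V E : Type*} (Q : TriangulationQuiver V E) : Set V :=
  {v | ∃ a, Q.f a = a ∧ Q.src a = v}

/-- An arrow `a` is virtual if `m_a n_a = 2`. -/
def Virtual {V E : Type*} (Q : TriangulationQuiver V E) (w : Q.WeightFunction) (a : E) : Prop :=
  w.m a * Q.n a = 2

section Algebra

variable (K : Type*) [Field K] {V E : Type*} [Fintype V] (Q : TriangulationQuiver V E)

/-- The arrow `a` in the path algebra `K Q`. -/
noncomputable def x (a : E) : PathAlgebra K Q.src Q.tgt :=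
  PathAlgebra.arrow K Q.src Q.tgt a

/-- The path `a (g a) (g² a) ⋯` of length `l` along the `g`-orbit of `a`. -/
noncomputable def gPath (a : E) (l : ℕ) : PathAlgebra K Q.src Q.tgt :=
  ((List.range l).map fun i => Q.x K (Q.g^[i] a)).prod

/-- The path `A_a` of length `m_a n_a - 1` along the `g`-orbit of `a`
(here `m_a n_a ≥ 2`). -/
noncomputable def pathA (w : Q.WeightFunction) (a : E) : PathAlgebra K Q.src Q.tgt :=
  Q.gPath K a (w.m a * Q.n a - 1)

/-- The path `B_a` of length `m_a n_a` along the `g`-orbit of `a`. -/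
noncomputable def pathB (w : Q.WeightFunction) (a : E) : PathAlgebra K Q.src Q.tgt :=
  Q.gPath K a (w.m a * Q.n a)

variable {K}

/-- The relations that define the socle deformed weighted surface algebra; the ideal is generated
by the differences of the two sides. -/
inductive DeformedRel (w : Q.WeightFunction) (c : Q.ParameterFunction K) (b : Q.border → K) :
    PathAlgebra K Q.src Q.tgt → PathAlgebra K Q.src Q.tgt → Prop
  | triangle (a : E) (h : Q.f a ≠ a) : DeformedRel w c b
      (Q.x K a * Q.x K (Q.f a)) (c.c (Q.bar a) • Q.pathA K w (Q.bar a))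
  | loop (a : E) (h : Q.f a = a) : DeformedRel w c b
      (Q.x K a * Q.x K a)
      (c.c (Q.bar a) • Q.pathA K w (Q.bar a) +
        b ⟨Q.src a, a, h, rfl⟩ • Q.pathB K w (Q.bar a))
  | zero_fg (a : E)
      (h : ¬ (Q.Virtual w (Q.f (Q.f a)) ∨
        (Q.Virtual w (Q.f (Q.bar a)) ∧ w.m (Q.bar a) = 1 ∧ Q.n (Q.bar a) = 3))) :
      DeformedRel w c b (Q.x K a * Q.x K (Q.f a) * Q.x K (Q.g (Q.f a))) 0
  | zero_gf (a : E)
      (h : ¬ (Q.Virtual w (Q.f a) ∨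
        (Q.Virtual w (Q.f (Q.f a)) ∧ w.m (Q.f a) = 1 ∧ Q.n (Q.f a) = 3))) :
      DeformedRel w c b (Q.x K a * Q.x K (Q.g a) * Q.x K (Q.f (Q.g a))) 0

/-- The socle deformed weighted surface algebra `Λ(Q, f, m, c, b)`. -/
abbrev DeformedAlgebra (w : Q.WeightFunction) (c : Q.ParameterFunction K) (b : Q.border → K) :=
  RingQuot (DeformedRel Q w c b)

end Algebra

end TriangulationQuiver

/-- `A` is isomorphic, as a `K`-algebra, to a weighted surface algebra
`Λ(Q, f, m, c) = Λ(Q, f, m, c, 0)`. Since the quivers are finite, those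
with vertices and arrows in `Type` represent all of them up to isomorphism. -/
def IsWeightedSurfaceAlgebra (K : Type*) [Field K] (A : Type*) [Ring A] [Algebra K A] : Prop :=
  ∃ (V E : Type) (_ : Fintype V) (Q : TriangulationQuiver V E) (w : Q.WeightFunction)
    (c : Q.ParameterFunction K), Nonempty (A ≃ₐ[K] Q.DeformedAlgebra w c 0)

/-! ## The algebras `Q(2B)₃ᵗ(b)` -/

/-- The arrows of the quiver with vertices `0`, `1`, a loop `α` at `0`, arrows
`β : 0 → 1` and `γ : 1 → 0`, and a loop `η` at `1`. -/
inductive TwoBArrow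
  | α
  | β
  | γ
  | η

namespace TwoBArrow

def src : TwoBArrow → Fin 2
  | α => 0
  | β => 0
  | γ => 1
  | η => 1

def tgt : TwoBArrow → Fin 2
  | α => 0
  | β => 1
  | γ => 0
  | η => 1

/-- An arrow as an element of the path algebra. -/
noncomputable def x (K : Type*) [Field K] (a : TwoBArrow) : PathAlgebra K src tgt :=
  PathAlgebra.arrow K src tgt a

end TwoBArrow

open TwoBArrow in
/-- The defining relations of `Q(2B)₃ᵗ(b)`. -/
inductive TwoBRel (K : Type*) [Field K] (t : ℕ) (b : K) :
    PathAlgebra K TwoBArrow.src TwoBArrow.tgt → PathAlgebra K TwoBArrow.src TwoBArrow.tgt → Prop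
  | r1 : TwoBRel K t b (x K α * x K β) (x K β * x K η)
  | r2 : TwoBRel K t b (x K η * x K γ) (x K γ * x K α)
  | r3 : TwoBRel K t b (x K α ^ 2) (x K β * x K γ + b • x K α ^ 3)
  | r4 : TwoBRel K t b (x K γ * x K β) (x K η ^ (t - 1))
  | r5 : TwoBRel K t b (x K α ^ 4) 0
  | r6 : TwoBRel K t b (x K η ^ (t + 1)) 0
  | r7 : TwoBRel K t b (x K γ * x K α ^ 2) 0
  | r8 : TwoBRel K t b (x K α ^ 2 * x K β) 0

/-- The algebra `Q(2B)₃ᵗ(b) = Q(2B)₃ᵗ(1, b)`, used for `t ≥ 4`. -/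
abbrev TwoBAlgebra (K : Type*) [Field K] (t : ℕ) (b : K) := RingQuot (TwoBRel K t b)

/-! The border function is read off a symmetric trace form. Every algebra `Λ` of the theorem carries
a linear form `τ` with `τ (y z) = τ (z y)` and explicit values on paths (`traceWord`): `c_a⁻¹` on
`B_a`, `1` on the triangles `a · f a · f (f a)`, a few corrections near virtual arrows, and on the
square of a border loop `α` the value `b / c_α`, up to such a correction. It comes from a rotation
invariant function on words that respects the relations, so no basis of `Λ` is needed.

Suppose that `Λ` is isomorphic to an algebra with zero border function. The arrow ideal is the
common kernel of all characters, and characters correspond to vertices. After dividing by the common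
radical of the two trace forms, which makes the arrow ideal nilpotent, and conjugating by a unit,
there is one algebra with two presentations that share their idempotents and their arrow ideal `J`
(`exists_pair_of_algEquiv`). At the vertex of a border loop `α` the second presentation has a loop
`ρ = a α + j` with `a ≠ 0` and `j ∈ J²` (`Compatible.exists_loopPair`).

Let `ρ` be a border loop. Its square annihilates `J²`. In characteristic two `τ (α j) + τ (j α) =
0`, and if `4 ≤ m_α n_α` the vanishing of `τ` on `ρ² J²` forces `τ (j²) = 0`
(`TraceModel.τ_sq_of_leading`; the computation takes place in matrices over `K[X]` that record
motion along `g`-orbits). Hence `τ (ρ²) = a² τ (α²)`. On the other hand `ρ²` is a multiple of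
`A_{bar ρ}`, and a rotation of this path vanishes, so every trace form kills `ρ²`
(`trace_p_border_border_eq_zero`). Therefore `b` vanishes at `α`. In one exceptional configuration,
a pentagon around `α`, both traces carry a correction; the pentagon is visible in both presentations
and the corrections agree (`Compatible.pent_border`).

There remains `m_α n_α = 3`, which is also forced when `ρ` is not a border loop
(`LoopPair.len_eq_three`). Then the quiver has two vertices, which gives (i). Let `t` be the weight
of the other loop `η`. For odd `t` all paths `B_a` have odd length, so on `J` the form `τ (y²)` is
the square of the `α`-coefficient of `y` times `b / c_α`; the second presentation provides an
element with non-zero `α`-coefficient whose square has trace zero, so `b` vanishes again. For even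
`t`, rescaling identifies `Λ` with some `Q(2B)₃ᵗ(b')`, where `b' ≠ 0`. Conversely, for even `t` the
substitution `η ↦ η + s η²`, `β ↦ β + s βη` removes `b'`, and `Q(2B)₃ᵗ(0)` is the weighted surface
algebra of a disc (`TwoBAlgebra.nonempty_algEquiv_zero`, `TwoBAlgebra.nonempty_algEquiv_disc`). -/

set_option linter.unusedSectionVars false

namespace TriangulationQuiver

/-! ### Combinatorics of triangulation quivers, `g`-orbits and weights -/

section Combinatorics

variable {V E : Type*} (Q : TriangulationQuiver V E)

theorem eq_or_eq_bar {a b : E} (h : Q.src b = Q.src a) : b = a ∨ b = Q.bar a := by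
  obtain ⟨x, y, hxy, hs⟩ := Set.ncard_eq_two.mp (Q.two_out (Q.src a))
  have h1 : a ∈ ({x, y} : Set E) := by rw [← hs]; rfl
  have h2 : b ∈ ({x, y} : Set E) := by rw [← hs]; exact h
  have h3 : Q.bar a ∈ ({x, y} : Set E) := by rw [← hs]; exact Q.src_bar a
  have h4 := Q.bar_ne a
  simp only [Set.mem_insert_iff, Set.mem_singleton_iff] at h1 h2 h3
  grind

theorem bar_bar (a : E) : Q.bar (Q.bar a) = a := by
  have h := Q.eq_or_eq_bar (a := a) (b := Q.bar (Q.bar a)) (by rw [src_bar, src_bar])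
  have := Q.bar_ne (Q.bar a)
  tauto

theorem f_f_f (a : E) : Q.f (Q.f (Q.f a)) = a := by
  have := congrArg (fun p : Equiv.Perm E => p a) Q.f_cubed
  simpa [pow_succ] using this

theorem g_def (a : E) : Q.g a = Q.bar (Q.f a) := rfl

theorem bar_g (a : E) : Q.bar (Q.g a) = Q.f a := Q.bar_bar _

theorem g_f_f (a : E) : Q.g (Q.f (Q.f a)) = Q.bar a := by rw [g_def, f_f_f]

theorem g_ne_f (a : E) : Q.g a ≠ Q.f a := Q.bar_ne _

theorem src_g (a : E) : Q.src (Q.g a) = Q.tgt a := by rw [g_def, src_bar, src_f]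

theorem g_injective : Function.Injective Q.g := fun a b h => by
  have : Q.f a = Q.f b := by rw [← bar_g, ← bar_g, h]
  exact Q.f.injective this

theorem tgt_f_f (a : E) : Q.tgt (Q.f (Q.f a)) = Q.src a := by rw [← src_f, f_f_f]

theorem tgt_eq_of_f_eq {a : E} (h : Q.f a = a) : Q.tgt a = Q.src a := by rw [← src_f, h]

theorem loop_cases {a : E} (h : Q.tgt a = Q.src a) : Q.f a = a ∨ Q.g a = a := by
  rcases Q.eq_or_eq_bar (a := a) (b := Q.f a) (by rw [src_f, h]) with h1 | h1
  · exact .inl h1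
  · right; rw [g_def, h1, bar_bar]

theorem in_cases {a b : E} (h : Q.tgt b = Q.tgt a) : b = a ∨ Q.g b = Q.f a := by
  rcases Q.eq_or_eq_bar (a := Q.f a) (b := Q.f b) (by rw [src_f, src_f, h]) with h1 | h1
  · exact .inl (Q.f.injective h1)
  · right; rw [g_def, h1, bar_bar]

/-- If both arrows starting at a vertex are loops, then there is only one vertex. -/
theorem not_both_loops (a : E) (h : Q.tgt a = Q.src a) : Q.tgt (Q.bar a) ≠ Q.src a := by
  intro h'
  have hab : ∀ b, Q.src b = Q.src a → Q.tgt b = Q.src a := by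
    intro b hb
    rcases Q.eq_or_eq_bar hb with rfl | rfl <;> assumption
  have hin : ∀ b, Q.tgt b = Q.src a → Q.src b = Q.src a := by
    intro b hb
    rcases Q.in_cases (hb.trans h.symm) with rfl | h1
    · rfl
    · rcases Q.in_cases (hb.trans h'.symm) with rfl | h2
      · exact Q.src_bar a
      · exact absurd (Q.f.injective (h1.symm.trans h2)).symm (Q.bar_ne a)
  have key : ∀ u v, Relation.EqvGen (fun x y => ∃ a, Q.src a = x ∧ Q.tgt a = y) u v →
      (u = Q.src a ↔ v = Q.src a) := by
    intro u v huv
    induction huv with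
    | rel x y hxy =>
      obtain ⟨b, rfl, rfl⟩ := hxy
      exact ⟨hab b, hin b⟩
    | refl x => rfl
    | symm x y _ ih => exact ih.symm
    | trans x y z _ _ ih1 ih2 => exact ih1.trans ih2
  obtain ⟨u, v, huv⟩ := Q.two_vertices
  exact huv (((key (Q.src a) u (Q.connected _ _)).1 rfl).trans
    ((key (Q.src a) v (Q.connected _ _)).1 rfl).symm)

theorem finite_arrows (Q : TriangulationQuiver V E) [Finite V] : Finite E := by
  have : (Set.univ : Set E) = ⋃ v : V, {a | Q.src a = v} := by ext; simp
  rw [← Set.finite_univ_iff, this]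
  exact Set.finite_iUnion fun v => Set.finite_of_ncard_ne_zero (by rw [Q.two_out]; norm_num)

section Orbits

variable [Finite V]

theorem isPeriodic (a : E) : a ∈ Function.periodicPts Q.g := by
  have := Q.finite_arrows
  exact Q.g_injective.mem_periodicPts a

theorem n_pos (a : E) : 0 < Q.n a := Function.minimalPeriod_pos_of_mem_periodicPts (Q.isPeriodic a)

theorem n_g (a : E) : Q.n (Q.g a) = Q.n a := Function.minimalPeriod_apply (Q.isPeriodic a)

theorem g_iterate_n (a : E) : Q.g^[Q.n a] a = a := Function.iterate_minimalPeriod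

theorem g_iterate_eq_iff {a : E} {k : ℕ} : Q.g^[k] a = a ↔ Q.n a ∣ k :=
  Function.isPeriodicPt_iff_minimalPeriod_dvd

variable {Q} (w : Q.WeightFunction)

/-- The length `m_a n_a` of the path `B_a`. -/
noncomputable def WeightFunction.len (a : E) : ℕ := w.m a * Q.n a

theorem WeightFunction.len_g (a : E) : w.len (Q.g a) = w.len a := by
  rw [len, len, w.m_g, Q.n_g]

theorem WeightFunction.len_iterate (a : E) (k : ℕ) : w.len (Q.g^[k] a) = w.len a := by
  induction k with
  | zero => rfl
  | succ k ih => rw [Function.iterate_succ_apply', w.len_g, ih]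

theorem WeightFunction.len_f_f (a : E) : w.len (Q.f (Q.f a)) = w.len (Q.bar a) := by
  rw [← w.len_g, Q.g_f_f]

theorem WeightFunction.two_le_len (a : E) : 2 ≤ w.len a := w.two_le a

theorem WeightFunction.g_iterate_len (a : E) : Q.g^[w.len a] a = a :=
  Q.g_iterate_eq_iff.2 (Dvd.intro_left _ rfl)

/-- The last arrow of `B_a` is the `g`-preimage of `a`; it is the arrow that closes up `A_a`. -/
theorem WeightFunction.g_iterate_len_sub_one (a : E) :
    Q.g^[w.len a - 1] a = Q.f (Q.f (Q.bar a)) := by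
  apply Q.g_injective
  rw [← Function.iterate_succ_apply' Q.g, Nat.succ_eq_add_one,
    Nat.sub_add_cancel (by have := w.two_le_len a; omega), w.g_iterate_len, Q.g_f_f, Q.bar_bar]

theorem WeightFunction.three_le_bar {a : E} (h : w.len a = 2) : 3 ≤ w.len (Q.bar a) := by
  by_cases hl : Q.src a = Q.tgt a
  · have := w.four_le (Q.bar a) (by rwa [Q.bar_bar]) (by rwa [Q.bar_bar])
    unfold len; omega
  · exact w.three_le (Q.bar a) (by rwa [Q.bar_bar]) (by rwa [Q.bar_bar])

theorem WeightFunction.four_le_bar {a : E} (h : w.len a = 2) (hl : Q.tgt a = Q.src a) :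
    4 ≤ w.len (Q.bar a) :=
  w.four_le (Q.bar a) (by rwa [Q.bar_bar]) (by rw [Q.bar_bar, hl])

theorem WeightFunction.g_g_of_len_two {a : E} (h : w.len a = 2) : Q.g (Q.g a) = a := by
  have := w.g_iterate_len a
  rwa [h] at this

theorem n_eq_one_iff {a : E} : Q.n a = 1 ↔ Q.g a = a := Function.minimalPeriod_eq_one_iff_isFixedPt

/-- A shorter orbit would make `bar a` a second border loop at the same vertex, against
connectedness. In particular border loops are never virtual. -/
theorem three_le_n_of_border {a : E} (h : Q.f a = a) : 3 ≤ Q.n a := by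
  have h0 := Q.n_pos a
  have h1 : Q.n a ≠ 1 := by
    rw [Ne, n_eq_one_iff]; exact fun h1 => Q.g_ne_f a (h1.trans h.symm)
  have h2 : Q.n a ≠ 2 := by
    intro h2
    have h3 := Q.g_iterate_n a
    rw [h2] at h3
    change Q.g (Q.g a) = a at h3
    have h5 : Q.g a = Q.bar a := by rw [g_def, h]
    have h6 : Q.f (Q.bar a) = Q.bar a := by
      rw [← h5, ← Q.bar_g, h3]; exact h5.symm
    have h7 := Q.tgt_eq_of_f_eq h6
    rw [Q.src_bar] at h7
    exact Q.not_both_loops a (Q.tgt_eq_of_f_eq h) h7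
  omega

/-- The arrows `f a` and `f (f a)` next to an arrow `a` with `g a = a` lie on a `g`-orbit of length
at least three. -/
theorem three_le_n_f_of_g_eq {a : E} (h : Q.g a = a) : 3 ≤ Q.n (Q.f a) := by
  have h0 := Q.n_pos (Q.f a)
  have hb : Q.bar a = Q.f a := by rw [← Q.bar_g, h]
  have ha : Q.g (Q.f (Q.f a)) = Q.f a := by rw [Q.g_f_f, hb]
  have hfa : Q.f a ≠ a := by rw [← hb]; exact Q.bar_ne a
  have h1 : Q.n (Q.f a) ≠ 1 := by
    rw [Ne, n_eq_one_iff]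
    intro h1
    have := Q.g_injective (h1.trans ha.symm)
    exact hfa (Q.f.injective this).symm
  have h2 : Q.n (Q.f a) ≠ 2 := by
    intro h2
    have h3 := Q.g_iterate_n (Q.f a)
    rw [h2] at h3
    change Q.g (Q.g (Q.f a)) = Q.f a at h3
    have := Q.g_injective (h3.trans ha.symm)
    exact Q.g_ne_f _ this
  omega

theorem WeightFunction.three_le_len_of_border {a : E} (h : Q.f a = a) : 3 ≤ w.len a :=
  (three_le_n_of_border h).trans (Nat.le_mul_of_pos_left _ (w.m_pos a))

theorem WeightFunction.three_le_len_f_of_g_eq {a : E} (h : Q.g a = a) : 3 ≤ w.len (Q.f a) :=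
  (three_le_n_f_of_g_eq h).trans (Nat.le_mul_of_pos_left _ (w.m_pos _))

/-- The condition under which the word `[a, f a, g (f a), g (g (f a))]` is a non-zero element of the
socle: `f (bar a)` is virtual and the `g`-orbit of `bar a` has length three and weight one. -/
def WeightFunction.Pent (a : E) : Prop :=
  w.len (Q.f (Q.bar a)) = 2 ∧ w.m (Q.bar a) = 1 ∧ Q.n (Q.bar a) = 3

variable {w} in
theorem WeightFunction.Pent.len_bar {a : E} (h : w.Pent a) : w.len (Q.bar a) = 3 := by
  rw [len, h.2.1, h.2.2]

theorem WeightFunction.pent_of_len {a : E} (h : w.len (Q.f (Q.bar a)) = 2)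
    (h3 : w.len (Q.bar a) = 3) : w.Pent a := by
  have h1 : Q.n (Q.bar a) ≠ 1 := by
    rw [Ne, n_eq_one_iff]
    intro h1
    have := w.three_le_len_f_of_g_eq h1
    omega
  have h3' : w.m (Q.bar a) * Q.n (Q.bar a) = 3 := h3
  have hn : Q.n (Q.bar a) ∣ 3 := Dvd.intro_left _ h3'
  have : Q.n (Q.bar a) = 3 := by
    rcases (Nat.dvd_prime Nat.prime_three).1 hn with h | h
    · exact absurd h h1
    · exact h
  refine ⟨h, ?_, this⟩
  rw [this] at h3'
  omega

variable {w}

/-- This closes the word `a, f a, g (f a), g (g (f a))` and puts all its letters on one `g`-orbit.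
It follows by walking around the triangles adjacent to the virtual arrow `f (bar a)` and to the
three-element orbit of `bar a`. -/
theorem WeightFunction.Pent.g_g_g {a : E} (h : w.Pent a) : Q.g (Q.g (Q.g (Q.f a))) = a := by
  have h1 := w.g_g_of_len_two h.1
  have h2 := Q.g_iterate_n (Q.bar a)
  rw [h.2.2] at h2
  change Q.g (Q.g (Q.g (Q.bar a))) = _ at h2
  have hf := Q.f_f_f
  have hb := Q.bar_bar
  have hg := Q.g_def
  have hi := Q.f.injective
  have e1 := Q.g_f_f a
  have e2 := Q.g_injective
  -- `f (f a) = g (g (bar a))`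
  have e3 : Q.f (Q.f a) = Q.g (Q.g (Q.bar a)) := by
    apply e2; rw [e1, h2]
  have e4 : Q.g (Q.f a) = Q.f (Q.g (Q.bar a)) := by
    rw [← Q.bar_g (Q.g (Q.bar a)), ← e3]; rfl
  have e5 : Q.g (Q.bar a) = Q.bar (Q.f (Q.bar a)) := rfl
  have e6 : Q.g (Q.f (Q.bar (Q.f (Q.bar a)))) = Q.f (Q.f (Q.bar a)) := by
    apply e2
    have : Q.g (Q.f (Q.bar (Q.f (Q.bar a)))) = Q.bar (Q.f (Q.f (Q.bar (Q.f (Q.bar a))))) := rfl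
    have h7 : Q.f (Q.f (Q.bar (Q.f (Q.bar a)))) = Q.g (Q.f (Q.bar a)) := by
      apply e2; rw [Q.g_f_f, h1, Q.bar_bar]
    rw [this, h7]
    simp [Q.bar_g]
  rw [e4, e5, e6, Q.g_f_f, Q.bar_bar]

/-- For a border loop `a`, the arrow `f (bar a)` would be a virtual loop whose neighbour has `m n =
3`, which the lower bound `4` for neighbours of virtual loops forbids. -/
theorem WeightFunction.Pent.f_ne {a : E} (h : w.Pent a) : Q.f a ≠ a := by
  intro ha
  have h1 : Q.g a = Q.bar a := by rw [g_def, ha]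
  have h2 := Q.g_iterate_n (Q.bar a)
  rw [h.2.2] at h2
  change Q.g (Q.g (Q.g (Q.bar a))) = _ at h2
  have h3 : Q.g (Q.g (Q.bar a)) = a := Q.g_injective (h2.trans h1.symm)
  -- `f (bar a)` is a virtual loop
  have h4 : Q.f (Q.f (Q.bar a)) = Q.g (Q.bar a) := by
    apply Q.g_injective; rw [Q.g_f_f, Q.bar_bar, h3]
  have h5 : Q.tgt (Q.f (Q.bar a)) = Q.src (Q.f (Q.bar a)) := by
    rw [← Q.src_f, h4, Q.src_g, Q.src_f]
  have h6 := w.four_le_bar h.1 h5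
  rw [← Q.g_def, w.len_g, h.len_bar] at h6
  omega

theorem WeightFunction.Pent.five_le_n {a : E} (h : w.Pent a) : 5 ≤ Q.n a := by
  have h0 := h.g_g_g
  have hn : Q.n (Q.f a) = Q.n a := by
    conv_rhs => rw [← h.g_g_g]
    rw [Q.n_g, Q.n_g, Q.n_g]
  have hp := Q.n_pos (Q.f a)
  have key := Q.g_iterate_n (Q.f a)
  have hf := h.f_ne
  have hg := Q.g_ne_f a
  rw [← hn]
  have h3 : Q.n (Q.f a) ≠ 3 := by
    intro h3; rw [h3] at key; exact hf (key.symm.trans h0)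
  have h4 : Q.n (Q.f a) ≠ 4 := by
    intro h4; rw [h4] at key
    change Q.g (Q.g (Q.g (Q.g (Q.f a)))) = _ at key
    rw [h0] at key; exact hg key
  have h1 : Q.n (Q.f a) ≠ 1 := by
    intro h1; rw [n_eq_one_iff] at h1
    rw [h1, h1, h1] at h0; exact hf h0
  have h2 : Q.n (Q.f a) ≠ 2 := by
    intro h2; rw [h2] at key
    change Q.g (Q.g (Q.f a)) = _ at key
    have e1 : Q.g (Q.f a) = a := by rw [key] at h0; exact h0
    -- then `f (bar a) = a` is virtual
    have e2 : Q.f (Q.f a) = Q.bar a := by rw [← Q.bar_g, e1]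
    have e3 : Q.f (Q.bar a) = a := by rw [← e2, Q.f_f_f]
    have e4 : Q.tgt (Q.bar a) = Q.src (Q.bar a) := by rw [← Q.src_f, e3, Q.src_bar]
    rcases Q.loop_cases e4 with e5 | e5
    · exact Q.bar_ne a (e5.symm.trans e3)
    · have := n_eq_one_iff.2 e5
      rw [h.2.2] at this; omega
  omega

theorem WeightFunction.Pent.five_le_len {a : E} (h : w.Pent a) : 5 ≤ w.len a :=
  h.five_le_n.trans (Nat.le_mul_of_pos_left _ (w.m_pos a))

/-- The four-term identity for the square around a virtual arrow. -/
theorem WeightFunction.g_f_g_f {a : E} (h : w.len (Q.f (Q.f a)) = 2) :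
    Q.g (Q.f (Q.g (Q.f a))) = a := by
  have h1 := w.g_g_of_len_two h
  rw [Q.g_f_f] at h1
  have h2 : Q.g (Q.f a) = Q.bar (Q.f (Q.f a)) := rfl
  rw [h2]
  have h3 : Q.f (Q.f (Q.bar (Q.f (Q.f a)))) = Q.bar a := by
    apply Q.g_injective; rw [Q.g_f_f, Q.bar_bar, h1]
  rw [Q.g_def, h3, Q.bar_bar]

theorem WeightFunction.f_g_f_g {a : E} (h : w.len (Q.f a) = 2) :
    Q.f (Q.g (Q.f (Q.g a))) = a := by
  have h1 : w.len (Q.f (Q.f (Q.g a))) = 2 := by rw [w.len_f_f, Q.bar_g, h]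
  exact Q.g_injective (w.g_f_g_f h1)

end Orbits

end Combinatorics

end TriangulationQuiver

namespace TriangulationQuiver

/-! ### The trace form on words and its invariance under rotation -/

section TraceWord

variable {V E : Type*} (Q : TriangulationQuiver V E)

/-- The word `a, g a, g (g a), …` of length `l`. -/
noncomputable def gWord (a : E) (l : ℕ) : List E := (List.range l).map fun i => Q.g^[i] a

theorem gWord_zero (a : E) : Q.gWord a 0 = [] := rfl

theorem gWord_succ (a : E) (l : ℕ) : Q.gWord a (l + 1) = a :: Q.gWord (Q.g a) l := by
  simp [gWord, List.range_succ_eq_map, Function.comp_def]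

theorem gWord_length (a : E) (l : ℕ) : (Q.gWord a l).length = l := by simp [gWord]

theorem gWord_add (a : E) (k l : ℕ) :
    Q.gWord a (k + l) = Q.gWord a k ++ Q.gWord (Q.g^[k] a) l := by
  induction k generalizing a with
  | zero => simp [gWord_zero]
  | succ k ih =>
    rw [Nat.add_right_comm, gWord_succ, gWord_succ, ih, List.cons_append,
      Function.iterate_succ_apply]

theorem gWord_succ' (a : E) (l : ℕ) : Q.gWord a (l + 1) = Q.gWord a l ++ [Q.g^[l] a] := by
  rw [gWord_add]; rfl

theorem gWord_one (a : E) : Q.gWord a 1 = [a] := rfl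

theorem gWord_two (a : E) : Q.gWord a 2 = [a, Q.g a] := rfl

theorem gWord_three (a : E) : Q.gWord a 3 = [a, Q.g a, Q.g (Q.g a)] := rfl

theorem gWord_four (a : E) : Q.gWord a 4 = [a, Q.g a, Q.g (Q.g a), Q.g (Q.g (Q.g a))] := rfl

theorem gWord_eq_cons {a : E} {l : ℕ} (h : 0 < l) :
    Q.gWord a l = a :: Q.gWord (Q.g a) (l - 1) := by
  obtain ⟨l, rfl⟩ := Nat.exists_eq_add_of_lt h
  rw [← gWord_succ]; congr 1

variable {Q} [Finite V] {K : Type*} [Field K]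
variable (w : Q.WeightFunction) (c : Q.ParameterFunction K) (β : E → K)

theorem ParameterFunction.c_f_f (a : E) : c.c (Q.f (Q.f a)) = c.c (Q.bar a) := by
  rw [← c.c_g, Q.g_f_f]

open Classical in
/-- The summand of the trace form supported on the words `B_a`. -/
noncomputable def orbitTerm : List E → K
  | [] => 0
  | a :: l => if a :: l = Q.gWord a (w.len a) then (c.c a)⁻¹ else 0

open Classical in
variable (K) (Q) in
/-- The summand of the trace form supported on the triangles. -/
noncomputable def triangleTerm : List E → K
  | [] => 0
  | a :: l => if l = [Q.f a, Q.f (Q.f a)] then 1 else 0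

open Classical in
/-- The summand of the trace form supported on the squares around virtual arrows. -/
noncomputable def squareTerm : List E → K
  | [] => 0
  | a :: l =>
    -- With `f (f a)` virtual, the relation `g (f a) · f (g (f a)) = c · f (f a)` turns this square
    -- into `c` times a triangle of trace one. The second clause is the rotated word.
    (if l = [Q.f a, Q.g (Q.f a), Q.f (Q.g (Q.f a))] ∧ w.len (Q.f (Q.f a)) = 2 then
      c.c (Q.f (Q.f a)) else 0) +
    (if l = [Q.g a, Q.f (Q.g a), Q.g (Q.f (Q.g a))] ∧ w.len (Q.f a) = 2 then
      c.c (Q.f a) else 0)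

/-- For `Pent a` the relations give `a · f a · g (f a) = c c' · bar a · f (bar a) = c c' c_a A_a`,
where `c`, `c'` are the parameters of `bar a` and of `f (bar a)`. Completing `A_a` to `B_a` leaves
the trace `c c'`. -/
noncomputable def pentValue (a : E) : K := c.c (Q.bar a) * c.c (Q.f (Q.bar a))

open Classical in
/-- The summand of the trace form supported on the words described by `WeightFunction.Pent`. -/
noncomputable def pentTerm : List E → K
  | [] => 0
  | a :: l =>
    -- The four clauses are the four rotations of the closed word `x, f x, g (f x), g (g (f x))`
    -- with `Pent x`, where `x` is in turn the first, last, third and second letter.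
    (if l = [Q.f a, Q.g (Q.f a), Q.g (Q.g (Q.f a))] ∧ w.Pent a then pentValue c a else 0) +
    (if l = [Q.g a, Q.g (Q.g a), Q.g (Q.g (Q.g a))] ∧ w.Pent (Q.f (Q.f a)) ∧
        Q.g (Q.g (Q.g a)) = Q.f (Q.f a) then
      pentValue c (Q.f (Q.f a)) else 0) +
    (if l = [Q.g a, Q.g (Q.g a), Q.f (Q.g (Q.g a))] ∧ w.Pent (Q.g (Q.g a)) then
      pentValue c (Q.g (Q.g a)) else 0) +
    (if l = [Q.g a, Q.f (Q.g a), Q.g (Q.f (Q.g a))] ∧ w.Pent (Q.g a) then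
      pentValue c (Q.g a) else 0)

open Classical in
/-- The summand of the trace form supported on the squares of the border loops. -/
noncomputable def borderTerm : List E → K
  | [] => 0
  | a :: l => if Q.f a = a ∧ l = [a] then
      -- Forced by `a² = c A_{bar a} + β B_{bar a}`: on `A_{bar a}` only the pentagon term can be
      -- non-zero, and `B_{bar a}` has trace `c_a⁻¹`.
      c.c (Q.bar a) * pentTerm w c (Q.gWord (Q.bar a) (w.len (Q.bar a) - 1)) + β a / c.c a
    else 0

/-- The values of the trace form of a (socle deformed) weighted surface algebra on paths. Here
`β a` is the value of the border function at the source of the border loop `a`. -/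
noncomputable def traceWord (l : List E) : K :=
  orbitTerm w c l + triangleTerm Q K l + borderTerm w c β l + squareTerm w c l + pentTerm w c l

theorem orbitTerm_rotate (a : E) (l : List E) :
    orbitTerm w c (l ++ [a]) = orbitTerm w c (a :: l) := by
  classical
  rcases l with _ | ⟨y, l⟩
  · rfl
  have h2 := w.two_le_len a
  have h2' := w.two_le_len y
  by_cases h : Q.g a = y
  · subst h
    simp only [List.cons_append, orbitTerm, w.len_g, c.c_g]
    congr 1
    obtain ⟨k, hk⟩ : ∃ k, w.len a = k + 1 := ⟨w.len a - 1, by omega⟩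
    have h3 := w.g_iterate_len a
    rw [hk, Function.iterate_succ_apply] at h3
    rw [hk, gWord_succ' _ (Q.g a), h3, gWord_succ, ← List.cons_append, List.append_cancel_right_eq]
    simp
  · simp only [List.cons_append, orbitTerm]
    rw [if_neg, if_neg]
    · intro h1
      obtain ⟨k, hk⟩ : ∃ k, w.len a = k + 2 := ⟨w.len a - 2, by omega⟩
      rw [hk, gWord_succ, gWord_succ] at h1
      simp only [List.cons.injEq] at h1
      exact h h1.2.1.symm
    · intro h1
      obtain ⟨k, hk⟩ : ∃ k, w.len y = k + 1 := ⟨w.len y - 1, by omega⟩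
      have h3 := w.g_iterate_len y
      rw [hk, gWord_succ', ← List.cons_append] at h1
      have h4 := List.append_inj_right' h1 rfl
      rw [hk, Function.iterate_succ_apply'] at h3
      simp only [List.cons.injEq, and_true] at h4
      exact h (by rw [h4, h3])

theorem triangleTerm_rotate (a : E) (l : List E) :
    triangleTerm Q K (l ++ [a]) = triangleTerm Q K (a :: l) := by
  rcases l with _ | ⟨y, _ | ⟨z, _ | ⟨u, l⟩⟩⟩ <;> simp [triangleTerm]
  congr 1
  have := Q.f_f_f
  apply propext
  constructor <;> rintro ⟨rfl, rfl⟩ <;> simp [this]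

theorem borderTerm_rotate (a : E) (l : List E) :
    borderTerm w c β (l ++ [a]) = borderTerm w c β (a :: l) := by
  rcases l with _ | ⟨y, _ | ⟨z, l⟩⟩ <;> simp [borderTerm]
  by_cases h : a = y
  · subst h; rfl
  · simp [h, Ne.symm h]

theorem ite_congr_of_imp {α : Type*} {p q : Prop} [Decidable p] [Decidable q] {x y z : α}
    (h : p ↔ q) (hv : p → x = y) : (if p then x else z) = if q then y else z := by
  by_cases hp : p
  · rw [if_pos hp, if_pos (h.1 hp), hv hp]
  · rw [if_neg hp, if_neg fun hq => hp (h.2 hq)]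

theorem squareTerm_rotate (a : E) (l : List E) :
    squareTerm w c (l ++ [a]) = squareTerm w c (a :: l) := by
  classical
  rcases l with _ | ⟨x, _ | ⟨y, _ | ⟨z, _ | ⟨u, l⟩⟩⟩⟩
  case cons.cons.cons.nil =>
    simp only [List.nil_append, List.cons_append, squareTerm, List.cons.injEq, and_true]
    rw [add_comm]
    congr 1
    · apply ite_congr_of_imp
      · constructor
        · rintro ⟨⟨rfl, rfl, rfl⟩, h⟩
          rw [w.f_g_f_g h]; exact ⟨⟨rfl, rfl, rfl⟩, h⟩
        · rintro ⟨⟨rfl, rfl, rfl⟩, h⟩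
          exact ⟨⟨rfl, rfl, (w.g_f_g_f h).symm⟩, h⟩
      · rintro ⟨⟨rfl, rfl, rfl⟩, h⟩
        rw [w.f_g_f_g h]
    · apply ite_congr_of_imp
      · constructor
        · rintro ⟨⟨rfl, rfl, rfl⟩, h⟩
          rw [w.g_f_g_f h]
          refine ⟨⟨rfl, rfl, rfl⟩, ?_⟩
          rwa [← Q.bar_g, w.g_f_g_f h, ← w.len_f_f]
        · rintro ⟨⟨rfl, rfl, rfl⟩, h⟩
          refine ⟨⟨rfl, rfl, (w.f_g_f_g h).symm⟩, ?_⟩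
          rwa [w.len_f_f, Q.bar_g]
      · rintro ⟨⟨rfl, rfl, rfl⟩, h⟩
        rw [← Q.bar_g (Q.f (Q.g (Q.f x))), w.g_f_g_f h, ← c.c_f_f]
  all_goals simp [squareTerm]

theorem pentTerm_rotate (a : E) (l : List E) :
    pentTerm w c (l ++ [a]) = pentTerm w c (a :: l) := by
  classical
  rcases l with _ | ⟨x, _ | ⟨y, _ | ⟨z, _ | ⟨u, l⟩⟩⟩⟩
  case cons.cons.cons.nil =>
    simp only [List.nil_append, List.cons_append, pentTerm, List.cons.injEq, and_true]
    have h1 : (if (y = Q.f x ∧ z = Q.g (Q.f x) ∧ a = Q.g (Q.g (Q.f x))) ∧ w.Pent x then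
        pentValue c x else 0) = if (x = Q.g a ∧ y = Q.f (Q.g a) ∧ z = Q.g (Q.f (Q.g a))) ∧
          w.Pent (Q.g a) then pentValue c (Q.g a) else 0 := by
      apply ite_congr_of_imp
      · constructor
        · rintro ⟨⟨rfl, rfl, rfl⟩, h⟩
          rw [h.g_g_g]; exact ⟨⟨rfl, rfl, rfl⟩, h⟩
        · rintro ⟨⟨rfl, rfl, rfl⟩, h⟩
          exact ⟨⟨rfl, rfl, (Q.g_injective h.g_g_g).symm⟩, h⟩
      · rintro ⟨⟨rfl, rfl, rfl⟩, h⟩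
        rw [h.g_g_g]
    have h2 : (if (y = Q.g x ∧ z = Q.g (Q.g x) ∧ a = Q.g (Q.g (Q.g x))) ∧
          w.Pent (Q.f (Q.f x)) ∧ Q.g (Q.g (Q.g x)) = Q.f (Q.f x) then
        pentValue c (Q.f (Q.f x)) else 0) = if (x = Q.f a ∧ y = Q.g (Q.f a) ∧
          z = Q.g (Q.g (Q.f a))) ∧ w.Pent a then pentValue c a else 0 := by
      apply ite_congr_of_imp
      · constructor
        · rintro ⟨⟨rfl, rfl, rfl⟩, h, h'⟩
          rw [h', Q.f_f_f]; exact ⟨⟨rfl, rfl, rfl⟩, h⟩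
        · rintro ⟨⟨rfl, rfl, rfl⟩, h⟩
          rw [h.g_g_g, Q.f_f_f]
          exact ⟨⟨rfl, rfl, rfl⟩, h, rfl⟩
      · rintro ⟨⟨rfl, rfl, rfl⟩, h, h'⟩
        rw [h']
    have h3 : (if (y = Q.g x ∧ z = Q.g (Q.g x) ∧ a = Q.f (Q.g (Q.g x))) ∧
          w.Pent (Q.g (Q.g x)) then pentValue c (Q.g (Q.g x)) else 0) =
        if (x = Q.g a ∧ y = Q.g (Q.g a) ∧ z = Q.g (Q.g (Q.g a))) ∧
          w.Pent (Q.f (Q.f a)) ∧ Q.g (Q.g (Q.g a)) = Q.f (Q.f a) then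
          pentValue c (Q.f (Q.f a)) else 0 := by
      apply ite_congr_of_imp
      · constructor
        · rintro ⟨⟨rfl, rfl, rfl⟩, h⟩
          have h4 : Q.g (Q.f (Q.g (Q.g x))) = x := Q.g_injective (Q.g_injective h.g_g_g)
          rw [h4, Q.f_f_f]; exact ⟨⟨rfl, rfl, rfl⟩, h, rfl⟩
        · rintro ⟨⟨rfl, rfl, rfl⟩, h, h'⟩
          rw [h', Q.f_f_f]
          exact ⟨⟨rfl, rfl, rfl⟩, h⟩
      · rintro ⟨⟨rfl, rfl, rfl⟩, h⟩
        rw [Q.f_f_f]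
    have h4 : (if (y = Q.g x ∧ z = Q.f (Q.g x) ∧ a = Q.g (Q.f (Q.g x))) ∧ w.Pent (Q.g x) then
        pentValue c (Q.g x) else 0) = if (x = Q.g a ∧ y = Q.g (Q.g a) ∧
          z = Q.f (Q.g (Q.g a))) ∧ w.Pent (Q.g (Q.g a)) then pentValue c (Q.g (Q.g a)) else 0 := by
      apply ite_congr_of_imp
      · constructor
        · rintro ⟨⟨rfl, rfl, rfl⟩, h⟩
          have h4 : Q.g (Q.g (Q.f (Q.g x))) = x := Q.g_injective h.g_g_g
          rw [h4]; exact ⟨⟨rfl, rfl, rfl⟩, h⟩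
        · rintro ⟨⟨rfl, rfl, rfl⟩, h⟩
          exact ⟨⟨rfl, rfl, (Q.g_injective (Q.g_injective h.g_g_g)).symm⟩, h⟩
      · rintro ⟨⟨rfl, rfl, rfl⟩, h⟩
        have h4 : Q.g (Q.g (Q.f (Q.g x))) = x := Q.g_injective h.g_g_g
        rw [h4]
    rw [h1, h2, h3, h4]
    ring
  all_goals simp [pentTerm]

theorem traceWord_rotate (a : E) (l : List E) :
    traceWord w c β (l ++ [a]) = traceWord w c β (a :: l) := by
  simp only [traceWord, orbitTerm_rotate, triangleTerm_rotate, borderTerm_rotate,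
    squareTerm_rotate, pentTerm_rotate]

theorem traceWord_append_comm (k l : List E) :
    traceWord w c β (k ++ l) = traceWord w c β (l ++ k) := by
  induction k generalizing l with
  | nil => simp
  | cons a k ih =>
    rw [List.cons_append, ← traceWord_rotate, List.append_assoc, ih, List.append_assoc]
    rfl

theorem traceWord_nil : traceWord w c β [] = 0 := by
  simp [traceWord, orbitTerm, triangleTerm, borderTerm, squareTerm, pentTerm]

end TraceWord

end TriangulationQuiver

namespace TriangulationQuiver

/-! ### The trace form respects the defining relations -/

section TraceRelations

variable {V E : Type*} {Q : TriangulationQuiver V E} [Finite V] {K : Type*} [Field K]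
variable (w : Q.WeightFunction) (c : Q.ParameterFunction K) (β : E → K)

open Classical in
theorem traceWord_cons_f (a : E) (l : List E) :
    traceWord w c β (a :: Q.f a :: l) =
      (if l = [Q.f (Q.f a)] then 1 else 0) +
      (if Q.f a = a ∧ l = [] then c.c (Q.bar a) *
        pentTerm w c (Q.gWord (Q.bar a) (w.len (Q.bar a) - 1)) + β a / c.c a else 0) +
      (if l = [Q.g (Q.f a), Q.f (Q.g (Q.f a))] ∧ w.len (Q.f (Q.f a)) = 2 then
        c.c (Q.f (Q.f a)) else 0) +
      (if l = [Q.g (Q.f a), Q.g (Q.g (Q.f a))] ∧ w.Pent a then pentValue c a else 0) := by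
  have h1 := Q.g_ne_f a
  have h2 : ¬ (a :: Q.f a :: l = Q.gWord a (w.len a)) := by
    intro h
    obtain ⟨k, hk⟩ : ∃ k, w.len a = k + 2 := ⟨w.len a - 2, by have := w.two_le_len a; omega⟩
    rw [hk, gWord_succ, gWord_succ] at h
    simp only [List.cons.injEq, true_and] at h
    exact h1 h.1.symm
  simp only [traceWord, orbitTerm, triangleTerm, borderTerm, squareTerm, pentTerm, if_neg h2,
    List.cons.injEq, true_and, h1.symm, false_and, if_false, add_zero, zero_add]
  congr 3
  apply ite_congr_of_imp
  · tauto
  · tauto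

/-- All letters of a pentagon word lie on one `g`-orbit, and this orbit has `m n ≥ 5`. -/
theorem pentTerm_eq_zero {x : E} (h : w.len x < 5) (l : List E) : pentTerm w c (x :: l) = 0 := by
  classical
  have h1 : ¬ w.Pent x := fun hp => by have := hp.five_le_len; omega
  have h2 : ¬ (w.Pent (Q.f (Q.f x)) ∧ Q.g (Q.g (Q.g x)) = Q.f (Q.f x)) := fun ⟨hp, he⟩ => by
    have := hp.five_le_len
    rw [← he, w.len_g, w.len_g, w.len_g] at this; omega
  have h3 : ¬ w.Pent (Q.g (Q.g x)) := fun hp => by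
    have := hp.five_le_len
    rw [w.len_g, w.len_g] at this; omega
  have h4 : ¬ w.Pent (Q.g x) := fun hp => by
    have := hp.five_le_len
    rw [w.len_g] at this; omega
  simp [pentTerm, h1, h2, h3, h4]

/-- The path `A_{bar a}` can itself be a pentagon word only at a border loop `a`, so this correction
does not interfere with the triangle relations. -/
theorem f_eq_of_pent {a : E} (h : w.len (Q.bar a) = 5)
    (hg : Q.g (Q.g (Q.g (Q.bar a))) = Q.f (Q.f (Q.bar a))) : Q.f a = a := by
  have h1 := w.g_iterate_len_sub_one (Q.bar a)
  rw [h, Q.bar_bar] at h1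
  change Q.g (Q.g (Q.g (Q.g (Q.bar a)))) = _ at h1
  rw [hg, Q.g_f_f, Q.bar_bar] at h1
  conv_rhs => rw [← Q.f_f_f a, ← h1]

-- A word that begins with `A_x` has only three sources of trace: the arrow that completes it to
-- `B_x`, the empty completion (when `A_x` is a pentagon word), and a square around the virtual
-- arrow `f x` when `m n = 3`.
open Classical in
theorem traceWord_gWord_append {x : E} (h : 3 ≤ w.len x) (l : List E) :
    traceWord w c β (Q.gWord x (w.len x - 1) ++ l) =
      (if l = [Q.f (Q.f (Q.bar x))] then (c.c x)⁻¹ else 0) +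
      (if l = [] then pentTerm w c (Q.gWord x (w.len x - 1)) else 0) +
      (if (l = [Q.f (Q.g x), Q.g (Q.f (Q.g x))] ∧ w.len (Q.f x) = 2) ∧ w.len x = 3 then
        c.c (Q.f x) else 0) := by
  have hgf := Q.g_ne_f x
  obtain ⟨k, hk⟩ : ∃ k, w.len x = k + 3 := ⟨w.len x - 3, by omega⟩
  have hW : Q.gWord x (w.len x - 1) ++ l = x :: Q.g x :: (Q.gWord (Q.g (Q.g x)) k ++ l) := by
    rw [hk, show k + 3 - 1 = k + 1 + 1 by omega, gWord_succ, gWord_succ]; rfl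
  have hO : orbitTerm w c (Q.gWord x (w.len x - 1) ++ l) =
      if l = [Q.f (Q.f (Q.bar x))] then (c.c x)⁻¹ else 0 := by
    have : (x :: Q.g x :: (Q.gWord (Q.g (Q.g x)) k ++ l) = Q.gWord x (w.len x)) ↔
        l = [Q.f (Q.f (Q.bar x))] := by
      rw [← hW]
      conv_lhs => rw [show w.len x = w.len x - 1 + 1 by omega, gWord_succ',
        w.g_iterate_len_sub_one, Nat.add_sub_cancel]
      rw [List.append_cancel_left_eq]
    rw [hW, orbitTerm]
    simp only [this]
  have hT : triangleTerm Q K (Q.gWord x (w.len x - 1) ++ l) = 0 := by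
    rw [hW, triangleTerm, if_neg]
    simp [hgf]
  have hB : borderTerm w c β (Q.gWord x (w.len x - 1) ++ l) = 0 := by
    rw [hW, borderTerm, if_neg]
    rintro ⟨h1, h2⟩
    simp only [List.cons.injEq] at h2
    exact hgf (h2.1.trans h1.symm)
  have hS : squareTerm w c (Q.gWord x (w.len x - 1) ++ l) =
      (if (l = [Q.f (Q.g x), Q.g (Q.f (Q.g x))] ∧ w.len (Q.f x) = 2) ∧ w.len x = 3 then
        c.c (Q.f x) else 0) := by
    rw [hW, squareTerm, if_neg (by simp [hgf]), zero_add]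
    apply ite_congr_of_imp _ fun _ => rfl
    rcases k with _ | k
    · simp [gWord_zero, hk]
    · have := Q.g_ne_f (Q.g x)
      rw [gWord_succ]
      simp [this, hk]
  have hP : pentTerm w c (Q.gWord x (w.len x - 1) ++ l) =
      if l = [] then pentTerm w c (Q.gWord x (w.len x - 1)) else 0 := by
    by_cases h5 : w.len x < 5
    · rw [hW, pentTerm_eq_zero w c h5, gWord_eq_cons _ (by omega), pentTerm_eq_zero w c h5]
      simp
    · obtain ⟨j, rfl⟩ : ∃ j, k = j + 2 := ⟨k - 2, by omega⟩
      by_cases hl : l = []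
      · simp [hl]
      rw [if_neg hl, hW, gWord_succ, gWord_succ, pentTerm, if_neg, if_neg, if_neg, if_neg]
      · simp
      · have := Q.g_ne_f (Q.g x)
        simp [this]
      · have := Q.g_ne_f (Q.g (Q.g x))
        simp [this]
      · simp [hl]
      · simp [hgf]
  rw [traceWord, hO, hT, hB, hS, hP]
  ring

/-- Completions of the two sides are matched term by term. The triangle at `a` corresponds to
`B_{bar a}`. If `bar a` is virtual, the square at `a` corresponds to the triangle at `bar a`; if `m
n = 3` for `bar a`, the pentagon word at `a` corresponds to a square around `f (bar a)`. -/
theorem traceWord_triangle {a : E} (ha : Q.f a ≠ a) (l : List E) :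
    traceWord w c β (a :: Q.f a :: l) =
      c.c (Q.bar a) * traceWord w c β (Q.gWord (Q.bar a) (w.len (Q.bar a) - 1) ++ l) := by
  classical
  have hc := c.c_ne (Q.bar a)
  rw [traceWord_cons_f]
  simp only [ha, false_and, if_false, add_zero]
  have h2 := w.two_le_len (Q.bar a)
  obtain hM | hM : w.len (Q.bar a) = 2 ∨ 3 ≤ w.len (Q.bar a) := by omega
  · -- `bar a` is virtual
    have hb := w.three_le_bar hM
    rw [Q.bar_bar] at hb
    have hgg := w.g_g_of_len_two hM
    have hff : Q.f (Q.f a) = Q.g (Q.bar a) := Q.g_injective (by rw [Q.g_f_f, hgg])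
    have e1 : Q.g (Q.f a) = Q.f (Q.bar a) := by
      rw [← Q.bar_g (Q.bar a), ← hff]; rfl
    have e2 : Q.f (Q.f (Q.bar a)) = Q.f (Q.g (Q.f a)) := by rw [e1]
    have n0 : ¬ w.Pent a := fun hp => by have := hp.len_bar; omega
    have n1 : w.len (Q.f (Q.f (Q.bar a))) ≠ 2 := by rw [w.len_f_f, Q.bar_bar]; omega
    have n2 : w.len (Q.f (Q.bar a)) ≠ 2 := by
      intro h
      have h3 := w.three_le_bar h
      rw [← Q.g_def, w.len_g] at h3; omega
    have n3 : Q.f (Q.bar a) ≠ Q.bar a := by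
      intro h
      have := w.three_le_len_of_border h
      omega
    have n4 : w.len (Q.f (Q.g (Q.f a))) ≠ 2 := by rwa [← e2]
    have n5 : w.len (Q.g (Q.bar a)) = 2 := by rw [w.len_g, hM]
    rw [hM]
    change _ = c.c (Q.bar a) * traceWord w c β (Q.bar a :: l)
    rw [traceWord, pentTerm_eq_zero w c (by omega)]
    simp only [orbitTerm, triangleTerm, borderTerm, squareTerm, n0, n2, n3, n4, n5, false_and,
      and_false, if_false, add_zero, hM, e1, e2, hff, gWord_two, List.cons.injEq, true_and, and_true,
      c.c_g, mul_add, mul_ite, mul_inv_cancel₀ hc, mul_zero, mul_one]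
  · have n1 : w.len (Q.f (Q.f a)) ≠ 2 := by rw [w.len_f_f]; omega
    rw [traceWord_gWord_append w c β hM, Q.bar_bar]
    have n2 : pentTerm w c (Q.gWord (Q.bar a) (w.len (Q.bar a) - 1)) = 0 := by
      by_cases h5 : w.len (Q.bar a) < 5
      · rw [gWord_eq_cons _ (by omega), pentTerm_eq_zero w c h5]
      · obtain ⟨j, hj⟩ : ∃ j, w.len (Q.bar a) = j + 5 := ⟨w.len (Q.bar a) - 5, by omega⟩
        rw [hj, show j + 5 - 1 = j + 1 + 1 + 1 + 1 by omega, gWord_succ, gWord_succ, gWord_succ,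
          gWord_succ, pentTerm, if_neg, if_neg, if_neg, if_neg]
        · simp
        · have := Q.g_ne_f (Q.g (Q.bar a))
          simp [this]
        · have := Q.g_ne_f (Q.g (Q.g (Q.bar a)))
          simp [this]
        · rintro ⟨h1, h2, h3⟩
          rcases j with _ | j
          · exact ha (f_eq_of_pent w hj h3)
          · simp [gWord_succ] at h1
        · have := Q.g_ne_f (Q.bar a)
          simp [this]
    rw [n2]
    simp only [n1, and_false, if_false, add_zero, ite_self]
    rw [mul_add, mul_ite, mul_ite, mul_inv_cancel₀ hc, mul_zero]
    congr 1
    by_cases h3 : w.len (Q.bar a) = 3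
    · have hggg := w.g_iterate_len (Q.bar a)
      rw [h3] at hggg
      change Q.g (Q.g (Q.g (Q.bar a))) = _ at hggg
      have hff : Q.f (Q.f a) = Q.g (Q.g (Q.bar a)) := Q.g_injective (by rw [Q.g_f_f, hggg])
      have e1 : Q.g (Q.f a) = Q.f (Q.g (Q.bar a)) := by
        rw [← Q.bar_g (Q.g (Q.bar a)), ← hff]; rfl
      rw [e1]
      apply ite_congr_of_imp _ fun _ => rfl
      constructor
      · rintro ⟨h1, h2⟩
        exact ⟨⟨h1, h2.1⟩, h3⟩
      · rintro ⟨⟨h1, h2⟩, -⟩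
        exact ⟨h1, w.pent_of_len h2 h3⟩
    · have n0 : ¬ w.Pent a := fun hp => h3 hp.len_bar
      simp [n0, h3]

/-- The case `l = []` is the choice of `borderTerm`, and `l = [a]` compares `a³` with `c B_{bar a}`;
both sides vanish for all other `l`. -/
theorem traceWord_loop {a : E} (ha : Q.f a = a) (l : List E) :
    traceWord w c β (a :: a :: l) =
      c.c (Q.bar a) * traceWord w c β (Q.gWord (Q.bar a) (w.len (Q.bar a) - 1) ++ l) +
      β a * traceWord w c β (Q.gWord (Q.bar a) (w.len (Q.bar a)) ++ l) := by
  classical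
  have hc := c.c_ne (Q.bar a)
  have hg : Q.g a = Q.bar a := by rw [Q.g_def, ha]
  have hM := w.three_le_len_of_border ha
  have hMb : w.len (Q.bar a) = w.len a := by rw [← hg, w.len_g]
  have hcb : c.c (Q.bar a) = c.c a := by rw [← hg, c.c_g]
  have n0 : ¬ w.Pent a := fun hp => hp.f_ne ha
  have n1 : w.len (Q.f (Q.f a)) ≠ 2 := by rw [ha, ha]; omega
  have h1 := traceWord_cons_f w c β a l
  have hB : Q.gWord (Q.bar a) (w.len (Q.bar a)) ++ l =
      Q.gWord (Q.bar a) (w.len (Q.bar a) - 1) ++ (a :: l) := by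
    conv_lhs => rw [show w.len (Q.bar a) = w.len (Q.bar a) - 1 + 1 by omega, gWord_succ',
        w.g_iterate_len_sub_one, Q.bar_bar, ha, ha]
    simp
  have n2 : ¬ (w.len (Q.f (Q.bar a)) = 2 ∧ w.len (Q.bar a) = 3) := by
    rintro ⟨h1, h2⟩
    exact n0 (w.pent_of_len h1 h2)
  have n3 : ¬ ((a :: l = [Q.f (Q.g (Q.bar a)), Q.g (Q.f (Q.g (Q.bar a)))] ∧
      w.len (Q.f (Q.bar a)) = 2) ∧ w.len (Q.bar a) = 3) := by tauto
  have n4 : ¬ ((l = [Q.f (Q.g (Q.bar a)), Q.g (Q.f (Q.g (Q.bar a)))] ∧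
      w.len (Q.f (Q.bar a)) = 2) ∧ w.len (Q.bar a) = 3) := by tauto
  rw [hB, traceWord_gWord_append w c β (by omega), traceWord_gWord_append w c β (by omega)]
  rw [ha] at h1
  rw [h1, if_neg n3, if_neg n4]
  simp only [Q.bar_bar, ha, n0, and_false, if_false, add_zero, true_and, reduceCtorEq,
    List.cons.injEq, show ¬ w.len a = 2 by omega]
  by_cases h2 : l = []
  · subst h2
    simp [hcb, div_eq_mul_inv]
  · by_cases h3 : l = [a]
    · subst h3
      simp [hc]
    · simp [h2, h3]

theorem traceWord_zero_fg {a : E} (h : ¬ (w.len (Q.f (Q.f a)) = 2 ∨ w.Pent a)) (l : List E) :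
    traceWord w c β (a :: Q.f a :: Q.g (Q.f a) :: l) = 0 := by
  classical
  push Not at h
  have := Q.g_ne_f (Q.f a)
  rw [traceWord_cons_f]
  simp [h.1, h.2, this]

theorem traceWord_zero_gf {a : E} (h : ¬ (w.len (Q.f a) = 2 ∨ w.Pent (Q.g a))) (l : List E) :
    traceWord w c β (a :: Q.g a :: Q.f (Q.g a) :: l) = 0 := by
  classical
  push Not at h
  have h1 := Q.g_ne_f a
  have h2 := (Q.g_ne_f (Q.g a)).symm
  have h3 : ¬ (a :: Q.g a :: Q.f (Q.g a) :: l = Q.gWord a (w.len a)) := by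
    intro h3
    obtain ⟨k, hk⟩ : ∃ k, w.len a = k + 2 := ⟨w.len a - 2, by have := w.two_le_len a; omega⟩
    rw [hk, gWord_succ, gWord_succ] at h3
    rcases k with _ | k
    · simp [gWord_zero] at h3
    · rw [gWord_succ] at h3
      simp only [List.cons.injEq, true_and] at h3
      exact h2 h3.1
  simp [traceWord, orbitTerm, triangleTerm, borderTerm, squareTerm, pentTerm, h.1, h.2, h1, h2, h3]

theorem isChain_gWord (a : E) (k : ℕ) :
    List.IsChain (fun x y => Q.tgt x = Q.src y) (Q.gWord a k) := by
  induction k generalizing a with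
  | zero => simp [gWord_zero]
  | succ k ih =>
    rw [gWord_succ]
    rcases k with _ | k
    · simp [gWord_zero]
    · have := ih (Q.g a)
      rw [gWord_succ] at this ⊢
      exact List.isChain_cons_cons.2 ⟨(Q.src_g a).symm, this⟩

/-- A word with non-zero trace is a closed path. -/
theorem traceWord_support {a : E} {l : List E} (h : traceWord w c β (a :: l) ≠ 0) :
    List.IsChain (fun x y => Q.tgt x = Q.src y) (a :: l) ∧
      Q.tgt ((a :: l).getLast (List.cons_ne_nil _ _)) = Q.src a := by
  have hsg := Q.src_g
  have hsf := Q.src_f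
  by_contra hn
  have hO : orbitTerm w c (a :: l) = 0 := by
    rw [orbitTerm, if_neg]
    intro h1
    apply hn
    refine ⟨h1 ▸ isChain_gWord a _, ?_⟩
    have h2 := w.two_le_len a
    have h3 : Q.gWord a (w.len a) = Q.gWord a (w.len a - 1) ++ [Q.f (Q.f (Q.bar a))] := by
      conv_lhs => rw [show w.len a = w.len a - 1 + 1 by omega, gWord_succ',
        w.g_iterate_len_sub_one]
    simp only [h1, h3, List.getLast_append_singleton, Q.tgt_f_f, Q.src_bar]
  have hT : triangleTerm Q K (a :: l) = 0 := by
    rw [triangleTerm, if_neg]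
    rintro rfl
    exact hn (by simp [hsf, Q.tgt_f_f])
  have hB : borderTerm w c β (a :: l) = 0 := by
    rw [borderTerm, if_neg]
    rintro ⟨h1, rfl⟩
    exact hn (by simp [Q.tgt_eq_of_f_eq h1])
  have hS : squareTerm w c (a :: l) = 0 := by
    rw [squareTerm, if_neg, if_neg, add_zero]
    · rintro ⟨rfl, h1⟩
      apply hn
      simp [hsf, hsg, ← Q.src_f (Q.g (Q.f (Q.g a))), w.f_g_f_g h1]
    · rintro ⟨rfl, h1⟩
      apply hn
      simp [hsf, hsg, ← Q.src_g (Q.f (Q.g (Q.f a))), w.g_f_g_f h1]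
  have hP : pentTerm w c (a :: l) = 0 := by
    rw [pentTerm, if_neg, if_neg, if_neg, if_neg]
    · simp
    · rintro ⟨rfl, h1⟩
      apply hn
      simp [hsf, hsg, ← Q.src_g (Q.g (Q.f (Q.g a))), Q.g_injective h1.g_g_g]
    · rintro ⟨rfl, h1⟩
      apply hn
      simp [hsf, hsg, ← Q.src_g (Q.f (Q.g (Q.g a))), Q.g_injective (Q.g_injective h1.g_g_g)]
    · rintro ⟨rfl, h1, h2⟩
      exact hn ⟨by simp [hsg], by simp [h2, Q.tgt_f_f]⟩
    · rintro ⟨rfl, h1⟩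
      apply hn
      simp [hsf, hsg, ← Q.src_g (Q.g (Q.g (Q.f a))), h1.g_g_g]
  exact h (by rw [traceWord, hO, hT, hB, hS, hP]; simp)

/-- A word of length at least four with non-zero trace is one of the words `B_a`, unless its length
is four and there are virtual arrows. -/
theorem traceWord_of_five_le {l : List E} (h : 5 ≤ l.length) :
    traceWord w c β l = orbitTerm w c l := by
  rcases l with _ | ⟨a, _ | ⟨x, _ | ⟨y, _ | ⟨z, _ | ⟨u, l⟩⟩⟩⟩⟩ <;>
    simp [traceWord, triangleTerm, borderTerm, squareTerm, pentTerm] at h ⊢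

theorem traceWord_of_four_le {l : List E} (h : 4 ≤ l.length) (hv : ∀ a, w.len a ≠ 2) :
    traceWord w c β l = orbitTerm w c l := by
  rcases l with _ | ⟨a, _ | ⟨x, _ | ⟨y, _ | ⟨z, l⟩⟩⟩⟩ <;>
    simp [traceWord, triangleTerm, borderTerm, squareTerm, pentTerm, hv,
      WeightFunction.Pent] at h ⊢

theorem orbitTerm_append_comm (k l : List E) :
    orbitTerm w c (k ++ l) = orbitTerm w c (l ++ k) := by
  induction k generalizing l with
  | nil => simp
  | cons x k ih =>
    rw [List.cons_append, ← orbitTerm_rotate, List.append_assoc, ih, List.append_assoc]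
    rfl

/-- If a word with one of the letters in the `g`-orbit of `a` has length greater than that of `B_a`,
its trace in the orbit part vanishes. -/
theorem orbitTerm_eq_zero {k l : List E} {a : E} (h : (k ++ a :: l).length ≠ w.len a) :
    orbitTerm w c (k ++ a :: l) = 0 := by
  rw [orbitTerm_append_comm, List.cons_append, orbitTerm, if_neg]
  intro h1
  have := congrArg List.length h1
  rw [gWord_length] at this
  apply h
  rw [← this]
  simp; omega

theorem orbitTerm_eq_zero_of_f {a b : E} (hb : b ≠ Q.g a) (k l : List E) :
    orbitTerm w c (k ++ a :: b :: l) = 0 := by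
  rw [orbitTerm_append_comm, List.cons_append, orbitTerm, if_neg]
  intro h1
  obtain ⟨j, hj⟩ : ∃ j, w.len a = j + 2 := ⟨w.len a - 2, by have := w.two_le_len a; omega⟩
  rw [hj, gWord_succ, gWord_succ] at h1
  simp only [List.cons_append, List.cons.injEq, true_and] at h1
  exact hb h1.1

end TraceRelations

end TriangulationQuiver

/-! ### Path algebras and the extension of trace forms -/

section PathAlgebra

variable {K : Type*} [Field K] {V E : Type*} [Fintype V] {src tgt : E → V}

namespace PathAlgebra

variable (K src tgt) in
/-- The idempotent of the path algebra at a vertex. -/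
noncomputable def vertex (v : V) : PathAlgebra K src tgt :=
  RingQuot.mkAlgHom K (PathRel K src tgt) (FreeAlgebra.ι K (Sum.inl v))

variable (K src tgt) in
/-- The product of a list of arrows in the path algebra. -/
noncomputable def word (l : List E) : PathAlgebra K src tgt :=
  (l.map (arrow K src tgt)).prod

theorem word_cons (a : E) (l : List E) :
    word K src tgt (a :: l) = arrow K src tgt a * word K src tgt l := by simp [word]

theorem word_append (k l : List E) :
    word K src tgt (k ++ l) = word K src tgt k * word K src tgt l := by simp [word]

theorem vertex_mul_self (v : V) :
    vertex K src tgt v * vertex K src tgt v = vertex K src tgt v := by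
  rw [vertex, ← map_mul]; exact RingQuot.mkAlgHom_rel K (PathRel.idem v)

theorem vertex_mul_ne {u v : V} (h : u ≠ v) : vertex K src tgt u * vertex K src tgt v = 0 := by
  rw [vertex, vertex, ← map_mul, RingQuot.mkAlgHom_rel K (PathRel.orth u v h), map_zero]

theorem sum_vertex : ∑ v, vertex K src tgt v = 1 := by
  simp only [vertex]
  rw [← map_sum, RingQuot.mkAlgHom_rel K PathRel.one, map_one]

theorem vertex_mul_arrow (a : E) :
    vertex K src tgt (src a) * arrow K src tgt a = arrow K src tgt a := by
  rw [vertex, arrow, ← map_mul]; exact RingQuot.mkAlgHom_rel K (PathRel.source a)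

theorem arrow_mul_vertex (a : E) :
    arrow K src tgt a * vertex K src tgt (tgt a) = arrow K src tgt a := by
  rw [vertex, arrow, ← map_mul]; exact RingQuot.mkAlgHom_rel K (PathRel.target a)

theorem arrow_mul_vertex_ne {a : E} {v : V} (h : tgt a ≠ v) :
    arrow K src tgt a * vertex K src tgt v = 0 := by
  rw [← arrow_mul_vertex, mul_assoc, vertex_mul_ne h, mul_zero]

theorem vertex_mul_arrow_ne {a : E} {v : V} (h : v ≠ src a) :
    vertex K src tgt v * arrow K src tgt a = 0 := by
  rw [← vertex_mul_arrow, ← mul_assoc, vertex_mul_ne h, zero_mul]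

section Lift

variable {B : Type*} [Semiring B] [Algebra K B] {e : V → B} {x : E → B}

/-- The universal property of the path algebra. -/
theorem exists_lift (h1 : ∀ v, e v * e v = e v) (h2 : ∀ u v, u ≠ v → e u * e v = 0)
    (h3 : ∑ v, e v = 1) (h4 : ∀ a, e (src a) * x a = x a) (h5 : ∀ a, x a * e (tgt a) = x a) :
    ∃ φ : PathAlgebra K src tgt →ₐ[K] B, (∀ v, φ (vertex K src tgt v) = e v) ∧
      ∀ a, φ (arrow K src tgt a) = x a := by
  have h : ∀ ⦃y z⦄, PathRel K src tgt y z →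
      FreeAlgebra.lift K (Sum.elim e x) y = FreeAlgebra.lift K (Sum.elim e x) z := by
    rintro y z (v | ⟨u, v, h⟩ | _ | a | a)
    · simp [h1]
    · simp [h2 u v h]
    · simp [h3]
    · simp [h4]
    · simp [h5]
  refine ⟨RingQuot.liftAlgHom K ⟨_, h⟩, fun v => ?_, fun a => ?_⟩
  · rw [vertex, RingQuot.liftAlgHom_mkAlgHom_apply]; simp
  · rw [arrow, RingQuot.liftAlgHom_mkAlgHom_apply]; simp

theorem algHom_ext {φ ψ : PathAlgebra K src tgt →ₐ[K] B}
    (hv : ∀ v, φ (vertex K src tgt v) = ψ (vertex K src tgt v))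
    (ha : ∀ a, φ (arrow K src tgt a) = ψ (arrow K src tgt a)) : φ = ψ := by
  apply RingQuot.ringQuot_ext'
  apply FreeAlgebra.hom_ext
  funext s
  rcases s with v | a
  · exact hv v
  · exact ha a

end Lift

theorem mem_span_words (y : PathAlgebra K src tgt) :
    y ∈ Submodule.span K (Set.range (vertex K src tgt) ∪ Set.range (word K src tgt)) := by
  classical
  set S := Submodule.span K (Set.range (vertex K src tgt) ∪ Set.range (word K src tgt)) with hS
  have hw : ∀ l, word K src tgt l ∈ S := fun l => Submodule.subset_span (.inr ⟨l, rfl⟩)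
  have hv : ∀ v, vertex K src tgt v ∈ S := fun v => Submodule.subset_span (.inl ⟨v, rfl⟩)
  have hmul : ∀ y ∈ S, ∀ s : V ⊕ E,
      RingQuot.mkAlgHom K (PathRel K src tgt) (FreeAlgebra.ι K s) * y ∈ S := by
    intro y hy s
    induction hy using Submodule.span_induction with
    | mem y hy =>
      rcases hy with ⟨v, rfl⟩ | ⟨l, rfl⟩
      · rcases s with u | a
        · by_cases h : u = v
          · subst h; exact (vertex_mul_self (K := K) (src := src) (tgt := tgt) u).symm ▸ hv u
          · change vertex K src tgt u * _ ∈ S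
            rw [vertex_mul_ne h]; exact S.zero_mem
        · change arrow K src tgt a * _ ∈ S
          by_cases h : tgt a = v
          · subst h; rw [arrow_mul_vertex, ← mul_one (arrow K src tgt a)]
            exact hw [a]
          · rw [arrow_mul_vertex_ne h]; exact S.zero_mem
      · rcases s with u | a
        · change vertex K src tgt u * _ ∈ S
          rcases l with _ | ⟨b, l⟩
          · simpa [word] using hv u
          · rw [word_cons, ← mul_assoc]
            by_cases h : u = src b
            · subst h; rw [vertex_mul_arrow, ← word_cons]; exact hw _
            · rw [vertex_mul_arrow_ne h, zero_mul]; exact S.zero_mem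
        · change arrow K src tgt a * _ ∈ S
          rw [← word_cons]; exact hw _
    | zero => rw [mul_zero]; exact S.zero_mem
    | add y z _ _ hy hz => rw [mul_add]; exact S.add_mem hy hz
    | smul k y _ hy => rw [mul_smul_comm]; exact S.smul_mem _ hy
  obtain ⟨y, rfl⟩ := RingQuot.mkAlgHom_surjective K (PathRel K src tgt) y
  have key : ∀ z ∈ S, RingQuot.mkAlgHom K (PathRel K src tgt) y * z ∈ S := by
    induction y using FreeAlgebra.induction with
    | grade0 r => intro z hz; rw [AlgHom.commutes, ← Algebra.smul_def]; exact S.smul_mem _ hz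
    | grade1 s => intro z hz; exact hmul z hz s
    | mul a b ha hb => intro z hz; rw [map_mul, mul_assoc]; exact ha _ (hb _ hz)
    | add a b ha hb => intro z hz; rw [map_add, add_mul]; exact S.add_mem (ha _ hz) (hb _ hz)
  have := key 1 (hw [])
  rwa [mul_one] at this

/-- A rotation invariant function on words that is supported on closed paths extends to a trace form
of the path algebra. -/
theorem exists_traceForm (t : List E → K) (ht : ∀ k l, t (k ++ l) = t (l ++ k))
    (hnil : t [] = 0)
    (hs : ∀ a l, t (a :: l) ≠ 0 → List.IsChain (fun x y => tgt x = src y) (a :: l) ∧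
      tgt ((a :: l).getLast (List.cons_ne_nil _ _)) = src a) :
    ∃ T : PathAlgebra K src tgt →ₗ[K] K, (∀ y z, T (y * z) = T (z * y)) ∧
      ∀ l, T (word K src tgt l) = t l := by
  classical
  let ℓ : MonoidAlgebra K (FreeMonoid E) →ₗ[K] K :=
    { toFun := fun y => y.coeff.sum fun w r => r * t w.toList
      map_add' := fun y z => by
        rw [MonoidAlgebra.coeff_add]
        exact Finsupp.sum_add_index' (by simp) (by intros; ring)
      map_smul' := fun r y => by
        rw [MonoidAlgebra.coeff_smul, RingHom.id_apply, Finsupp.smul_sum]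
        refine (Finsupp.sum_smul_index' fun w => by simp).trans ?_
        simp only [smul_eq_mul, mul_assoc] }
  have hℓ : ∀ w r, ℓ (MonoidAlgebra.single w r) = r * t w.toList := by
    intro w r
    change (MonoidAlgebra.single w r).coeff.sum (fun w r => r * t w.toList) = _
    rw [MonoidAlgebra.coeff_single, Finsupp.sum_single_index (by simp)]
  have hcomm : ∀ y z, ℓ (y * z) = ℓ (z * y) := by
    intro y z
    induction y using MonoidAlgebra.induction_linear with
    | zero => simp
    | add y y' hy hy' => rw [add_mul, mul_add, map_add, map_add, hy, hy']
    | single w r =>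
      induction z using MonoidAlgebra.induction_linear with
      | zero => simp
      | add z z' hz hz' => rw [add_mul, mul_add, map_add, map_add, hz, hz']
      | single w' r' =>
        rw [MonoidAlgebra.single_mul_single, MonoidAlgebra.single_mul_single, hℓ, hℓ,
          FreeMonoid.toList_mul, FreeMonoid.toList_mul, ht, mul_comm r]
  -- An arrow goes to the matrix unit from its source to its target, with the arrow as entry in the
  -- free algebra. The trace form is the matrix trace followed by the cyclic functional `ℓ`; words
  -- that do not compose map to zero.
  obtain ⟨θ, hθv, hθa⟩ := exists_lift (K := K) (src := src) (tgt := tgt)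
    (B := Matrix V V (MonoidAlgebra K (FreeMonoid E)))
    (e := fun v => Matrix.single v v 1)
    (x := fun a => Matrix.single (src a) (tgt a) (MonoidAlgebra.single (FreeMonoid.of a) 1))
    (by intro v; simp) (by intro u v h; simp [h])
    (by ext i j; simp [Matrix.sum_apply, Matrix.single_apply, Matrix.one_apply, ite_and])
    (by intro a; simp) (by intro a; simp)
  let T : PathAlgebra K src tgt →ₗ[K] K :=
    { toFun := fun y => ∑ v, ℓ (θ y v v)
      map_add' := fun y z => by simp [Finset.sum_add_distrib]
      map_smul' := fun r y => by simp [Finset.mul_sum] }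
  refine ⟨T, fun y z => ?_, ?_⟩
  · change ∑ v, ℓ (θ (y * z) v v) = ∑ v, ℓ (θ (z * y) v v)
    simp only [map_mul, Matrix.mul_apply, map_sum]
    rw [Finset.sum_comm]
    exact Finset.sum_congr rfl fun u _ => Finset.sum_congr rfl fun v _ => hcomm _ _
  · have hθ : ∀ l a, θ (word K src tgt (a :: l)) =
        if List.IsChain (fun x y => tgt x = src y) (a :: l) then
          Matrix.single (src a) (tgt ((a :: l).getLast (List.cons_ne_nil _ _)))
            (MonoidAlgebra.single (FreeMonoid.ofList (a :: l)) 1) else 0 := by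
      intro l
      induction l with
      | nil => intro a; simp [word, hθa]
      | cons b l ih =>
        intro a
        rw [word_cons, map_mul, ih, hθa]
        by_cases h : List.IsChain (fun x y => tgt x = src y) (b :: l)
        · rw [if_pos h]
          by_cases h' : tgt a = src b
          · rw [if_pos ((List.isChain_cons_cons (R := fun x y : E => tgt x = src y)).2 ⟨h', h⟩), h', Matrix.single_mul_single_same,
              MonoidAlgebra.single_mul_single, List.getLast_cons_cons, mul_one]
            rfl
          · rw [if_neg (fun hc => h' ((List.isChain_cons_cons (R := fun x y : E => tgt x = src y)).1 hc).1),
              Matrix.single_mul_single_of_ne (h := h')]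
        · rw [if_neg h, if_neg (fun hc => h ((List.isChain_cons_cons (R := fun x y : E => tgt x = src y)).1 hc).2), mul_zero]
    intro l
    change ∑ v, ℓ (θ (word K src tgt l) v v) = t l
    rcases l with _ | ⟨a, l⟩
    · have h0 : ℓ 1 = 0 := by rw [MonoidAlgebra.one_def, hℓ]; simpa using hnil
      simp [word, hnil, h0]
    · rw [hθ]
      split_ifs with h
      · rw [Finset.sum_eq_single (src a)]
        · rw [Matrix.single_apply]
          split_ifs with h'
          · rw [hℓ, one_mul]; rfl
          · rw [map_zero]
            by_contra hne
            exact h' ⟨rfl, (hs a l (Ne.symm hne)).2⟩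
        · intro v _ hv
          rw [Matrix.single_apply, if_neg (fun h => hv h.1.symm), map_zero]
        · simp
      · by_contra hne
        apply h
        refine (hs a l fun h0 => hne ?_).1
        simp [h0]

end PathAlgebra

end PathAlgebra

/-- A linear map factors through a surjection that kills no more than it does. -/
theorem LinearMap.exists_factor {K M N P : Type*} [Field K] [AddCommGroup M] [Module K M]
    [AddCommGroup N] [Module K N] [AddCommGroup P] [Module K P] (p : M →ₗ[K] N)
    (hp : Function.Surjective p) (T : M →ₗ[K] P) (h : LinearMap.ker p ≤ LinearMap.ker T) :
    ∃ τ : N →ₗ[K] P, ∀ y, τ (p y) = T y := by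
  refine ⟨(LinearMap.ker p).liftQ T h ∘ₗ (p.quotKerEquivOfSurjective hp).symm.toLinearMap,
    fun y => ?_⟩
  have : (p.quotKerEquivOfSurjective hp).symm (p y) = Submodule.Quotient.mk y := by
    rw [LinearEquiv.symm_apply_eq]; rfl
  simp [this]

/-- A trace form that respects the generating relations descends to the quotient algebra. -/
theorem RingQuot.exists_traceForm {K R : Type*} [Field K] [Ring R] [Algebra K R]
    {r : R → R → Prop} (T : R →ₗ[K] K) (hT : ∀ y z, T (y * z) = T (z * y))
    (hr : ∀ y z, r y z → ∀ s, T (y * s) = T (z * s)) :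
    ∃ τ : RingQuot r →ₗ[K] K, ∀ y, τ (RingQuot.mkAlgHom K r y) = T y := by
  refine LinearMap.exists_factor (RingQuot.mkAlgHom K r).toLinearMap
    (RingQuot.mkAlgHom_surjective K r) T fun y hy => ?_
  have key : ∀ y z, RingQuot.Rel r y z → ∀ s, T (y * s) = T (z * s) := by
    intro y z h
    induction h with
    | of h => exact hr _ _ h
    | add_left _ ih => intro s; rw [add_mul, add_mul, map_add, map_add, ih]
    | mul_left _ ih => intro s; rw [mul_assoc, mul_assoc, ih]
    | mul_right _ ih => intro s; rw [mul_assoc, hT, mul_assoc, ih, ← mul_assoc, hT, ← mul_assoc]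
  have key' : ∀ y z, Relation.EqvGen (RingQuot.Rel r) y z → ∀ s, T (y * s) = T (z * s) := by
    intro y z h
    induction h with
    | rel y z h => exact key y z h
    | refl y => intro s; rfl
    | symm y z _ ih => intro s; exact (ih s).symm
    | trans y z u _ _ ih1 ih2 => intro s; exact (ih1 s).trans (ih2 s)
  have h0 : RingQuot.mkAlgHom K r y = RingQuot.mkAlgHom K r 0 := by
    rw [map_zero]; exact hy
  have h1 : RingQuot.mkRingHom r y = RingQuot.mkRingHom r 0 := by
    have h2 := RingQuot.mkAlgHom_coe K r
    rw [← h2]; exact h0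
  rw [RingQuot.mkRingHom_def] at h1
  have := key' _ _ (Quot.eqvGen_exact (RingQuot.mk.inj h1)) 1
  simpa using this

/-! ### Presentations equipped with a trace form -/

namespace TriangulationQuiver

variable {V E : Type*} [Fintype V] {Q : TriangulationQuiver V E} {K : Type*} [Field K]

section

variable (w : Q.WeightFunction) (c : Q.ParameterFunction K) (β : E → K)

/-- An algebra presented by a triangulation quiver: a surjection from the path algebra that
satisfies the relations of a socle deformed weighted surface algebra with border values `β`, and a
trace form with the standard values on paths. -/
structure TraceModel (A : Type*) [Ring A] [Algebra K A] where
  hom : PathAlgebra K Q.src Q.tgt →ₐ[K] A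
  surj : Function.Surjective hom
  triangle : ∀ a, Q.f a ≠ a → hom (PathAlgebra.word K Q.src Q.tgt [a, Q.f a]) =
    c.c (Q.bar a) • hom (PathAlgebra.word K Q.src Q.tgt (Q.gWord (Q.bar a) (w.len (Q.bar a) - 1)))
  loop : ∀ a, Q.f a = a → hom (PathAlgebra.word K Q.src Q.tgt [a, a]) =
    c.c (Q.bar a) • hom (PathAlgebra.word K Q.src Q.tgt (Q.gWord (Q.bar a) (w.len (Q.bar a) - 1)))
    + β a • hom (PathAlgebra.word K Q.src Q.tgt (Q.gWord (Q.bar a) (w.len (Q.bar a))))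
  zero_fg : ∀ a, ¬ (w.len (Q.f (Q.f a)) = 2 ∨ w.Pent a) →
    hom (PathAlgebra.word K Q.src Q.tgt [a, Q.f a, Q.g (Q.f a)]) = 0
  zero_gf : ∀ a, ¬ (w.len (Q.f a) = 2 ∨ w.Pent (Q.g a)) →
    hom (PathAlgebra.word K Q.src Q.tgt [a, Q.g a, Q.f (Q.g a)]) = 0
  τ : A →ₗ[K] K
  τ_comm : ∀ y z, τ (y * z) = τ (z * y)
  τ_word : ∀ l, τ (hom (PathAlgebra.word K Q.src Q.tgt l)) = traceWord w c β l

end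

section

variable (w : Q.WeightFunction) (c : Q.ParameterFunction K)

open Classical in
/-- The border values as a function on arrows. -/
noncomputable def borderValue (b : Q.border → K) (a : E) : K :=
  if h : Q.f a = a then b ⟨Q.src a, a, h, rfl⟩ else 0

theorem virtual_or_pent_g (a : E) : (Q.Virtual w (Q.f a) ∨
    (Q.Virtual w (Q.f (Q.f a)) ∧ w.m (Q.f a) = 1 ∧ Q.n (Q.f a) = 3)) ↔
      (w.len (Q.f a) = 2 ∨ w.Pent (Q.g a)) := by
  rw [WeightFunction.Pent, bar_g]; rfl

theorem gPath_eq_word (a : E) (l : ℕ) :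
    Q.gPath K a l = PathAlgebra.word K Q.src Q.tgt (Q.gWord a l) := by
  simp only [gPath, PathAlgebra.word, gWord, List.map_map]
  rfl

theorem pathA_eq_word (a : E) :
    Q.pathA K w a = PathAlgebra.word K Q.src Q.tgt (Q.gWord a (w.len a - 1)) :=
  gPath_eq_word _ _

theorem pathB_eq_word (a : E) :
    Q.pathB K w a = PathAlgebra.word K Q.src Q.tgt (Q.gWord a (w.len a)) :=
  gPath_eq_word _ _

open PathAlgebra in
theorem exists_traceForm_deformedAlgebra (b : Q.border → K) :
    ∃ τ : Q.DeformedAlgebra w c b →ₗ[K] K, (∀ y z, τ (y * z) = τ (z * y)) ∧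
      ∀ l, τ (RingQuot.mkAlgHom K _ (word K Q.src Q.tgt l)) = traceWord w c (borderValue b) l := by
  obtain ⟨T, hT, hw⟩ := PathAlgebra.exists_traceForm (K := K) (src := Q.src) (tgt := Q.tgt)
    (traceWord w c (borderValue b)) (traceWord_append_comm w c _) (traceWord_nil w c _)
    (fun a l h => traceWord_support w c _ h)
  classical
  -- Relations must be tested against right multiplication by everything that spans the path
  -- algebra, including vertices. All words of one relation start at the same vertex, so this common
  -- factor reduces the vertex case to the empty completion.
  have hv : ∀ a l v, T (word K Q.src Q.tgt (a :: l) * vertex K Q.src Q.tgt v) =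
      (if v = Q.src a then 1 else 0 : ℕ) • traceWord w c (borderValue b) (a :: l) := by
    intro a l v
    rw [hT, word_cons, ← mul_assoc]
    split_ifs with h
    · rw [h, vertex_mul_arrow, ← word_cons, hw, one_smul]
    · rw [vertex_mul_arrow_ne h, zero_mul, map_zero, zero_smul]
  have hr : ∀ y z, DeformedRel Q w c b y z → ∀ s, T (y * s) = T (z * s) := by
    intro y z h s
    induction PathAlgebra.mem_span_words s using Submodule.span_induction with
    | zero => simp
    | add s s' _ _ ih ih' => rw [mul_add, mul_add, map_add, map_add, ih, ih']
    | smul k s _ ih => rw [mul_smul_comm, mul_smul_comm, map_smul, map_smul, ih]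
    | mem s hs =>
      have h2 := fun a => w.two_le_len a
      have hA : ∀ a, Q.gWord a (w.len a - 1) = a :: Q.gWord (Q.g a) (w.len a - 1 - 1) :=
        fun a => gWord_eq_cons _ (by have := h2 a; omega)
      have hB : ∀ a, Q.gWord a (w.len a) = a :: Q.gWord (Q.g a) (w.len a - 1) :=
        fun a => gWord_eq_cons _ (by have := h2 a; omega)
      have e1 : ∀ a, Q.x K a * Q.x K (Q.f a) = word K Q.src Q.tgt [a, Q.f a] := by
        intro a; simp [x, word]
      have e2 : ∀ a b c, Q.x K a * Q.x K b * Q.x K c = word K Q.src Q.tgt [a, b, c] := by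
        intro a b c; simp [x, word, mul_assoc]
      rcases hs with ⟨v, rfl⟩ | ⟨l, rfl⟩
      · rcases h with ⟨a, h⟩ | ⟨a, h⟩ | ⟨a, h⟩ | ⟨a, h⟩
        · have := traceWord_triangle w c (borderValue b) h []
          rw [List.append_nil] at this
          rw [e1, pathA_eq_word, smul_mul_assoc, map_smul, hv, this, hA, hv, src_bar,
            smul_eq_mul, mul_smul_comm]
        · have := traceWord_loop w c (borderValue b) h []
          rw [List.append_nil, List.append_nil] at this
          have e3 := e1 a
          rw [h] at e3
          rw [e3, pathA_eq_word, pathB_eq_word, add_mul, smul_mul_assoc, smul_mul_assoc, map_add,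
            map_smul, map_smul, hv, this, hA, hv, hB, hv, src_bar, borderValue, dif_pos h,
            smul_add, smul_eq_mul, smul_eq_mul, mul_smul_comm, mul_smul_comm]
        · rw [e2, hv, zero_mul, map_zero, traceWord_zero_fg w c _ h, smul_zero]
        · rw [e2, hv, zero_mul, map_zero, traceWord_zero_gf w c _ ((virtual_or_pent_g w a).not.1 h), smul_zero]
      · rcases h with ⟨a, h⟩ | ⟨a, h⟩ | ⟨a, h⟩ | ⟨a, h⟩
        · rw [e1, pathA_eq_word, smul_mul_assoc, map_smul, ← word_append, ← word_append, hw, hw]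
          exact traceWord_triangle w c (borderValue b) h l
        · have e3 := e1 a
          rw [h] at e3
          rw [e3, pathA_eq_word, pathB_eq_word, add_mul, smul_mul_assoc, smul_mul_assoc, map_add,
            map_smul, map_smul, ← word_append, ← word_append, ← word_append, hw, hw, hw]
          have := traceWord_loop w c (borderValue b) h l
          rw [borderValue, dif_pos h] at this
          exact this
        · rw [e2, ← word_append, hw, zero_mul, map_zero]
          exact traceWord_zero_fg w c _ h l
        · rw [e2, ← word_append, hw, zero_mul, map_zero]
          exact traceWord_zero_gf w c _ ((virtual_or_pent_g w a).not.1 h) l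
  obtain ⟨τ, hτ⟩ := RingQuot.exists_traceForm T hT hr
  refine ⟨τ, fun y z => ?_, fun l => by rw [hτ, hw]⟩
  obtain ⟨y, rfl⟩ := RingQuot.mkAlgHom_surjective K _ y
  obtain ⟨z, rfl⟩ := RingQuot.mkAlgHom_surjective K _ z
  rw [← map_mul, ← map_mul, hτ, hτ, hT]

open PathAlgebra in
/-- A socle deformed weighted surface algebra, with its trace form. -/
noncomputable def deformedModel (b : Q.border → K) :
    TraceModel w c (borderValue b) (Q.DeformedAlgebra w c b) where
  hom := RingQuot.mkAlgHom K _
  surj := RingQuot.mkAlgHom_surjective K _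
  triangle a h := by
    have := RingQuot.mkAlgHom_rel K (DeformedRel.triangle (w := w) (c := c) (b := b) a h)
    rw [pathA_eq_word, map_smul] at this
    rw [← this]; simp [word, x]
  loop a h := by
    have := RingQuot.mkAlgHom_rel K (DeformedRel.loop (w := w) (c := c) (b := b) a h)
    rw [pathA_eq_word, pathB_eq_word, map_add, map_smul, map_smul] at this
    rw [borderValue, dif_pos h, ← this]; simp [word, x]
  zero_fg a h := by
    have := RingQuot.mkAlgHom_rel K (DeformedRel.zero_fg (w := w) (c := c) (b := b) a h)
    rw [map_zero] at this
    rw [← this]; simp [word, x, mul_assoc]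
  zero_gf a h := by
    have := RingQuot.mkAlgHom_rel K (DeformedRel.zero_gf (w := w) (c := c) (b := b) a
      ((virtual_or_pent_g w a).not.2 h))
    rw [map_zero] at this
    rw [← this]; simp [word, x, mul_assoc]
  τ := (exists_traceForm_deformedAlgebra w c b).choose
  τ_comm := (exists_traceForm_deformedAlgebra w c b).choose_spec.1
  τ_word := (exists_traceForm_deformedAlgebra w c b).choose_spec.2

end

end TriangulationQuiver

/-! ### Powers of the arrow ideal and characters -/

namespace TriangulationQuiver

namespace TraceModel

open PathAlgebra

variable {V E : Type*} [Fintype V] {Q : TriangulationQuiver V E} {K : Type*} [Field K]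
variable {w : Q.WeightFunction} {c : Q.ParameterFunction K} {β : E → K}
variable {A : Type*} [Ring A] [Algebra K A] (S : TraceModel w c β A)

/-- The idempotent at a vertex. -/
noncomputable def e (v : V) : A := S.hom (vertex K Q.src Q.tgt v)

/-- The product of a list of arrows. -/
noncomputable def p (l : List E) : A := S.hom (word K Q.src Q.tgt l)

theorem p_nil : S.p [] = 1 := by simp [p, word]

theorem p_append (k l : List E) : S.p (k ++ l) = S.p k * S.p l := by
  rw [p, word_append, map_mul]; rfl

theorem p_cons (a : E) (l : List E) : S.p (a :: l) = S.p [a] * S.p l := S.p_append [a] l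

theorem e_mul_self (v : V) : S.e v * S.e v = S.e v := by rw [e, ← map_mul, vertex_mul_self]

theorem e_mul_ne {u v : V} (h : u ≠ v) : S.e u * S.e v = 0 := by
  rw [e, e, ← map_mul, vertex_mul_ne h, map_zero]

theorem sum_e : ∑ v, S.e v = 1 := by simp only [e]; rw [← map_sum, sum_vertex, map_one]

theorem e_mul_p (a : E) (l : List E) : S.e (Q.src a) * S.p (a :: l) = S.p (a :: l) := by
  rw [e, p, ← map_mul, word_cons, ← mul_assoc, vertex_mul_arrow]

theorem e_mul_p_ne {v : V} {a : E} (h : v ≠ Q.src a) (l : List E) : S.e v * S.p (a :: l) = 0 := by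
  rw [e, p, ← map_mul, word_cons, ← mul_assoc, vertex_mul_arrow_ne h, zero_mul, map_zero]

theorem p_mul_e (l : List E) (a : E) : S.p (l ++ [a]) * S.e (Q.tgt a) = S.p (l ++ [a]) := by
  rw [e, p, ← map_mul, word_append, mul_assoc, word_cons, mul_assoc]
  simp [word, arrow_mul_vertex]

theorem p_mul_e_ne {v : V} {a : E} (h : Q.tgt a ≠ v) (l : List E) :
    S.p (l ++ [a]) * S.e v = 0 := by
  rw [e, p, ← map_mul, word_append, mul_assoc, word_cons, mul_assoc]
  simp [word, arrow_mul_vertex_ne h]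

theorem e_mul_x (a : E) : S.e (Q.src a) * S.p [a] = S.p [a] := S.e_mul_p a []

theorem x_mul_e (a : E) : S.p [a] * S.e (Q.tgt a) = S.p [a] := S.p_mul_e [] a

theorem x_mul_e_ne {v : V} {a : E} (h : Q.tgt a ≠ v) : S.p [a] * S.e v = 0 := S.p_mul_e_ne h []

/-- A product of arrows that do not compose vanishes. -/
theorem p_eq_zero {a b : E} (h : Q.tgt a ≠ Q.src b) (l : List E) : S.p (a :: b :: l) = 0 := by
  rw [p_cons, ← S.e_mul_p b, ← mul_assoc, S.x_mul_e_ne h, zero_mul]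

theorem τ_p (l : List E) : S.τ (S.p l) = traceWord w c β l := S.τ_word l

theorem p_triangle {a : E} (h : Q.f a ≠ a) : S.p [a, Q.f a] =
    c.c (Q.bar a) • S.p (Q.gWord (Q.bar a) (w.len (Q.bar a) - 1)) := S.triangle a h

theorem p_loop {a : E} (h : Q.f a = a) : S.p [a, a] =
    c.c (Q.bar a) • S.p (Q.gWord (Q.bar a) (w.len (Q.bar a) - 1)) +
      β a • S.p (Q.gWord (Q.bar a) (w.len (Q.bar a))) := S.loop a h

theorem p_zero_fg {a : E} (h : ¬ (w.len (Q.f (Q.f a)) = 2 ∨ w.Pent a)) :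
    S.p [a, Q.f a, Q.g (Q.f a)] = 0 := S.zero_fg a h

theorem p_zero_gf {a : E} (h : ¬ (w.len (Q.f a) = 2 ∨ w.Pent (Q.g a))) :
    S.p [a, Q.g a, Q.f (Q.g a)] = 0 := S.zero_gf a h

/-! ### Powers of the arrow ideal -/

/-- The span of the paths of length at least `k`. -/
noncomputable def J (k : ℕ) : Submodule K A := Submodule.span K (S.p '' {l | k ≤ l.length})

theorem p_mem_J {k : ℕ} {l : List E} (h : k ≤ l.length) : S.p l ∈ S.J k :=
  Submodule.subset_span ⟨l, h, rfl⟩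

theorem J_le {k l : ℕ} (h : k ≤ l) : S.J l ≤ S.J k :=
  Submodule.span_mono (Set.image_mono fun _ hl => le_trans h hl)

@[elab_as_elim]
theorem J_induction {k : ℕ} {P : ∀ y, y ∈ S.J k → Prop}
    (hp : ∀ (l : List E) (h : k ≤ l.length), P (S.p l) (S.p_mem_J h))
    (h0 : P 0 (zero_mem _))
    (hadd : ∀ y z hy hz, P y hy → P z hz → P (y + z) (add_mem hy hz))
    (hsmul : ∀ (r : K) y hy, P y hy → P (r • y) (Submodule.smul_mem _ r hy))
    {y : A} (hy : y ∈ S.J k) : P y hy := by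
  induction hy using Submodule.span_induction with
  | mem y hy => obtain ⟨l, hl, rfl⟩ := hy; exact hp l hl
  | zero => exact h0
  | add y z h h' hy hz => exact hadd y z h h' hy hz
  | smul r y h hy => exact hsmul r y h hy

theorem J_mul (k l : ℕ) : S.J k * S.J l = S.J (k + l) := by
  rw [J, J, Submodule.span_mul_span]
  congr 1
  ext y
  constructor
  · rintro ⟨_, ⟨l1, h1, rfl⟩, _, ⟨l2, h2, rfl⟩, rfl⟩
    refine ⟨l1 ++ l2, ?_, S.p_append l1 l2⟩
    simp only [Set.mem_ofPred_eq, List.length_append] at h1 h2 ⊢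
    omega
  · rintro ⟨l', h, rfl⟩
    simp only [Set.mem_ofPred_eq] at h
    refine ⟨_, ⟨l'.take k, ?_, rfl⟩, _, ⟨l'.drop k, ?_, rfl⟩, ?_⟩
    · simp only [Set.mem_ofPred_eq, List.length_take]; omega
    · simp only [Set.mem_ofPred_eq, List.length_drop]; omega
    · change S.p _ * S.p _ = _
      rw [← p_append, List.take_append_drop]

theorem mul_mem_J {k l : ℕ} {y z : A} (hy : y ∈ S.J k) (hz : z ∈ S.J l) : y * z ∈ S.J (k + l) := by
  rw [← J_mul]; exact Submodule.mul_mem_mul hy hz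

theorem mul_mem_J' {k l m : ℕ} {y z : A} (hy : y ∈ S.J k) (hz : z ∈ S.J l) (h : m ≤ k + l) :
    y * z ∈ S.J m := S.J_le h (S.mul_mem_J hy hz)

theorem J_succ_eq_pow (k : ℕ) : S.J (k + 1) = S.J 1 ^ (k + 1) := by
  induction k with
  | zero => simp
  | succ k ih => rw [pow_succ, ← ih, J_mul]

theorem J_eq_of_J_one {V' E' : Type*} [Fintype V'] {Q' : TriangulationQuiver V' E'}
    {w' : Q'.WeightFunction} {c' : Q'.ParameterFunction K} {β' : E' → K}
    (S' : TraceModel w' c' β' A) (h : S.J 1 = S'.J 1) {k : ℕ} (hk : 1 ≤ k) : S.J k = S'.J k := by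
  obtain ⟨k, rfl⟩ := Nat.exists_eq_add_of_le' hk
  rw [J_succ_eq_pow S k, J_succ_eq_pow S' k, h]

theorem mem_span (y : A) : ∃ r : V → K, y - ∑ v, r v • S.e v ∈ S.J 1 := by
  obtain ⟨y, rfl⟩ := S.surj y
  classical
  induction mem_span_words y using Submodule.span_induction with
  | mem y hy =>
    rcases hy with ⟨v, rfl⟩ | ⟨l, rfl⟩
    · refine ⟨Pi.single v 1, ?_⟩
      simp [Pi.single_apply, e]
    · rcases l with _ | ⟨a, l⟩
      · refine ⟨1, ?_⟩
        have := S.sum_e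
        simp [this, word]
      · exact ⟨0, by simpa using! S.p_mem_J (l := a :: l) (by simp)⟩
  | zero => exact ⟨0, by simp⟩
  | add y z _ _ hy hz =>
    obtain ⟨r, hr⟩ := hy
    obtain ⟨s, hs⟩ := hz
    refine ⟨r + s, ?_⟩
    have := (S.J 1).add_mem hr hs
    simp only [map_add, Pi.add_apply, add_smul, Finset.sum_add_distrib]
    convert this using 1
    abel
  | smul k y _ hy =>
    obtain ⟨r, hr⟩ := hy
    refine ⟨k • r, ?_⟩
    have := (S.J 1).smul_mem k hr
    simpa [smul_sub, Finset.smul_sum, mul_smul] using this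

theorem e_mul_mem_J {k : ℕ} (v : V) {y : A} (hk : 1 ≤ k) (hy : y ∈ S.J k) : S.e v * y ∈ S.J k := by
  induction hy using S.J_induction with
  | hp l hl =>
    rcases l with _ | ⟨a, l⟩
    · simp at hl; omega
    · by_cases h : v = Q.src a
      · rw [h, e_mul_p]; exact S.p_mem_J hl
      · rw [S.e_mul_p_ne h]; exact zero_mem _
  | h0 => simp
  | hadd y z _ _ hy hz => rw [mul_add]; exact add_mem hy hz
  | hsmul r y _ hy => rw [mul_smul_comm]; exact Submodule.smul_mem _ _ hy

theorem mul_e_mem_J {k : ℕ} (v : V) {y : A} (hk : 1 ≤ k) (hy : y ∈ S.J k) : y * S.e v ∈ S.J k := by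
  induction hy using S.J_induction with
  | hp l hl =>
    rcases List.eq_nil_or_concat l with rfl | ⟨l, a, rfl⟩
    · simp at hl; omega
    · rw [List.concat_eq_append] at hl ⊢
      by_cases h : Q.tgt a = v
      · rw [← h, p_mul_e]; exact S.p_mem_J hl
      · rw [S.p_mul_e_ne h]; exact zero_mem _
  | h0 => simp
  | hadd y z _ _ hy hz => rw [add_mul]; exact add_mem hy hz
  | hsmul r y _ hy => rw [smul_mul_assoc]; exact Submodule.smul_mem _ _ hy

theorem mul_left_mem_J {k : ℕ} (z : A) {y : A} (hk : 1 ≤ k) (hy : y ∈ S.J k) : z * y ∈ S.J k := by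
  obtain ⟨r, hr⟩ := S.mem_span z
  rw [← sub_add_cancel z (∑ v, r v • S.e v), add_mul, Finset.sum_mul]
  refine add_mem (S.mul_mem_J' hr hy (by omega)) (sum_mem fun v _ => ?_)
  rw [smul_mul_assoc]
  exact Submodule.smul_mem _ _ (S.e_mul_mem_J v hk hy)

theorem mul_right_mem_J {k : ℕ} (z : A) {y : A} (hk : 1 ≤ k) (hy : y ∈ S.J k) : y * z ∈ S.J k := by
  obtain ⟨r, hr⟩ := S.mem_span z
  rw [← sub_add_cancel z (∑ v, r v • S.e v), mul_add, Finset.mul_sum]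
  refine add_mem (S.mul_mem_J' hy hr (by omega)) (sum_mem fun v _ => ?_)
  rw [mul_smul_comm]
  exact Submodule.smul_mem _ _ (S.mul_e_mem_J v hk hy)

/-- The leading part of an element of the arrow ideal that starts at the source of `a`. -/
theorem exists_leading (a : E) {y : A} (hy : y ∈ S.J 1) : ∃ r s : K, ∃ j ∈ S.J 2,
    S.e (Q.src a) * y = r • S.p [a] + s • S.p [Q.bar a] + j := by
  induction hy using S.J_induction with
  | hp l hl =>
    rcases l with _ | ⟨b, _ | ⟨d, l⟩⟩
    · simp at hl
    · by_cases h : Q.src b = Q.src a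
      · rw [← h, e_mul_p]
        rcases Q.eq_or_eq_bar h with rfl | rfl
        · exact ⟨1, 0, 0, zero_mem _, by simp⟩
        · exact ⟨0, 1, 0, zero_mem _, by simp⟩
      · rw [S.e_mul_p_ne (Ne.symm h)]
        exact ⟨0, 0, 0, zero_mem _, by simp⟩
    · exact ⟨0, 0, _, S.e_mul_mem_J (Q.src a) (by norm_num)
        (S.p_mem_J (l := b :: d :: l) (by simp)),
        by simp⟩
  | h0 => exact ⟨0, 0, 0, zero_mem _, by simp⟩
  | hadd y z _ _ hy hz =>
    obtain ⟨r, s, j, hj, h⟩ := hy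
    obtain ⟨r', s', j', hj', h'⟩ := hz
    refine ⟨r + r', s + s', j + j', add_mem hj hj', ?_⟩
    rw [mul_add, h, h']; module
  | hsmul k y _ hy =>
    obtain ⟨r, s, j, hj, h⟩ := hy
    refine ⟨k * r, k * s, k • j, Submodule.smul_mem _ _ hj, ?_⟩
    rw [mul_smul_comm, h]; module

/-- The leading part of an element of the arrow ideal between the source and the target of an arrow
`a` without a parallel arrow. -/
theorem exists_leading' {a : E} (ha : Q.tgt (Q.bar a) ≠ Q.tgt a) {y : A} (hy : y ∈ S.J 1)
    (h1 : S.e (Q.src a) * y = y) (h2 : y * S.e (Q.tgt a) = y) : ∃ r : K, ∃ j ∈ S.J 2,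
    y = r • S.p [a] + j := by
  obtain ⟨r, s, j, hj, h⟩ := S.exists_leading a hy
  refine ⟨r, j * S.e (Q.tgt a), S.mul_e_mem_J _ (by norm_num) hj, ?_⟩
  rw [h1] at h
  conv_lhs => rw [← h2, h]
  rw [add_mul, add_mul, smul_mul_assoc, smul_mul_assoc, x_mul_e, S.x_mul_e_ne ha, smul_zero,
    add_zero]

/-! ### Vanishing of the trace form -/

theorem τ_mul_p_eq_zero {k : ℕ} {l' : List E}
    (h : ∀ l : List E, k ≤ l.length → traceWord w c β (l ++ l') = 0) {y : A} (hy : y ∈ S.J k) :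
    S.τ (y * S.p l') = 0 := by
  induction hy using S.J_induction with
  | hp l hl => rw [← p_append, τ_p, h l hl]
  | h0 => simp
  | hadd y z _ _ hy hz => rw [add_mul, map_add, hy, hz, add_zero]
  | hsmul r y _ hy => rw [smul_mul_assoc, map_smul, hy, smul_zero]

/-- There are finitely many arrows, and a word that is longer than every `B_a` and has at least five
letters has trace zero. -/
theorem exists_J_le_ker : ∃ N, ∀ y ∈ S.J N, S.τ y = 0 := by
  have := Q.finite_arrows
  have := Fintype.ofFinite E
  refine ⟨∑ a, w.len a + 5, fun y hy => ?_⟩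
  rw [← mul_one y, ← S.p_nil]
  refine S.τ_mul_p_eq_zero (fun l hl => ?_) hy
  rw [List.append_nil, traceWord_of_five_le _ _ _ (by omega)]
  rcases l with _ | ⟨a, l⟩
  · rfl
  · refine orbitTerm_eq_zero (k := []) w c fun h => ?_
    have := Finset.single_le_sum (f := w.len) (fun _ _ => Nat.zero_le _) (Finset.mem_univ a)
    simp only [List.nil_append] at h
    omega

/-! ### Characters -/

/-- A character is non-zero on exactly one idempotent, so it kills every arrow that is not a loop.
For a loop `a`, a power of `a` is a combination of paths through such arrows: `a²` for a border
loop, and `a ^ (m n - 1)` if `g a = a`, by the relation for `f a · f (f a)`. -/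
theorem exists_character (χ : A →ₐ[K] K) : ∃ v, χ (S.e v) = 1 ∧ (∀ u, u ≠ v → χ (S.e u) = 0) ∧
    ∀ y ∈ S.J 1, χ y = 0 := by
  have h1 : ∃ v, χ (S.e v) ≠ 0 := by
    by_contra! h
    have := congrArg χ S.sum_e
    simp [h] at this
  obtain ⟨v, hv⟩ := h1
  have hv1 : χ (S.e v) = 1 := by
    have := congrArg χ (S.e_mul_self v)
    rw [map_mul] at this
    exact mul_left_cancel₀ hv (by rw [this, mul_one])
  have hu : ∀ u, u ≠ v → χ (S.e u) = 0 := by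
    intro u hu
    have := congrArg χ (S.e_mul_ne hu)
    rwa [map_mul, hv1, mul_one, map_zero] at this
  refine ⟨v, hv1, hu, ?_⟩
  have hsrc : ∀ a, Q.src a ≠ v → χ (S.p [a]) = 0 := by
    intro a ha
    rw [← e_mul_x, map_mul, hu _ ha, zero_mul]
  have htgt : ∀ a, Q.tgt a ≠ v → χ (S.p [a]) = 0 := by
    intro a ha
    rw [← x_mul_e, map_mul, hu _ ha, mul_zero]
  have hnl : ∀ a, Q.tgt a ≠ Q.src a → χ (S.p [a]) = 0 := by
    intro a ha
    by_cases h : Q.src a = v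
    · exact htgt a fun h' => ha (h'.trans h.symm)
    · exact hsrc a h
  have hg : ∀ a k, 1 ≤ k → χ (S.p [a]) = 0 → χ (S.p (Q.gWord a k)) = 0 := by
    intro a k hk h
    rw [gWord_eq_cons _ hk, p_cons, map_mul, h, zero_mul]
  have hx : ∀ a, χ (S.p [a]) = 0 := by
    intro a
    by_cases hl : Q.tgt a = Q.src a
    · have hbar := Q.not_both_loops a hl
      rw [← Q.src_bar] at hbar
      have h0 := hnl _ hbar
      have h2 := w.two_le_len (Q.bar a)
      rcases Q.loop_cases hl with hf | hgl
      · have := congrArg χ (S.p_loop hf)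
        rw [map_add, map_smul, map_smul, hg _ _ (by omega) h0, hg _ _ (by omega) h0, p_cons,
          map_mul] at this
        simpa using this
      · have hb : Q.bar a = Q.f a := by rw [← Q.bar_g, hgl]
        have hne : Q.f (Q.f a) ≠ Q.f a := by
          intro h
          exact Q.bar_ne a (hb.trans (Q.f.injective h))
        have := congrArg χ (S.p_triangle hne)
        rw [← g_def, hgl, map_smul, p_cons, map_mul, ← hb, h0, zero_mul] at this
        have h3 : χ (S.p (Q.gWord a (w.len a - 1))) = χ (S.p [a]) ^ (w.len a - 1) := by
          generalize w.len a - 1 = k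
          induction k with
          | zero => simp [gWord_zero, p_nil]
          | succ k ih => rw [gWord_succ, hgl, p_cons, map_mul, ih, pow_succ']
        rw [h3] at this
        have := (smul_eq_zero.1 this.symm).resolve_left (c.c_ne a)
        exact pow_eq_zero_iff (by have := w.two_le_len a; omega) |>.1 this
    · exact hnl a hl
  intro y hy
  induction hy using S.J_induction with
  | hp l hl =>
    rcases l with _ | ⟨a, l⟩
    · simp at hl
    · rw [p_cons, map_mul, hx, zero_mul]
  | h0 => simp
  | hadd y z _ _ hy hz => rw [map_add, hy, hz, add_zero]
  | hsmul r y _ hy => rw [map_smul, hy, smul_zero]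

/-! ### Change of algebra -/

variable {B : Type*} [Ring B] [Algebra K B]

/-- The image of a presentation under a surjection that is compatible with the trace form. -/
noncomputable def map (φ : A →ₐ[K] B) (hφ : Function.Surjective φ) (τ : B →ₗ[K] K)
    (hτ : ∀ y, τ (φ y) = S.τ y) : TraceModel w c β B where
  hom := φ.comp S.hom
  surj := hφ.comp S.surj
  triangle a h := by simp [S.triangle a h]
  loop a h := by simp [S.loop a h]
  zero_fg a h := by simp [S.zero_fg a h]
  zero_gf a h := by simp [S.zero_gf a h]
  τ := τ
  τ_comm y z := by
    obtain ⟨y, rfl⟩ := hφ y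
    obtain ⟨z, rfl⟩ := hφ z
    rw [← map_mul, ← map_mul, hτ, hτ, S.τ_comm]
  τ_word l := by simp [hτ, S.τ_word]

theorem map_J (φ : A →ₐ[K] B) (hφ : Function.Surjective φ) (τ : B →ₗ[K] K)
    (hτ : ∀ y, τ (φ y) = S.τ y) (k : ℕ) :
    (S.map φ hφ τ hτ).J k = (S.J k).map φ.toLinearMap := by
  rw [J, J, Submodule.map_span, ← Set.image_comp]; rfl

end TraceModel

end TriangulationQuiver

namespace TriangulationQuiver

/-! ### From an isomorphism to two presentations of a common quotient -/

section Reduction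

universe uA uV uE uK

open PathAlgebra

variable {V : Type uV} {E : Type uE} [Fintype V] {Q : TriangulationQuiver V E}
variable {K : Type uK} [Field K]
variable {w : Q.WeightFunction} {c : Q.ParameterFunction K} {β : E → K}
variable {V' E' : Type*} [Fintype V'] {Q' : TriangulationQuiver V' E'}
variable {w' : Q'.WeightFunction} {c' : Q'.ParameterFunction K} {β' : E' → K}

/-- All arrows can be sent to zero, because every path in the relations has positive length. -/
theorem exists_character_deformedAlgebra (w : Q.WeightFunction) (c : Q.ParameterFunction K)
    (b : Q.border → K) (v : V) :
    ∃ χ : Q.DeformedAlgebra w c b →ₐ[K] K, χ ((deformedModel w c b).e v) = 1 := by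
  classical
  obtain ⟨φ, hv, ha⟩ := PathAlgebra.exists_lift (K := K) (src := Q.src) (tgt := Q.tgt) (B := K)
    (e := fun u => if u = v then 1 else 0) (x := fun _ => 0) (by simp)
    (by intro u u' h; by_cases h1 : u = v <;> by_cases h2 : u' = v <;> simp_all) (by simp)
    (by simp) (by simp)
  have hw : ∀ a k, 0 < k → φ (word K Q.src Q.tgt (Q.gWord a k)) = 0 := by
    intro a k hk
    rw [gWord_eq_cons _ hk, word_cons, map_mul, ha, zero_mul]
  have hr : ∀ ⦃y z⦄, DeformedRel Q w c b y z → φ y = φ z := by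
    rintro y z (⟨a, h⟩ | ⟨a, h⟩ | ⟨a, h⟩ | ⟨a, h⟩)
    · have := w.two_le_len (Q.bar a)
      rw [pathA_eq_word, map_smul, hw _ _ (by omega)]
      simp [x, ha]
    · have := w.two_le_len (Q.bar a)
      rw [pathA_eq_word, pathB_eq_word, map_add, map_smul, map_smul, hw _ _ (by omega),
        hw _ _ (by omega)]
      simp [x, ha]
    · simp [x, ha]
    · simp [x, ha]
  refine ⟨RingQuot.liftAlgHom K ⟨φ, hr⟩, ?_⟩
  change RingQuot.liftAlgHom K ⟨φ, hr⟩ (RingQuot.mkAlgHom K _ _) = 1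
  rw [RingQuot.liftAlgHom_mkAlgHom_apply, hv, if_pos rfl]

namespace TraceModel

variable {A : Type uA} [Ring A] [Algebra K A] (S : TraceModel w c β A) (S' : TraceModel w' c' β' A)

theorem character_unique {χ χ' : A →ₐ[K] K} {v : V} (h : χ (S.e v) = 1) (h' : χ' (S.e v) = 1) :
    χ = χ' := by
  obtain ⟨u, h1, h2, h3⟩ := S.exists_character χ
  obtain ⟨u', h1', h2', h3'⟩ := S.exists_character χ'
  have hu : v = u := by by_contra hne; rw [h2 _ hne] at h; exact zero_ne_one h
  have hu' : v = u' := by by_contra hne; rw [h2' _ hne] at h'; exact zero_ne_one h'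
  subst hu hu'
  have he : ∀ u, χ (S.e u) = χ' (S.e u) := by
    intro u
    by_cases hu : u = v
    · rw [hu, h, h']
    · rw [h2 _ hu, h2' _ hu]
  ext y
  obtain ⟨r, hr⟩ := S.mem_span y
  rw [← sub_add_cancel y (∑ v, r v • S.e v), map_add, map_add, h3 _ hr, h3' _ hr, map_sum, map_sum]
  simp only [map_smul, he]

/-- The right side does not mention the presentation, so the arrow ideal is an invariant of the
algebra. -/
theorem mem_J_one_iff (hS : ∀ v, ∃ χ : A →ₐ[K] K, χ (S.e v) = 1) (y : A) :
    y ∈ S.J 1 ↔ ∀ χ : A →ₐ[K] K, χ y = 0 := by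
  classical
  refine ⟨fun h χ => ?_, fun h => ?_⟩
  · obtain ⟨v, -, -, h3⟩ := S.exists_character χ
    exact h3 y h
  · obtain ⟨r, hr⟩ := S.mem_span y
    have : ∀ v, r v = 0 := by
      intro v
      obtain ⟨χ, hχ⟩ := hS v
      obtain ⟨u, h1, h2, h3⟩ := S.exists_character χ
      have hu : v = u := by by_contra hne; rw [h2 _ hne] at hχ; exact zero_ne_one hχ
      subst hu
      have := h3 _ hr
      rw [map_sub, h, map_sum, Finset.sum_eq_single v] at this
      · simpa [h1] using this
      · intro u _ hu; rw [map_smul, h2 u hu, smul_zero]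
      · simp
    simpa [this] using hr

/-- Vertices of either presentation correspond to the characters of `A`. Corresponding idempotents
have the same value under every character, so they differ by an element of the arrow ideal. -/
theorem exists_vertex_equiv (hS : ∀ v, ∃ χ : A →ₐ[K] K, χ (S.e v) = 1)
    (hS' : ∀ v, ∃ χ : A →ₐ[K] K, χ (S'.e v) = 1) :
    ∃ σ : V ≃ V', ∀ v, S.e v - S'.e (σ v) ∈ S.J 1 := by
  choose χ hχ using hS
  choose χ' hχ' using hS'
  choose σ hσ _ _ using fun v => S'.exists_character (χ v)
  choose σ' hσ' _ _ using fun v => S.exists_character (χ' v)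
  have e1 : ∀ v, χ v = χ' (σ v) := fun v => S'.character_unique (hσ v) (hχ' _)
  have e2 : ∀ v, χ' v = χ (σ' v) := fun v => S.character_unique (hσ' v) (hχ _)
  have inj : ∀ u v, χ u = χ v → u = v := by
    intro u v h
    by_contra hne
    obtain ⟨u', h1, h2, -⟩ := S.exists_character (χ u)
    have h3 : ∀ z, χ u (S.e z) = 1 → z = u' := by
      intro z hz; by_contra hne; rw [h2 _ hne] at hz; exact zero_ne_one hz
    exact hne ((h3 u (hχ u)).trans (h3 v (by rw [h]; exact hχ v)).symm)
  have inj' : ∀ u v, χ' u = χ' v → u = v := by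
    intro u v h
    by_contra hne
    obtain ⟨u', h1, h2, -⟩ := S'.exists_character (χ' u)
    have h3 : ∀ z, χ' u (S'.e z) = 1 → z = u' := by
      intro z hz; by_contra hne; rw [h2 _ hne] at hz; exact zero_ne_one hz
    exact hne ((h3 u (hχ' u)).trans (h3 v (by rw [h]; exact hχ' v)).symm)
  refine ⟨⟨σ, σ', fun v => inj _ _ (by rw [← e2, ← e1]), fun v => inj' _ _ (by rw [← e1, ← e2])⟩,
    fun v => ?_⟩
  rw [S.mem_J_one_iff fun v => ⟨χ v, hχ v⟩]
  intro ψ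
  change ψ (S.e v - S'.e (σ v)) = 0
  obtain ⟨u, h1, h2, -⟩ := S.exists_character ψ
  obtain ⟨u', h1', h2', -⟩ := S'.exists_character ψ
  have e3 : ψ = χ u := S.character_unique h1 (hχ u)
  have e4 : ψ = χ' u' := S'.character_unique h1' (hχ' u')
  have e5 : u' = σ u := inj' _ _ (by rw [← e4, ← e1, ← e3])
  rw [map_sub]
  by_cases h : v = u
  · rw [h, h1, ← e5, h1', sub_self]
  · rw [h2 _ h, h2' _ (fun h' => h (inj _ _ (by rw [e1, e1, h', ← e5, ← e4, e3]))), sub_self]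

/-- The elements of the arrow ideal in the radicals of both trace forms. -/
def commonRadical : Ideal A where
  carrier := {y | y ∈ S.J 1 ∧ ∀ z, S.τ (y * z) = 0 ∧ S'.τ (y * z) = 0}
  zero_mem' := by simp
  add_mem' := by
    rintro y y' ⟨h1, h2⟩ ⟨h1', h2'⟩
    exact ⟨add_mem h1 h1', fun z => by simp [add_mul, h2, h2']⟩
  smul_mem' := by
    rintro z y ⟨h1, h2⟩
    refine ⟨S.mul_left_mem_J z le_rfl h1, fun z' => ?_⟩
    rw [smul_eq_mul, mul_assoc, S.τ_comm, mul_assoc, S'.τ_comm, mul_assoc]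
    exact h2 _

instance commonRadical_isTwoSided : (commonRadical S S').IsTwoSided where
  mul_mem_of_left := by
    rintro y z ⟨h1, h2⟩
    refine ⟨S.mul_right_mem_J z le_rfl h1, fun z' => ?_⟩
    rw [mul_assoc]
    exact h2 _

/-- Conjugation of a presentation by a unit. -/
noncomputable def conj (u : Aˣ) : TraceModel w c β A where
  __ := S.map (MulSemiringAction.toAlgEquiv K A (ConjAct.toConjAct u)).toAlgHom
    (MulSemiringAction.toAlgEquiv K A (ConjAct.toConjAct u)).surjective S.τ (fun y => by
      change S.τ (ConjAct.toConjAct u • y) = _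
      rw [ConjAct.units_smul_def, ConjAct.ofConjAct_toConjAct, S.τ_comm, ← mul_assoc,
        Units.inv_mul, one_mul])

theorem conj_e (u : Aˣ) (v : V) : (S.conj u).e v = u * S.e v * ↑u⁻¹ := rfl

theorem conj_p (u : Aˣ) (l : List E) : (S.conj u).p l = u * S.p l * ↑u⁻¹ := rfl

theorem conj_J_one (u : Aˣ) : (S.conj u).J 1 = S.J 1 := by
  apply le_antisymm
  · intro y hy
    induction hy using J_induction with
    | hp l hl =>
      rw [conj_p]
      exact S.mul_right_mem_J _ le_rfl (S.mul_left_mem_J _ le_rfl (S.p_mem_J hl))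
    | h0 => exact zero_mem _
    | hadd y z _ _ hy hz => exact add_mem hy hz
    | hsmul r y _ hy => exact Submodule.smul_mem _ _ hy
  · intro y hy
    induction hy using J_induction with
    | hp l hl =>
      have : S.p l = ↑u⁻¹ * (S.conj u).p l * u := by
        rw [conj_p, ← mul_assoc, ← mul_assoc, Units.inv_mul, one_mul, mul_assoc, Units.inv_mul,
          mul_one]
      rw [this]
      exact (S.conj u).mul_right_mem_J _ le_rfl
        ((S.conj u).mul_left_mem_J _ le_rfl ((S.conj u).p_mem_J hl))
    | h0 => exact zero_mem _
    | hadd y z _ _ hy hz => exact add_mem hy hz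
    | hsmul r y _ hy => exact Submodule.smul_mem _ _ hy

/-- The element `u = ∑ e_v e'_{σ v}` is `1` modulo the nilpotent arrow ideal, hence a unit, and it
satisfies `u e'_{σ v} = e_v u`. -/
theorem exists_conj (hJ : S.J 1 = S'.J 1) {N : ℕ} (hN : S.J N = ⊥) (σ : V ≃ V')
    (hσ : ∀ v, S.e v - S'.e (σ v) ∈ S.J 1) :
    ∃ S'' : TraceModel w' c' β' A, (∀ v, S''.e (σ v) = S.e v) ∧ S.J 1 = S''.J 1 := by
  classical
  set u := ∑ v, S.e v * S'.e (σ v) with hu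
  have h1 : u - 1 ∈ S.J 1 := by
    have : u - 1 = -∑ v, S.e v * (S.e v - S'.e (σ v)) := by
      simp only [mul_sub, e_mul_self, Finset.sum_sub_distrib, S.sum_e, hu]
      abel
    rw [this]
    exact neg_mem (sum_mem fun v _ => S.mul_left_mem_J _ le_rfl (hσ v))
  have h2 : ∀ k, (u - 1) ^ (k + 1) ∈ S.J (k + 1) := by
    intro k
    induction k with
    | zero => simpa using h1
    | succ k ih => rw [pow_succ]; exact S.mul_mem_J ih h1
  have h3 : IsNilpotent (u - 1) := by
    refine ⟨N + 1, ?_⟩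
    have := S.J_le (Nat.le_succ N) (h2 N)
    rwa [hN, Submodule.mem_bot] at this
  have h4 : IsUnit u := by
    have := h3.isUnit_one_add
    simpa using this
  obtain ⟨u', hu'⟩ := h4
  have h5 : ∀ v, (u' : A) * S'.e (σ v) = S.e v * u' := by
    intro v
    rw [hu', hu, Finset.sum_mul, Finset.mul_sum, Finset.sum_eq_single v, Finset.sum_eq_single v]
    · rw [mul_assoc, e_mul_self, ← mul_assoc, e_mul_self]
    · intro v' _ h
      rw [← mul_assoc, S.e_mul_ne h.symm, zero_mul]
    · simp
    · intro v' _ h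
      rw [mul_assoc, S'.e_mul_ne (fun h' => h (σ.injective h')), mul_zero]
    · simp
  refine ⟨S'.conj u', fun v => ?_, by rw [conj_J_one, hJ]⟩
  rw [conj_e, h5, mul_assoc, Units.mul_inv, mul_one]

/-- Long paths lie in the radicals of both trace forms. So the arrow ideal is nilpotent modulo the
common radical, while both forms survive in the quotient. This replaces any statement on the
dimension of the algebra. -/
theorem exists_pair (hS : ∀ v, ∃ χ : A →ₐ[K] K, χ (S.e v) = 1)
    (hS' : ∀ v, ∃ χ : A →ₐ[K] K, χ (S'.e v) = 1) :
    ∃ (B : Type uA) (_ : Ring B) (_ : Algebra K B) (T : TraceModel w c β B)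
      (T' : TraceModel w' c' β' B) (σ : V ≃ V'),
      (∀ v, T'.e (σ v) = T.e v) ∧ T.J 1 = T'.J 1 := by
  have hJ : S.J 1 = S'.J 1 := by
    ext y
    rw [S.mem_J_one_iff hS, S'.mem_J_one_iff hS']
  obtain ⟨σ, hσ⟩ := S.exists_vertex_equiv S' hS hS'
  set I := commonRadical S S' with hI
  have hker : ∀ y ∈ I, S.τ y = 0 ∧ S'.τ y = 0 := by
    intro y hy
    have := hy.2 1
    rwa [mul_one] at this
  have hmk : Function.Surjective (Ideal.Quotient.mkₐ K I) := Ideal.Quotient.mkₐ_surjective K I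
  have hk0 : ∀ y, (Ideal.Quotient.mkₐ K I) y = 0 ↔ y ∈ I := fun y =>
    Ideal.Quotient.eq_zero_iff_mem
  obtain ⟨τ, hτ⟩ := LinearMap.exists_factor (Ideal.Quotient.mkₐ K I).toLinearMap hmk S.τ
    (fun y hy => (hker y ((hk0 y).1 hy)).1)
  obtain ⟨τ', hτ'⟩ := LinearMap.exists_factor (Ideal.Quotient.mkₐ K I).toLinearMap hmk S'.τ
    (fun y hy => (hker y ((hk0 y).1 hy)).2)
  let T := S.map (Ideal.Quotient.mkₐ K I) hmk τ hτ
  let T' := S'.map (Ideal.Quotient.mkₐ K I) hmk τ' hτ'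
  have hmap : ∀ k, T.J k = (S.J k).map (Ideal.Quotient.mkₐ K I).toLinearMap := S.map_J _ hmk τ hτ
  have hTJ : T.J 1 = T'.J 1 := by
    rw [hmap, S'.map_J _ hmk τ' hτ', hJ]
  obtain ⟨N, hN⟩ := S.exists_J_le_ker
  obtain ⟨N', hN'⟩ := S'.exists_J_le_ker
  have hnil : T.J (N + N' + 1) = ⊥ := by
    rw [hmap, eq_bot_iff]
    rintro _ ⟨y, hy, rfl⟩
    rw [Submodule.mem_bot]
    refine (hk0 y).2 ⟨S.J_le (by omega) hy, fun z => ⟨hN _ ?_, hN' _ ?_⟩⟩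
    · exact S.J_le (by omega) (S.mul_right_mem_J z (by omega) hy)
    · have h := S.mul_right_mem_J z (by omega) hy
      rw [S.J_eq_of_J_one S' hJ (by omega)] at h
      exact S'.J_le (by omega) h
  obtain ⟨T'', h1, h2⟩ := T.exists_conj T' hTJ hnil σ (fun v => by
    rw [hmap]
    exact ⟨_, hσ v, map_sub _ _ _⟩)
  exact ⟨A ⧸ I, inferInstance, inferInstance, T, T'', σ, h1, h2⟩

/-- Transport of a presentation along an isomorphism. -/
noncomputable def comap {B : Type*} [Ring B] [Algebra K B] (S : TraceModel w c β B)
    (φ : A ≃ₐ[K] B) : TraceModel w c β A :=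
  S.map φ.symm.toAlgHom φ.symm.surjective (S.τ ∘ₗ φ.toLinearMap) (fun y => by simp)

end TraceModel

/-- An isomorphism between two socle deformed weighted surface algebras induces two presentations of
a common quotient with the same idempotents and the same arrow ideal. -/
theorem exists_pair_of_algEquiv (b : Q.border → K) (b' : Q'.border → K)
    (φ : Q.DeformedAlgebra w c b ≃ₐ[K] Q'.DeformedAlgebra w' c' b') :
    ∃ (A : Type (max uV uE uK)) (_ : Ring A) (_ : Algebra K A) (T : TraceModel w c (borderValue b) A)
      (T' : TraceModel w' c' (borderValue b') A) (σ : V ≃ V'),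
      (∀ v, T'.e (σ v) = T.e v) ∧ T.J 1 = T'.J 1 := by
  refine (deformedModel w c b).exists_pair ((deformedModel w' c' b').comap φ)
    (exists_character_deformedAlgebra w c b) fun v => ?_
  obtain ⟨χ, hχ⟩ := exists_character_deformedAlgebra w' c' b' v
  exact ⟨χ.comp φ.toAlgHom, (congrArg χ (φ.apply_symm_apply _)).trans hχ⟩

end Reduction

end TriangulationQuiver

/-! ### Long paths, and the representation along `g`-orbits -/

namespace PathAlgebra

variable {K : Type*} [Field K] {V E : Type*} [Fintype V] {src tgt : E → V}

variable (K src tgt) in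
/-- The span of the paths of length at least `k` in the path algebra. -/
noncomputable def longPaths (k : ℕ) : Submodule K (PathAlgebra K src tgt) :=
  Submodule.span K (word K src tgt '' {l | k ≤ l.length})

theorem word_mem {k : ℕ} {l : List E} (h : k ≤ l.length) :
    word K src tgt l ∈ longPaths K src tgt k := Submodule.subset_span ⟨l, h, rfl⟩

theorem mul_mem_longPaths {k l m : ℕ} {y z : PathAlgebra K src tgt}
    (hy : y ∈ longPaths K src tgt k) (hz : z ∈ longPaths K src tgt l) (h : m ≤ k + l) :
    y * z ∈ longPaths K src tgt m := by
  have h1 : y * z ∈ longPaths K src tgt k * longPaths K src tgt l := Submodule.mul_mem_mul hy hz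
  rw [longPaths, longPaths, Submodule.span_mul_span] at h1
  refine Submodule.span_le.2 ?_ h1
  rintro _ ⟨_, ⟨l1, h1, rfl⟩, _, ⟨l2, h2, rfl⟩, rfl⟩
  simp only [Set.mem_ofPred_eq] at h1 h2
  change word K src tgt l1 * word K src tgt l2 ∈ _
  rw [← word_append]
  exact word_mem (by rw [List.length_append]; omega)

theorem vertex_mul_word (v : V) (a : E) (l : List E) :
    vertex K src tgt v * word K src tgt (a :: l) = 0 ∨
      src a = v ∧ vertex K src tgt v * word K src tgt (a :: l) = word K src tgt (a :: l) := by
  by_cases h : v = src a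
  · subst h
    exact .inr ⟨rfl, by rw [word_cons, ← mul_assoc, vertex_mul_arrow]⟩
  · exact .inl (by rw [word_cons, ← mul_assoc, vertex_mul_arrow_ne h, zero_mul])

theorem word_mul_vertex (v : V) (l : List E) (a : E) :
    word K src tgt (l ++ [a]) * vertex K src tgt v = 0 ∨
      tgt a = v ∧ word K src tgt (l ++ [a]) * vertex K src tgt v = word K src tgt (l ++ [a]) := by
  have h1 : word K src tgt [a] = arrow K src tgt a := by simp [word]
  by_cases h : tgt a = v
  · subst h
    exact .inr ⟨rfl, by rw [word_append, mul_assoc, h1, arrow_mul_vertex]⟩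
  · exact .inl (by rw [word_append, mul_assoc, h1, arrow_mul_vertex_ne h, mul_zero])

/-- A path of positive length either is closed at `v` or is killed by the idempotent at `v`. -/
theorem vertex_mul_word_mul_vertex (v : V) (a : E) (l : List E) :
    vertex K src tgt v * word K src tgt (a :: l) * vertex K src tgt v = 0 ∨
      src a = v ∧ tgt ((a :: l).getLast (List.cons_ne_nil _ _)) = v ∧
      vertex K src tgt v * word K src tgt (a :: l) * vertex K src tgt v =
        word K src tgt (a :: l) := by
  rcases vertex_mul_word (K := K) (src := src) (tgt := tgt) v a l with h | ⟨h, h'⟩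
  · exact .inl (by rw [h, zero_mul])
  · rw [h']
    have h2 := List.dropLast_append_getLast (List.cons_ne_nil a l)
    rcases word_mul_vertex (K := K) (src := src) (tgt := tgt) v (a :: l).dropLast
      ((a :: l).getLast (List.cons_ne_nil _ _)) with h3 | ⟨h3, h4⟩
    · rw [h2] at h3; exact .inl h3
    · rw [h2] at h4; exact .inr ⟨h, h3, h4⟩

theorem vertex_mul_mul_vertex_mem {k : ℕ} (hk : 1 ≤ k) (v : V) {y : PathAlgebra K src tgt}
    (hy : y ∈ longPaths K src tgt k) :
    vertex K src tgt v * y * vertex K src tgt v ∈ longPaths K src tgt k := by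
  induction hy using Submodule.span_induction with
  | mem y hy =>
    obtain ⟨l, hl, rfl⟩ := hy
    simp only [Set.mem_ofPred_eq] at hl
    rcases l with _ | ⟨a, l⟩
    · simp at hl; omega
    · rcases vertex_mul_word_mul_vertex (K := K) (src := src) (tgt := tgt) v a l with
        h | ⟨-, -, h⟩
      · rw [h]; exact zero_mem _
      · rw [h]; exact word_mem hl
  | zero => simp
  | add y z _ _ hy hz => rw [mul_add, add_mul]; exact add_mem hy hz
  | smul r y _ hy => rw [mul_smul_comm, smul_mul_assoc]; exact Submodule.smul_mem _ _ hy

end PathAlgebra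

namespace TriangulationQuiver

open PathAlgebra Polynomial

section OrbitRepresentation

variable {V E : Type*} [Fintype V] (Q : TriangulationQuiver V E) (K : Type*) [Field K]

theorem eq_gWord_cons_iff {x a : E} {l : List E} :
    x :: l = Q.gWord a (l.length + 1) ↔ x = a ∧ l = Q.gWord (Q.g a) l.length := by
  rw [gWord_succ, List.cons.injEq]

/-- The representation of the path algebra on the free module over the arrows, in which an arrow `a`
acts as `X` times the matrix unit at `(a, g a)`. -/
theorem exists_orbitRep [Fintype E] [DecidableEq E] [DecidableEq V] :
    ∃ Ψ : PathAlgebra K Q.src Q.tgt →ₐ[K] Matrix E E K[X],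
      (∀ v a b, Ψ (vertex K Q.src Q.tgt v) a b = if a = b ∧ Q.src a = v then 1 else 0) ∧
      ∀ l a b, Ψ (word K Q.src Q.tgt l) a b =
        if l = Q.gWord a l.length ∧ b = Q.g^[l.length] a then X ^ l.length else 0 := by
  obtain ⟨Ψ, hv, ha⟩ := PathAlgebra.exists_lift (K := K) (src := Q.src) (tgt := Q.tgt)
    (B := Matrix E E K[X]) (e := fun v => Matrix.diagonal fun a => if Q.src a = v then 1 else 0)
    (x := fun a => Matrix.single a (Q.g a) X)
    (by intro v; rw [Matrix.diagonal_mul_diagonal]; simp)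
    (by intro u v h
        rw [Matrix.diagonal_mul_diagonal, ← Matrix.diagonal_zero]
        congr 1
        funext a
        by_cases h1 : Q.src a = u
        · rw [if_neg (show ¬ Q.src a = v from fun h2 => h (h1.symm.trans h2)), mul_zero]
        · rw [if_neg h1, zero_mul])
    (by refine Matrix.ext fun a b => ?_
        rw [Matrix.sum_apply]
        by_cases h : a = b <;> simp [h, Matrix.one_apply])
    (by intro a; ext b d; rw [Matrix.diagonal_mul]
        by_cases h : a = b
        · simp [h]
        · simp [h])
    (by intro a; ext b d; rw [Matrix.mul_diagonal]
        by_cases h : Q.g a = d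
        · simp [← h, src_g]
        · simp [h])
  refine ⟨Ψ, fun v a b => ?_, fun l => ?_⟩
  · rw [hv, Matrix.diagonal_apply]
    by_cases h1 : a = b
    · subst h1; simp
    · rw [if_neg h1, if_neg fun h => h1 h.1]
  · induction l with
    | nil =>
      intro a b
      simp [word, Matrix.one_apply, gWord_zero, eq_comm]
    | cons x l ih =>
      intro a b
      rw [word_cons, map_mul, Matrix.mul_apply, ha]
      simp only [List.length_cons, eq_gWord_cons_iff, Function.iterate_succ_apply]
      by_cases h : x = a
      · subst h
        rw [Finset.sum_eq_single (Q.g x)]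
        · rw [ih, Matrix.single_apply_same, mul_ite, mul_zero, pow_succ']
          simp
        · intro d _ hd
          rw [Matrix.single_apply, if_neg fun hh => hd hh.2.symm, zero_mul]
        · simp
      · rw [if_neg fun hh => h hh.1.1]
        refine Finset.sum_eq_zero fun d _ => ?_
        rw [Matrix.single_apply, if_neg fun hh => h hh.1, zero_mul]

variable {Q K} [Fintype E] [DecidableEq E] [DecidableEq V]
  {Ψ : PathAlgebra K Q.src Q.tgt →ₐ[K] Matrix E E K[X]}

/-- The degree in `X` counts steps along the `g`-orbit, so the entry at `(a, b)` involves only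
exponents `k` with `g^k a = b`. -/
theorem orbitRep_coeff
    (hv : ∀ v a b, Ψ (vertex K Q.src Q.tgt v) a b = if a = b ∧ Q.src a = v then 1 else 0)
    (hw : ∀ l a b, Ψ (word K Q.src Q.tgt l) a b =
        if l = Q.gWord a l.length ∧ b = Q.g^[l.length] a then X ^ l.length else 0)
    (y : PathAlgebra K Q.src Q.tgt) {a b : E} {k : ℕ}
    (h : Q.g^[k] a ≠ b) : (Ψ y a b).coeff k = 0 := by
  induction mem_span_words y using Submodule.span_induction with
  | mem y hy =>
    rcases hy with ⟨v, rfl⟩ | ⟨l, rfl⟩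
    · rw [hv]
      split_ifs with h1
      · rw [Polynomial.coeff_one, if_neg]
        rintro rfl
        exact h h1.1
      · simp
    · rw [hw]
      split_ifs with h1
      · rw [Polynomial.coeff_X_pow, if_neg]
        rintro rfl
        exact h h1.2.symm
      · simp
  | zero => simp
  | add y z _ _ hy hz => rw [map_add, Matrix.add_apply, Polynomial.coeff_add, hy, hz, add_zero]
  | smul r y _ hy => rw [map_smul, Matrix.smul_apply, Polynomial.coeff_smul, hy, smul_zero]

theorem orbitRep_coeff_of_lt
    (hw : ∀ l a b, Ψ (word K Q.src Q.tgt l) a b =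
        if l = Q.gWord a l.length ∧ b = Q.g^[l.length] a then X ^ l.length else 0)
    {k l : ℕ} {y : PathAlgebra K Q.src Q.tgt}
    (hy : y ∈ longPaths K Q.src Q.tgt k) (h : l < k) (a b : E) : (Ψ y a b).coeff l = 0 := by
  induction hy using Submodule.span_induction with
  | mem y hy =>
    obtain ⟨l', hl, rfl⟩ := hy
    simp only [Set.mem_ofPred_eq] at hl
    rw [hw]
    split_ifs with h1
    · rw [Polynomial.coeff_X_pow, if_neg (by omega)]
    · simp
  | zero => simp
  | add y z _ _ hy hz => rw [map_add, Matrix.add_apply, Polynomial.coeff_add, hy, hz, add_zero]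
  | smul r y _ hy => rw [map_smul, Matrix.smul_apply, Polynomial.coeff_smul, hy, smul_zero]

/-- An element that ends at `src α` has non-zero columns only at the two arrows that start there.
Closed elements at this vertex are therefore handled as `2 × 2` matrices. -/
theorem orbitRep_mul
    (hv : ∀ v a b, Ψ (vertex K Q.src Q.tgt v) a b = if a = b ∧ Q.src a = v then 1 else 0)
    (α : E) {y : PathAlgebra K Q.src Q.tgt}
    (hy : y * vertex K Q.src Q.tgt (Q.src α) = y) (z : PathAlgebra K Q.src Q.tgt) (a b : E) :
    Ψ (y * z) a b = Ψ y a α * Ψ z α b + Ψ y a (Q.bar α) * Ψ z (Q.bar α) b := by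
  rw [map_mul, Matrix.mul_apply, ← Finset.sum_pair (f := fun d => Ψ y a d * Ψ z d b)
    (Q.bar_ne α).symm]
  symm
  refine Finset.sum_subset (Finset.subset_univ _) fun d _ hd => ?_
  have h1 : Q.src d ≠ Q.src α := by
    intro h
    rcases Q.eq_or_eq_bar h with rfl | rfl <;> simp at hd
  rw [← hy, map_mul, Matrix.mul_apply, Finset.sum_eq_zero, zero_mul]
  intro d' _
  rw [hv]
  by_cases h2 : d' = d
  · rw [h2, if_neg fun hh => h1 hh.2, mul_zero]
  · rw [if_neg fun hh => h2 hh.1, mul_zero]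

end OrbitRepresentation

end TriangulationQuiver

namespace TriangulationQuiver

/-! ### Words through a border loop -/

section Border

variable {V E : Type*} {Q : TriangulationQuiver V E}

theorem g_of_border {α : E} (hα : Q.f α = α) : Q.g α = Q.bar α := by rw [g_def, hα]

theorem tgt_bar_of_border {α : E} (hα : Q.f α = α) : Q.tgt (Q.bar α) ≠ Q.src α :=
  Q.not_both_loops α (Q.tgt_eq_of_f_eq hα)

theorem f_bar_of_border {α : E} (hα : Q.f α = α) : Q.f (Q.bar α) ≠ Q.bar α := by
  intro h
  have := Q.tgt_eq_of_f_eq h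
  rw [src_bar] at this
  exact tgt_bar_of_border hα this

variable [Finite V] (w : Q.WeightFunction)

theorem WeightFunction.len_bar_of_border {α : E} (hα : Q.f α = α) : w.len (Q.bar α) = w.len α := by
  rw [← g_of_border hα, w.len_g]

theorem not_pent_of_border {α : E} (hα : Q.f α = α) : ¬ w.Pent α := fun h => h.f_ne hα

theorem len_f_bar_of_border {α : E} (hα : Q.f α = α) (h3 : w.len α = 3) :
    w.len (Q.f (Q.bar α)) ≠ 2 := fun h =>
  not_pent_of_border w hα (w.pent_of_len h (by rw [w.len_bar_of_border hα, h3]))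

theorem gWord_of_border {α : E} (hα : Q.f α = α) (k : ℕ) :
    Q.gWord α (k + 1) = α :: Q.gWord (Q.bar α) k := by rw [gWord_succ, g_of_border hα]

theorem gWord_len_of_border {α : E} (hα : Q.f α = α) :
    Q.gWord α (w.len α) = α :: Q.gWord (Q.bar α) (w.len α - 1) := by
  rw [← gWord_of_border hα]
  congr 1
  have := w.two_le_len α; omega

variable {K : Type*} [Field K] {w} (c : Q.ParameterFunction K) (β : E → K)

theorem ParameterFunction.c_bar_of_border {α : E} (hα : Q.f α = α) : c.c (Q.bar α) = c.c α := by
  rw [← g_of_border hα, c.c_g]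

theorem squareTerm_of_border {α : E} (hα : Q.f α = α) (l : List E) :
    squareTerm w c (α :: l) = 0 := by
  have := w.three_le_len_of_border hα
  have h : w.len α ≠ 2 := by omega
  simp [squareTerm, hα, h]

/-- A word of length at least four that is not a rotation of a path `B_a` has trace zero, if no
virtual arrow is near one of its letters. -/
theorem traceWord_eq_zero {x : E} {k l : List E} (h4 : 4 ≤ (k ++ x :: l).length)
    (hne : (k ++ x :: l).length ≠ w.len x)
    (h : 5 ≤ (k ++ x :: l).length ∨ w.len x < 5 ∧ w.len (Q.f x) ≠ 2 ∧ w.len (Q.bar x) ≠ 2) :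
    traceWord w c β (k ++ x :: l) = 0 := by
  have h0 := orbitTerm_eq_zero w c hne
  by_cases h5 : 5 ≤ (k ++ x :: l).length
  · rw [traceWord_of_five_le _ _ _ h5, h0]
  · obtain ⟨h1, h2, h3⟩ := h.resolve_left h5
    rw [orbitTerm_append_comm] at h0
    rw [traceWord_append_comm]
    have hp := pentTerm_eq_zero w c h1 (l ++ k)
    have hs : squareTerm w c (x :: (l ++ k)) = 0 := by
      rw [squareTerm, if_neg, if_neg, add_zero]
      · exact fun h => h2 h.2
      · exact fun h => h3 (by rw [← w.len_f_f]; exact h.2)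
    have hl : (k ++ x :: l).length = (l ++ k).length + 1 := by
      simp only [List.length_append, List.length_cons]; omega
    have ht : triangleTerm Q K (x :: (l ++ k)) = 0 := by
      rw [triangleTerm, if_neg]
      intro h
      rw [h] at hl; simp at hl; simp at h4; omega
    have hb : borderTerm w c β (x :: (l ++ k)) = 0 := by
      rw [borderTerm, if_neg]
      intro h
      rw [h.2] at hl; simp at hl; simp at h4; omega
    rw [List.cons_append] at h0 ⊢
    rw [traceWord, h0, ht, hb, hs, hp]; simp

theorem traceWord_of_border_of_len_lt {α : E} (hα : Q.f α = α) {k l : List E}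
    (h : w.len α < (k ++ α :: l).length) : traceWord w c β (k ++ α :: l) = 0 := by
  have := w.three_le_len_of_border hα
  refine traceWord_eq_zero c β (by omega) (by omega) ?_
  by_cases h5 : 5 ≤ (k ++ α :: l).length
  · exact .inl h5
  · exact .inr ⟨by omega, by rw [hα]; omega, by rw [w.len_bar_of_border hα]; omega⟩

theorem traceWord_bar_of_border_of_len_lt {α : E} (hα : Q.f α = α) {k l : List E}
    (h : w.len α < (k ++ Q.bar α :: l).length) : traceWord w c β (k ++ Q.bar α :: l) = 0 := by
  have := w.three_le_len_of_border hα
  have hb := w.len_bar_of_border hα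
  refine traceWord_eq_zero c β (by omega) (by omega) ?_
  by_cases h5 : 5 ≤ (k ++ Q.bar α :: l).length
  · exact .inl h5
  · refine .inr ⟨by omega, len_f_bar_of_border w hα (by omega), by rw [Q.bar_bar]; omega⟩

theorem traceWord_gWord_of_border {α : E} (hα : Q.f α = α) :
    traceWord w c β (Q.gWord α (w.len α)) = (c.c α)⁻¹ := by
  have h3 := w.three_le_len_of_border hα
  rw [gWord_len_of_border w hα]
  rw [show α :: Q.gWord (Q.bar α) (w.len α - 1) = [α] ++ Q.gWord (Q.bar α) (w.len α - 1) from rfl,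
    traceWord_append_comm w c β [α]]
  have h3' : 3 ≤ w.len (Q.bar α) := by rwa [w.len_bar_of_border hα]
  rw [← w.len_bar_of_border hα, traceWord_gWord_append w c β h3', Q.bar_bar, hα, hα,
    c.c_bar_of_border hα]
  simp

theorem traceWord_border_two {α : E} (hα : Q.f α = α) :
    traceWord w c β [α, α] =
      c.c α * pentTerm w c (Q.gWord (Q.bar α) (w.len α - 1)) + β α / c.c α := by
  have h := traceWord_cons_f w c β α []
  rw [hα] at h
  rw [h, w.len_bar_of_border hα, c.c_bar_of_border hα]
  simp

theorem traceWord_border_cons_cons {α : E} (hα : Q.f α = α) {l : List E} (hl : 2 ≤ l.length) :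
    traceWord w c β (α :: α :: l) = 0 := by
  have h := traceWord_cons_f w c β α l
  have h3 := w.three_le_len_of_border hα
  have h1 : l ≠ [α] := by rintro rfl; simp at hl
  have h2 : l ≠ [] := by rintro rfl; simp at hl
  have h4 : w.len α ≠ 2 := by omega
  rw [hα, hα] at h
  rw [h]
  simp [h1, h2, h4, not_pent_of_border w hα]

theorem traceWord_border_three {α : E} (hα : Q.f α = α) :
    traceWord w c β [α, α, α] = 1 := by
  have h := traceWord_cons_f w c β α [α]
  have h3 := w.three_le_len_of_border hα
  rw [hα, hα] at h
  rw [h]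
  simp

theorem pentTerm_of_length_ne {l : List E} (h : l.length ≠ 4) : pentTerm w c l = 0 := by
  rcases l with _ | ⟨a, _ | ⟨x, _ | ⟨y, _ | ⟨z, _ | ⟨u, l⟩⟩⟩⟩⟩ <;> simp [pentTerm] at h ⊢

end Border

namespace TraceModel

open PathAlgebra

variable {V E : Type*} [Fintype V] {Q : TriangulationQuiver V E} {K : Type*} [Field K]
variable {w : Q.WeightFunction} {c : Q.ParameterFunction K} {β : E → K}
variable {A : Type*} [Ring A] [Algebra K A] (S : TraceModel w c β A)

theorem τ_mul_p_mul_p_eq_zero {k : ℕ} {l1 l2 : List E}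
    (h : ∀ l : List E, k ≤ l.length → traceWord w c β (l1 ++ l ++ l2) = 0) {y : A}
    (hy : y ∈ S.J k) : S.τ (S.p l1 * y * S.p l2) = 0 := by
  rw [S.τ_comm, ← mul_assoc, ← p_append, S.τ_comm]
  refine S.τ_mul_p_eq_zero (fun l hl => ?_) hy
  rw [← List.append_assoc, traceWord_append_comm, ← List.append_assoc, h l hl]

theorem τ_x_mul_mul_x_eq_zero {x : E} {k : ℕ} (l : List E)
    (h : ∀ l' : List E, k ≤ l'.length → traceWord w c β (x :: l' ++ l) = 0) {y : A}
    (hy : y ∈ S.J k) : S.τ (S.p [x] * y * S.p l) = 0 :=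
  S.τ_mul_p_mul_p_eq_zero (l1 := [x]) h hy

/-- The coefficient of a border loop, as a linear functional. -/
noncomputable def coef (α : E) : A →ₗ[K] K :=
  c.c α • S.τ ∘ₗ LinearMap.mulRight K (S.p (Q.gWord (Q.bar α) (w.len α - 1)))

theorem coef_apply (α : E) (y : A) :
    S.coef α y = c.c α * S.τ (y * S.p (Q.gWord (Q.bar α) (w.len α - 1))) := rfl

theorem coef_self {α : E} (hα : Q.f α = α) : S.coef α (S.p [α]) = 1 := by
  rw [coef_apply, ← p_append, τ_p]
  change c.c α * traceWord w c β (α :: Q.gWord (Q.bar α) (w.len α - 1)) = 1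
  rw [← gWord_len_of_border w hα, traceWord_gWord_of_border c β hα, mul_inv_cancel₀ (c.c_ne α)]

theorem coef_J_two {α : E} (hα : Q.f α = α) {y : A} (hy : y ∈ S.J 2) : S.coef α y = 0 := by
  have h3 := w.three_le_len_of_border hα
  rw [coef_apply, S.τ_mul_p_eq_zero (fun l hl => ?_) hy, mul_zero]
  have hg : Q.gWord (Q.bar α) (w.len α - 1) =
      Q.bar α :: Q.gWord (Q.g (Q.bar α)) (w.len α - 1 - 1) := gWord_eq_cons _ (by omega)
  rw [hg]
  apply traceWord_bar_of_border_of_len_lt c β hα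
  simp only [List.length_append, List.length_cons, gWord_length]
  omega

theorem e_mul_gWord (a : E) {k : ℕ} (hk : 0 < k) :
    S.e (Q.src a) * S.p (Q.gWord a k) = S.p (Q.gWord a k) := by
  rw [gWord_eq_cons _ hk, e_mul_p]

theorem coef_eq_zero_of_mul_e {α : E} (hα : Q.f α = α) {y : A} (hy : y * S.e (Q.src α) = 0) :
    S.coef α y = 0 := by
  have h3 := w.three_le_len_of_border hα
  rw [coef_apply, ← S.e_mul_gWord (Q.bar α) (by omega), ← mul_assoc, Q.src_bar, hy, zero_mul,
    map_zero, mul_zero]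

theorem coef_eq_zero_of_e_mul {α : E} (hα : Q.f α = α) {y : A} (hy : S.e (Q.src α) * y = 0) :
    S.coef α y = 0 := by
  have h3 := w.three_le_len_of_border hα
  have h : S.p (Q.gWord (Q.bar α) (w.len α - 1)) * S.e (Q.src α) =
      S.p (Q.gWord (Q.bar α) (w.len α - 1)) := by
    obtain ⟨k, hk⟩ : ∃ k, w.len α - 1 = k + 1 := ⟨w.len α - 2, by omega⟩
    have h1 := w.g_iterate_len_sub_one α
    rw [hk, Function.iterate_succ_apply, g_of_border hα] at h1
    have h2 : Q.tgt (Q.g^[k] (Q.bar α)) = Q.src α := by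
      rw [h1, tgt_f_f, src_bar]
    rw [hk, gWord_succ', ← h2, p_mul_e]
  rw [coef_apply, ← h, S.τ_comm, mul_assoc, hy, mul_zero, map_zero, mul_zero]

theorem coef_bar {α : E} (hα : Q.f α = α) : S.coef α (S.p [Q.bar α]) = 0 :=
  S.coef_eq_zero_of_mul_e hα (S.x_mul_e_ne (tgt_bar_of_border hα))

end TraceModel

end TriangulationQuiver

/-! ### Traces of squares at a border vertex in characteristic two -/

namespace TriangulationQuiver

open PathAlgebra Polynomial

section

variable {K : Type*} [Field K]

/-- If `d W` has no coefficient in the degrees `l + 1` for multiples `l < M` of `n`, and `d` is a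
polynomial in `X ^ n` and `W = a X + ⋯`, then the coefficients of `d` in degrees less than `M`
vanish. -/
theorem coeff_eq_zero_of_coeff_mul {d W : K[X]} {n M : ℕ} (hd : ∀ l, ¬ n ∣ l → d.coeff l = 0)
    (hd0 : d.coeff 0 = 0) (hW0 : W.coeff 0 = 0) (hW1 : W.coeff 1 ≠ 0)
    (h : ∀ l, 0 < l → l < M → n ∣ l → (d * W).coeff (l + 1) = 0) {l : ℕ} (hl : l < M) :
    d.coeff l = 0 := by
  induction l using Nat.strong_induction_on with
  | _ l ih =>
    by_cases hnl : n ∣ l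
    · rcases Nat.eq_zero_or_pos l with rfl | h0
      · exact hd0
      · have := h l h0 hl hnl
        rw [Polynomial.coeff_mul, Finset.sum_eq_single (l, 1)] at this
        · exact (mul_eq_zero.1 this).resolve_right hW1
        · rintro ⟨p, q⟩ hpq hne
          rw [Finset.HasAntidiagonal.mem_antidiagonal] at hpq
          simp only at hpq ⊢
          rcases Nat.lt_trichotomy p l with h1 | h1 | h1
          · rw [ih p h1 (by omega), zero_mul]
          · exact absurd (by rw [h1, show q = 1 by omega]) hne
          · rw [show q = 0 by omega, hW0, mul_zero]
        · simp
    · exact hd l hnl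

theorem coeff_mul_eq_zero {d v : K[X]} {M k l : ℕ} (hd : ∀ l, l < M → d.coeff l = 0)
    (hv : ∀ l, l < k → v.coeff l = 0) (h : l < M + k) : (d * v).coeff l = 0 := by
  rw [Polynomial.coeff_mul]
  refine Finset.sum_eq_zero ?_
  rintro ⟨p, q⟩ hpq
  rw [Finset.HasAntidiagonal.mem_antidiagonal] at hpq
  simp only at hpq ⊢
  by_cases h1 : p < M
  · rw [hd p h1, zero_mul]
  · rw [hv q (by omega), mul_zero]

end

section

variable {V E : Type*} [Fintype V] {Q : TriangulationQuiver V E} {K : Type*} [Field K]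
variable {w : Q.WeightFunction} {c : Q.ParameterFunction K} {β : E → K}
variable {A : Type*} [Ring A] [Algebra K A] (S : TraceModel w c β A)
variable [Fintype E] [DecidableEq E] [DecidableEq V]
  {Ψ : PathAlgebra K Q.src Q.tgt →ₐ[K] Matrix E E K[X]}

/-- Among words from this vertex only those that follow the orbit have a diagonal entry in the two
rows at the vertex, and `B_x` contributes `X ^ len x`. The coefficient in degree `len α` thus
singles out `B_x`. -/
theorem orbitTerm_eq_coeff
    (hw : ∀ l a b, Ψ (word K Q.src Q.tgt l) a b =
        if l = Q.gWord a l.length ∧ b = Q.g^[l.length] a then X ^ l.length else 0)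
    {α : E} (hα : Q.f α = α) {x : E} (hx : Q.src x = Q.src α) (l : List E) :
    c.c α * orbitTerm w c (x :: l) = (Ψ (word K Q.src Q.tgt (x :: l)) α α +
      Ψ (word K Q.src Q.tgt (x :: l)) (Q.bar α) (Q.bar α)).coeff (w.len α) := by
  have hc : c.c x = c.c α ∧ w.len x = w.len α := by
    rcases Q.eq_or_eq_bar hx with rfl | rfl
    · exact ⟨rfl, rfl⟩
    · exact ⟨c.c_bar_of_border hα, w.len_bar_of_border hα⟩
  have key : ∀ a : E, (Ψ (word K Q.src Q.tgt (x :: l)) a a).coeff (w.len x) =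
      if x = a ∧ x :: l = Q.gWord x (w.len x) then 1 else 0 := by
    intro a
    rw [hw]
    by_cases hxa : x = a
    · subst hxa
      by_cases h : x :: l = Q.gWord x (w.len x)
      · have h1 : (x :: l).length = w.len x := by rw [h, gWord_length]
        rw [h1, if_pos ⟨h, (w.g_iterate_len x).symm⟩, if_pos ⟨rfl, h⟩, coeff_X_pow, if_pos rfl]
      · rw [if_neg (show ¬ (x = x ∧ x :: l = Q.gWord x (w.len x)) from fun hh => h hh.2)]
        split_ifs with h2
        · rw [coeff_X_pow, if_neg]
          intro h3
          exact h (h3 ▸ h2.1)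
        · simp
    · rw [if_neg (show ¬ (x = a ∧ x :: l = Q.gWord x (w.len x)) from fun hh => hxa hh.1), if_neg,
        coeff_zero]
      rintro ⟨h, -⟩
      rw [List.length_cons, gWord_succ, List.cons.injEq] at h
      exact hxa h.1
  rw [coeff_add, ← hc.2, key, key, ← hc.1, orbitTerm]
  have hb := Q.bar_ne α
  by_cases h : x :: l = Q.gWord x (w.len x)
  · rw [if_pos h, mul_inv_cancel₀ (c.c_ne x)]
    rcases Q.eq_or_eq_bar hx with h1 | h1
    · rw [if_pos ⟨h1, h⟩, if_neg (fun hh => hb (hh.1.symm.trans h1)), add_zero]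
    · rw [if_neg (fun hh => hb (h1.symm.trans hh.1)), if_pos ⟨h1, h⟩, zero_add]
  · rw [if_neg h, if_neg (fun hh => h hh.2), if_neg (fun hh => h hh.2), mul_zero, add_zero]

theorem orbitRep_diag_eq_zero
    (hw : ∀ l a b, Ψ (word K Q.src Q.tgt l) a b =
        if l = Q.gWord a l.length ∧ b = Q.g^[l.length] a then X ^ l.length else 0)
    {a x : E} (hx : x ≠ a) (l : List E) (b : E) : Ψ (word K Q.src Q.tgt (x :: l)) a b = 0 := by
  rw [hw, if_neg]
  rintro ⟨h, -⟩
  rw [List.length_cons, gWord_succ, List.cons.injEq] at h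
  exact hx h.1

/-- On long closed paths, the trace form is given by the orbit representation. -/
theorem TraceModel.τ_longPaths
    (hw : ∀ l a b, Ψ (word K Q.src Q.tgt l) a b =
        if l = Q.gWord a l.length ∧ b = Q.g^[l.length] a then X ^ l.length else 0)
    {α : E} (hα : Q.f α = α) {y : PathAlgebra K Q.src Q.tgt}
    (hy : y ∈ longPaths K Q.src Q.tgt 5) :
    c.c α * S.τ (S.e (Q.src α) * S.hom y) =
      (Ψ y α α + Ψ y (Q.bar α) (Q.bar α)).coeff (w.len α) := by
  induction hy using Submodule.span_induction with
  | mem y hy =>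
    obtain ⟨l, hl, rfl⟩ := hy
    simp only [Set.mem_ofPred_eq] at hl
    rcases l with _ | ⟨x, l⟩
    · simp at hl
    · change c.c α * S.τ (S.e _ * S.p _) = _
      by_cases hx : Q.src x = Q.src α
      · rw [← hx, S.e_mul_p, S.τ_p, traceWord_of_five_le _ _ _ hl, orbitTerm_eq_coeff hw hα hx]
      · rw [S.e_mul_p_ne (Ne.symm hx), map_zero, mul_zero, orbitRep_diag_eq_zero hw,
          orbitRep_diag_eq_zero hw]
        · simp
        · rintro rfl; exact hx (Q.src_bar α)
        · rintro rfl; exact hx rfl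
  | zero => simp
  | add y z _ _ hy hz =>
    rw [map_add, mul_add, map_add, mul_add, hy, hz, map_add, Matrix.add_apply, Matrix.add_apply]
    simp only [coeff_add]; ring
  | smul r y _ hy =>
    rw [map_smul, mul_smul_comm, map_smul, smul_eq_mul, mul_left_comm, hy, map_smul,
      Matrix.smul_apply, Matrix.smul_apply]
    simp only [coeff_add, coeff_smul, smul_eq_mul]; ring

/-- Squares of paths of length two are the only squares in `J⁴` to which the exceptional terms can
contribute. Only the path `bar α · g (bar α)` survives, which is the origin of the extra term in
`τ_sq_closed`. -/
theorem square_pent_zero {α : E} (hα : Q.f α = α) {x y : E} (hx : Q.src x = Q.src α)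
    (h : ¬ (x = Q.bar α ∧ y = Q.g (Q.bar α))) :
    squareTerm w c [x, y, x, y] + pentTerm w c [x, y, x, y] = 0 := by
  have h3 := w.three_le_len_of_border hα
  have hn := three_le_n_of_border hα
  have hgg : Q.g (Q.g α) ≠ α := by
    intro h
    have := Nat.le_of_dvd (by norm_num) (Q.g_iterate_eq_iff.1 (show Q.g^[2] α = α from h))
    omega
  rcases Q.eq_or_eq_bar hx with rfl | rfl
  · rw [squareTerm_of_border c hα, zero_add, pentTerm, if_neg, if_neg, if_neg, if_neg]
    · simp
    · rintro ⟨h, -⟩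
      simp only [List.cons.injEq, and_true] at h
      apply Q.bar_ne x
      have h1 : Q.f (Q.bar x) = x := by rw [← g_of_border hα]; exact h.2.1.symm
      rw [← Q.f_f_f (Q.bar x), h1, hα, hα]
    · rintro ⟨h, -⟩
      simp only [List.cons.injEq, and_true] at h
      exact hgg h.2.1.symm
    · rintro ⟨h, -⟩
      simp only [List.cons.injEq, and_true] at h
      exact hgg h.2.1.symm
    · exact fun h => not_pent_of_border w hα h.2
  · have hy' : y ≠ Q.g (Q.bar α) := fun h' => h ⟨rfl, h'⟩
    have hg := Q.g_ne_f
    rw [squareTerm, pentTerm, if_neg, if_neg, if_neg, if_neg, if_neg, if_neg]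
    · simp
    · rintro ⟨h, -⟩; simp only [List.cons.injEq, and_true] at h; exact hy' h.1
    · rintro ⟨h, -⟩; simp only [List.cons.injEq, and_true] at h; exact hy' h.1
    · rintro ⟨h, -⟩; simp only [List.cons.injEq, and_true] at h; exact hy' h.1
    · rintro ⟨h, -⟩; simp only [List.cons.injEq, and_true] at h
      rw [← h.2.1, h.1] at h
      exact hg _ h.2.2.symm
    · rintro ⟨h, -⟩; simp only [List.cons.injEq, and_true] at h; exact hy' h.1
    · rintro ⟨-, h⟩
      rw [w.len_f_f, Q.bar_bar] at h
      omega

end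

end TriangulationQuiver

namespace TriangulationQuiver

open PathAlgebra Polynomial

variable {V E : Type*} [Fintype V] {Q : TriangulationQuiver V E} {K : Type*} [Field K]
variable {w : Q.WeightFunction} {c : Q.ParameterFunction K} {β : E → K}
variable {A : Type*} [Ring A] [Algebra K A] (S : TraceModel w c β A)

/-- The squares of closed paths at a border vertex, in characteristic two. -/
theorem TraceModel.τ_sq_closed [CharP K 2] [Fintype E] [DecidableEq E] [DecidableEq V]
    {Ψ : PathAlgebra K Q.src Q.tgt →ₐ[K] Matrix E E K[X]}
    (hv : ∀ v a b, Ψ (vertex K Q.src Q.tgt v) a b = if a = b ∧ Q.src a = v then 1 else 0)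
    (hw : ∀ l a b, Ψ (word K Q.src Q.tgt l) a b =
        if l = Q.gWord a l.length ∧ b = Q.g^[l.length] a then X ^ l.length else 0)
    {α : E} (hα : Q.f α = α) {y Y : PathAlgebra K Q.src Q.tgt}
    (hy : y ∈ longPaths K Q.src Q.tgt 2)
    (hY : Y = vertex K Q.src Q.tgt (Q.src α) * y * vertex K Q.src Q.tgt (Q.src α)) :
    c.c α * S.τ (S.hom (Y * Y)) =
      (Ψ (Y * Y) α α + Ψ (Y * Y) (Q.bar α) (Q.bar α)).coeff (w.len α) +
      c.c α * (squareTerm w c [Q.bar α, Q.g (Q.bar α), Q.bar α, Q.g (Q.bar α)] +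
        pentTerm w c [Q.bar α, Q.g (Q.bar α), Q.bar α, Q.g (Q.bar α)]) *
          ((Ψ Y (Q.bar α) α).coeff 2) ^ 2 := by
  have hclosed : ∀ y, vertex K Q.src Q.tgt (Q.src α) * y * vertex K Q.src Q.tgt (Q.src α) *
      vertex K Q.src Q.tgt (Q.src α) =
      vertex K Q.src Q.tgt (Q.src α) * y * vertex K Q.src Q.tgt (Q.src α) := by
    intro y; rw [mul_assoc _ _ (vertex K Q.src Q.tgt (Q.src α)), vertex_mul_self]
  induction hy using Submodule.span_induction generalizing Y with
  | mem y hy =>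
    obtain ⟨l, hl, rfl⟩ := hy
    simp only [Set.mem_ofPred_eq] at hl
    rcases l with _ | ⟨x, _ | ⟨z, l⟩⟩
    · simp at hl
    · simp at hl
    rcases vertex_mul_word_mul_vertex (K := K) (src := Q.src) (tgt := Q.tgt) (Q.src α) x (z :: l)
      with h | ⟨h1, h2, h3⟩
    · rw [hY, h]; simp
    rw [hY, h3, ← word_append]
    change c.c α * S.τ (S.p _) = _
    have h4 := orbitTerm_eq_coeff (w := w) (c := c) hw hα h1 (z :: l ++ x :: z :: l)
    rw [List.cons_append, S.τ_p, ← h4]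
    rcases l with _ | ⟨u, l⟩
    · have hb : (Ψ (word K Q.src Q.tgt [x, z]) (Q.bar α) α).coeff 2 =
          if x = Q.bar α ∧ z = Q.g (Q.bar α) then 1 else 0 := by
        rw [hw]
        simp only [List.length_cons, List.length_nil, zero_add, Nat.reduceAdd, gWord_two,
          List.cons.injEq, and_true]
        by_cases h5 : x = Q.bar α ∧ z = Q.g (Q.bar α)
        · have h6 : Q.g (Q.g (Q.bar α)) = α := by
            simp only [List.getLast_cons_cons, List.getLast_singleton] at h2
            rcases Q.in_cases (a := α) (b := z) (by rw [h2, Q.tgt_eq_of_f_eq hα]) with h7 | h7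
            · exfalso
              apply tgt_bar_of_border hα
              rw [← Q.src_g, ← h5.2, h7]
            · rw [← h5.2, h7, hα]
          rw [if_pos h5, if_pos ⟨h5, h6.symm⟩, coeff_X_pow, if_pos rfl]
        · rw [if_neg h5, if_neg fun hh => h5 hh.1, coeff_zero]
      rw [hb]
      have h6 : traceWord w c β [x, z, x, z] = orbitTerm w c [x, z, x, z] +
          (squareTerm w c [x, z, x, z] + pentTerm w c [x, z, x, z]) := by
        simp [traceWord, triangleTerm, borderTerm]; ring
      change c.c α * traceWord w c β [x, z, x, z] = c.c α * orbitTerm w c [x, z, x, z] + _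
      rw [h6, mul_add]
      by_cases h5 : x = Q.bar α ∧ z = Q.g (Q.bar α)
      · rw [if_pos h5, h5.1, h5.2]; ring
      · rw [if_neg h5, square_pent_zero hα h1 h5]; ring
    · rw [traceWord_of_five_le _ _ _ (by simp only [List.length_cons, List.length_append]; omega), orbitRep_coeff_of_lt hw (k := 3)
        (word_mem (by simp only [List.length_cons]; omega)) (by norm_num)]
      ring
  | zero => rw [hY]; simp
  | add y z _ _ hy hz =>
    specialize hy rfl
    specialize hz rfl
    rw [mul_add, add_mul] at hY
    set Y1 := vertex K Q.src Q.tgt (Q.src α) * y * vertex K Q.src Q.tgt (Q.src α) with hY1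
    set Y2 := vertex K Q.src Q.tgt (Q.src α) * z * vertex K Q.src Q.tgt (Q.src α) with hY2
    have c1 : Y1 * vertex K Q.src Q.tgt (Q.src α) = Y1 := hclosed y
    have c2 : Y2 * vertex K Q.src Q.tgt (Q.src α) = Y2 := hclosed z
    -- In characteristic two both sides of the claim are additive in `Y`: the cross terms have trace
    -- zero, under `τ` and under the trace of the `2 × 2` block, since a trace takes equal values on
    -- `Y1 Y2` and `Y2 Y1`.
    have hYY : Y * Y = Y1 * Y1 + Y2 * Y2 + (Y1 * Y2 + Y2 * Y1) := by rw [hY]; noncomm_ring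
    have ht : S.τ (S.hom (Y1 * Y2 + Y2 * Y1)) = 0 := by
      rw [map_add, map_add, map_mul S.hom Y1, map_mul S.hom Y2, S.τ_comm, CharTwo.add_self_eq_zero]
    have hp : Ψ (Y1 * Y2 + Y2 * Y1) α α + Ψ (Y1 * Y2 + Y2 * Y1) (Q.bar α) (Q.bar α) = 0 := by
      rw [map_add, Matrix.add_apply, Matrix.add_apply, orbitRep_mul hv α c1, orbitRep_mul hv α c2,
        orbitRep_mul hv α c1, orbitRep_mul hv α c2]
      have h2 : (2 : K[X]) = 0 := CharTwo.two_eq_zero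
      linear_combination (Ψ Y1 α α * Ψ Y2 α α + Ψ Y1 α (Q.bar α) * Ψ Y2 (Q.bar α) α +
        Ψ Y2 α (Q.bar α) * Ψ Y1 (Q.bar α) α +
        Ψ Y1 (Q.bar α) (Q.bar α) * Ψ Y2 (Q.bar α) (Q.bar α)) * h2
    have e1 : (Ψ (Y * Y) α α + Ψ (Y * Y) (Q.bar α) (Q.bar α)) =
        (Ψ (Y1 * Y1) α α + Ψ (Y1 * Y1) (Q.bar α) (Q.bar α)) +
        (Ψ (Y2 * Y2) α α + Ψ (Y2 * Y2) (Q.bar α) (Q.bar α)) := by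
      rw [hYY, map_add, map_add, Matrix.add_apply, Matrix.add_apply, Matrix.add_apply,
        Matrix.add_apply]
      linear_combination hp
    have e2 : (Ψ Y (Q.bar α) α).coeff 2 =
        (Ψ Y1 (Q.bar α) α).coeff 2 + (Ψ Y2 (Q.bar α) α).coeff 2 := by
      rw [hY, map_add, Matrix.add_apply, coeff_add]
    rw [e1, e2, coeff_add, CharTwo.add_sq, hYY, map_add, map_add, map_add, map_add, ht, add_zero,
      mul_add, hy, hz]
    ring
  | smul r y _ hy =>
    specialize hy rfl
    rw [mul_smul_comm, smul_mul_assoc] at hY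
    set Y1 := vertex K Q.src Q.tgt (Q.src α) * y * vertex K Q.src Q.tgt (Q.src α) with hY1
    have hYY : Y * Y = (r * r) • (Y1 * Y1) := by rw [hY, smul_mul_smul_comm]
    have e1 : (Ψ (Y * Y) α α + Ψ (Y * Y) (Q.bar α) (Q.bar α)) =
        (r * r) • (Ψ (Y1 * Y1) α α + Ψ (Y1 * Y1) (Q.bar α) (Q.bar α)) := by
      rw [hYY, map_smul, Matrix.smul_apply, Matrix.smul_apply, smul_add]
    have e2 : (Ψ Y (Q.bar α) α).coeff 2 = r * (Ψ Y1 (Q.bar α) α).coeff 2 := by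
      rw [hY, map_smul, Matrix.smul_apply, coeff_smul, smul_eq_mul]
    rw [e1, e2, hYY, map_smul, map_smul, coeff_smul, smul_eq_mul, smul_eq_mul]
    linear_combination (r * r) * hy

end TriangulationQuiver

namespace TriangulationQuiver

open PathAlgebra Polynomial

variable {V E : Type*} [Fintype V] {Q : TriangulationQuiver V E} {K : Type*} [Field K]
variable {w : Q.WeightFunction} {c : Q.ParameterFunction K} {β : E → K}
variable {A : Type*} [Ring A] [Algebra K A] (S : TraceModel w c β A)

theorem TraceModel.exists_lift_mem {k : ℕ} {j : A} (hj : j ∈ S.J k) :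
    ∃ y ∈ longPaths K Q.src Q.tgt k, S.hom y = j := by
  have : S.J k = (longPaths K Q.src Q.tgt k).map S.hom.toLinearMap := by
    rw [J, longPaths, Submodule.map_span, ← Set.image_comp]; rfl
  rw [this] at hj
  exact hj

theorem orbitRep_gWord [Fintype E] [DecidableEq E]
    {Ψ : PathAlgebra K Q.src Q.tgt →ₐ[K] Matrix E E K[X]}
    (hw : ∀ l a b, Ψ (word K Q.src Q.tgt l) a b =
        if l = Q.gWord a l.length ∧ b = Q.g^[l.length] a then X ^ l.length else 0)
    {q : ℕ} (hq : 0 < q) (x a b : E) : Ψ (word K Q.src Q.tgt (Q.gWord x q)) a b =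
      if x = a ∧ b = Q.g^[q] a then X ^ q else 0 := by
  rw [hw, gWord_length]
  congr 1
  apply propext
  constructor
  · rintro ⟨h, h'⟩
    rw [gWord_eq_cons _ hq, gWord_eq_cons _ hq, List.cons.injEq] at h
    exact ⟨h.1, h'⟩
  · rintro ⟨rfl, h'⟩
    exact ⟨rfl, h'⟩

/-- Let `ρ = a α + j` be a multiple of a border loop `α`, up to closed paths of length at least two.
In characteristic two, if the trace form vanishes on `ρ ^ 2 J ^ 2`, then its values on
`ρ ^ 2 α` and `ρ ^ 2` are determined by `a`. -/
theorem TraceModel.τ_sq_of_leading [CharP K 2] {α : E} (hα : Q.f α = α) {j : A} (hj : j ∈ S.J 2)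
    (he : S.e (Q.src α) * j = j) (he' : j * S.e (Q.src α) = j) {a : K} (ha : a ≠ 0)
    {ρ : A} (hρ : ρ = a • S.p [α] + j) (h0 : ∀ y ∈ S.J 2, S.τ (ρ * ρ * y) = 0) :
    S.τ (ρ * ρ * S.p [α]) = a ^ 2 ∧
      (4 ≤ w.len α → S.τ (ρ * ρ) = a ^ 2 * S.τ (S.p [α, α])) := by
  classical
  have := Q.finite_arrows
  have := Fintype.ofFinite E
  obtain ⟨Ψ, hv, hw⟩ := Q.exists_orbitRep K
  obtain ⟨y, hy, hyj⟩ := S.exists_lift_mem hj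
  have hc := c.c_ne α
  have hM3 := w.three_le_len_of_border hα
  have hn3 := three_le_n_of_border hα
  have hnM : Q.n α ∣ w.len α := Dvd.intro_left _ rfl
  have hnb : Q.n (Q.bar α) = Q.n α := by rw [← g_of_border hα, Q.n_g]
  have hba := Q.bar_ne α
  have two : (2 : K) = 0 := CharTwo.two_eq_zero
  have two' : (2 : K[X]) = 0 := CharTwo.two_eq_zero
  set b := Q.bar α with hb
  set ε := vertex K Q.src Q.tgt (Q.src α) with hε
  have hεε : ε * ε = ε := vertex_mul_self _
  set Y := ε * y * ε with hY
  have hYε : Y * ε = Y := by rw [hY, mul_assoc, hεε]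
  have hεY : ε * Y = Y := by rw [hY, ← mul_assoc, ← mul_assoc, hεε]
  have hYmem : Y ∈ longPaths K Q.src Q.tgt 2 := vertex_mul_mul_vertex_mem (by norm_num) _ hy
  have hYj : S.hom Y = j := by
    rw [hY, map_mul, map_mul, hyj]
    change S.e _ * j * S.e _ = j
    rw [he, he']
  set x := word K Q.src Q.tgt [α] with hx
  have hxmem : x ∈ longPaths K Q.src Q.tgt 1 := word_mem (by simp)
  have hxε : x * ε = x := by
    have := arrow_mul_vertex (K := K) (src := Q.src) (tgt := Q.tgt) α
    rw [Q.tgt_eq_of_f_eq hα] at this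
    simpa [hx, word] using this
  have hεx : ε * x = x := by
    have := vertex_mul_arrow (K := K) (src := Q.src) (tgt := Q.tgt) α
    simpa [hx, word] using this
  have hxp : S.hom x = S.p [α] := rfl
  set R := a • x + Y with hR
  have hRρ : S.hom R = ρ := by rw [hR, map_add, map_smul, hYj, hρ, hxp]
  have hRε : R * ε = R := by rw [hR, add_mul, smul_mul_assoc, hxε, hYε]
  have hεR : ε * R = R := by rw [hR, mul_add, mul_smul_comm, hεx, hεY]
  have hΨx : ∀ p q, Ψ x p q = if α = p ∧ q = Q.g p then X else 0 := by
    intro p q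
    have := orbitRep_gWord hw (q := 1) (by norm_num) α p q
    rw [gWord_one, pow_one] at this
    exact this
  have hga : Q.g α = b := g_of_border hα
  -- In the rows and columns `α`, `b`, the element `Y` is the matrix `(t, u; v, s)`, and `R` is `(t,
  -- a X + u; v, s)`, because `α` contributes only `X` at `(α, b)`.
  set t := Ψ Y α α with ht
  set u := Ψ Y α b with hu
  set v := Ψ Y b α with hvv
  set s := Ψ Y b b with hs
  have hRαα : Ψ R α α = t := by
    rw [hR, map_add, map_smul, Matrix.add_apply, Matrix.smul_apply, hΨx, if_neg, smul_zero,
      zero_add]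
    rw [hga]; exact fun h => hba h.2.symm
  have hRαb : Ψ R α b = a • X + u := by
    rw [hR, map_add, map_smul, Matrix.add_apply, Matrix.smul_apply, hΨx, if_pos ⟨rfl, hga.symm⟩]
  have hRb : ∀ q, Ψ R b q = Ψ Y b q := by
    intro q
    rw [hR, map_add, map_smul, Matrix.add_apply, Matrix.smul_apply, hΨx, if_neg, smul_zero,
      zero_add]
    exact fun h => hba h.1.symm
  have hYlt : ∀ l, l < 2 → ∀ p q, (Ψ Y p q).coeff l = 0 := fun l hl p q =>
    orbitRep_coeff_of_lt hw hYmem hl p q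
  have hdn : ∀ l, ¬ Q.n α ∣ l → (t + s).coeff l = 0 := by
    intro l hl
    rw [coeff_add, orbitRep_coeff hv hw Y (fun h => hl (Q.g_iterate_eq_iff.1 h)),
      orbitRep_coeff hv hw Y (fun h => hl (hnb ▸ Q.g_iterate_eq_iff.1 h)), add_zero]
  have hRR : ∀ p q, Ψ (R * R) p q = Ψ R p α * Ψ R α q + Ψ R p b * Ψ R b q := fun p q =>
    orbitRep_mul hv α hRε R p q
  have hRRε : R * R * ε = R * R := by rw [mul_assoc, hRε]
  have hεRR : ε * (R * R) = R * R := by rw [← mul_assoc, hεR]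
  have hRmem : R ∈ longPaths K Q.src Q.tgt 1 := by
    refine add_mem (Submodule.smul_mem _ _ hxmem) ?_
    have := mul_mem_longPaths hYmem (word_mem (l := []) (k := 0) (by simp)) (m := 1) (by simp)
    rwa [show word K Q.src Q.tgt [] = 1 by simp [word], mul_one] at this
  -- the coefficients of `t + s` in degrees less than `len α` vanish
  have hd : ∀ l, l < w.len α → (t + s).coeff l = 0 := by
    intro l hl
    refine coeff_eq_zero_of_coeff_mul (W := a • X + u) (n := Q.n α) hdn ?_ ?_ ?_ ?_ hl
    · rw [coeff_add, hYlt 0 (by norm_num), hYlt 0 (by norm_num), add_zero]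
    · rw [coeff_add, hYlt 0 (by norm_num)]; simp
    · rw [coeff_add, hYlt 1 (by norm_num)]; simpa using ha
    · intro l h1 h2 h3
      -- The test element `Z` is the path of length `q` along the orbit from `b` to `α`. The
      -- coefficient of `R² Z` in degree `len α` is then the coefficient of the `(α, b)` entry of
      -- `R²`, namely `(t + s)(a X + u)`, in degree `l + 1`.
      obtain ⟨q, hq⟩ : ∃ q, w.len α = l + q + 1 := ⟨w.len α - l - 1, by omega⟩
      have h4 : Q.n α ∣ q + 1 := by
        have := Nat.dvd_sub hnM h3
        rwa [show w.len α - l = q + 1 by omega] at this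
      have h5 := Nat.le_of_dvd (by omega) h4
      have h6 : Q.g^[q] b = α := by
        rw [← hga, ← Function.iterate_succ_apply]; exact Q.g_iterate_eq_iff.2 h4
      set Z := word K Q.src Q.tgt (Q.gWord b q) with hZ
      have hZmem : Z ∈ longPaths K Q.src Q.tgt 2 := word_mem (by rw [gWord_length]; omega)
      have hΨZ : ∀ p r, Ψ Z p r = if b = p ∧ r = Q.g^[q] p then X ^ q else 0 :=
        orbitRep_gWord hw (by omega) b
      have e1 : S.τ (S.hom (R * R * Z)) = 0 := by
        rw [map_mul S.hom, map_mul S.hom, hRρ]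
        exact h0 _ (S.p_mem_J (by rw [gWord_length]; omega))
      -- The term `α² Z` may be too short for `τ_longPaths`, but both its trace and its matrix
      -- vanish; the rest `D` consists of paths of length at least five.
      set D := a • (x * Y * Z) + a • (Y * x * Z) + Y * Y * Z with hD
      have e2 : R * R * Z = (a * a) • word K Q.src Q.tgt (α :: α :: Q.gWord b q) + D := by
        have : word K Q.src Q.tgt (α :: α :: Q.gWord b q) = x * x * Z := by
          rw [hx, ← word_append, hZ, ← word_append]; rfl
        rw [this, hR, hD]
        simp only [add_mul, mul_add, smul_mul_assoc, mul_smul_comm]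
        module
      have hDmem : D ∈ longPaths K Q.src Q.tgt 5 := by
        refine add_mem (add_mem ?_ ?_) ?_
        · exact Submodule.smul_mem _ _ (mul_mem_longPaths (mul_mem_longPaths hxmem hYmem le_rfl)
            hZmem (by norm_num))
        · exact Submodule.smul_mem _ _ (mul_mem_longPaths (mul_mem_longPaths hYmem hxmem le_rfl)
            hZmem (by norm_num))
        · exact mul_mem_longPaths (mul_mem_longPaths hYmem hYmem le_rfl) hZmem (by norm_num)
      have hεD : ε * D = D := by
        rw [hD]
        simp only [mul_add, mul_smul_comm, ← mul_assoc, hεx, hεY]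
      have e3 := S.τ_longPaths hw hα hDmem
      have e4 : S.e (Q.src α) * S.hom D = S.hom D := by
        change S.hom ε * S.hom D = _
        rw [← map_mul S.hom, hεD]
      rw [e2, map_add, map_add, map_smul, map_smul] at e1
      have e5 : S.τ (S.hom (word K Q.src Q.tgt (α :: α :: Q.gWord b q))) = 0 := by
        rw [S.τ_word, traceWord_border_cons_cons c β hα (by rw [gWord_length]; omega)]
      rw [e5, smul_zero, zero_add] at e1
      rw [e4, e1, mul_zero] at e3
      have e6 : ∀ p r, Ψ D p r = Ψ (R * R * Z) p r := by
        intro p r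
        clear_value D
        rw [e2, map_add, map_smul, Matrix.add_apply, Matrix.smul_apply, hw, if_neg, smul_zero,
          zero_add]
        rintro ⟨h7, -⟩
        rw [List.length_cons, List.length_cons, gWord_succ, gWord_succ, List.cons.injEq,
          List.cons.injEq] at h7
        rw [← h7.1, hga] at h7
        exact hba h7.2.1.symm
      rw [e6, e6, orbitRep_mul hv α hRRε, orbitRep_mul hv α hRRε] at e3
      simp only [hΨZ, hRR, ← hb, h6, hba, hRαα, hRαb, hRb, false_and, and_false, and_self,
        if_true, if_false, mul_zero, add_zero, zero_add, coeff_mul_X_pow'] at e3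
      rw [if_pos (by omega), show w.len α - q = l + 1 by omega] at e3
      rw [e3]
      congr 1
      ring
  have hvlt : ∀ l, l < 2 → v.coeff l = 0 := fun l hl => hYlt l hl _ _
  have hτ : ∀ y : A, c.c α * S.τ y = 0 → S.τ y = 0 := fun y h => (mul_eq_zero.1 h).resolve_left hc
  have hYY : ∀ p q, Ψ (Y * Y) p q = Ψ Y p α * Ψ Y α q + Ψ Y p b * Ψ Y b q := fun p q =>
    orbitRep_mul hv α hYε Y p q
  refine ⟨?_, fun hM4 => ?_⟩
  · have hYYε : Y * Y * ε = Y * Y := by rw [mul_assoc, hYε]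
    -- The relevant entry of `Y²` is the one at `(b, α)`, equal to `(t + s) v`. It starts in degree
    -- at least `len α + 2`, too high for the coefficient in degree `len α - 1`.
    have e1 : S.τ (j * j * S.p [α]) = 0 := by
      apply hτ
      have e2 := S.τ_longPaths hw hα (y := Y * Y * x)
        (mul_mem_longPaths (mul_mem_longPaths hYmem hYmem le_rfl) hxmem (by norm_num))
      rw [map_mul S.hom, map_mul S.hom, hYj, hxp, ← mul_assoc, ← mul_assoc, he] at e2
      rw [e2, orbitRep_mul hv α hYYε, orbitRep_mul hv α hYYε]
      simp only [hΨx, hga, ← hb, hba.symm, false_and, and_false, and_self, if_true, if_false,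
        mul_zero, add_zero, zero_add, hYY]
      obtain ⟨k, hk⟩ : ∃ k, w.len α = k + 1 := ⟨w.len α - 1, by omega⟩
      rw [hk, coeff_mul_X]
      have := coeff_mul_eq_zero hd hvlt (l := k) (by omega)
      rw [← this]
      congr 1
      ring
    have e2 : ρ * ρ * S.p [α] = (a * a) • S.p [α, α, α] +
        a • (S.p [α] * j * S.p [α] + j * S.p [α] * S.p [α]) + j * j * S.p [α] := by
      have : S.p [α, α, α] = S.p [α] * S.p [α] * S.p [α] := by
        rw [← p_append, ← p_append]; rfl
      rw [this, hρ]
      simp only [add_mul, mul_add, smul_mul_assoc, mul_smul_comm, smul_smul, smul_add]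
      module
    have e3 : S.τ (S.p [α] * j * S.p [α]) = S.τ (j * S.p [α] * S.p [α]) := by
      rw [mul_assoc, S.τ_comm]
    rw [e2, map_add, map_add, map_smul, map_smul, map_add, e1, e3, CharTwo.add_self_eq_zero, S.τ_p,
      traceWord_border_three c β hα]
    simp; ring
  -- The coefficient of `bar α · g (bar α)` in `Y` must vanish to remove the exceptional squares. It
  -- can be non-zero only if `n_α = 3`; then `len α ≥ 6`, and testing `ρ²` against the orbit path of
  -- length `len α - 3` gives `a v₂ = 0`. For `len α = 3` no test path is left, which is why the
  -- disc is different.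
  · have hv2 : v.coeff 2 = 0 := by
      by_cases hn : Q.n α = 3
      · obtain ⟨m, hm⟩ := hnM
        rw [hn] at hm
        obtain ⟨q, hq⟩ : ∃ q, w.len α = q + 3 := ⟨w.len α - 3, by omega⟩
        have h6 : Q.g^[q] α = α := Q.g_iterate_eq_iff.2 (by rw [hn]; omega)
        set Z := word K Q.src Q.tgt (Q.gWord α q) with hZ
        have hZmem : Z ∈ longPaths K Q.src Q.tgt 3 := word_mem (by rw [gWord_length]; omega)
        have hΨZ : ∀ p r, Ψ Z p r = if α = p ∧ r = Q.g^[q] p then X ^ q else 0 :=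
          orbitRep_gWord hw (by omega) α
        have e1 : S.τ (S.hom (R * R * Z)) = 0 := by
          rw [map_mul S.hom, map_mul S.hom, hRρ]
          exact h0 _ (S.p_mem_J (by rw [gWord_length]; omega))
        have e3 := S.τ_longPaths hw hα (y := R * R * Z)
          (mul_mem_longPaths (mul_mem_longPaths hRmem hRmem le_rfl) hZmem (by norm_num))
        have e4 : S.e (Q.src α) * S.hom (R * R * Z) = S.hom (R * R * Z) := by
          change S.hom ε * S.hom _ = _
          rw [← map_mul S.hom, ← mul_assoc, hεRR]
        rw [e4, e1, mul_zero, orbitRep_mul hv α hRRε, orbitRep_mul hv α hRRε] at e3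
        simp only [hΨZ, hRR, ← hb, h6, hba, hba.symm, hRαα, hRαb, hRb, false_and, and_false,
          and_self, if_true, if_false, mul_zero, add_zero, coeff_mul_X_pow'] at e3
        rw [if_pos (by omega), show w.len α - q = 3 by omega] at e3
        have htlt : ∀ l, l < 3 → t.coeff l = 0 := by
          intro l hl
          rcases Nat.eq_zero_or_pos l with rfl | h7
          · exact hYlt 0 (by norm_num) _ _
          · refine orbitRep_coeff hv hw Y fun h => ?_
            have := Nat.le_of_dvd h7 (Q.g_iterate_eq_iff.1 h)
            omega
        have e5 : (t * t).coeff 3 = 0 :=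
          coeff_mul_eq_zero htlt (k := 1) (fun l hl => htlt l (by omega)) (by norm_num)
        have e6 : (u * v).coeff 3 = 0 :=
          coeff_mul_eq_zero (M := 2) (fun l hl => hYlt l hl _ _) hvlt (by norm_num)
        rw [coeff_add, e5, add_mul, coeff_add, e6, smul_mul_assoc, coeff_smul, coeff_X_mul] at e3
        simp only [zero_add, add_zero, smul_eq_mul] at e3
        exact (mul_eq_zero.1 e3.symm).resolve_left ha
      · refine orbitRep_coeff hv hw Y fun h => hn ?_
        rw [← hga, ← Function.iterate_succ_apply] at h
        have := Nat.le_of_dvd (by norm_num) (Q.g_iterate_eq_iff.1 h)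
        omega
    -- The block trace of `Y²` is `t² + s² + 2 u v = (t + s)²` in characteristic two, and `t + s`
    -- starts in degree at least `len α`.
    have e1 : S.τ (j * j) = 0 := by
      apply hτ
      have e2 := S.τ_sq_closed hv hw hα hy hY
      rw [map_mul S.hom, hYj] at e2
      rw [e2, hv2, hYY, hYY]
      have := coeff_mul_eq_zero hd (k := 1) (fun l hl => hd l (by omega)) (l := w.len α) (by omega)
      rw [zero_pow two_ne_zero, mul_zero, add_zero, ← this]
      congr 1
      linear_combination (u * v - t * s) * two'
    have e2 : ρ * ρ = (a * a) • S.p [α, α] + a • (S.p [α] * j + j * S.p [α]) + j * j := by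
      have : S.p [α, α] = S.p [α] * S.p [α] := by
        rw [← p_append]; rfl
      rw [this, hρ]
      simp only [add_mul, mul_add, smul_mul_assoc, mul_smul_comm, smul_smul, smul_add]
      module
    rw [e2, map_add, map_add, map_smul, map_smul, map_add, e1, S.τ_comm j, CharTwo.add_self_eq_zero]
    rw [smul_zero, add_zero, add_zero, smul_eq_mul, pow_two]

end TriangulationQuiver

/-! ### Relations around a border loop, and the trace of its square -/

namespace TriangulationQuiver

section Combinatorics

variable {V E : Type*} {Q : TriangulationQuiver V E}

theorem g_f_f_bar (α : E) : Q.g (Q.f (Q.f (Q.bar α))) = α := by rw [g_f_f, bar_bar]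

variable [Finite V] {w : Q.WeightFunction}

/-- The arrows around a virtual arrow `f y`. -/
theorem f_f_g_of_virtual {y : E} (h : w.len (Q.f y) = 2) :
    Q.f (Q.f (Q.g y)) = Q.g (Q.f y) := by
  apply Q.f.injective
  rw [Q.f_f_f, ← Q.bar_g (Q.g (Q.f y)), w.g_g_of_len_two h]
  rfl

theorem g_f_g_of_virtual {y : E} (h : w.len (Q.f y) = 2) :
    Q.g (Q.f (Q.g y)) = Q.f (Q.f y) := by
  rw [g_def, f_f_g_of_virtual h, bar_g]

theorem g_g_f_g_of_virtual {y : E} (h : w.len (Q.f y) = 2) :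
    Q.g (Q.g (Q.f (Q.g y))) = Q.bar y := by
  rw [g_f_g_of_virtual h, g_f_f]

theorem g_iterate_of_border {α : E} (hα : Q.f α = α) (k : ℕ) :
    Q.g^[k] (Q.bar α) = Q.g^[k + 1] α := by
  rw [Function.iterate_succ_apply, g_of_border hα]

/-- The arrow before a border loop in its `g`-orbit. -/
theorem g_iterate_sub_two_of_border {α : E} (hα : Q.f α = α) :
    Q.g^[w.len α - 2] (Q.bar α) = Q.f (Q.f (Q.bar α)) := by
  have := w.three_le_len_of_border hα
  rw [g_iterate_of_border hα, ← w.g_iterate_len_sub_one α]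
  congr 1
  omega

/-- The pentagon around a border loop `α`. -/
theorem WeightFunction.Pent.of_border {α : E} (hα : Q.f α = α)
    (h : w.Pent (Q.f (Q.f (Q.bar α)))) :
    Q.g (Q.g (Q.g (Q.bar α))) = Q.f (Q.f (Q.bar α)) ∧ Q.n α = 5 := by
  have h1 : Q.g (Q.g (Q.g (Q.bar α))) = Q.f (Q.f (Q.bar α)) := by
    have := h.g_g_g
    rwa [Q.f_f_f] at this
  refine ⟨h1, ?_⟩
  have h2 : Q.g^[5] α = α := by
    change Q.g (Q.g (Q.g (Q.g (Q.g α)))) = α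
    rw [g_of_border hα, h1, g_f_f_bar]
  have h3 := Q.g_iterate_eq_iff.1 h2
  rcases (Nat.dvd_prime (by norm_num)).1 h3 with h4 | h4
  · have := three_le_n_of_border hα
    omega
  · exact h4

end Combinatorics

namespace TraceModel

variable {V E : Type*} [Fintype V] {Q : TriangulationQuiver V E} {K : Type*} [Field K]
variable {w : Q.WeightFunction} {c : Q.ParameterFunction K} {β : E → K}
variable {A : Type*} [Ring A] [Algebra K A] (S : TraceModel w c β A)

theorem p_border_border_bar {α : E} (hα : Q.f α = α) : S.p [α, α, Q.bar α] = 0 := by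
  have h := S.p_zero_fg (a := α) (by
    rw [hα, hα]
    have := w.three_le_len_of_border hα
    rintro (h | h)
    · omega
    · exact not_pent_of_border w hα h)
  rwa [hα, g_of_border hα] at h

theorem p_border_border_eq {α : E} (hα : Q.f α = α) : S.p [α, α] =
    c.c α • S.p (Q.gWord (Q.bar α) (w.len α - 1)) +
      β α • S.p (Q.gWord (Q.bar α) (w.len α)) := by
  rw [S.p_loop hα, w.len_bar_of_border hα, c.c_bar_of_border hα]

theorem p_border_border_mem {α : E} (hα : Q.f α = α) : S.p [α, α] ∈ S.J (w.len α - 1) := by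
  rw [S.p_border_border_eq hα]
  exact add_mem (Submodule.smul_mem _ _ (S.p_mem_J (by rw [gWord_length])))
    (Submodule.smul_mem _ _ (S.p_mem_J (by rw [gWord_length]; omega)))

/-- The square of a border loop is annihilated by the square of the arrow ideal. -/
theorem p_border_border_mul {α : E} (hα : Q.f α = α) {y : A} (hy : y ∈ S.J 2) :
    S.p [α, α] * y = 0 := by
  have hM := w.three_le_len_of_border hα
  have hb : ∀ l, S.p [α, α] * S.p (Q.bar α :: l) = 0 := by
    intro l
    rw [S.p_cons (Q.bar α), ← mul_assoc, ← p_append]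
    change S.p [α, α, Q.bar α] * _ = 0
    rw [S.p_border_border_bar hα, zero_mul]
  have hx : ∀ x l, x ≠ α → S.p [α, α] * S.p (x :: l) = 0 := by
    intro x l hxα
    by_cases h : Q.src x = Q.src α
    · rcases Q.eq_or_eq_bar h with rfl | rfl
      · exact absurd rfl hxα
      · exact hb l
    · rw [← p_append]
      change S.p (α :: α :: x :: l) = 0
      rw [S.p_cons, S.p_eq_zero (by rw [Q.tgt_eq_of_f_eq hα]; exact Ne.symm h), mul_zero]
  have hA : ∀ k, 0 < k → S.p [α, α] * S.p (Q.gWord (Q.bar α) k) = 0 := by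
    intro k hk
    rw [gWord_eq_cons _ hk, hb]
  induction hy using S.J_induction with
  | hp l hl =>
    rcases l with _ | ⟨x, _ | ⟨z, l⟩⟩
    · simp at hl
    · simp at hl
    · by_cases hxα : x = α
      · subst hxα
        by_cases hzα : z = x
        · subst hzα
          have : S.p [z, z] * S.p (z :: z :: l) = S.p [z, z] * S.p [z, z] * S.p l := by
            rw [mul_assoc, ← S.p_append [z, z] l, ← p_append, ← p_append]; rfl
          rw [this]
          nth_rewrite 2 [S.p_border_border_eq hα]
          rw [mul_add, mul_smul_comm, mul_smul_comm, hA _ (by omega), hA _ (by omega)]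
          simp
        · have : S.p [x, x] * S.p (x :: z :: l) = S.p [x] * (S.p [x, x] * S.p (z :: l)) := by
            rw [← p_append, ← p_append, ← p_append]; rfl
          rw [this, hx z l hzα, mul_zero]
      · exact hx x _ hxα
  | h0 => rw [mul_zero]
  | hadd y z _ _ hy hz => rw [mul_add, hy, hz, add_zero]
  | hsmul r y _ hy => rw [mul_smul_comm, hy, smul_zero]

theorem p_triangle_of_len_two {a : E} (h : Q.f a ≠ a) (h2 : w.len (Q.bar a) = 2) :
    S.p [a, Q.f a] = c.c (Q.bar a) • S.p [Q.bar a] := by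
  rw [S.p_triangle h, h2]; rfl

theorem p_triangle_of_len_three {a : E} (h : Q.f a ≠ a) (h3 : w.len (Q.bar a) = 3) :
    S.p [a, Q.f a] = c.c (Q.bar a) • S.p [Q.bar a, Q.g (Q.bar a)] := by
  rw [S.p_triangle h, h3]; rfl

theorem f_ne_of_len_ne {a : E} (h : w.len (Q.f a) ≠ w.len a) : Q.f a ≠ a := fun h' =>
  h (by rw [h'])

/-- A reduction in a pentagon: `γ` is an arrow with `w.Pent γ`, preceded by `y = g⁻¹ γ`. -/
theorem p_pent {y : E} (h : w.Pent (Q.g y)) :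
    S.p [y, Q.g y, Q.f (Q.g y)] = pentValue c (Q.g y) • S.p [Q.bar y, Q.g (Q.f y)] := by
  have h1 := h.len_bar
  have h5 := h.five_le_len
  have h2 := h.1
  rw [bar_g] at h1 h2
  rw [w.len_f_f] at h2
  rw [w.len_g] at h5
  have e1 : S.p [Q.g y, Q.f (Q.g y)] = c.c (Q.f y) • S.p [Q.f y, Q.g (Q.f y)] := by
    rw [S.p_triangle_of_len_three h.f_ne (by rw [bar_g, h1]), bar_g]
  have e2 : S.p [y, Q.f y] = c.c (Q.bar y) • S.p [Q.bar y] :=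
    S.p_triangle_of_len_two (f_ne_of_len_ne (w := w) (by omega)) h2
  rw [S.p_cons, e1, mul_smul_comm, ← p_append]
  have e3 : S.p ([y] ++ [Q.f y, Q.g (Q.f y)]) = S.p [y, Q.f y] * S.p [Q.g (Q.f y)] := by
    rw [← p_append]; rfl
  rw [e3, e2, smul_mul_assoc, ← p_append, smul_smul, pentValue, bar_g, c.c_f_f]
  rfl

section

variable {α : E}

/-- This is `A_{bar α}` with its first letter moved to the end. Its last three letters are `y, g y,
f (g y)`, a zero relation unless `f y` is virtual or `Pent (g y)`. In these exceptions the preceding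
letters yield another zero relation; only a pentagon with `len α = 5` leaves no room for it. -/
theorem p_around_border (hα : Q.f α = α) (h4 : 4 ≤ w.len α)
    (h5 : ¬ (w.len α = 5 ∧ w.Pent (Q.f (Q.f (Q.bar α))))) :
    S.p (Q.gWord (Q.g (Q.bar α)) (w.len α - 2) ++ [Q.bar α]) = 0 := by
  have hga := g_of_border hα
  have hb := w.len_bar_of_border hα
  obtain ⟨k, hk⟩ : ∃ k, w.len α = k + 4 := ⟨w.len α - 4, by omega⟩
  obtain ⟨y, hy⟩ : ∃ y, y = Q.g^[k] (Q.g (Q.bar α)) := ⟨_, rfl⟩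
  have hgy : Q.g y = Q.f (Q.f (Q.bar α)) := by
    rw [← g_iterate_sub_two_of_border (w := w) hα, hk, hy]
    rw [← Function.iterate_succ_apply' Q.g, ← Function.iterate_succ_apply]
    rfl
  have hfgy : Q.f (Q.g y) = Q.bar α := by rw [hgy, Q.f_f_f]
  have hly : w.len y = w.len α := by rw [hy, w.len_iterate, w.len_g, hb]
  have e0 : Q.gWord (Q.g (Q.bar α)) (w.len α - 2) ++ [Q.bar α] =
      Q.gWord (Q.g (Q.bar α)) k ++ [y, Q.g y, Q.f (Q.g y)] := by
    rw [hk, show k + 4 - 2 = k + 2 by omega, gWord_add, ← hy, gWord_two, hfgy, List.append_assoc]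
    rfl
  rw [e0, p_append]
  -- If `f y` is virtual, the last two letters contract to a multiple of `f y`, and the letter `y'`
  -- before `y` gives the zero relation `y' · y · f y`.
  by_cases hv : w.len (Q.f y) = 2
  · have hbar : Q.g (Q.g (Q.bar α)) = Q.bar y := by rw [← hfgy]; exact g_g_f_g_of_virtual hv
    have hlb : w.len (Q.bar y) = w.len α := by rw [← hbar, w.len_g, w.len_g, hb]
    have e1 : S.p [Q.g y, Q.f (Q.g y)] = c.c (Q.f y) • S.p [Q.f y] := by
      have := S.p_triangle_of_len_two (a := Q.g y) (by
        rw [hfgy]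
        intro h
        have h1 : Q.g (Q.bar α) = α := by rw [h, hgy, g_f_f_bar]
        have h2 : Q.n α ∣ 2 := Q.g_iterate_eq_iff.1 (by
          change Q.g (Q.g α) = α
          rw [hga, h1])
        have := Nat.le_of_dvd (by norm_num) h2
        have := three_le_n_of_border hα
        omega) (by rw [bar_g, hv])
      rwa [bar_g] at this
    have e2 : S.p [y, Q.g y, Q.f (Q.g y)] = c.c (Q.f y) • S.p [y, Q.f y] := by
      rw [p_cons, e1, mul_smul_comm, ← p_append]; rfl
    rcases k with _ | k
    · exfalso
      have h1 : Q.f (Q.f y) = y := by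
        rw [← g_f_g_of_virtual hv, hfgy, hy]; rfl
      have h2 : Q.f y = y := by
        have := Q.f_f_f y
        rwa [h1] at this
      rw [h2] at hv; omega
    · obtain ⟨y', hy'⟩ : ∃ y', y' = Q.g^[k] (Q.g (Q.bar α)) := ⟨_, rfl⟩
      have hgy' : Q.g y' = y := by rw [hy', hy, Function.iterate_succ_apply']
      have e3 : S.p [y', y, Q.f y] = 0 := by
        have := S.p_zero_gf (a := y') (by
          rw [← bar_g, hgy', hlb]
          rintro (h | h)
          · omega
          · have := h.len_bar
            omega)
        rwa [hgy'] at this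
      rw [gWord_succ', ← hy', e2, mul_smul_comm, p_append, mul_assoc, ← p_append]
      change _ • (_ * S.p [y', y, Q.f y]) = 0
      rw [e3, mul_zero, smul_zero]
  · by_cases hp : w.Pent (Q.g y)
    · have hp' := hp
      rw [hgy] at hp'
      obtain ⟨h1, h2⟩ := hp'.of_border hα
      have hM : w.len α = w.m α * 5 := by rw [WeightFunction.len, h2]
      -- Since `n_α = 5`, the length is now at least ten, so the path passes through `bar α` again,
      -- at `P`. After the reduction of the pentagon the zero relation `P · g P · f (g P)` appears.
      have hM6 : w.len α ≠ 5 := fun h => h5 ⟨h, hp'⟩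
      obtain ⟨i, hi⟩ : ∃ i, k = i + 2 := ⟨k - 2, by omega⟩
      obtain ⟨P, hP⟩ : ∃ P, P = Q.g^[i] (Q.g (Q.bar α)) := ⟨_, rfl⟩
      have hP' : P = Q.bar α := by
        rw [hP, ← Function.iterate_succ_apply]
        refine Q.g_iterate_eq_iff.2 ?_
        rw [← hga, Q.n_g, h2]; omega
      have hgP : Q.g (Q.g P) = y := by
        rw [hP, hy, hi, Function.iterate_succ_apply', Function.iterate_succ_apply']
      have hv2 : w.len (Q.f (Q.g P)) = 2 := by
        have := hp.1
        rwa [bar_g, w.len_f_f, ← hgP, bar_g] at this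
      have h3 : w.len (Q.f (Q.g (Q.g P))) = 3 := by
        have := hp.len_bar
        rwa [bar_g, ← hgP] at this
      have hb4 := g_g_f_g_of_virtual hv2
      have e3 : S.p [P, Q.g P, Q.f (Q.g P)] = 0 := by
        refine S.p_zero_gf ?_
        rw [← bar_g, ← hb4, w.len_g, w.len_g]
        rintro (h | h)
        · omega
        · have h6 := h.1
          have h7 := Q.g_iterate_n (Q.f (Q.g (Q.g P)))
          have h8 := hp.2.2
          rw [bar_g, ← hgP] at h8
          rw [h8] at h7
          change Q.g (Q.g (Q.g _)) = _ at h7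
          rw [← hb4, ← bar_g, h7, ← g_def, w.len_g, hgP] at h6
          omega
      rw [S.p_pent hp, ← hgP, bar_g, hi, gWord_add, gWord_two, ← hP, p_append, mul_smul_comm,
        mul_assoc, ← p_append]
      have e4 : S.p ([P, Q.g P] ++ [Q.f (Q.g P), Q.g (Q.f (Q.g (Q.g P)))]) =
          S.p [P, Q.g P, Q.f (Q.g P)] * S.p [Q.g (Q.f (Q.g (Q.g P)))] := by
        rw [← p_append]; rfl
      rw [e4, e3, zero_mul, mul_zero, smul_zero]
    · rw [S.p_zero_gf (by tauto), mul_zero]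

/-- The form `τ'` is an arbitrary trace form. In the application it belongs to the other
presentation, of which only symmetry is known here. -/
theorem trace_p_border_border (hα : Q.f α = α) {τ' : A →ₗ[K] K}
    (hτ : ∀ y z, τ' (y * z) = τ' (z * y))
    (hβ : β α = 0) : τ' (S.p [α, α]) =
      c.c α * τ' (S.p (Q.gWord (Q.g (Q.bar α)) (w.len α - 2) ++ [Q.bar α])) := by
  have h3 := w.three_le_len_of_border hα
  rw [S.p_border_border_eq hα, hβ, zero_smul, add_zero, map_smul, smul_eq_mul,
    gWord_eq_cons _ (by omega), p_cons, hτ, ← p_append]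
  rfl

theorem trace_p_border_border_eq_zero (hα : Q.f α = α) {τ' : A →ₗ[K] K}
    (hτ : ∀ y z, τ' (y * z) = τ' (z * y))
    (hβ : β α = 0) (h4 : 4 ≤ w.len α)
    (h5 : ¬ (w.len α = 5 ∧ w.Pent (Q.f (Q.f (Q.bar α))))) : τ' (S.p [α, α]) = 0 := by
  rw [S.trace_p_border_border hα hτ hβ, S.p_around_border hα h4 h5, map_zero, mul_zero]

/-- In the pentagon the rotated path does not vanish: it reduces, by `p_pent` and a triangle
relation, to a multiple of a rotation of `B_α`, and `α³` is itself `c_α B_α` when the border value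
is zero. -/
theorem trace_p_border_border_of_pent (hα : Q.f α = α) {τ' : A →ₗ[K] K}
    (hτ : ∀ y z, τ' (y * z) = τ' (z * y))
    (hβ : β α = 0) (h5 : w.len α = 5) (hp : w.Pent (Q.f (Q.f (Q.bar α)))) :
    τ' (S.p [α, α]) =
      c.c α * pentValue c (Q.f (Q.f (Q.bar α))) * τ' (S.p [α, α, α]) := by
  have hga := g_of_border hα
  have hb := w.len_bar_of_border hα
  obtain ⟨h1, -⟩ := hp.of_border hα
  set d := Q.bar α with hd
  set y := Q.g (Q.g d) with hy
  have hgy : Q.g y = Q.f (Q.f d) := h1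
  rw [← hgy] at hp
  have hfg : Q.f (Q.g y) = d := by rw [hgy, Q.f_f_f]
  have hv : w.len (Q.bar y) = 2 := by
    have := hp.1
    rwa [bar_g, w.len_f_f] at this
  have hv2 : w.len (Q.f (Q.g d)) = 2 := by rw [← bar_g]; exact hv
  have e1 : S.p [Q.bar y, Q.g (Q.f y)] = c.c α • S.p [y, Q.g y, α, d] := by
    have h3 : Q.g (Q.f y) = Q.f (Q.bar y) := by
      have := g_f_g_of_virtual hv2
      rwa [← Q.bar_g (Q.g d)] at this
    have hly : w.len y = 5 := by rw [hy, w.len_g, w.len_g, hb, h5]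
    have h6 : Q.f (Q.bar y) ≠ Q.bar y := by
      rw [← h3]
      refine fun h => ?_
      have h7 : w.len (Q.f y) = 3 := by
        have := hp.len_bar
        rwa [bar_g] at this
      rw [← h, w.len_g] at hv; omega
    rw [h3, S.p_triangle h6, bar_bar, hly]
    have h8 : c.c y = c.c α := by
      rw [hy, c.c_g, c.c_g, c.c_bar_of_border hα]
    rw [h8, show 5 - 1 = 4 by rfl, gWord_four, hgy, g_f_f_bar, hga]
  have e2 : S.p (Q.gWord (Q.g d) (w.len α - 2) ++ [d]) =
      (pentValue c (Q.g y) * c.c α) • S.p [Q.g d, y, Q.g y, α, d] := by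
    rw [h5, show 5 - 2 = 3 by rfl, gWord_three]
    change S.p ([Q.g d] ++ [y, Q.g y, d]) = _
    have e3 := S.p_pent hp
    rw [hfg] at e3
    rw [p_append, e3, e1, smul_smul, mul_smul_comm, ← p_append]
    rfl
  have e4 : S.p [α, α, α] = c.c α • S.p [α, d, Q.g d, y, Q.g y] := by
    rw [S.p_cons, S.p_border_border_eq hα, hβ, zero_smul, add_zero, mul_smul_comm, ← p_append, h5]
    rfl
  have e5 : τ' (S.p [Q.g d, y, Q.g y, α, d]) = τ' (S.p [α, d, Q.g d, y, Q.g y]) := by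
    have h6 : S.p [Q.g d, y, Q.g y, α, d] = S.p [Q.g d, y, Q.g y] * S.p [α, d] := by
      rw [← p_append]; rfl
    rw [h6, hτ, ← p_append]
    rfl
  rw [S.trace_p_border_border hα hτ hβ, e2, e4, map_smul, map_smul, e5, hgy, smul_eq_mul,
    smul_eq_mul]
  ring

theorem τ_p_border_border_of_pent (hα : Q.f α = α) (h5 : w.len α = 5)
    (hp : w.Pent (Q.f (Q.f (Q.bar α)))) :
    S.τ (S.p [α, α]) = c.c α * pentValue c (Q.f (Q.f (Q.bar α))) + β α / c.c α := by
  classical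
  have h1 := (hp.of_border hα).1
  have hg := Q.g_ne_f
  rw [S.τ_p, traceWord_border_two c β hα, h5, show 5 - 1 = 4 by rfl, gWord_four, pentTerm, if_neg,
    if_pos ⟨rfl, hp, h1⟩, if_neg, if_neg]
  · simp
  · rintro ⟨h, -⟩; simp only [List.cons.injEq, and_true] at h; exact hg _ h.2.1
  · rintro ⟨h, -⟩; simp only [List.cons.injEq, and_true, true_and] at h; exact hg _ h
  · rintro ⟨h, -⟩; simp only [List.cons.injEq, and_true] at h; exact hg _ h.1

theorem τ_p_border_border_of_not_pent (hα : Q.f α = α)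
    (hp : ¬ (w.len α = 5 ∧ w.Pent (Q.f (Q.f (Q.bar α))))) :
    S.τ (S.p [α, α]) = β α / c.c α := by
  classical
  have hg := Q.g_ne_f
  rw [S.τ_p, traceWord_border_two c β hα]
  by_cases h5 : w.len α = 5
  · rw [h5, show 5 - 1 = 4 by rfl, gWord_four, pentTerm, if_neg, if_neg, if_neg, if_neg]
    · simp
    · rintro ⟨h, -⟩; simp only [List.cons.injEq, and_true] at h; exact hg _ h.2.1
    · rintro ⟨h, -⟩; simp only [List.cons.injEq, and_true, true_and] at h; exact hg _ h
    · exact fun h => hp ⟨h5, h.2.1⟩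
    · rintro ⟨h, -⟩; simp only [List.cons.injEq, and_true] at h; exact hg _ h.1
  · rw [pentTerm_of_length_ne]
    · simp
    · rw [gWord_length]; omega

end

end TraceModel

end TriangulationQuiver

/-! ### Comparison of loops in two presentations -/

namespace TriangulationQuiver

namespace TraceModel

variable {V E : Type*} [Fintype V] {Q : TriangulationQuiver V E} {K : Type*} [Field K]
variable {w : Q.WeightFunction} {c : Q.ParameterFunction K} {β : E → K}
variable {V' E' : Type*} [Fintype V'] {Q' : TriangulationQuiver V' E'}
variable {w' : Q'.WeightFunction} {c' : Q'.ParameterFunction K} {β' : E' → K}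
variable {A : Type*} [Ring A] [Algebra K A]

/-- Two presentations of an algebra with the same idempotents and the same arrow ideal. -/
structure Compatible (S : TraceModel w c β A) (S' : TraceModel w' c' β' A) (σ : V ≃ V') : Prop where
  e : ∀ v, S'.e (σ v) = S.e v
  J_one : S.J 1 = S'.J 1

/-- A border loop `α` of the first presentation and a loop `ρ` of the second presentation at the
same vertex, with `ρ = a α` modulo the square of the arrow ideal. -/
structure LoopPair (S : TraceModel w c β A) (S' : TraceModel w' c' β' A) (α : E) (ρ : E') (a : K) :
    Prop where
  J_one : S.J 1 = S'.J 1
  border : Q.f α = α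
  loop : Q'.tgt ρ = Q'.src ρ
  e : S'.e (Q'.src ρ) = S.e (Q.src α)
  ne : a ≠ 0
  mem : S'.p [ρ] - a • S.p [α] ∈ S.J 2

variable {S : TraceModel w c β A} {S' : TraceModel w' c' β' A} {σ : V ≃ V'}

theorem Compatible.symm (h : Compatible S S' σ) : Compatible S' S σ.symm :=
  ⟨fun v => by rw [← h.e, Equiv.apply_symm_apply], h.J_one.symm⟩

theorem Compatible.J (h : Compatible S S' σ) {k : ℕ} (hk : 1 ≤ k) : S.J k = S'.J k :=
  S.J_eq_of_J_one S' h.J_one hk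

theorem exists_arrow_at (Q : TriangulationQuiver V E) (v : V) : ∃ a, Q.src a = v := by
  have := Q.two_out v
  have h : {a | Q.src a = v}.Nonempty := Set.nonempty_of_ncard_ne_zero (by omega)
  exact h

/-- At a border vertex, the second presentation also has a loop. -/
theorem Compatible.exists_loopPair (h : Compatible S S' σ) {α : E} (hα : Q.f α = α) :
    ∃ ρ a, LoopPair S S' α ρ a ∧ Q'.src ρ = σ (Q.src α) := by
  obtain ⟨ρ₀, hρ₀⟩ := exists_arrow_at Q' (σ (Q.src α))
  have hα1 : S.p [α] ∈ S'.J 1 := by rw [← h.J_one]; exact S.p_mem_J (by simp)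
  obtain ⟨r, s, j, hj, hrs⟩ := S'.exists_leading ρ₀ hα1
  rw [hρ₀, h.e, S.e_mul_x] at hrs
  rw [← h.J (by norm_num)] at hj
  have h1 := congrArg (S.coef α) hrs
  rw [S.coef_self hα, map_add, map_add, map_smul, map_smul, S.coef_J_two hα hj, add_zero] at h1
  obtain ⟨ρ, hsrc, hρ⟩ : ∃ ρ, Q'.src ρ = σ (Q.src α) ∧ S.coef α (S'.p [ρ]) ≠ 0 := by
    by_contra! hne
    rw [hne _ hρ₀, hne _ ((Q'.src_bar _).trans hρ₀)] at h1
    simp at h1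
  have htgt : Q'.tgt ρ = Q'.src ρ := by
    by_contra hne
    rw [hsrc] at hne
    apply hρ
    apply S.coef_eq_zero_of_mul_e hα
    rw [← h.e, S'.x_mul_e_ne hne]
  have hρ1 : S'.p [ρ] ∈ S.J 1 := by rw [h.J_one]; exact S'.p_mem_J (by simp)
  have he : S'.e (Q'.src ρ) = S.e (Q.src α) := by rw [hsrc, h.e]
  have hnp : Q.tgt (Q.bar α) ≠ Q.tgt α := by
    rw [Q.tgt_eq_of_f_eq hα]; exact tgt_bar_of_border hα
  obtain ⟨a, j, hj, hl⟩ := S.exists_leading' hnp hρ1 (by rw [← he, S'.e_mul_x])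
    (by rw [Q.tgt_eq_of_f_eq hα, ← he, ← htgt, S'.x_mul_e])
  refine ⟨ρ, a, ⟨h.J_one, hα, htgt, he, ?_, by rw [hl]; simpa using hj⟩, hsrc⟩
  rintro rfl
  apply hρ
  rw [hl, zero_smul, zero_add, S.coef_J_two hα hj]

namespace LoopPair

variable {α : E} {ρ : E'} {a : K}

theorem J (h : LoopPair S S' α ρ a) {k : ℕ} (hk : 1 ≤ k) : S.J k = S'.J k :=
  S.J_eq_of_J_one S' h.J_one hk

theorem symm (h : LoopPair S S' α ρ a) (hρ : Q'.f ρ = ρ) : LoopPair S' S ρ α a⁻¹ where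
  J_one := h.J_one.symm
  border := hρ
  loop := Q.tgt_eq_of_f_eq h.border
  e := h.e.symm
  ne := inv_ne_zero h.ne
  mem := by
    rw [← h.J (by norm_num)]
    have := (S.J 2).smul_mem (-a⁻¹) h.mem
    rw [smul_sub, smul_smul, neg_mul, inv_mul_cancel₀ h.ne] at this
    convert this using 1
    module

/-- The hypothesis of `τ_sq_of_leading` holds because `ρ²` annihilates the square of the arrow
ideal. -/
theorem τ_sq [CharP K 2] (h : LoopPair S S' α ρ a) (hρ : Q'.f ρ = ρ) :
    S.τ (S'.p [ρ, ρ] * S.p [α]) = a ^ 2 ∧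
      (4 ≤ w.len α → S.τ (S'.p [ρ, ρ]) = a ^ 2 * S.τ (S.p [α, α])) := by
  have h1 : S'.p [ρ, ρ] = S'.p [ρ] * S'.p [ρ] := by rw [← p_append]; rfl
  rw [h1]
  refine S.τ_sq_of_leading h.border h.mem ?_ ?_ h.ne (by abel) fun y hy => ?_
  · rw [mul_sub, mul_smul_comm, S.e_mul_x, ← h.e, S'.e_mul_x]
  · have h2 := S.x_mul_e α
    have h3 := S'.x_mul_e ρ
    rw [Q.tgt_eq_of_f_eq h.border] at h2
    rw [Q'.tgt_eq_of_f_eq hρ, h.e] at h3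
    rw [sub_mul, smul_mul_assoc, h2, h3]
  · rw [h.J (by norm_num)] at hy
    rw [← h1, S'.p_border_border_mul hρ hy, map_zero]

/-- The square `ρ²` lies in `J ^ (len ρ - 1)` and `τ (ρ² α) = a² ≠ 0`, whereas `τ` vanishes on words
through `α` of length greater than `len α`. -/
theorem len_le [CharP K 2] (h : LoopPair S S' α ρ a) (hρ : Q'.f ρ = ρ) : w'.len ρ ≤ w.len α := by
  by_contra hlt
  have h3 := w'.three_le_len_of_border hρ
  have h1 := (h.τ_sq hρ).1
  have h2 := S'.p_border_border_mem hρ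
  rw [← h.J (by omega)] at h2
  rw [S.τ_mul_p_eq_zero (fun l hl => ?_) h2] at h1
  · exact h.ne (pow_eq_zero_iff two_ne_zero |>.1 h1.symm)
  · refine traceWord_of_border_of_len_lt c β h.border ?_
    simp only [List.length_append, List.length_singleton]
    omega

theorem len_eq [CharP K 2] (h : LoopPair S S' α ρ a) (hρ : Q'.f ρ = ρ) : w'.len ρ = w.len α :=
  le_antisymm (h.len_le hρ) ((h.symm hρ).len_le h.border)

theorem τ_cube [CharP K 2] (h : LoopPair S S' α ρ a) (hρ : Q'.f ρ = ρ) :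
    S.τ (S'.p [ρ, ρ, ρ]) = a ^ 3 := by
  have h1 : S'.p [ρ, ρ, ρ] = S'.p [ρ, ρ] * (S'.p [ρ] - a • S.p [α]) +
      a • (S'.p [ρ, ρ] * S.p [α]) := by
    have : S'.p [ρ, ρ, ρ] = S'.p [ρ, ρ] * S'.p [ρ] := by rw [← p_append]; rfl
    rw [this, mul_sub, mul_smul_comm]
    abel
  have h2 := h.mem
  rw [h.J (by norm_num)] at h2
  rw [h1, S'.p_border_border_mul hρ h2, zero_add, map_smul, (h.τ_sq hρ).1, smul_eq_mul]
  ring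

end LoopPair

end TraceModel

end TriangulationQuiver

/-! ### The exceptional pentagon around a border loop -/

namespace TriangulationQuiver

namespace TraceModel

variable {V E : Type*} [Fintype V] {Q : TriangulationQuiver V E} {K : Type*} [Field K]
variable {w : Q.WeightFunction} {c : Q.ParameterFunction K} {β : E → K}
variable {V' E' : Type*} [Fintype V'] {Q' : TriangulationQuiver V' E'}
variable {w' : Q'.WeightFunction} {c' : Q'.ParameterFunction K} {β' : E' → K}
variable {A : Type*} [Ring A] [Algebra K A]
variable {S : TraceModel w c β A} {S' : TraceModel w' c' β' A} {σ : V ≃ V'}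

/-- Leading terms multiply. -/
theorem mul_leading (S : TraceModel w c β A) {x y : A} {r s : K} {l l' : List E} {k : ℕ}
    (hx : x - r • S.p l ∈ S.J (l.length + 1)) (hy : y - s • S.p l' ∈ S.J (l'.length + 1))
    (hk : k = l.length + l'.length + 1) : x * y - (r * s) • S.p (l ++ l') ∈ S.J k := by
  have h1 : x * y - (r * s) • S.p (l ++ l') =
      (x - r • S.p l) * (y - s • S.p l') + s • ((x - r • S.p l) * S.p l') +
        r • (S.p l * (y - s • S.p l')) := by
    rw [p_append]
    simp only [mul_sub, sub_mul, smul_mul_assoc, mul_smul_comm, smul_sub]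
    module
  rw [h1]
  refine add_mem (add_mem (S.mul_mem_J' hx hy (by omega)) (Submodule.smul_mem _ _ ?_))
    (Submodule.smul_mem _ _ ?_)
  · exact S.mul_mem_J' hx (S.p_mem_J le_rfl) (by omega)
  · exact S.mul_mem_J' (S.p_mem_J le_rfl) hy (by omega)

/-- If a linear functional detects `x`, but neither `bar b` nor the square of the arrow ideal, then
`x` is a non-zero multiple of `b` modulo the square of the arrow ideal. -/
theorem exists_leading_of_functional (S : TraceModel w c β A) {b : E}
    (hb : Q.tgt (Q.bar b) ≠ Q.tgt b) {x : A} (hx : x ∈ S.J 1) (hs : S.e (Q.src b) * x = x) {z : V}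
    (ht : x * S.e z = x) (ℓ : A →ₗ[K] K) (h2 : ∀ y ∈ S.J 2, ℓ y = 0) (hbar : ℓ (S.p [Q.bar b]) = 0)
    (hne : ℓ x ≠ 0) : z = Q.tgt b ∧ ∃ r : K, r ≠ 0 ∧ x - r • S.p [b] ∈ S.J 2 ∧
      ℓ x = r * ℓ (S.p [b]) := by
  obtain ⟨r, s, j, hj, h⟩ := S.exists_leading b hx
  rw [hs] at h
  have h1 : ℓ x = r * ℓ (S.p [b]) := by
    rw [h, map_add, map_add, map_smul, map_smul, hbar, h2 j hj]; simp
  have hr : r ≠ 0 := by rintro rfl; rw [zero_mul] at h1; exact hne h1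
  have hz : z = Q.tgt b := by
    by_contra hz
    apply hne
    rw [← ht, h, add_mul, add_mul, smul_mul_assoc, smul_mul_assoc, S.x_mul_e_ne (Ne.symm hz),
      smul_zero, zero_add, map_add, h2 _ (S.mul_e_mem_J _ (by norm_num) hj), add_zero, map_smul]
    by_cases h' : Q.tgt (Q.bar b) = z
    · rw [← h', S.x_mul_e, hbar, smul_zero]
    · rw [S.x_mul_e_ne h', map_zero, smul_zero]
  refine ⟨hz, r, hr, ?_, h1⟩
  have h3 : x - r • S.p [b] = j * S.e z := by
    conv_lhs => rw [← ht, h]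
    rw [hz, add_mul, add_mul, smul_mul_assoc, smul_mul_assoc, S.x_mul_e, S.x_mul_e_ne hb]
    simp
  rw [h3]
  exact S.mul_e_mem_J _ (by norm_num) hj

theorem traceWord_gWord {x : E} (h : 3 ≤ w.len x) :
    traceWord w c β (Q.gWord x (w.len x - 1) ++ [Q.f (Q.f (Q.bar x))]) = (c.c x)⁻¹ := by
  rw [traceWord_gWord_append w c β h]
  simp

/-- The pentagon around a border loop, with the relevant values of the trace form. -/
structure IsPentagon (w : Q.WeightFunction) (c : Q.ParameterFunction K) (β : E → K)
    (α d P R h y u N : E) : Prop where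
  len_α : w.len α = 5
  len_d : w.len d = 5
  len_h : w.len h = 5
  len_N : w.len N = 3
  src_d : Q.src d = Q.src α
  bar_d : Q.bar d = α
  bar_P : Q.bar P = y
  bar_h : Q.bar h = u
  src_P : Q.src P = Q.tgt d
  src_R : Q.src R = Q.tgt P
  src_h : Q.src h = Q.tgt R
  src_N : Q.src N = Q.tgt u
  tgt_y : Q.tgt y = Q.src h
  tgt_α : Q.tgt α ≠ Q.tgt d
  tgt_P : Q.tgt y ≠ Q.tgt P
  tgt_R : Q.tgt (Q.bar R) ≠ Q.tgt R
  tgt_h : Q.tgt u ≠ Q.tgt h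
  tgt_u : Q.tgt u ≠ Q.src u
  g_α : d = Q.g α
  g_d : P = Q.g d
  g_P : R = Q.g P
  g_R : h = Q.g R
  tr_d : ∀ l l' : List E, 2 ≤ l.length → 2 ≤ l'.length → l ≠ [P, R] →
    traceWord w c β (d :: (l ++ l')) = 0
  tr_orbit : traceWord w c β [d, P, R, h, α] = (c.c α)⁻¹
  tr_triangle : traceWord w c β [d, y, h] = 1
  tr_square : traceWord w c β [P, R, u, N] = c.c (Q.f u)
  tr_uNy : traceWord w c β [u, N, y] = (c.c u)⁻¹
  tr_d_y : ∀ l : List E, 2 ≤ l.length → traceWord w c β (d :: y :: l) = 0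
  tr_N_y : ∀ l : List E, 2 ≤ l.length → traceWord w c β (N :: y :: l) = 0
  tr_h_d : ∀ l : List E, 2 ≤ l.length → l ≠ [P, R] → traceWord w c β (h :: d :: l) = 0
  tr_u_N : ∀ l : List E, 2 ≤ l.length → l ≠ [P, R] → traceWord w c β (u :: N :: l) = 0

/-- The arrows `α, d, P, R, h` form the `g`-orbit of length five, `u, N, y` the adjacent orbit of
length three, and `f P = bar R` is the virtual arrow between them. The trace values listed are those
needed to recognise these arrows in another presentation. -/
theorem WeightFunction.Pent.isPentagon {α : E} (hα : Q.f α = α) (h5 : w.len α = 5)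
    (hp : w.Pent (Q.f (Q.f (Q.bar α)))) :
    IsPentagon w c β α (Q.bar α) (Q.g (Q.bar α)) (Q.g (Q.g (Q.bar α)))
      (Q.g (Q.g (Q.g (Q.bar α)))) (Q.f (Q.bar α)) (Q.f (Q.g (Q.g (Q.bar α))))
      (Q.g (Q.f (Q.g (Q.g (Q.bar α))))) := by
  classical
  have hga := g_of_border hα
  have hb := w.len_bar_of_border hα
  obtain ⟨h1, hn5⟩ := hp.of_border hα
  set d := Q.bar α with hd
  set P := Q.g d with hP
  set R := Q.g P with hR
  set h := Q.g R with hh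
  rw [← h1] at hp
  have lP : w.len P = 5 := by rw [hP, w.len_g, hb, h5]
  have lR : w.len R = 5 := by rw [hR, w.len_g, lP]
  have lh : w.len h = 5 := by rw [hh, w.len_g, lR]
  have hfh : Q.f h = d := by rw [h1, Q.f_f_f]
  have hgh : Q.g h = α := by rw [h1, g_f_f_bar]
  have hbh : Q.bar h = Q.f R := Q.bar_g R
  have hbP : Q.bar P = Q.f d := Q.bar_g d
  have hbR : Q.bar R = Q.f P := Q.bar_g P
  have lu : w.len (Q.f R) = 3 := by rw [← hbh]; exact hp.len_bar
  have lv : w.len (Q.f P) = 2 := by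
    rw [← hbR, ← w.len_f_f, ← hbh]; exact hp.1
  have hgN : Q.g (Q.g (Q.f R)) = Q.f d := by rw [← hbP]; exact g_g_f_g_of_virtual lv
  have ly : w.len (Q.f d) = 3 := by rw [← hgN, w.len_g, w.len_g, lu]
  have lN : w.len (Q.g (Q.f R)) = 3 := by rw [w.len_g, lu]
  have hfN : Q.f (Q.g (Q.f R)) = P := by rw [← Q.bar_g, hgN, ← hbP, Q.bar_bar]
  have hfu : w.len (Q.f (Q.f R)) = 2 := by rw [w.len_f_f, hbR, lv]
  have hffd : Q.f (Q.f d) = h := h1.symm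
  have hne : ∀ {a b : E}, w.len a ≠ w.len b → a ≠ b := fun hab h => hab (by rw [h])
  have htα := Q.tgt_eq_of_f_eq hα
  have hg := Q.g_ne_f
  have hdα : Q.tgt α ≠ Q.tgt d := by rw [htα]; exact Ne.symm (tgt_bar_of_border hα)
  have hin : ∀ {a b : E}, a ≠ b → w.len (Q.g b) ≠ w.len (Q.f a) → Q.tgt b ≠ Q.tgt a := by
    intro a b hab hl ht
    rcases Q.in_cases ht with h | h
    · exact hab h.symm
    · exact hl (by rw [h])
  have hdP : Q.f d ≠ d := hne (by omega)
  refine ⟨h5, by omega, lh, lN, Q.src_bar α, Q.bar_bar α, hbP, hbh, Q.src_g d, Q.src_g P,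
    Q.src_g R, Q.src_g _, by rw [← Q.src_f, hffd], hdα, hin (hne (by omega)) ?_,
    hin (Ne.symm (Q.bar_ne R)) ?_, hin (hne (by omega)) ?_, ?_, hga.symm, rfl, rfl, rfl, ?_,
    ?_, ?_, ?_, ?_, ?_, ?_, ?_, ?_⟩
  · rw [w.len_g]; omega
  · rw [hbR, w.len_g]; omega
  · rw [w.len_g, hfh]; omega
  · intro ht
    rcases Q.loop_cases ht with h | h
    · rw [h] at hfu; omega
    · have h4 := n_eq_one_iff.2 h
      have h5 := hp.2.2
      rw [hbh] at h5; omega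
  · intro l l' hl hl' hne'
    have hld : w.len d = 5 := by omega
    have h5' : 5 ≤ (d :: (l ++ l')).length := by simp; omega
    rw [traceWord_of_five_le _ _ _ h5', orbitTerm, if_neg]
    intro h6
    rw [hld, show 5 = 1 + 2 + 2 by rfl, gWord_add, gWord_add] at h6
    have h7 := congrArg List.length h6
    simp only [List.length_cons, List.length_append, gWord_length] at h7
    rw [gWord_one, List.append_assoc, List.singleton_append, List.cons.injEq] at h6
    exact hne' (List.append_inj h6.2 (by rw [gWord_length]; omega)).1
  · have := traceWord_gWord_of_border (w := w) c β hα
    rw [gWord_len_of_border w hα, h5, show 5 - 1 = 4 by rfl, gWord_four,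
      ← traceWord_rotate] at this
    exact this
  · rw [traceWord_cons_f, hffd, if_pos rfl, if_neg, if_neg, if_neg]
    · simp
    · simp
    · simp
    · simp
  · have h2 : traceWord w c β [P, R, Q.f R, Q.g (Q.f R)] =
        traceWord w c β (R :: Q.f R :: [Q.g (Q.f R), P]) := (traceWord_rotate w c β P _).symm
    rw [h2, traceWord_cons_f, if_neg, if_neg, if_pos, if_neg]
    · simp
    · rintro ⟨h3, -⟩
      simp only [List.cons.injEq, and_true, true_and] at h3
      rw [hgN] at h3
      exact hne (by omega) h3
    · exact ⟨by rw [hfN], hfu⟩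
    · simp
    · simp
  · have := traceWord_gWord (c := c) (β := β) (x := Q.f R) (w := w) (by omega)
    rw [lu, ← hbh, Q.bar_bar, hfh, hbh] at this
    exact this
  · intro l hl
    rw [traceWord_cons_f, if_neg, if_neg, if_neg, if_neg]
    · simp
    · rintro ⟨-, h3⟩
      have := h3.1
      rw [hd, Q.bar_bar, hα] at this; omega
    · rintro ⟨-, h3⟩
      rw [hffd] at h3; omega
    · exact fun h3 => hdP h3.1
    · rintro rfl; simp at hl
  · intro l hl
    rw [← hgN]
    by_cases h5 : 5 ≤ (Q.g (Q.f R) :: Q.g (Q.g (Q.f R)) :: l).length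
    · exact traceWord_eq_zero (k := []) c β (by simp at h5 ⊢; omega)
        (by simp; omega) (.inl h5)
    · have hl2 : l.length = 2 := by simp at h5; omega
      have h6 := pentTerm_eq_zero w c (x := Q.g (Q.f R)) (by omega) (Q.g (Q.g (Q.f R)) :: l)
      have h7 := orbitTerm_eq_zero (k := []) (a := Q.g (Q.f R)) (l := Q.g (Q.g (Q.f R)) :: l) w c
        (by simp; omega)
      rw [List.nil_append] at h7
      rw [traceWord, h6, h7, triangleTerm, borderTerm, squareTerm, if_neg, if_neg, if_neg, if_neg]
      · simp
      · rintro ⟨-, h8⟩; rw [hfN] at h8; omega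
      · rintro ⟨h8, -⟩; rw [List.cons.injEq] at h8; exact hg _ h8.1
      · rintro ⟨-, h8⟩; rw [List.cons.injEq] at h8; rw [h8.2] at hl; simp at hl
      · intro h8; rw [List.cons.injEq] at h8; rw [h8.2] at hl; simp at hl
  · intro l hl hne'
    rw [← hfh, traceWord_cons_f, if_neg, if_neg, if_neg, if_neg]
    · simp
    · rintro ⟨h3, -⟩
      rw [hfh] at h3
      exact hne' h3
    · rintro ⟨-, h3⟩
      rw [hfh] at h3; omega
    · rintro ⟨-, h3⟩
      rw [h3] at hl; simp at hl
    · rintro rfl; simp at hl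
  · intro l hl hne'
    by_cases h5 : 5 ≤ (Q.f R :: Q.g (Q.f R) :: l).length
    · exact traceWord_eq_zero (k := []) c β (by simp at h5 ⊢; omega)
        (by simp; omega) (.inl h5)
    · have hl2 : l.length = 2 := by simp at h5; omega
      have h6 := pentTerm_eq_zero w c (x := Q.f R) (by omega) (Q.g (Q.f R) :: l)
      have h7 := orbitTerm_eq_zero (k := []) (a := Q.f R) (l := Q.g (Q.f R) :: l) w c
        (by simp; omega)
      rw [List.nil_append] at h7
      rw [traceWord, h6, h7, triangleTerm, borderTerm, squareTerm, if_neg, if_neg, if_neg, if_neg]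
      · simp
      · rintro ⟨h8, -⟩; rw [List.cons.injEq, hfN] at h8; exact hne' h8.2
      · rintro ⟨h8, -⟩; rw [List.cons.injEq] at h8; exact hg _ h8.1
      · rintro ⟨-, h8⟩; rw [List.cons.injEq] at h8; rw [h8.2] at hl; simp at hl
      · intro h8; rw [List.cons.injEq] at h8; rw [h8.2] at hl; simp at hl

end TraceModel

end TriangulationQuiver

namespace TriangulationQuiver

namespace TraceModel

variable {V E : Type*} [Fintype V] {Q : TriangulationQuiver V E} {K : Type*} [Field K]
variable {w : Q.WeightFunction} {c : Q.ParameterFunction K} {β : E → K}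
variable {V' E' : Type*} [Fintype V'] {Q' : TriangulationQuiver V' E'}
variable {w' : Q'.WeightFunction} {c' : Q'.ParameterFunction K} {β' : E' → K}
variable {A : Type*} [Ring A] [Algebra K A]
variable {S : TraceModel w c β A} {S' : TraceModel w' c' β' A} {σ : V ≃ V'}

/-- If a path of length five around a `g`-orbit of length five is detected by the trace form, then
its factors are proportional to arrows, up to longer paths. -/
theorem Compatible.step (h : Compatible S S' σ) {b a₀ : E} {x : E'} {k k' k'' : List E} {y : A}
    {n : ℕ}
    (hk' : k' = k ++ [a₀]) (hk'' : k'' = k ++ [a₀, b])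
    (h5 : w.len a₀ = 5) (hb : b = Q.g a₀) (htb : Q.tgt (Q.bar b) ≠ Q.tgt b)
    (hs : S'.e (Q'.src x) = S.e (Q.src b)) (hy : y ∈ S.J n) (hn : k.length + n = 3)
    (hne : S.τ (S.p k' * (S'.p [x] * y)) ≠ 0) :
    S'.e (Q'.tgt x) = S.e (Q.tgt b) ∧ ∃ r : K, r ≠ 0 ∧ S'.p [x] - r • S.p [b] ∈ S.J 2 ∧
      S.τ (S.p k' * (S'.p [x] * y)) = r * S.τ (S.p k'' * y) := by
  subst hk' hk''
  have hz : S'.e (Q'.tgt x) = S.e (σ.symm (Q'.tgt x)) := by rw [← h.e, Equiv.apply_symm_apply]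
  have hx : S'.p [x] ∈ S.J 1 := by rw [h.J_one]; exact S'.p_mem_J (by simp)
  let ℓ : A →ₗ[K] K := S.τ ∘ₗ LinearMap.mulLeft K (S.p (k ++ [a₀])) ∘ₗ LinearMap.mulRight K y
  have hℓ : ∀ u, ℓ u = S.τ (S.p (k ++ [a₀]) * (u * y)) := fun u => rfl
  have h2 : ∀ u ∈ S.J 2, ℓ u = 0 := by
    intro u hu
    rw [hℓ, S.τ_comm]
    refine S.τ_mul_p_eq_zero (k := 2 + n) (fun l hl => ?_) (S.mul_mem_J hu hy)
    rw [← List.append_assoc]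
    have hl6 : 6 ≤ (l ++ k ++ [a₀]).length := by simp; omega
    exact traceWord_eq_zero c β (by omega) (by omega) (.inl (by omega))
  have hbar : ℓ (S.p [Q.bar b]) = 0 := by
    rw [hℓ, ← mul_assoc, ← p_append, S.τ_comm]
    refine S.τ_mul_p_eq_zero (k := n) (fun l hl => ?_) hy
    have hl5 : 5 ≤ (l ++ (k ++ [a₀] ++ [Q.bar b])).length := by simp; omega
    rw [traceWord_of_five_le _ _ _ hl5]
    rw [List.append_assoc k, ← List.append_assoc l]
    refine orbitTerm_eq_zero_of_f (w := w) (c := c) ?_ _ []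
    rw [← hb]; exact Q.bar_ne b
  obtain ⟨h3, r, hr, hm, hv⟩ := S.exists_leading_of_functional htb hx
    (by rw [← hs, S'.e_mul_x]) (by rw [← hz, S'.x_mul_e]) ℓ h2 hbar hne
  refine ⟨by rw [hz, h3], r, hr, hm, ?_⟩
  rw [← hℓ, hv, hℓ, ← mul_assoc, ← p_append, List.append_assoc]
  rfl

/-- On `J²` both functionals see only the word `l₀`, so `F` is a multiple of `G` there. -/
theorem eq_zero_of_functional (S : TraceModel w c β A) {l₀ : List E} (F G : A →ₗ[K] K)
    (hF : ∀ l : List E, 2 ≤ l.length → l ≠ l₀ → F (S.p l) = 0)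
    (hG : ∀ l : List E, 2 ≤ l.length → l ≠ l₀ → G (S.p l) = 0) (hG0 : G (S.p l₀) ≠ 0) {j : A}
    (hj : j ∈ S.J 2) (h : G j = 0) : F j = 0 := by
  have key : G (S.p l₀) * F j = F (S.p l₀) * G j := by
    clear h
    induction hj using S.J_induction with
    | hp l hl =>
      by_cases hl0 : l = l₀
      · rw [hl0, mul_comm]
      · rw [hF l hl hl0, hG l hl hl0]; simp
    | h0 => simp
    | hadd y z _ _ hy hz =>
      rw [map_add, map_add, mul_add, mul_add, hy, hz]
    | hsmul r y _ hy =>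
      rw [map_smul, map_smul, smul_eq_mul, smul_eq_mul, mul_left_comm, hy, mul_left_comm]
  rw [h, mul_zero] at key
  exact (mul_eq_zero.1 key).resolve_left hG0

section

variable {α : E} {ρ : E'} {a : K} {d P R h y u N : E}

/-- Since `ρ²` is `c' A_{bar ρ}` up to longer paths and `τ (ρ² α) = a² ≠ 0`, the form `τ` detects `α
· A_{bar ρ}`. Peeling off one letter of `A_{bar ρ}` at a time by `Compatible.step` identifies its
leading term. -/
theorem Compatible.leading_around_border [CharP K 2] (hC : Compatible S S' σ)
    (hL : LoopPair S S' α ρ a) (hρ : Q'.f ρ = ρ)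
    (hI : IsPentagon w c β α d P R h y u N) :
    S'.e (Q'.tgt (Q'.bar ρ)) = S.e (Q.tgt d) ∧
    S'.e (Q'.tgt (Q'.g (Q'.g (Q'.bar ρ)))) = S.e (Q.tgt R) ∧
    (∃ r : K, r ≠ 0 ∧ S'.p [Q'.g (Q'.bar ρ)] - r • S.p [P] ∈ S.J 2) ∧
    (∃ r : K, r ≠ 0 ∧ S'.p [Q'.g (Q'.g (Q'.bar ρ))] - r • S.p [R] ∈ S.J 2) ∧
    (∃ r : K, r ≠ 0 ∧ S'.p [Q'.f (Q'.f (Q'.bar ρ))] - r • S.p [h] ∈ S.J 2) := by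
  have h5 : w'.len ρ = 5 := by rw [hL.len_eq hρ, hI.len_α]
  have hH := g_iterate_sub_two_of_border (w := w') hρ
  rw [h5] at hH
  change Q'.g (Q'.g (Q'.g (Q'.bar ρ))) = _ at hH
  set D := Q'.bar ρ with hD
  have hlR : w.len R = 5 := by have := hI.len_h; rwa [hI.g_R, w.len_g] at this
  have hlP : w.len P = 5 := by rwa [hI.g_P, w.len_g] at hlR
  have hJ3 : ∀ k, 1 ≤ k → S'.J k = S.J k := fun k hk => (hC.J hk).symm
  have h1 := (hL.τ_sq hρ).1
  rw [S'.p_border_border_eq hρ, add_mul, map_add, smul_mul_assoc, smul_mul_assoc, map_smul,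
    map_smul, h5, show 5 - 1 = 4 by rfl, gWord_four, hH] at h1
  have h0 : S.τ (S'.p (Q'.gWord D 5) * S.p [α]) = 0 := by
    refine S.τ_mul_p_eq_zero (k := 5) (fun l hl => ?_) ?_
    · exact traceWord_of_border_of_len_lt c β hL.border (by rw [hI.len_α]; simp; omega)
    · rw [← hJ3 5 (by norm_num)]; exact S'.p_mem_J (by rw [gWord_length])
  rw [h0, smul_zero, add_zero, S.τ_comm] at h1
  have h2 : S.τ (S.p [α] * S'.p [D, Q'.g D, Q'.g (Q'.g D), Q'.f (Q'.f D)]) ≠ 0 := by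
    intro h3
    rw [h3, smul_zero] at h1
    exact hL.ne (pow_eq_zero_iff two_ne_zero |>.1 h1.symm)
  have hm : ∀ (n : ℕ) (l : List E'), 1 ≤ n → l.length = n → S'.p l ∈ S.J n := fun n l hn hl => by
    rw [← hJ3 _ hn]; exact S'.p_mem_J hl.ge
  rw [S'.p_cons] at h2
  obtain ⟨v1, r1, -, -, e1⟩ := hC.step (b := d) (a₀ := α) (k := []) (k' := [α])
    (k'' := [α, d]) rfl rfl (n := 3) hI.len_α hI.g_α
    (by rw [hI.bar_d]; exact hI.tgt_α) (by rw [hD, Q'.src_bar, hL.e, hI.src_d])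
    (hm _ _ (by norm_num) rfl) rfl h2
  rw [e1, S'.p_cons] at h2
  obtain ⟨v2, r2, h2', m2, e2⟩ := hC.step (b := P) (a₀ := d) (k := [α]) (k' := [α, d])
    (k'' := [α, d, P]) rfl rfl (n := 2) hI.len_d hI.g_d
    (by rw [hI.bar_P]; exact hI.tgt_P) (by rw [Q'.src_g, v1, hI.src_P])
    (hm _ _ (by norm_num) rfl) rfl (right_ne_zero_of_mul h2)
  have h3 := right_ne_zero_of_mul h2
  rw [e2, S'.p_cons] at h3
  obtain ⟨v3, r3, h3', m3, e3⟩ := hC.step (b := R) (a₀ := P) (k := [α, d]) (k' := [α, d, P])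
    (k'' := [α, d, P, R]) rfl rfl (n := 1) hlP hI.g_P
    hI.tgt_R (by rw [Q'.src_g, v2, hI.src_R])
    (hm _ _ (by norm_num) rfl) rfl (right_ne_zero_of_mul h3)
  have h4 := right_ne_zero_of_mul h3
  rw [e3, ← mul_one (S'.p [Q'.f (Q'.f D)])] at h4
  obtain ⟨v4, r4, h4', m4, e4⟩ := hC.step (b := h) (a₀ := R) (k := [α, d, P]) (k' := [α, d, P, R])
    (k'' := [α, d, P, R, h]) rfl rfl (n := 0) hlR hI.g_R
    (by rw [hI.bar_h]; exact hI.tgt_h) (by rw [← hH, Q'.src_g, v3, hI.src_h])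
    (by rw [← S.p_nil]; exact S.p_mem_J le_rfl) rfl (right_ne_zero_of_mul h4)
  exact ⟨v1, v3, ⟨r2, h2', m2⟩, ⟨r3, h3', m3⟩, ⟨r4, h4', m4⟩⟩

theorem IsPentagon.src_u (hI : IsPentagon w c β α d P R h y u N) : Q.src u = Q.src h := by
  rw [← hI.bar_h, Q.src_bar]

theorem IsPentagon.src_y (hI : IsPentagon w c β α d P R h y u N) : Q.src y = Q.src P := by
  rw [← hI.bar_P, Q.src_bar]

/-- The functional `x ↦ τ (x N y)` detects `u` but neither `h` nor `J²`. Since `u` is a combination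
of `H` and `bar H` modulo `J²`, the arrow `bar H` has a non-zero `u`-component. -/
theorem Compatible.leading_bar (hC : Compatible S S' σ)
    (hI : IsPentagon w c β α d P R h y u N) {H : E'} (hv : S'.e (Q'.src H) = S.e (Q.src h)) {r : K}
    (hH : S'.p [H] - r • S.p [h] ∈ S.J 2) :
    ∃ s : K, s ≠ 0 ∧ S'.p [Q'.bar H] - s • S.p [u] ∈ S.J 2 := by
  let ℓ : A →ₗ[K] K := S.τ ∘ₗ LinearMap.mulRight K (S.p [N, y])
  have hℓ : ∀ x, ℓ x = S.τ (x * S.p [N, y]) := fun x => rfl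
  have h2 : ∀ x ∈ S.J 2, ℓ x = 0 := by
    intro x hx
    refine S.τ_mul_p_eq_zero (fun l hl => ?_) hx
    rw [traceWord_append_comm]
    exact hI.tr_N_y l hl
  have hh : ℓ (S.p [h]) = 0 := by
    rw [hℓ, ← p_append]
    change S.τ (S.p [h, N, y]) = 0
    rw [S.p_eq_zero, map_zero]
    rw [hI.src_N]; exact hI.tgt_h.symm
  have hu : ℓ (S.p [u]) ≠ 0 := by
    rw [hℓ, ← p_append, τ_p]
    change traceWord w c β [u, N, y] ≠ 0
    rw [hI.tr_uNy]
    exact inv_ne_zero (c.c_ne _)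
  have hbar : Q.bar u = h := by rw [← hI.bar_h, Q.bar_bar]
  have hU1 : S'.p [Q'.bar H] ∈ S.J 1 := by rw [hC.J_one]; exact S'.p_mem_J (by simp)
  have hvu : S'.e (Q'.src (Q'.bar H)) = S.e (Q.src u) := by rw [Q'.src_bar, hv, hI.src_u]
  have hne : ℓ (S'.p [Q'.bar H]) ≠ 0 := by
    intro h0
    have hu1 : S.p [u] ∈ S'.J 1 := by rw [← hC.J_one]; exact S.p_mem_J (by simp)
    obtain ⟨r1, s1, j, hj, hs⟩ := S'.exists_leading H hu1
    rw [hv, ← hI.src_u, S.e_mul_x] at hs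
    rw [← hC.J (by norm_num)] at hj
    have h1 : ℓ (S'.p [H]) = 0 := by
      rw [← sub_add_cancel (S'.p [H]) (r • S.p [h]), map_add, map_smul, hh, h2 _ hH]; simp
    apply hu
    rw [hs, map_add, map_add, map_smul, map_smul, h0, h1, h2 _ hj]; simp
  have hz : S'.e (Q'.tgt (Q'.bar H)) = S.e (σ.symm (Q'.tgt (Q'.bar H))) := by
    rw [← hC.e, Equiv.apply_symm_apply]
  obtain ⟨-, s, hs, hm, -⟩ := S.exists_leading_of_functional (b := u)
    (by rw [hbar]; exact hI.tgt_h.symm) hU1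
    (by rw [← hvu, S'.e_mul_x]) (by rw [← hz, S'.x_mul_e]) ℓ h2 (by rw [hbar]; exact hh) hne
  exact ⟨s, hs, hm⟩

/-- The component `s` along `y` is found by evaluating `τ (f D · f (f D) · d)` twice, with `D = bar
ρ`: through leading terms, and through the triangle relation of the second presentation. -/
theorem Compatible.leading_f_bar [CharP K 2] (hC : Compatible S S' σ)
    (hL : LoopPair S S' α ρ a) (hρ : Q'.f ρ = ρ)
    (hI : IsPentagon w c β α d P R h y u N) {rP rR rh : K}
    (hv1 : S'.e (Q'.tgt (Q'.bar ρ)) = S.e (Q.tgt d))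
    (hv3 : S'.e (Q'.tgt (Q'.g (Q'.g (Q'.bar ρ)))) = S.e (Q.tgt R))
    (hP : S'.p [Q'.g (Q'.bar ρ)] - rP • S.p [P] ∈ S.J 2)
    (hR : S'.p [Q'.g (Q'.g (Q'.bar ρ))] - rR • S.p [R] ∈ S.J 2)
    (hrh : rh ≠ 0) (hH : S'.p [Q'.f (Q'.f (Q'.bar ρ))] - rh • S.p [h] ∈ S.J 2) :
    ∃ s : K, s * c.c α = c'.c ρ * rP * rR * a ∧ ∃ j ∈ S.J 2,
      S'.p [Q'.f (Q'.bar ρ)] = s • S.p [y] + j ∧ S.τ (j * S.p [u, N]) = 0 := by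
  have h5 : w'.len ρ = 5 := by rw [hL.len_eq hρ, hI.len_α]
  have hHg := g_iterate_sub_two_of_border (w := w') hρ
  rw [h5] at hHg
  change Q'.g (Q'.g (Q'.g (Q'.bar ρ))) = _ at hHg
  set D := Q'.bar ρ with hD
  have hlD : w'.len D = 5 := by rw [hD, w'.len_bar_of_border hρ, h5]
  have hYs : S'.e (Q'.src (Q'.f D)) = S.e (Q.src y) := by rw [Q'.src_f, hv1, hI.src_y, hI.src_P]
  have hYt : S'.e (Q'.tgt (Q'.f D)) = S.e (Q.tgt y) := by
    rw [← Q'.src_f, ← hHg, Q'.src_g, hv3, hI.tgt_y, hI.src_h]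
  have hby : Q.bar y = P := by rw [← hI.bar_P, Q.bar_bar]
  have hJ : ∀ k, 1 ≤ k → S'.J k = S.J k := fun k hk => (hC.J hk).symm
  obtain ⟨s, j, hj, hY⟩ := S.exists_leading' (a := y) (by rw [hby]; exact hI.tgt_P.symm)
    (y := S'.p [Q'.f D]) (by rw [hC.J_one]; exact S'.p_mem_J (by simp))
    (by rw [← hYs, S'.e_mul_x]) (by rw [← hYt, S'.x_mul_e])
  obtain ⟨jh, hjh, hHj⟩ : ∃ jh ∈ S.J 2, S'.p [Q'.f (Q'.f D)] = rh • S.p [h] + jh :=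
    ⟨_, hH, by abel⟩
  have hYH : S'.p [Q'.f D] * S'.p [Q'.f (Q'.f D)] =
      c'.c ρ • S'.p [Q'.g D, Q'.g (Q'.g D), Q'.f (Q'.f D), ρ] := by
    have h1 : Q'.f (Q'.f D) ≠ Q'.f D := fun h => f_bar_of_border hρ (Q'.f.injective h)
    rw [← p_append]
    change S'.p [Q'.f D, Q'.f (Q'.f D)] = _
    rw [S'.p_triangle h1, ← g_def, w'.len_g, hlD, c'.c_g, c'.c_bar_of_border hρ,
      show 5 - 1 = 4 by rfl, gWord_four, hHg]
    congr 4
    rw [g_f_f_bar]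
  have long : ∀ {k : ℕ} {z : A} {l' : List E} {x : E}, z ∈ S.J k → w.len x = 5 → x ∈ l' →
      6 ≤ k + l'.length → S.τ (z * S.p l') = 0 := by
    intro k z l' x hz hx hm hk
    obtain ⟨l1, l2, rfl⟩ := List.append_of_mem hm
    refine S.τ_mul_p_eq_zero (fun l hl => ?_) hz
    rw [← List.append_assoc]
    simp only [List.length_append, List.length_cons] at hk
    have h6 : 6 ≤ (l ++ l1 ++ x :: l2).length := by simp; omega
    exact traceWord_eq_zero c β (by omega) (by omega) (.inl (by omega))
  -- the functional that detects `[P, R]`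
  have hFd : ∀ l l' : List E, 2 ≤ l.length → 2 ≤ l'.length → l ≠ [P, R] →
      S.τ (S.p l * (S.p l' * S.p [d])) = 0 := by
    intro l l' hl hl' hne
    rw [← p_append, ← p_append, τ_p, ← List.append_assoc, traceWord_append_comm]
    exact hI.tr_d l l' hl hl' hne
  let G : A →ₗ[K] K := S.τ ∘ₗ LinearMap.mulRight K (S.p [h, α] * S.p [d])
  have hG : ∀ x, G x = S.τ (x * (S.p [h, α] * S.p [d])) := fun x => rfl
  have hG' : ∀ l : List E, 2 ≤ l.length → l ≠ [P, R] → G (S.p l) = 0 := fun l hl hne =>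
    hFd l [h, α] hl le_rfl hne
  have hG0 : G (S.p [P, R]) ≠ 0 := by
    rw [hG, ← p_append, ← p_append, τ_p, ← List.append_assoc, traceWord_append_comm]
    change traceWord w c β [d, P, R, h, α] ≠ 0
    rw [hI.tr_orbit]; exact inv_ne_zero (c.c_ne _)
  have hdy : ∀ {z : A} {l : List E}, z ∈ S.J 2 → S.τ (S.p [y] * z * S.p (l ++ [d])) = 0 := by
    intro z l hz
    refine S.τ_mul_p_mul_p_eq_zero (k := 2) (fun l' hl' => ?_) hz
    rw [← List.append_assoc, traceWord_append_comm]
    exact hI.tr_d_y _ (by simp; omega)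
  -- The functional `G` measures the component along `[P, R]`. Traced against `α d`, the product `f
  -- D · f (f D)` is a path of length four by the triangle relation, so the total length exceeds `5
  -- = len α` and the trace is zero; expanding the product leaves `rh · G j`.
  have hGj : G j = 0 := by
    have h1 : S.τ (S'.p [Q'.f D] * S'.p [Q'.f (Q'.f D)] * S.p [α, d]) = 0 := by
      rw [hYH, smul_mul_assoc, map_smul,
        long (k := 4) (x := α) (by rw [← hJ _ (by norm_num)]; exact S'.p_mem_J le_rfl) hI.len_α
          (by simp) (by simp), smul_zero]
    have hdyα : S.τ (S.p [y] * jh * S.p [α, d]) = 0 := hdy (l := [α]) hjh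
    rw [hY, hHj, add_mul, mul_add, mul_add, add_mul, add_mul, add_mul, map_add, map_add, map_add,
      long (k := 4) (x := α) (S.mul_mem_J' hj hjh le_rfl) hI.len_α (by simp) (by simp), add_zero,
      smul_mul_assoc, smul_mul_assoc, smul_mul_assoc, smul_mul_assoc, map_smul, map_smul,
      hdyα, smul_zero, add_zero, mul_smul_comm, mul_smul_comm, smul_mul_assoc,
      smul_mul_assoc, map_smul, map_smul] at h1
    have h2 : S.τ (S.p [y] * S.p [h] * S.p [α, d]) = 0 := by
      rw [← p_append, ← p_append, τ_p]
      change traceWord w c β ([y, h, α] ++ [d]) = 0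
      rw [traceWord_append_comm]
      exact hI.tr_d_y _ (by simp)
    rw [h2, smul_zero, smul_zero, zero_add, smul_eq_mul] at h1
    rw [hG, ← p_append]
    have h3 := (mul_eq_zero.1 h1).resolve_left hrh
    rw [mul_assoc, ← p_append] at h3
    exact h3
  have kill : ∀ z : A, (∀ l : List E, 2 ≤ l.length → l ≠ [P, R] → S.τ (S.p l * z) = 0) →
      S.τ (j * z) = 0 := by
    intro z hz
    have := S.eq_zero_of_functional (S.τ ∘ₗ LinearMap.mulRight K z) G (l₀ := [P, R])
      (fun l hl hne => by
        rw [LinearMap.comp_apply, LinearMap.mulRight_apply]; exact hz l hl hne) hG' hG0 hj hGj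
    rwa [LinearMap.comp_apply, LinearMap.mulRight_apply] at this
  have h4 : S.τ (j * S.p [h, d]) = 0 := by
    refine kill _ fun l hl hne => ?_
    rw [← p_append, τ_p, traceWord_append_comm]
    exact hI.tr_h_d l hl hne
  have h6 : S.τ (j * S.p [u, N]) = 0 := by
    refine kill _ fun l hl hne => ?_
    rw [← p_append, τ_p, traceWord_append_comm]
    exact hI.tr_u_N l hl hne
  have h7 : S.τ (j * (jh * S.p [d])) = 0 := by
    refine kill _ fun l hl hne => ?_
    rw [← mul_assoc]
    refine S.τ_mul_p_mul_p_eq_zero (k := 2) (fun l' hl' => ?_) hjh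
    rw [traceWord_append_comm]
    exact hI.tr_d l l' hl hl' hne
  refine ⟨s, ?_, j, hj, hY, h6⟩
  have h8 : S.τ (S'.p [Q'.f D] * S'.p [Q'.f (Q'.f D)] * S.p [d]) = s * rh := by
    have h9 : S.τ (S.p [y] * S.p [h] * S.p [d]) = 1 := by
      rw [← p_append, ← p_append, τ_p]
      change traceWord w c β ([y, h] ++ [d]) = 1
      rw [traceWord_append_comm]
      exact hI.tr_triangle
    have h10 : S.τ (S.p [y] * jh * S.p [d]) = 0 := hdy (l := []) hjh
    have h11 : S.τ (j * S.p [h] * S.p [d]) = 0 := by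
      rw [mul_assoc, ← p_append]; exact h4
    rw [hY, hHj, add_mul, mul_add, mul_add, add_mul, add_mul, add_mul, map_add, map_add, map_add]
    simp only [smul_mul_assoc, mul_smul_comm, map_smul, h9, h10, h11, mul_assoc j jh, h7,
      smul_eq_mul]
    ring
  have h12 : S.τ (S'.p [Q'.g D, Q'.g (Q'.g D), Q'.f (Q'.f D), ρ] * S.p [d]) =
      rP * rR * rh * a * (c.c α)⁻¹ := by
    have h13 := S.mul_leading (k := 3) (l := [P]) (l' := [R]) hP hR rfl
    have h14 := S.mul_leading (k := 4) (l := [P, R]) (l' := [h]) h13 hH rfl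
    have h15 := S.mul_leading (k := 5) (l := [P, R, h]) (l' := [α]) h14 hL.mem rfl
    have h16 := long (l' := [d]) h15 hI.len_d (by simp) (by simp)
    rw [sub_mul, map_sub, smul_mul_assoc, map_smul, ← p_append, sub_eq_zero] at h16
    rw [← p_append, ← p_append, ← p_append] at h16
    have h17 : S.τ (S.p ([P, R, h] ++ [α] ++ [d])) = (c.c α)⁻¹ := by
      rw [τ_p, traceWord_append_comm]
      exact hI.tr_orbit
    rw [h17] at h16
    exact h16
  have hc := c.c_ne α
  rw [hYH, smul_mul_assoc, map_smul, h12, smul_eq_mul] at h8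
  have h18 : rh * (s * c.c α) = rh * (c'.c ρ * rP * rR * a) := by
    field_simp at h8
    linear_combination (-rh) * h8
  exact mul_left_cancel₀ hrh h18

/-- The pentagon around a border loop is visible in every presentation of the algebra. -/
theorem Compatible.pent_of_isPentagon [CharP K 2] (hC : Compatible S S' σ)
    (hL : LoopPair S S' α ρ a) (hρ : Q'.f ρ = ρ)
    (hI : IsPentagon w c β α d P R h y u N) :
    w'.Pent (Q'.f (Q'.f (Q'.bar ρ))) ∧ c.c α * (c.c u * c.c (Q.f u)) =
      a * (c'.c ρ * pentValue c' (Q'.f (Q'.f (Q'.bar ρ)))) := by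
  have h5 : w'.len ρ = 5 := by rw [hL.len_eq hρ, hI.len_α]
  have hHg := g_iterate_sub_two_of_border (w := w') hρ
  rw [h5] at hHg
  change Q'.g (Q'.g (Q'.g (Q'.bar ρ))) = _ at hHg
  obtain ⟨hv1, hv3, ⟨rP, hrP, hP⟩, ⟨rR, hrR, hR⟩, ⟨rh, hrh, hH⟩⟩ :=
    hC.leading_around_border hL hρ hI
  obtain ⟨s, hs, j, hj, hY, hju⟩ := hC.leading_f_bar hL hρ hI hv1 hv3 hP hR hrh hH
  have hlD : w'.len (Q'.bar ρ) = 5 := by rw [w'.len_bar_of_border hρ, h5]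
  set D := Q'.bar ρ with hD
  have hHs : S'.e (Q'.src (Q'.f (Q'.f D))) = S.e (Q.src h) := by
    rw [← hHg, Q'.src_g, hv3, hI.src_h]
  obtain ⟨ru, hru, hu⟩ := hC.leading_bar hI hHs hH
  have hJ : ∀ k, 1 ≤ k → S'.J k = S.J k := fun k hk => (hC.J hk).symm
  have hU : Q'.bar (Q'.f (Q'.f D)) = Q'.f (Q'.g (Q'.g D)) := by rw [← hHg, Q'.bar_g]
  have hgY : Q'.g (Q'.f D) = Q'.f (Q'.g (Q'.g D)) := by rw [g_def, hU]
  have hbR : Q'.bar (Q'.g (Q'.g D)) = Q'.f (Q'.g D) := Q'.bar_g _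
  have hbP : Q'.bar (Q'.g D) = Q'.f D := Q'.bar_g _
  have hlP : w'.len (Q'.g D) = 5 := by rw [w'.len_g, hlD]
  have hlR : w'.len (Q'.g (Q'.g D)) = 5 := by rw [w'.len_g, hlP]
  have hlH : w'.len (Q'.f (Q'.f D)) = 5 := by rw [← hHg, w'.len_g, hlR]
  have hN : ∀ {k : ℕ} {z : A}, z ∈ S.J k → 4 ≤ k → S.τ (z * S.p [N]) = 0 := by
    intro k z hz hk
    refine S.τ_mul_p_eq_zero (fun l hl => ?_) hz
    have h6 : 5 ≤ (l ++ [N]).length := by simp; omega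
    exact traceWord_eq_zero c β (by omega) (by rw [hI.len_N]; omega) (.inl h6)
  -- the product of `f D` with an element of the square of the arrow ideal
  have hZ : ∀ z ∈ S.J 2, S.τ (S'.p [Q'.f D] * z * S.p [N]) = 0 := by
    intro z hz
    have h1 : S.τ (S.p [y] * z * S.p [N]) = 0 := by
      refine S.τ_mul_p_mul_p_eq_zero (k := 2) (fun l hl => ?_) hz
      rw [traceWord_append_comm]
      exact hI.tr_N_y l hl
    rw [hY, add_mul, add_mul, map_add, smul_mul_assoc, smul_mul_assoc, map_smul, h1, smul_zero,
      zero_add]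
    exact hN (S.mul_mem_J hj hz) le_rfl
  have hYN : S'.p [Q'.f D] * S.p [N] = 0 := by
    have h1 : S'.e (Q'.tgt (Q'.f D)) = S.e (Q.tgt y) := by rw [← Q'.src_f, hHs, hI.tgt_y]
    rw [← S'.x_mul_e, h1, ← S.e_mul_x N, mul_assoc, ← mul_assoc (S.e _), S.e_mul_ne, zero_mul,
      mul_zero]
    rw [hI.src_N, hI.tgt_y, ← hI.src_u]
    exact hI.tgt_u.symm
  have hYU : S.τ (S'.p [Q'.f D, Q'.f (Q'.g (Q'.g D))] * S.p [N]) = ru * s * (c.c u)⁻¹ := by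
    rw [hU] at hu
    have h1 := hZ _ hu
    have h2 : S.τ (S.p [y] * S.p [u] * S.p [N]) = (c.c u)⁻¹ := by
      rw [← p_append, ← p_append, τ_p]
      change traceWord w c β ([y] ++ [u, N]) = _
      rw [traceWord_append_comm]
      exact hI.tr_uNy
    have h3 : S.τ (j * S.p [u] * S.p [N]) = 0 := by rw [mul_assoc, ← p_append]; exact hju
    rw [mul_sub, sub_mul, map_sub, sub_eq_zero, ← p_append] at h1
    have h4 : S'.p [Q'.f D, Q'.f (Q'.g (Q'.g D))] =
      S'.p ([Q'.f D] ++ [Q'.f (Q'.g (Q'.g D))]) := rfl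
    rw [h4, h1, hY]
    simp only [add_mul, mul_smul_comm, smul_mul_assoc, map_add, map_smul, h2, h3, smul_eq_mul]
    ring
  have hX : S.τ (S'.p [Q'.g D, Q'.g (Q'.g D), Q'.f (Q'.g (Q'.g D))] * S.p [N]) =
      rP * rR * ru * c.c (Q.f u) := by
    rw [hU] at hu
    have h13 := S.mul_leading (k := 3) (l := [P]) (l' := [R]) hP hR rfl
    have h14 := S.mul_leading (k := 4) (l := [P, R]) (l' := [u]) h13 hu rfl
    have h16 := hN h14 le_rfl
    rw [sub_mul, map_sub, smul_mul_assoc, map_smul, ← p_append, sub_eq_zero, ← p_append,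
      ← p_append] at h16
    have h17 : S.τ (S.p ([P, R] ++ [u] ++ [N])) = c.c (Q.f u) := by
      rw [τ_p]; exact hI.tr_square
    rw [h17] at h16
    exact h16
  have hX0 : S.τ (S'.p [Q'.g D, Q'.g (Q'.g D), Q'.f (Q'.g (Q'.g D))] * S.p [N]) ≠ 0 := by
    rw [hX]
    exact mul_ne_zero (mul_ne_zero (mul_ne_zero hrP hrR) hru) (c.c_ne _)
  -- By leading terms the product does not vanish, so in the second quiver it must be one of the
  -- exceptions to the zero relation.
  have hor : w'.len (Q'.f (Q'.g D)) = 2 ∨ w'.Pent (Q'.g (Q'.g D)) := by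
    by_contra hcon
    rw [S'.p_zero_gf hcon, zero_mul, map_zero] at hX0
    exact hX0 rfl
  rcases hor with hlv | hp
  · have e1 : S'.p [Q'.g (Q'.g D), Q'.f (Q'.g (Q'.g D))] =
        c'.c (Q'.f (Q'.g D)) • S'.p [Q'.f (Q'.g D)] := by
      have h1 : Q'.f (Q'.g (Q'.g D)) ≠ Q'.g (Q'.g D) := by
        intro h1
        have := w'.len_bar_of_border h1
        rw [hbR] at this; omega
      have := S'.p_triangle_of_len_two h1 (by rw [hbR, hlv])
      rwa [hbR] at this
    have e2 : S'.p [Q'.g D, Q'.g (Q'.g D), Q'.f (Q'.g (Q'.g D))] =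
        (c'.c (Q'.f (Q'.g D)) * c'.c (Q'.f D)) •
          S'.p (Q'.gWord (Q'.f D) (w'.len (Q'.f D) - 1)) := by
      have h1 : Q'.f (Q'.g D) ≠ Q'.g D := f_ne_of_len_ne (w := w') (by omega)
      have := S'.p_triangle h1
      rw [hbP] at this
      rw [p_cons, e1, mul_smul_comm, ← p_append, mul_smul, ← this]
      rfl
    rw [e2, smul_mul_assoc, map_smul] at hX hX0
    -- The non-zero trace excludes the other lengths: for length two, `f D` does not compose with
    -- `N`; for length at least four, the factor after `f D` lies in `J²`, where `hZ` applies.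
    have hlY : w'.len (Q'.f D) = 3 := by
      have h2 := w'.two_le_len (Q'.f D)
      rcases (by omega : w'.len (Q'.f D) = 2 ∨ w'.len (Q'.f D) = 3 ∨ 4 ≤ w'.len (Q'.f D)) with
        h | h | h
      · rw [h, show 2 - 1 = 1 by rfl, gWord_one, hYN, map_zero, smul_zero] at hX0
        exact absurd rfl hX0
      · exact h
      · rw [gWord_eq_cons _ (by omega), p_cons, hZ, smul_zero] at hX0
        · exact absurd rfl hX0
        · rw [← hJ _ (by norm_num)]
          exact S'.p_mem_J (by rw [gWord_length]; omega)
    rw [hlY, show 3 - 1 = 2 by rfl, gWord_two, hgY, hYU, smul_eq_mul] at hX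
    have hpent : w'.Pent (Q'.f (Q'.f D)) := by
      refine w'.pent_of_len ?_ ?_
      · rw [hU, w'.len_f_f, hbR, hlv]
      · rw [hU, ← hgY, w'.len_g, hlY]
    refine ⟨hpent, ?_⟩
    have hcu : c'.c (Q'.f (Q'.g (Q'.g D))) = c'.c (Q'.f D) := by rw [← hgY, c'.c_g]
    have hcv : c'.c (Q'.f (Q'.f (Q'.g (Q'.g D)))) = c'.c (Q'.f (Q'.g D)) := by
      rw [c'.c_f_f, hbR]
    rw [pentValue, hU, hcu, hcv]
    have hcu' := c.c_ne u
    have h1 : ru * (c'.c (Q'.f (Q'.g D)) * c'.c (Q'.f D) * s) =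
        ru * (rP * rR * c.c (Q.f u) * c.c u) := by
      field_simp at hX
      linear_combination ru * hX
    have h2 := mul_left_cancel₀ hru h1
    have h3 : rP * rR * (c.c α * (c.c u * c.c (Q.f u))) = rP * rR *
        (a * (c'.c ρ * (c'.c (Q'.f D) * c'.c (Q'.f (Q'.g D))))) := by
      linear_combination (-c.c α) * h2 + c'.c (Q'.f (Q'.g D)) * c'.c (Q'.f D) * hs
    exact mul_left_cancel₀ (mul_ne_zero hrP hrR) h3
  -- In the other exception, `p_pent` reduces the product to a path whose two letters cannot be
  -- composed, as a comparison of orbit lengths shows.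
  · exfalso
    rw [S'.p_pent hp, smul_mul_assoc, map_smul, hbP] at hX0
    have hlv : w'.len (Q'.f (Q'.g D)) = 3 := by rw [← hbR]; exact hp.len_bar
    have hlY : w'.len (Q'.f D) = 2 := by rw [← hbP, ← w'.len_f_f, ← hbR]; exact hp.1
    by_cases hcomp : Q'.tgt (Q'.f D) = Q'.src (Q'.g (Q'.f (Q'.g D)))
    · rw [← Q'.src_f] at hcomp
      have hl : w'.len (Q'.g (Q'.f (Q'.g D))) = 3 := by rw [w'.len_g, hlv]
      rcases Q'.eq_or_eq_bar hcomp.symm with h1 | h1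
      · rw [h1] at hl; omega
      · rw [h1, hU, ← hgY, w'.len_g] at hl; omega
    · rw [S'.p_eq_zero hcomp, zero_mul, map_zero, smul_zero] at hX0
      exact hX0 rfl

end

end TraceModel

end TriangulationQuiver

/-! ### Border values at loops with `4 ≤ m n` -/

namespace TriangulationQuiver

namespace TraceModel

variable {V E : Type*} [Fintype V] {Q : TriangulationQuiver V E} {K : Type*} [Field K]
variable {w : Q.WeightFunction} {c : Q.ParameterFunction K} {β : E → K}
variable {V' E' : Type*} [Fintype V'] {Q' : TriangulationQuiver V' E'}
variable {w' : Q'.WeightFunction} {c' : Q'.ParameterFunction K} {β' : E' → K}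
variable {A : Type*} [Ring A] [Algebra K A]
variable {S : TraceModel w c β A} {S' : TraceModel w' c' β' A} {σ : V ≃ V'}
variable {α : E} {ρ : E'} {a : K}

theorem Compatible.pent_border [CharP K 2] (hC : Compatible S S' σ)
    (hL : LoopPair S S' α ρ a) (hρ : Q'.f ρ = ρ) (h5 : w.len α = 5)
    (hp : w.Pent (Q.f (Q.f (Q.bar α)))) :
    w'.Pent (Q'.f (Q'.f (Q'.bar ρ))) ∧ c.c α * pentValue c (Q.f (Q.f (Q.bar α))) =
      a * (c'.c ρ * pentValue c' (Q'.f (Q'.f (Q'.bar ρ)))) := by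
  have hI := WeightFunction.Pent.isPentagon (c := c) (β := β) hL.border h5 hp
  have h := hC.pent_of_isPentagon hL hρ hI
  rwa [pentValue, ← (hp.of_border hL.border).1, hI.bar_h]

/-- The border value at a border loop `α` with `4 ≤ m_α n_α` vanishes if it vanishes at a border
loop of another presentation. -/
theorem Compatible.border_eq_zero [CharP K 2] (hC : Compatible S S' σ)
    (hL : LoopPair S S' α ρ a) (hρ : Q'.f ρ = ρ) (hβ : β' ρ = 0) (h4 : 4 ≤ w.len α) :
    β α = 0 := by
  have hα := hL.border
  have hlen := hL.len_eq hρ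
  have hsq := (hL.τ_sq hρ).2 h4
  have hc := c.c_ne α
  have ha := hL.ne
  -- In the pentagon case both traces carry a correction. Since `τ (ρ³) = a³`, the identity of
  -- parameters in `pent_border` says exactly that the corrections cancel.
  by_cases hp : w.len α = 5 ∧ w.Pent (Q.f (Q.f (Q.bar α)))
  · obtain ⟨hp', he⟩ := hC.pent_border hL hρ hp.1 hp.2
    rw [S.τ_p_border_border_of_pent hα hp.1 hp.2,
      S'.trace_p_border_border_of_pent hρ S.τ_comm hβ (by rw [hlen, hp.1]) hp',
      hL.τ_cube hρ] at hsq
    have h1 : a ^ 2 * (β α / c.c α) = 0 := by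
      linear_combination (-a ^ 2) * he - hsq
    have h2 := (mul_eq_zero.1 h1).resolve_left (pow_ne_zero 2 ha)
    exact (div_eq_zero_iff.1 h2).resolve_right hc
  · have hp' : ¬ (w'.len ρ = 5 ∧ w'.Pent (Q'.f (Q'.f (Q'.bar ρ)))) := by
      rintro ⟨h5, hp'⟩
      exact hp ⟨by omega, (hC.symm.pent_border (hL.symm hρ) hα h5 hp').1⟩
    rw [S.τ_p_border_border_of_not_pent hα hp,
      S'.trace_p_border_border_eq_zero hρ S.τ_comm hβ (by omega) hp'] at hsq
    have h2 := (mul_eq_zero.1 hsq.symm).resolve_left (pow_ne_zero 2 ha)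
    exact (div_eq_zero_iff.1 h2).resolve_right hc

end TraceModel

end TriangulationQuiver

namespace TriangulationQuiver

/-! ### The disc: border loops with `m n = 3` -/

section Disc

variable {V E : Type*} {Q : TriangulationQuiver V E} [Finite V] {w : Q.WeightFunction}

variable {α : E}

/-- Write `β = bar α`, `γ = g β`, `η = f β`. Then `g` permutes `α, β, γ` cyclically and fixes `η`,
while `f` fixes `α` and permutes `β, η, γ` cyclically. This and the next lemmas amount to the quiver
of `Q(2B)`. -/
theorem f_f_bar_of_disc (hα : Q.f α = α) (h3 : w.len α = 3) :
    Q.f (Q.f (Q.bar α)) = Q.g (Q.bar α) := by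
  have := g_iterate_sub_two_of_border (w := w) hα
  rw [h3] at this
  exact this.symm

theorem g_g_bar_of_disc (hα : Q.f α = α) (h3 : w.len α = 3) :
    Q.g (Q.g (Q.bar α)) = α := by
  rw [← f_f_bar_of_disc hα h3, g_f_f_bar]

theorem f_g_bar_of_disc (hα : Q.f α = α) (h3 : w.len α = 3) :
    Q.f (Q.g (Q.bar α)) = Q.bar α := by
  rw [← f_f_bar_of_disc hα h3, Q.f_f_f]

theorem g_f_bar_of_disc (hα : Q.f α = α) (h3 : w.len α = 3) :
    Q.g (Q.f (Q.bar α)) = Q.f (Q.bar α) := by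
  rw [g_def, f_f_bar_of_disc hα h3, bar_g]

theorem tgt_g_bar_of_disc (hα : Q.f α = α) (h3 : w.len α = 3) :
    Q.tgt (Q.g (Q.bar α)) = Q.src α := by
  rw [← Q.src_g, g_g_bar_of_disc hα h3]

theorem tgt_f_bar_of_disc (hα : Q.f α = α) (h3 : w.len α = 3) :
    Q.tgt (Q.f (Q.bar α)) = Q.tgt (Q.bar α) := by
  rw [← Q.src_g, g_f_bar_of_disc hα h3, Q.src_f]

/-- No arrow leaves or enters the set formed by these two vertices, so connectedness applies. This
is what excludes three or more vertices. -/
theorem vertex_of_disc (hα : Q.f α = α) (h3 : w.len α = 3) (v : V) :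
    v = Q.src α ∨ v = Q.tgt (Q.bar α) := by
  have tα := Q.tgt_eq_of_f_eq hα
  have tγ := tgt_g_bar_of_disc hα h3
  have tη := tgt_f_bar_of_disc hα h3
  have key : ∀ x : E, (Q.src x = Q.src α ∨ Q.src x = Q.tgt (Q.bar α)) ↔
      (Q.tgt x = Q.src α ∨ Q.tgt x = Q.tgt (Q.bar α)) := by
    intro x
    constructor
    · rintro (h | h)
      · rcases Q.eq_or_eq_bar h with rfl | rfl
        · exact .inl tα
        · exact .inr rfl
      · rw [← Q.src_f] at h
        rcases Q.eq_or_eq_bar h with rfl | rfl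
        · exact .inr tη
        · exact .inl tγ
    · rintro (h | h)
      · rw [← tα] at h
        rcases Q.in_cases h with rfl | h
        · exact .inl rfl
        · rw [hα, ← g_g_bar_of_disc hα h3] at h
          rw [Q.g_injective h, Q.src_g]; exact .inr rfl
      · rcases Q.in_cases h with rfl | h
        · exact .inl (Q.src_bar α)
        · rw [← g_f_bar_of_disc hα h3] at h
          rw [Q.g_injective h, Q.src_f]; exact .inr rfl
  have h2 : ∀ u v, Relation.EqvGen (fun x y => ∃ a, Q.src a = x ∧ Q.tgt a = y) u v →
      ((u = Q.src α ∨ u = Q.tgt (Q.bar α)) ↔ (v = Q.src α ∨ v = Q.tgt (Q.bar α))) := by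
    intro u v h
    induction h with
    | rel x y h => obtain ⟨a, rfl, rfl⟩ := h; exact key a
    | refl => exact Iff.rfl
    | symm _ _ _ ih => exact ih.symm
    | trans _ _ _ _ _ ih1 ih2 => exact ih1.trans ih2
  exact (h2 _ _ (Q.connected (Q.src α) v)).1 (.inl rfl)

theorem arrow_of_disc (hα : Q.f α = α) (h3 : w.len α = 3) (x : E) :
    x = α ∨ x = Q.bar α ∨ x = Q.g (Q.bar α) ∨ x = Q.f (Q.bar α) := by
  rcases vertex_of_disc hα h3 (Q.src x) with h | h
  · rcases Q.eq_or_eq_bar h with h | h <;> simp [h]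
  · rw [← Q.src_f] at h
    rcases Q.eq_or_eq_bar h with h | h
    · simp [h]
    · rw [h]; exact .inr (.inr (.inl rfl))

theorem three_le_len_f_bar_of_disc (hα : Q.f α = α) (h3 : w.len α = 3) :
    3 ≤ w.len (Q.f (Q.bar α)) := by
  have h1 := w.two_le_len (Q.f (Q.bar α))
  have h2 := len_f_bar_of_border w hα h3
  omega

theorem len_of_disc (hα : Q.f α = α) (h3 : w.len α = 3) (x : E) :
    w.len x = 3 ∨ x = Q.f (Q.bar α) := by
  have hb := w.len_bar_of_border hα
  rcases arrow_of_disc hα h3 x with rfl | rfl | rfl | rfl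
  · exact .inl h3
  · exact .inl (by omega)
  · exact .inl (by rw [w.len_g]; omega)
  · exact .inr rfl

theorem gWord_append_of_g_eq {x : E} (h : Q.g x = x) (k l : ℕ) :
    Q.gWord x k ++ Q.gWord x l = Q.gWord x (k + l) := by
  rw [gWord_add, Function.iterate_fixed h]

end Disc

namespace TraceModel

variable {V E : Type*} [Fintype V] {Q : TriangulationQuiver V E} {K : Type*} [Field K]
variable {w : Q.WeightFunction} {c : Q.ParameterFunction K} {β : E → K}
variable {V' E' : Type*} [Fintype V'] {Q' : TriangulationQuiver V' E'}
variable {w' : Q'.WeightFunction} {c' : Q'.ParameterFunction K} {β' : E' → K}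
variable {A : Type*} [Ring A] [Algebra K A]
variable {S : TraceModel w c β A} {S' : TraceModel w' c' β' A} {σ : V ≃ V'}
variable {α : E} {ρ : E'} {a : K}

theorem add_mul_self_trace [CharP K 2] {τ : A →ₗ[K] K} (hτ : ∀ y z, τ (y * z) = τ (z * y))
    (y z : A) : τ ((y + z) * (y + z)) = τ (y * y) + τ (z * z) := by
  rw [add_mul, mul_add, mul_add, map_add, map_add, map_add, hτ z y]
  have := CharTwo.add_self_eq_zero (τ (y * z))
  linear_combination this

theorem coef_of_ne (S : TraceModel w c β A) (hα : Q.f α = α) {x : E} (hx : x ≠ α) :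
    S.coef α (S.p [x]) = 0 := by
  by_cases h : Q.src x = Q.src α
  · rcases Q.eq_or_eq_bar h with rfl | rfl
    · exact absurd rfl hx
    · exact S.coef_bar hα
  · refine S.coef_eq_zero_of_e_mul hα ?_
    rw [S.e_mul_p_ne (Ne.symm h)]

/-- In characteristic two the trace of a square is determined by the coefficient of the border
loop, if all paths `B_a` have odd length. -/
theorem τ_mul_self_of_disc [CharP K 2] (S : TraceModel w c β A) (hα : Q.f α = α)
    (h3 : w.len α = 3) (ht : ¬ Even (w.len (Q.f (Q.bar α)))) {y : A} (hy : y ∈ S.J 1) :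
    S.τ (y * y) = S.coef α y ^ 2 * (β α / c.c α) := by
  have hodd : ∀ x, ¬ Even (w.len x) := by
    intro x
    rcases len_of_disc hα h3 x with h | rfl
    · rw [h]; decide
    · exact ht
  have hv : ∀ x, w.len x ≠ 2 := fun x h => hodd x (by rw [h]; decide)
  induction hy using S.J_induction with
  | hp l hl =>
    rcases l with _ | ⟨x, _ | ⟨z, l⟩⟩
    · simp at hl
    · by_cases hx : x = α
      · subst hx
        rw [S.coef_self hα, ← p_append]
        change S.τ (S.p [x, x]) = _
        rw [S.τ_p_border_border_of_not_pent hα (by omega)]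
        ring
      · rw [S.coef_of_ne hα hx, ← p_append]
        change S.τ (S.p [x, x]) = _
        by_cases hc : Q.tgt x = Q.src x
        · rw [τ_p, traceWord, orbitTerm, if_neg, triangleTerm, if_neg, borderTerm, if_neg,
            squareTerm, if_neg, if_neg, pentTerm_of_length_ne]
          · simp
          · simp
          · simp
          · simp
          · rintro ⟨hf, -⟩
            rcases arrow_of_disc hα h3 x with h | rfl | rfl | rfl
            · exact hx h
            · exact f_bar_of_border hα hf
            · rw [f_g_bar_of_disc hα h3] at hf
              have := tgt_bar_of_border hα
              rw [hf, hc, Q.src_g] at this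
              rw [tgt_g_bar_of_disc hα h3, Q.src_g] at hc
              exact tgt_bar_of_border hα hc.symm
            · rw [f_f_bar_of_disc hα h3] at hf
              exact Q.g_ne_f _ hf
          · simp
          · intro h
            have := congrArg List.length h
            rw [gWord_length] at this
            exact hv x this.symm
        · rw [S.p_eq_zero hc]; simp
    -- The square of a word has even length, while all paths `B_a` have odd length and no arrow is
    -- virtual.
    · rw [S.coef_J_two hα (S.p_mem_J (by simp)), ← p_append, τ_p, traceWord_of_four_le]
      · simp only [List.cons_append, orbitTerm]
        rw [if_neg]
        · simp
        · intro h
          have := congrArg List.length h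
          rw [gWord_length] at this
          apply hodd x
          rw [← this]
          refine ⟨l.length + 2, ?_⟩
          simp; omega
      · simp; omega
      · exact hv
  | h0 => simp
  | hadd y z _ _ hy hz =>
    rw [add_mul_self_trace S.τ_comm, hy, hz, map_add, CharTwo.add_sq]
    ring
  | hsmul r y _ hy =>
    rw [smul_mul_assoc, mul_smul_comm, map_smul, map_smul, map_smul, hy, smul_eq_mul, smul_eq_mul,
      smul_eq_mul]
    ring

/-- If the border value vanishes, an element with non-zero coefficient at the border loop squares to
an element of trace zero. -/
theorem exists_trace_mul_self_of_disc [IsAlgClosed K] [CharP K 2] (S : TraceModel w c β A)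
    (hα : Q.f α = α) (h3 : w.len α = 3) (hβ : β α = 0) {r : ℕ}
    (ht : w.len (Q.f (Q.bar α)) = 2 * r + 1) {τ : A →ₗ[K] K}
    (hτ : ∀ y z, τ (y * z) = τ (z * y)) : ∃ s : K, s ≠ 0 ∧
      τ ((s • S.p [α] + S.p (Q.gWord (Q.f (Q.bar α)) r)) *
        (s • S.p [α] + S.p (Q.gWord (Q.f (Q.bar α)) r))) = 0 := by
  have hb := w.len_bar_of_border hα
  have hg := g_f_bar_of_disc hα h3
  have h1 : S.p [α, α] = c.c α • S.p [Q.bar α, Q.g (Q.bar α)] := by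
    rw [S.p_border_border_eq hα, hβ, zero_smul, add_zero, h3]; rfl
  have h2 : S.p [Q.g (Q.bar α), Q.bar α] =
      c.c (Q.f (Q.bar α)) • S.p (Q.gWord (Q.f (Q.bar α)) (2 * r)) := by
    have h4 : Q.f (Q.g (Q.bar α)) ≠ Q.g (Q.bar α) := by
      rw [f_g_bar_of_disc hα h3]
      intro h
      apply tgt_bar_of_border hα
      have h5 := congrArg Q.tgt h
      rwa [tgt_g_bar_of_disc hα h3] at h5
    have h5 := S.p_triangle h4
    rw [f_g_bar_of_disc hα h3, bar_g, ht] at h5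
    exact h5
  have h4 : τ (S.p [Q.bar α, Q.g (Q.bar α)]) =
      c.c (Q.f (Q.bar α)) * τ (S.p (Q.gWord (Q.f (Q.bar α)) (2 * r))) := by
    rw [p_cons, hτ, ← p_append]
    change τ (S.p [Q.g (Q.bar α), Q.bar α]) = _
    rw [h2, map_smul, smul_eq_mul]
  have hcα := c.c_ne α
  have hcη := c.c_ne (Q.f (Q.bar α))
  -- For every trace form the relations give `τ (α²) = c_α c_η τ (η ^ (2 r))`. With this `s` the two
  -- squares have equal trace and cancel in characteristic two.
  obtain ⟨s, hs⟩ := IsAlgClosed.exists_pow_nat_eq (c.c α * c.c (Q.f (Q.bar α)))⁻¹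
    (n := 2) (by norm_num)
  have hs0 : s ≠ 0 := by
    rintro rfl
    rw [zero_pow two_ne_zero] at hs
    exact inv_ne_zero (mul_ne_zero hcα hcη) hs.symm
  refine ⟨s, hs0, ?_⟩
  rw [add_mul_self_trace hτ, smul_mul_assoc, mul_smul_comm, map_smul, map_smul, ← p_append,
    ← p_append, gWord_append_of_g_eq hg, ← two_mul]
  change s • s • τ (S.p [α, α]) + _ = 0
  rw [h1, map_smul, h4, smul_eq_mul, smul_eq_mul, smul_eq_mul]
  have h5 : s * (s * (c.c α * (c.c (Q.f (Q.bar α)) *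
      τ (S.p (Q.gWord (Q.f (Q.bar α)) (2 * r)))))) =
      τ (S.p (Q.gWord (Q.f (Q.bar α)) (2 * r))) := by
    have : s ^ 2 * (c.c α * c.c (Q.f (Q.bar α))) = 1 := by
      rw [hs, inv_mul_cancel₀ (mul_ne_zero hcα hcη)]
    linear_combination τ (S.p (Q.gWord (Q.f (Q.bar α)) (2 * r))) * this
  rw [h5]
  exact CharTwo.add_self_eq_zero _

end TraceModel

end TriangulationQuiver

/-! ### Loops fixed by `g`, and discs with odd weight at the inner loop -/

namespace TriangulationQuiver

namespace TraceModel

variable {V E : Type*} [Fintype V] {Q : TriangulationQuiver V E} {K : Type*} [Field K]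
variable {w : Q.WeightFunction} {c : Q.ParameterFunction K} {β : E → K}
variable {V' E' : Type*} [Fintype V'] {Q' : TriangulationQuiver V' E'}
variable {w' : Q'.WeightFunction} {c' : Q'.ParameterFunction K} {β' : E' → K}
variable {A : Type*} [Ring A] [Algebra K A]
variable {S : TraceModel w c β A} {S' : TraceModel w' c' β' A} {σ : V ≃ V'}
variable {α : E} {ρ : E'} {a : K}

theorem bar_eq_f_of_g_eq {V E : Type*} {Q : TriangulationQuiver V E} {ρ : E} (hg : Q.g ρ = ρ) :
    Q.bar ρ = Q.f ρ := by rw [← Q.bar_g, hg]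

theorem tgt_f_of_g_eq {V E : Type*} {Q : TriangulationQuiver V E} {ρ : E} (hg : Q.g ρ = ρ) :
    Q.tgt (Q.f ρ) ≠ Q.src ρ := by
  rw [← bar_eq_f_of_g_eq hg]
  exact Q.not_both_loops ρ (by rw [← Q.src_g, hg])

/-- Here `bar ρ = f ρ`, so the triangle relation replaces `ρ · f ρ` by a path that starts with `f
ρ`. -/
theorem p_mul_p_f_of_g_eq (S : TraceModel w c β A) {ρ : E} (hg : Q.g ρ = ρ) :
    ∃ y ∈ S.J 1, S.p [ρ] * S.p [Q.f ρ] = S.p [Q.f ρ] * y := by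
  have hl := w.three_le_len_f_of_g_eq hg
  have hb := bar_eq_f_of_g_eq hg
  have hf : Q.f ρ ≠ ρ := by rw [← hb]; exact Q.bar_ne ρ
  have h1 := S.p_triangle hf
  rw [hb, gWord_eq_cons _ (by omega), p_cons _ (Q.f ρ)] at h1
  refine ⟨c.c (Q.f ρ) • S.p (Q.gWord (Q.g (Q.f ρ)) (w.len (Q.f ρ) - 1 - 1)),
    Submodule.smul_mem _ _ (S.p_mem_J (by rw [gWord_length]; omega)), ?_⟩
  rw [← p_append, mul_smul_comm, ← h1]
  rfl

/-- At a loop `ρ` with `g ρ = ρ`, all paths to other vertices are divisible by `f ρ`. -/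
theorem exists_eq_p_f_mul (S : TraceModel w c β A) {ρ : E} (hg : Q.g ρ = ρ) {y : A}
    (hy : y ∈ S.J 1) : ∃ z, S.e (Q.src ρ) * y * (1 - S.e (Q.src ρ)) = S.p [Q.f ρ] * z := by
  have key : ∀ l : List E, ∃ z,
      S.e (Q.src ρ) * S.p l * (1 - S.e (Q.src ρ)) = S.p [Q.f ρ] * z := by
    intro l
    induction l with
    | nil => exact ⟨0, by rw [p_nil, mul_one, mul_sub, mul_one, S.e_mul_self, sub_self, mul_zero]⟩
    | cons x l ih =>
      by_cases hx : Q.src x = Q.src ρ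
      · rcases Q.eq_or_eq_bar hx with rfl | rfl
        · obtain ⟨z, hz⟩ := ih
          obtain ⟨u, -, hu⟩ := S.p_mul_p_f_of_g_eq hg
          have ht : Q.tgt x = Q.src x := by rw [← Q.src_g, hg]
          refine ⟨u * z, ?_⟩
          have h1 : S.p [x] * S.e (Q.src x) = S.p [x] := by
            conv_lhs => rw [← ht, S.x_mul_e]
          rw [S.e_mul_p, p_cons, ← h1, mul_assoc, mul_assoc, ← mul_assoc (S.e _), hz, ← mul_assoc,
            hu, mul_assoc]
        · rw [bar_eq_f_of_g_eq hg, p_cons, ← mul_assoc]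
          have h1 : S.e (Q.src ρ) * S.p [Q.f ρ] = S.p [Q.f ρ] := by
            rw [← bar_eq_f_of_g_eq hg, ← Q.src_bar ρ, S.e_mul_x]
          exact ⟨S.p l * (1 - S.e (Q.src ρ)), by rw [h1, mul_assoc]⟩
      · exact ⟨0, by rw [S.e_mul_p_ne (Ne.symm hx)]; simp⟩
  induction hy using S.J_induction with
  | hp l _ => exact key l
  | h0 => exact ⟨0, by simp⟩
  | hadd y y' _ _ hy hy' =>
    obtain ⟨z, hz⟩ := hy
    obtain ⟨z', hz'⟩ := hy'
    exact ⟨z + z', by rw [mul_add, add_mul, hz, hz', mul_add]⟩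
  | hsmul r y _ hy =>
    obtain ⟨z, hz⟩ := hy
    exact ⟨r • z, by rw [mul_smul_comm, smul_mul_assoc, hz, mul_smul_comm]⟩

theorem traceWord_around_border (c : Q.ParameterFunction K) (β : E → K) (hα : Q.f α = α)
    (h4 : 4 ≤ w.len α) {l : List E} (hl : 1 ≤ l.length) :
    traceWord w c β (Q.bar α :: l ++ Q.gWord (Q.g (Q.bar α)) (w.len α - 2)) = 0 := by
  classical
  have hb := w.len_bar_of_border hα
  have hgg : Q.g (Q.bar α) ≠ Q.bar α := by
    intro h
    have := tgt_bar_of_border hα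
    rw [← Q.src_g, h, Q.src_bar] at this
    exact this rfl
  by_cases hlen : l.length = 1
  · obtain ⟨x, rfl⟩ := List.length_eq_one_iff.1 hlen
    obtain ⟨k, hk⟩ : ∃ k, w.len α = k + 4 := ⟨w.len α - 4, by omega⟩
    have h1 : Q.bar α :: [x] ++ Q.gWord (Q.g (Q.bar α)) (w.len α - 2) =
        Q.bar α :: x :: Q.g (Q.bar α) :: Q.g (Q.g (Q.bar α)) ::
          Q.gWord (Q.g (Q.g (Q.g (Q.bar α)))) k := by
      rw [hk, show k + 4 - 2 = k + 1 + 1 by omega, gWord_succ, gWord_succ]; rfl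
    have ho : orbitTerm w c (Q.bar α :: x :: Q.g (Q.bar α) :: Q.g (Q.g (Q.bar α)) ::
          Q.gWord (Q.g (Q.g (Q.g (Q.bar α)))) k) = 0 := by
      rw [orbitTerm, if_neg]
      intro h
      rw [hb, hk, gWord_succ, gWord_succ, gWord_succ] at h
      simp only [List.cons.injEq] at h
      exact hgg (Q.g_injective h.2.2.1).symm
    rw [h1]
    rcases k with _ | k
    · rw [gWord_zero] at ho ⊢
      rw [traceWord, ho, triangleTerm, if_neg, borderTerm, if_neg, squareTerm, if_neg, if_neg,
        pentTerm_eq_zero w c (by omega)]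
      · simp
      · rintro ⟨h, hv⟩
        simp only [List.cons.injEq] at h
        obtain ⟨rfl, h2, -⟩ := h
        have h3 := w.len_bar_of_border h2.symm
        rw [bar_g, w.len_g] at h3
        omega
      · rintro ⟨-, hv⟩
        rw [w.len_f_f, Q.bar_bar] at hv
        omega
      · simp
      · simp
    · rw [traceWord_of_five_le _ _ _ (by simp [gWord_length]), ho]
  · have h2 : Q.bar α :: l ++ Q.gWord (Q.g (Q.bar α)) (w.len α - 2) =
        [] ++ Q.bar α :: (l ++ Q.gWord (Q.g (Q.bar α)) (w.len α - 2)) := rfl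
    rw [h2]
    refine traceWord_bar_of_border_of_len_lt c β hα ?_
    simp only [List.length_append, List.length_cons, gWord_length, List.length_nil]
    omega

/-- If `g ρ = ρ`, all paths to other vertices are left multiples of `f ρ`, and `ρ` can be moved past
`f ρ`. Up to longer terms `α · bar α` then lies in `bar α · J`. For `len α ≥ 4` this contradicts the
trace against the remainder of `B_α`, which is non-zero on `α · bar α` and zero on `bar α · J`. -/
theorem LoopPair.len_eq_three (hL : LoopPair S S' α ρ a) (hg : Q'.g ρ = ρ) : w.len α = 3 := by
  have hα := hL.border
  have h3 := w.three_le_len_of_border hα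
  by_contra hne
  have h4 : 4 ≤ w.len α := by omega
  have hb := w.len_bar_of_border hα
  have hJ : ∀ k, 1 ≤ k → S'.J k = S.J k := fun k hk => (hL.J hk).symm
  have hte : S.p [Q.bar α] * S.e (Q.src α) = 0 := S.x_mul_e_ne (tgt_bar_of_border hα)
  have hse : S.e (Q.src α) * S.p [Q.bar α] = S.p [Q.bar α] := by rw [← Q.src_bar, S.e_mul_x]
  have hbJ : S.p [Q.bar α] ∈ S'.J 1 := by rw [hJ 1 le_rfl]; exact S.p_mem_J (by simp)
  obtain ⟨z, hz⟩ := S'.exists_eq_p_f_mul hg hbJ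
  rw [hL.e, hse, mul_sub, mul_one, hte, sub_zero] at hz
  obtain ⟨u, hu, hu'⟩ := S'.p_mul_p_f_of_g_eq hg
  have h1 : S'.p [ρ] * S.p [Q.bar α] = S'.p [Q'.f ρ] * (u * z) := by
    rw [hz, ← mul_assoc, hu', mul_assoc]
  have huz : u * z ∈ S.J 1 := by
    rw [← hJ 1 le_rfl]; exact S'.mul_right_mem_J z le_rfl hu
  have hβ1 : S'.p [Q'.f ρ] ∈ S.J 1 := by rw [← hJ 1 le_rfl]; exact S'.p_mem_J (by simp)
  obtain ⟨s, r, j, hj, hf⟩ := S.exists_leading α hβ1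
  have hs : S.e (Q.src α) * S'.p [Q'.f ρ] = S'.p [Q'.f ρ] := by
    rw [← hL.e, ← Q'.src_bar ρ, bar_eq_f_of_g_eq hg, S'.e_mul_x]
  have ht : S'.p [Q'.f ρ] * S.e (Q.src α) = 0 := by
    rw [← hL.e, S'.x_mul_e_ne (tgt_f_of_g_eq hg)]
  have hαe : S.p [α] * S.e (Q.src α) = S.p [α] := by
    conv_lhs => rw [← Q.tgt_eq_of_f_eq hα, S.x_mul_e]
  rw [hs] at hf
  have hf' : S'.p [Q'.f ρ] = r • S.p [Q.bar α] + j * (1 - S.e (Q.src α)) := by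
    have h2 : S'.p [Q'.f ρ] = S'.p [Q'.f ρ] * (1 - S.e (Q.src α)) := by
      rw [mul_sub, ht, mul_one, sub_zero]
    rw [h2, hf, add_mul, add_mul, smul_mul_assoc, smul_mul_assoc, mul_sub, mul_sub, hte, hαe,
      mul_one, mul_one]
    simp
  have hj' : j * (1 - S.e (Q.src α)) ∈ S.J 2 := S.mul_right_mem_J _ (by norm_num) hj
  set Y := Q.gWord (Q.g (Q.bar α)) (w.len α - 2) with hY
  have hkill : ∀ y ∈ S.J 3, S.τ (y * S.p Y) = 0 := by
    intro y hy
    refine S.τ_mul_p_eq_zero (fun l hl => ?_) hy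
    have hY' : Y = Q.g (Q.bar α) :: Q.gWord (Q.g (Q.g (Q.bar α))) (w.len α - 2 - 1) :=
      gWord_eq_cons _ (by omega)
    have h5 : 5 ≤ (l ++ Y).length := by
      rw [List.length_append, hY, gWord_length]; omega
    have h6 : (l ++ Y).length ≠ w.len (Q.g (Q.bar α)) := by
      rw [List.length_append, hY, gWord_length, w.len_g]; omega
    rw [hY'] at h5 h6 ⊢
    exact traceWord_eq_zero c β (by omega) h6 (.inl h5)
  have htest : S.τ (S.p [Q.bar α] * (u * z) * S.p Y) = 0 :=
    S.τ_x_mul_mul_x_eq_zero _ (fun l hl => traceWord_around_border c β hα h4 hl) huz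
  -- Two expressions for `ρ · bar α` are compared: `f ρ · (u z)`, and `a α · bar α` plus an element
  -- of `J³`.
  have h2 : a • (S.p [α] * S.p [Q.bar α]) = r • (S.p [Q.bar α] * (u * z)) +
      j * (1 - S.e (Q.src α)) * (u * z) - (S'.p [ρ] - a • S.p [α]) * S.p [Q.bar α] := by
    rw [sub_mul, h1, hf', add_mul, smul_mul_assoc, smul_mul_assoc]
    abel
  have h3' := congrArg (fun y => S.τ (y * S.p Y)) h2
  simp only [add_mul, sub_mul, smul_mul_assoc, map_add, map_sub, map_smul] at h3'
  rw [htest, hkill _ (S.mul_mem_J' hj' huz le_rfl)] at h3'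
  have h5 := hkill _ (S.mul_mem_J' hL.mem (S.p_mem_J (l := [Q.bar α]) le_rfl) le_rfl)
  rw [sub_mul, sub_mul, map_sub, smul_mul_assoc, smul_mul_assoc, map_smul] at h5
  rw [h5, ← p_append, ← p_append, τ_p] at h3'
  have h6 : [α] ++ [Q.bar α] ++ Y = Q.gWord α (w.len α) := by
    rw [gWord_len_of_border w hα, hY, gWord_eq_cons _ (a := Q.bar α) (by omega)]
    rfl
  rw [h6, traceWord_gWord_of_border c β hα] at h3'
  simp only [mul_zero, add_zero, sub_zero, smul_eq_mul] at h3'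
  exact mul_ne_zero hL.ne (inv_ne_zero (c.c_ne _)) h3'

theorem Compatible.exists_loopPair_of_loop (hC : Compatible S S' σ) (hα : Q.f α = α)
    {ρ : E'} (hs : Q'.src ρ = σ (Q.src α)) (ht : Q'.tgt ρ = Q'.src ρ) :
    ∃ a, LoopPair S S' α ρ a := by
  obtain ⟨ρ', a, hL, hs'⟩ := hC.exists_loopPair hα
  rcases Q'.eq_or_eq_bar (hs.trans hs'.symm) with rfl | rfl
  · exact ⟨a, hL⟩
  · exfalso
    apply Q'.not_both_loops ρ' hL.loop
    rw [ht, Q'.src_bar]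

theorem Compatible.coef_eq_zero (hC : Compatible S S' σ) (hα : Q.f α = α) {x : E'}
    (hx : Q'.src x ≠ σ (Q.src α)) (l : List E') : S.coef α (S'.p (x :: l)) = 0 := by
  refine S.coef_eq_zero_of_e_mul hα ?_
  rw [← hC.e, S'.e_mul_p_ne (Ne.symm hx)]

theorem LoopPair.coef (hL : LoopPair S S' α ρ a) : S.coef α (S'.p [ρ]) = a := by
  have h1 := S.coef_J_two hL.border hL.mem
  rw [map_sub, map_smul, S.coef_self hL.border, sub_eq_zero] at h1
  rw [h1, smul_eq_mul, mul_one]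

/-- The trace of squares distinguishes a disc with odd weight and non-zero border value from one
with border value zero. -/
theorem Compatible.border_eq_zero_of_disc [IsAlgClosed K] [CharP K 2] (hC : Compatible S S' σ)
    (hα : Q.f α = α) (h3 : w.len α = 3) (ht : ¬ Even (w.len (Q.f (Q.bar α)))) {μ : E'}
    (hμ : Q'.f μ = μ) (hμ3 : w'.len μ = 3) (hβ : β' μ = 0) {r : ℕ} (hr : 1 ≤ r)
    (ht' : w'.len (Q'.f (Q'.bar μ)) = 2 * r + 1)
    (hcoef : ∀ s : K, s ≠ 0 → S.coef α (s • S'.p [μ] +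
      S'.p (Q'.gWord (Q'.f (Q'.bar μ)) r)) ≠ 0) : β α = 0 := by
  obtain ⟨s, hs, h⟩ := S'.exists_trace_mul_self_of_disc hμ hμ3 hβ ht' S.τ_comm
  have hJ : s • S'.p [μ] + S'.p (Q'.gWord (Q'.f (Q'.bar μ)) r) ∈ S.J 1 := by
    rw [hC.J_one]
    exact add_mem (Submodule.smul_mem _ _ (S'.p_mem_J (by simp)))
      (S'.p_mem_J (by rw [gWord_length]; exact hr))
  rw [S.τ_mul_self_of_disc hα h3 ht hJ] at h
  have h1 := (mul_eq_zero.1 h).resolve_left (pow_ne_zero 2 (hcoef s hs))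
  exact (div_eq_zero_iff.1 h1).resolve_right (c.c_ne α)

theorem pow_leading (S : TraceModel w c β A) {x : A} {r : K} {b : E}
    (hx : x - r • S.p [b] ∈ S.J 2) (k : ℕ) :
    x ^ (k + 1) - r ^ (k + 1) • S.p (List.replicate (k + 1) b) ∈ S.J (k + 2) := by
  induction k with
  | zero => simpa using hx
  | succ k ih =>
    have h1 := S.mul_leading (l := List.replicate (k + 1) b) (l' := [b]) (k := k + 1 + 2)
      (by simpa using ih) hx (by simp)
    rwa [← List.replicate_succ', ← pow_succ, ← pow_succ] at h1

theorem p_gWord_of_g_eq (S : TraceModel w c β A) {x : E} (hg : Q.g x = x) (k : ℕ) :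
    S.p (Q.gWord x k) = S.p [x] ^ k := by
  induction k with
  | zero => rw [gWord_zero, p_nil, pow_zero]
  | succ k ih => rw [gWord_succ', p_append, ih, Function.iterate_fixed hg, pow_succ]

theorem traceWord_gWord_len {x : E} (h : 3 ≤ w.len x) :
    traceWord w c β (Q.gWord x (w.len x)) = (c.c x)⁻¹ := by
  have h1 := traceWord_gWord (c := c) (β := β) h
  obtain ⟨k, hk⟩ : ∃ k, w.len x = k + 1 := ⟨w.len x - 1, by omega⟩
  rw [← w.g_iterate_len_sub_one x, hk, Nat.add_sub_cancel, ← gWord_succ'] at h1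
  rwa [hk]

/-- The second presentation is also a disc, with border loop `μ` and inner loop `ρ` interchanged
with respect to the first. This forces `len ρ = 3`, so the test element is `s μ + ρ`, whose
`α`-coefficient is that of `ρ`. -/
theorem Compatible.border_eq_zero_of_g_eq [IsAlgClosed K] [CharP K 2] (hC : Compatible S S' σ)
    (hL : LoopPair S S' α ρ a) (hρ : Q'.src ρ = σ (Q.src α)) (hg : Q'.g ρ = ρ)
    (hβ : ∀ μ, β' μ = 0) (ht : ¬ Even (w.len (Q.f (Q.bar α)))) : β α = 0 := by
  have hα := hL.border
  have h3 := hL.len_eq_three hg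
  have hbρ := bar_eq_f_of_g_eq hg
  have tf := tgt_f_of_g_eq hg
  -- the other loop of the second quiver is a border loop
  set μ := Q'.g (Q'.f ρ) with hμdef
  have hbμ : Q'.bar μ = Q'.f (Q'.f ρ) := Q'.bar_g _
  have hsμ : Q'.src μ = Q'.tgt (Q'.f ρ) := Q'.src_g _
  have hbij : ∀ v : V', v = Q'.src ρ ∨ v = Q'.tgt (Q'.f ρ) := by
    intro v
    have h1 : ∀ u : V', u = σ (Q.src α) ∨ u = σ (Q.tgt (Q.bar α)) := by
      intro u
      rcases vertex_of_disc hα h3 (σ.symm u) with h | h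
      · left; rw [← h, Equiv.apply_symm_apply]
      · right; rw [← h, Equiv.apply_symm_apply]
    rcases h1 v with h | h
    · left; rw [h, hρ]
    · right
      rcases h1 (Q'.tgt (Q'.f ρ)) with h' | h'
      · rw [← hρ] at h'; exact absurd h' tf
      · rw [h, h']
  have htμ : Q'.tgt μ = Q'.src μ := by
    rw [hsμ]
    refine (hbij _).resolve_left fun h => ?_
    have h1 : Q'.tgt μ = Q'.tgt ρ := by rw [h, ← Q'.src_g, hg]
    rcases Q'.in_cases h1 with h2 | h2
    · apply tf
      rw [← hsμ, h2]
    · have h3 : Q'.g (Q'.f (Q'.f ρ)) = Q'.f ρ := by rw [Q'.g_f_f, hbρ]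
      rw [← h3] at h2
      have h4 := Q'.g_injective h2
      exact Q'.bar_ne μ (hbμ.trans h4.symm)
  have hfμ : Q'.f μ = μ := by
    refine (Q'.loop_cases htμ).resolve_right fun h => ?_
    have h1 := bar_eq_f_of_g_eq h
    rw [hbμ] at h1
    have h2 := Q'.f.injective h1
    apply tf
    have h4 : Q'.src (Q'.f ρ) = Q'.src μ := by rw [h2]
    rw [← hbρ, Q'.src_bar, hsμ] at h4
    exact h4.symm
  have hfbμ : Q'.f (Q'.bar μ) = ρ := by rw [hbμ, Q'.f_f_f]
  have hσ : Q'.src μ = σ (Q.tgt (Q.bar α)) := by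
    rcases vertex_of_disc hα h3 (σ.symm (Q'.src μ)) with h | h
    · exfalso; apply tf
      rw [← hsμ, hρ, ← h, Equiv.apply_symm_apply]
    · rw [← h, Equiv.apply_symm_apply]
  have hμ3 : w'.len μ = 3 := by
    obtain ⟨a', hL'⟩ := hC.symm.exists_loopPair_of_loop hfμ (ρ := Q.f (Q.bar α))
      (by rw [hσ, Equiv.symm_apply_apply, Q.src_f]) (by rw [tgt_f_bar_of_disc hα h3, Q.src_f])
    exact hL'.len_eq_three (g_f_bar_of_disc hα h3)
  have hk3 : 3 ≤ w'.len ρ := by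
    have := three_le_len_f_bar_of_disc hfμ hμ3
    rwa [hfbμ] at this
  -- The leading term of `ρ ^ k` is a multiple of `α ^ k`, which vanishes for `k ≥ 4`; but for `k =
  -- len ρ` the second trace form is non-zero on `ρ ^ k` and zero on longer paths.
  have hk : w'.len ρ = 3 := by
    by_contra hne
    have h4 : 4 ≤ w'.len ρ := by omega
    obtain ⟨k, hk⟩ : ∃ k, w'.len ρ = k + 4 := ⟨w'.len ρ - 4, by omega⟩
    have h1 := S.pow_leading hL.mem (k + 3)
    have h2 : S.p (List.replicate (k + 3 + 1) α) = 0 := by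
      have h5 : S.p (List.replicate (k + 3 + 1) α) =
          S.p [α, α] * S.p (α :: α :: List.replicate k α) := by
        rw [← p_append]; rfl
      rw [h5, S.p_border_border_mul hα (S.p_mem_J (by simp))]
    rw [h2, smul_zero, sub_zero, ← S'.p_gWord_of_g_eq hg, hC.J (by omega)] at h1
    have h5 : S'.τ (S'.p (Q'.gWord ρ (k + 3 + 1)) * S'.p []) = 0 := by
      refine S'.τ_mul_p_eq_zero (fun l hl => ?_) h1
      rw [List.append_nil, traceWord_of_five_le _ _ _ (by omega)]
      rcases l with _ | ⟨x, l⟩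
      · rfl
      · refine orbitTerm_eq_zero (k := []) w' c' ?_
        rw [List.nil_append]
        rcases len_of_disc hfμ hμ3 x with h6 | h6
        · omega
        · have h7 : w'.len x = k + 4 := by rw [h6, hfbμ, hk]
          omega
    rw [p_nil, mul_one, τ_p, show k + 3 + 1 = w'.len ρ by omega, traceWord_gWord_len hk3] at h5
    exact inv_ne_zero (c'.c_ne _) h5
  refine hC.border_eq_zero_of_disc hα h3 ht hfμ hμ3 (hβ μ) (r := 1) le_rfl
    (by rw [hfbμ, hk]) fun s _ => ?_
  rw [hfbμ, map_add, map_smul, hC.coef_eq_zero hα, smul_zero, zero_add, gWord_one, hL.coef]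
  · exact hL.ne
  · rw [hσ]
    intro h
    exact tgt_bar_of_border hα (σ.injective h)

/-- The path `η γ β η` is a multiple of `η ^ (t + 1)` through `γ β`, and zero through `η γ` and `β
η`, which produce the factor `α² β`. -/
theorem p_f_bar_pow_of_disc (S : TraceModel w c β A) (hα : Q.f α = α) (h3 : w.len α = 3) :
    S.p [Q.f (Q.bar α)] ^ (w.len (Q.f (Q.bar α)) + 1) = 0 := by
  have ht := three_le_len_f_bar_of_disc hα h3
  set η := Q.f (Q.bar α) with hη
  have hb := w.len_bar_of_border hα
  have hg := g_f_bar_of_disc hα h3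
  have hfγ := f_g_bar_of_disc hα h3
  have h4 : Q.f (Q.g (Q.bar α)) ≠ Q.g (Q.bar α) := by
    rw [hfγ]
    intro h
    apply tgt_bar_of_border hα
    have h5 := congrArg Q.tgt h
    rwa [tgt_g_bar_of_disc hα h3] at h5
  have e1 : S.p [Q.g (Q.bar α), Q.bar α] = c.c η • S.p [η] ^ (w.len η - 1) := by
    have h5 := S.p_triangle h4
    rwa [hfγ, bar_g, S.p_gWord_of_g_eq hg] at h5
  have hη1 : Q.f η = Q.g (Q.bar α) := f_f_bar_of_disc hα h3
  have e2 : S.p [η, Q.g (Q.bar α)] = c.c (Q.g (Q.bar α)) • S.p [Q.g (Q.bar α), α] := by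
    have h5 : Q.f η ≠ η := by rw [hη1]; exact Q.g_ne_f _
    have h6 : Q.bar η = Q.g (Q.bar α) := rfl
    have h7 := S.p_triangle_of_len_three h5 (by rw [h6, w.len_g]; omega)
    rwa [hη1, h6, g_g_bar_of_disc hα h3] at h7
  have e3 : S.p [Q.bar α, η] = c.c α • S.p [α, Q.bar α] := by
    have h7 := S.p_triangle_of_len_three (f_bar_of_border hα) (by rw [Q.bar_bar, h3])
    rwa [Q.bar_bar, g_of_border hα] at h7
  have e4 : S.p [η, Q.g (Q.bar α), Q.bar α, η] = 0 := by
    have h5 : S.p [η, Q.g (Q.bar α), Q.bar α, η] =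
        S.p [η, Q.g (Q.bar α)] * S.p [Q.bar α, η] := by rw [← p_append]; rfl
    have h6 : S.p [Q.g (Q.bar α), α] * S.p [α, Q.bar α] =
        S.p [Q.g (Q.bar α)] * S.p [α, α, Q.bar α] := by rw [← p_append, ← p_append]; rfl
    rw [h5, e2, e3, smul_mul_assoc, mul_smul_comm, h6, S.p_border_border_bar hα, mul_zero,
      smul_zero, smul_zero]
  have e5 : S.p [η, Q.g (Q.bar α), Q.bar α, η] =
      c.c η • S.p [η] ^ (w.len η + 1) := by
    have h5 : S.p [η, Q.g (Q.bar α), Q.bar α, η] =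
        S.p [η] * S.p [Q.g (Q.bar α), Q.bar α] * S.p [η] := by
      rw [← p_append, ← p_append]; rfl
    rw [h5, e1, mul_smul_comm, smul_mul_assoc, ← pow_succ', ← pow_succ]
    congr 2
    omega
  rw [e5] at e4
  exact (smul_eq_zero.1 e4).resolve_left (c.c_ne _)

/-- The two loops of a disc correspond to each other in two presentations by discs. -/
theorem Compatible.len_f_bar_le_of_disc (hC : Compatible S S' σ) (hα : Q.f α = α)
    (h3 : w.len α = 3) (hρ : Q'.f ρ = ρ) (hρ3 : w'.len ρ = 3) (hs : Q'.src ρ = σ (Q.src α)) :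
    w.len (Q.f (Q.bar α)) ≤ w'.len (Q'.f (Q'.bar ρ)) := by
  have ht := three_le_len_f_bar_of_disc hα h3
  have hg := g_f_bar_of_disc hα h3
  have hg' := g_f_bar_of_disc hρ hρ3
  have hb := w.len_bar_of_border hα
  set η := Q.f (Q.bar α) with hη
  set η' := Q'.f (Q'.bar ρ) with hη'
  have hbη : Q.bar η = Q.g (Q.bar α) := rfl
  have htη : Q.tgt η = Q.src η := by rw [hη, tgt_f_bar_of_disc hα h3, Q.src_f]
  have htη' : Q'.tgt η' = Q'.src η' := by rw [hη', tgt_f_bar_of_disc hρ hρ3, Q'.src_f]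
  have hsη' : Q'.src η' ≠ Q'.src ρ := by rw [hη', Q'.src_f]; exact tgt_bar_of_border hρ
  have hv : S'.e (Q'.src η') = S.e (Q.src η) := by
    rcases vertex_of_disc hα h3 (σ.symm (Q'.src η')) with h | h
    · exfalso; apply hsη'
      rw [hs, ← h, Equiv.apply_symm_apply]
    · rw [hη, Q.src_f, ← h, ← hC.e, Equiv.apply_symm_apply]
  have hbt : Q.tgt (Q.bar η) ≠ Q.tgt η := by
    rw [htη, hη, Q.src_f, ← hη, hbη, tgt_g_bar_of_disc hα h3]
    exact (tgt_bar_of_border hα).symm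
  have hbt' : Q'.tgt (Q'.bar η') ≠ Q'.tgt η' := by
    rw [htη', hη', Q'.src_f]
    change Q'.tgt (Q'.g (Q'.bar ρ)) ≠ _
    rw [tgt_g_bar_of_disc hρ hρ3]
    exact (tgt_bar_of_border hρ).symm
  obtain ⟨r, j, hj, hr⟩ := S'.exists_leading' (a := η') hbt' (y := S.p [η])
    (by rw [← hC.J_one]; exact S.p_mem_J (by simp)) (by rw [hv, S.e_mul_x])
    (by rw [htη', hv, ← htη, S.x_mul_e])
  -- If `len η' < len η`, the leading term `η' ^ len η` vanishes. So `η ^ len η` lies in a higher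
  -- power of `J`, against the non-zero trace of `B_η`.
  have h1 := S'.pow_leading (x := S.p [η]) (r := r) (b := η')
    (by rw [hr, add_sub_cancel_left]; exact hj) (w.len η - 1)
  rw [show w.len η - 1 + 1 = w.len η by omega, show w.len η - 1 + 2 = w.len η + 1 by omega] at h1
  by_contra hlt
  obtain ⟨k, hk⟩ : ∃ k, w.len η = (w'.len η' + 1) + k := ⟨w.len η - (w'.len η' + 1), by omega⟩
  have h2 : S'.p (List.replicate (w.len η) η') = 0 := by
    have h5 : ∀ m, S'.p (List.replicate m η') = S'.p [η'] ^ m := by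
      intro m
      induction m with
      | zero => rw [List.replicate_zero, p_nil, pow_zero]
      | succ m ih => rw [List.replicate_succ, p_cons, ih, pow_succ']
    rw [h5, hk, pow_add, S'.p_f_bar_pow_of_disc hρ hρ3, zero_mul]
  rw [h2, smul_zero, sub_zero, ← S.p_gWord_of_g_eq hg, ← hC.J (by omega)] at h1
  have h5 : S.τ (S.p (Q.gWord η (w.len η)) * S.p []) = 0 := by
    refine S.τ_mul_p_eq_zero (fun l hl => ?_) h1
    rw [List.append_nil]
    have hall : ∀ x, w.len x = 3 ∨ w.len x = w.len η := fun x => by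
      rcases len_of_disc hα h3 x with h | h
      · exact .inl h
      · exact .inr (by rw [h])
    rw [traceWord_of_four_le _ _ _ (by omega) (fun x hx => by rcases hall x with h | h <;> omega)]
    rcases l with _ | ⟨x, l⟩
    · rfl
    · refine orbitTerm_eq_zero (k := []) w c ?_
      rw [List.nil_append]
      rcases hall x with h | h <;> omega
  rw [p_nil, mul_one, τ_p, traceWord_gWord_len ht] at h5
  exact inv_ne_zero (c.c_ne _) h5

/-- Both inner loops have the same weight, hence the same odd one. The inner loop starts at the
other vertex, so the test element has `α`-coefficient `s a ≠ 0`. -/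
theorem Compatible.border_eq_zero_of_disc_disc [IsAlgClosed K] [CharP K 2]
    (hC : Compatible S S' σ) (hL : LoopPair S S' α ρ a) (hs : Q'.src ρ = σ (Q.src α))
    (hρ : Q'.f ρ = ρ) (h3 : w.len α = 3) (hβ : β' ρ = 0)
    (ht : ¬ Even (w.len (Q.f (Q.bar α)))) : β α = 0 := by
  have hα := hL.border
  have hρ3 : w'.len ρ = 3 := by rw [hL.len_eq hρ, h3]
  have h1 := hC.len_f_bar_le_of_disc hα h3 hρ hρ3 hs
  have h2 := hC.symm.len_f_bar_le_of_disc hρ hρ3 hα h3 (by rw [hs, Equiv.symm_apply_apply])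
  have h4 := three_le_len_f_bar_of_disc hα h3
  obtain ⟨r, hr⟩ := Nat.not_even_iff_odd.1 ht
  refine hC.border_eq_zero_of_disc hα h3 ht hρ hρ3 hβ (r := r) (by omega) (by omega) fun s h => ?_
  rw [map_add, map_smul, hL.coef, gWord_eq_cons _ (by omega), hC.coef_eq_zero hα, add_zero]
  · exact mul_ne_zero h hL.ne
  · rw [← hs, Q'.src_f]
    exact tgt_bar_of_border hρ

/-- A border loop with non-zero border value in one presentation of an algebra, if all border values
vanish in another presentation. -/
theorem Compatible.disc_of_border_ne_zero [IsAlgClosed K] [CharP K 2] (hC : Compatible S S' σ)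
    (hα : Q.f α = α) (hβ : β α ≠ 0) (hβ' : ∀ ρ, β' ρ = 0) :
    w.len α = 3 ∧ Even (w.len (Q.f (Q.bar α))) := by
  obtain ⟨ρ, a, hL, hs⟩ := hC.exists_loopPair hα
  rcases Q'.loop_cases hL.loop with hρ | hg
  · have h3 : w.len α = 3 := by
      by_contra hne
      have := w.three_le_len_of_border hα
      exact hβ (hC.border_eq_zero hL hρ (hβ' ρ) (by omega))
    refine ⟨h3, ?_⟩
    by_contra ht
    exact hβ (hC.border_eq_zero_of_disc_disc hL hs hρ h3 (hβ' ρ) ht)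
  · refine ⟨hL.len_eq_three hg, ?_⟩
    by_contra ht
    exact hβ (hC.border_eq_zero_of_g_eq hL hs hg hβ' ht)

end TraceModel

end TriangulationQuiver

/-- Elements of an algebra that satisfy the defining relations of the socle deformed weighted
surface algebra of a disc, with vertices `e₀` and `e₁`, loops `a` at `e₀` and `h` at `e₁`, and arrows
`b`, `g` between them. -/
structure IsDiscRep {K B : Type*} [Field K] [Ring B] [Algebra K B] (t : ℕ) (c d r : K)
    (e₀ e₁ a b g h : B) : Prop where
  e₀_e₀ : e₀ * e₀ = e₀
  e₁_e₁ : e₁ * e₁ = e₁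
  e₀_e₁ : e₀ * e₁ = 0
  e₁_e₀ : e₁ * e₀ = 0
  sum : e₀ + e₁ = 1
  e_a : e₀ * a = a
  a_e : a * e₀ = a
  e_b : e₀ * b = b
  b_e : b * e₁ = b
  e_g : e₁ * g = g
  g_e : g * e₀ = g
  e_h : e₁ * h = h
  h_e : h * e₁ = h
  b_h : b * h = c • (a * b)
  h_g : h * g = c • (g * a)
  g_b : g * b = d • h ^ (t - 1)
  a_a : a * a = c • (b * g) + r • (b * g * a)
  a_a_b : a * a * b = 0
  g_a_a : g * a * a = 0
  b_g_b : b * g * b = 0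
  g_b_g : g * b * g = 0

/-! ### Rescaling and deforming the relations of a disc -/

namespace IsDiscRep

variable {K B : Type*} [Field K] [Ring B] [Algebra K B] {t : ℕ} {c d r : K}
variable {e₀ e₁ a b g h : B}

/-- Rescaling of the arrows. -/
theorem smul (H : IsDiscRep t c d r e₀ e₁ a b g h) {s u v q c' d' r' : K}
    (h1 : c' * s = q * c) (h2 : u * v * d = d' * q ^ (t - 1)) (h3 : s ^ 2 * c = c' * (u * v))
    (h4 : s ^ 2 * r = r' * (u * v * s)) :
    IsDiscRep t c' d' r' e₀ e₁ (s • a) (u • b) (v • g) (q • h) where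
  e₀_e₀ := H.e₀_e₀
  e₁_e₁ := H.e₁_e₁
  e₀_e₁ := H.e₀_e₁
  e₁_e₀ := H.e₁_e₀
  sum := H.sum
  e_a := by rw [mul_smul_comm, H.e_a]
  a_e := by rw [smul_mul_assoc, H.a_e]
  e_b := by rw [mul_smul_comm, H.e_b]
  b_e := by rw [smul_mul_assoc, H.b_e]
  e_g := by rw [mul_smul_comm, H.e_g]
  g_e := by rw [smul_mul_assoc, H.g_e]
  e_h := by rw [mul_smul_comm, H.e_h]
  h_e := by rw [smul_mul_assoc, H.h_e]
  b_h := by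
    simp only [smul_mul_assoc, mul_smul_comm, H.b_h, smul_smul]
    congr 1; linear_combination -u * h1
  h_g := by
    simp only [smul_mul_assoc, mul_smul_comm, H.h_g, smul_smul]
    congr 1; linear_combination -v * h1
  g_b := by
    simp only [smul_mul_assoc, mul_smul_comm, H.g_b, smul_smul, smul_pow]
    congr 1; linear_combination h2
  a_a := by
    simp only [smul_mul_assoc, mul_smul_comm, H.a_a, smul_smul, smul_add]
    congr 2
    · linear_combination h3
    · linear_combination h4
  a_a_b := by simp only [smul_mul_assoc, mul_smul_comm, H.a_a_b, smul_zero]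
  g_a_a := by simp only [smul_mul_assoc, mul_smul_comm, H.g_a_a, smul_zero]
  b_g_b := by simp only [smul_mul_assoc, mul_smul_comm, H.b_g_b, smul_zero]
  g_b_g := by simp only [smul_mul_assoc, mul_smul_comm, H.g_b_g, smul_zero]

theorem b_h_h (H : IsDiscRep t c d r e₀ e₁ a b g h) : b * h * h = 0 := by
  rw [H.b_h, smul_mul_assoc, mul_assoc, H.b_h, mul_smul_comm, ← mul_assoc, H.a_a_b, smul_zero,
    smul_zero]

theorem h_h_g (H : IsDiscRep t c d r e₀ e₁ a b g h) : h * h * g = 0 := by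
  rw [mul_assoc, H.h_g, mul_smul_comm, ← mul_assoc, H.h_g, smul_mul_assoc, H.g_a_a, smul_zero,
    smul_zero]

theorem a_b_h (H : IsDiscRep t c d r e₀ e₁ a b g h) : a * b * h = 0 := by
  rw [mul_assoc, H.b_h, mul_smul_comm, ← mul_assoc, H.a_a_b, smul_zero]

theorem h_g_a (H : IsDiscRep t c d r e₀ e₁ a b g h) : h * g * a = 0 := by
  rw [H.h_g, smul_mul_assoc, H.g_a_a, smul_zero]

/-- Evaluate `h g b h` through `g b`, and through `h g` and `b h`. -/
theorem h_pow (H : IsDiscRep t c d r e₀ e₁ a b g h) (hd : d ≠ 0) (ht : 1 ≤ t) :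
    h ^ (t + 1) = 0 := by
  have h1 : h * (g * b) * h = d • h ^ (t + 1) := by
    rw [H.g_b, mul_smul_comm, smul_mul_assoc, ← pow_succ', ← pow_succ,
      show t - 1 + 1 + 1 = t + 1 by omega]
  have h2 : h * (g * b) * h = 0 := by
    rw [← mul_assoc, H.h_g, smul_mul_assoc, smul_mul_assoc, mul_assoc, H.b_h, mul_smul_comm,
      mul_assoc, ← mul_assoc a a b, H.a_a_b, mul_zero, smul_zero, smul_zero]
  rw [h2] at h1
  exact (smul_eq_zero.1 h1.symm).resolve_left hd

/-- A change of the arrows `b` and `h` that changes the parameter `r`. -/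
theorem deform (H : IsDiscRep t 1 1 r e₀ e₁ a b g h) (ht : 3 ≤ t) {s : K} {y : B}
    (he : e₁ * y = y) (he' : y * e₁ = y) (h1 : b * y = b * h) (h2 : b * h * y = 0)
    (h3 : y * g = h * g) (h4 : y ^ (t - 1) = h ^ (t - 1) + s • h ^ t) :
    IsDiscRep t 1 1 (r - s) e₀ e₁ a (b + s • (b * h)) g y where
  e₀_e₀ := H.e₀_e₀
  e₁_e₁ := H.e₁_e₁
  e₀_e₁ := H.e₀_e₁
  e₁_e₀ := H.e₁_e₀
  sum := H.sum
  e_a := H.e_a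
  a_e := H.a_e
  e_b := by rw [mul_add, mul_smul_comm, ← mul_assoc, H.e_b]
  b_e := by rw [add_mul, smul_mul_assoc, mul_assoc, H.h_e, H.b_e]
  e_g := H.e_g
  g_e := H.g_e
  e_h := he
  h_e := he'
  b_h := by
    rw [add_mul, smul_mul_assoc, h2, h1, mul_add, mul_smul_comm, ← mul_assoc, H.a_b_h, H.b_h]
    simp
  h_g := by rw [h3, H.h_g]
  g_b := by
    rw [mul_add, mul_smul_comm, ← mul_assoc, H.g_b, h4, one_smul, one_smul, ← pow_succ,
      show t - 1 + 1 = t by omega]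
  a_a := by
    -- Hence `(b + s b h) g = b g + s b g a`: the new `b` absorbs `s` from the coefficient of `b g
    -- a` in `a²`.
    have h5 : b * h * g = b * g * a := by rw [mul_assoc, H.h_g, one_smul, mul_assoc]
    have h6 : b * g * a * a = 0 := by rw [mul_assoc b, mul_assoc b, H.g_a_a, mul_zero]
    rw [add_mul, smul_mul_assoc, h5, H.a_a, add_mul, smul_mul_assoc, h6]
    module
  a_a_b := by rw [mul_add, mul_smul_comm, ← mul_assoc, H.a_a_b]; simp
  g_a_a := H.g_a_a
  b_g_b := by
    have h5 : b * h * g * b = 0 := by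
      rw [mul_assoc, H.g_b, one_smul, show t - 1 = (t - 3) + 1 + 1 by omega, pow_succ', ← mul_assoc,
        H.b_h_h, zero_mul]
    simp only [add_mul, mul_add, mul_smul_comm, smul_mul_assoc, ← mul_assoc, H.b_g_b, h5, zero_mul,
      smul_zero, add_zero]
  g_b_g := by
    have h5 : g * b * h * g = 0 := by
      rw [H.g_b, one_smul, ← pow_succ, show t - 1 + 1 = (t - 2) + 2 by omega, pow_add, pow_two,
        mul_assoc, H.h_h_g, mul_zero]
    rw [mul_add, mul_smul_comm, add_mul, H.g_b_g, smul_mul_assoc, ← mul_assoc, h5]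
    simp

end IsDiscRep

/-! ### The substitution `x ↦ x + s x²` in characteristic two -/

section Substitution

open Polynomial

variable {K B : Type*} [Field K] [CharP K 2] [Ring B] [Algebra K B]

theorem pow_mul_one_add_smul_pow {t : ℕ} {x : B} (hx : x ^ (t + 1) = 0) (s : K) {m : ℕ}
    (hm : t ≤ m + 1) (n : ℕ) :
    x ^ m * (1 + s • x) ^ n = x ^ m + ((n : K) * s) • x ^ (m + 1) := by
  have h0 : x ^ (m + 1) * x = 0 := by
    rw [← pow_succ, show m + 1 + 1 = (t + 1) + (m + 1 - t) by omega, pow_add, hx, zero_mul]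
  induction n with
  | zero => simp
  | succ n ih =>
    rw [pow_succ, ← mul_assoc, ih, add_mul, mul_add, smul_mul_assoc, mul_add, mul_smul_comm,
      mul_smul_comm, h0, mul_one, mul_one, ← pow_succ]
    push_cast
    module

theorem add_smul_sq_pow (s : K) (x : B) (n : ℕ) :
    (x + s • x ^ 2) ^ n = x ^ n * (1 + s • x) ^ n := by
  have h : x + s • x ^ 2 = x * (1 + s • x) := by rw [mul_add, mul_smul_comm, mul_one, pow_two]
  rw [h]
  refine Commute.mul_pow ?_ n
  exact (Commute.one_right x).add_right ((Commute.refl x).smul_right s)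

/-- For even `t` and characteristic two, the powers of `x + s x²`, where `x ^ (t + 1) = 0`. -/
theorem add_smul_sq_pow_sub_one {t : ℕ} (ht : Even t) (ht0 : 1 ≤ t) {x : B}
    (hx : x ^ (t + 1) = 0) (s : K) : (x + s • x ^ 2) ^ (t - 1) = x ^ (t - 1) + s • x ^ t := by
  rw [add_smul_sq_pow, pow_mul_one_add_smul_pow hx s (by omega), show t - 1 + 1 = t by omega]
  have h1 : ((t - 1 : ℕ) : K) = 1 := by
    obtain ⟨k, hk⟩ := ht
    rw [show t - 1 = 2 * (k - 1) + 1 by omega]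
    push_cast
    rw [CharTwo.two_eq_zero]; ring
  rw [h1, one_mul]

theorem add_smul_sq_pow_self {t : ℕ} {x : B} (hx : x ^ (t + 1) = 0) (s : K) :
    (x + s • x ^ 2) ^ t = x ^ t := by
  rw [add_smul_sq_pow, pow_mul_one_add_smul_pow hx s (by omega), hx, smul_zero, add_zero]

/-- An approximate inverse of the polynomial `X + s X²` in characteristic two. -/
noncomputable def invPoly (s : K) (n : ℕ) : K[X] :=
  ∑ k ∈ Finset.range n, C (s ^ (2 ^ k - 1)) * X ^ 2 ^ k

/-- Squaring is additive, and `s` times the square of the `k`-th summand is the next summand, so the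
sum telescopes. -/
theorem invPoly_add_sq (s : K) (n : ℕ) : invPoly s n + C s * invPoly s n ^ 2 =
    X + C (s ^ (2 ^ n - 1)) * X ^ 2 ^ n := by
  induction n with
  | zero =>
    have : (X : K[X]) + X = 0 := CharTwo.add_self_eq_zero X
    simp [invPoly, this]
  | succ n ih =>
    have h1 : invPoly s (n + 1) = invPoly s n + C (s ^ (2 ^ n - 1)) * X ^ 2 ^ n := by
      rw [invPoly, Finset.sum_range_succ]; rfl
    have h2 : C s * (C (s ^ (2 ^ n - 1)) * X ^ 2 ^ n) ^ 2 =
        C (s ^ (2 ^ (n + 1) - 1)) * X ^ 2 ^ (n + 1) := by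
      have h3 : 1 ≤ 2 ^ n := Nat.one_le_two_pow
      rw [mul_pow, ← C_pow, ← mul_assoc, ← C_mul, ← pow_mul, ← pow_mul, ← pow_succ',
        show (2 ^ n - 1) * 2 + 1 = 2 ^ (n + 1) - 1 by rw [pow_succ]; omega, ← pow_succ]
    have h3 := CharTwo.add_self_eq_zero (C (s ^ (2 ^ n - 1)) * X ^ 2 ^ n : K[X])
    rw [h1, CharTwo.add_sq, mul_add, h2]
    linear_combination ih + h3

/-- The same telescoping on the other side; together they show that the substitutions are mutually
inverse on nilpotent elements once `2 ^ n` exceeds the order of nilpotency. -/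
theorem invPoly_comp (s : K) (n : ℕ) : (invPoly s n).comp (X + C s * X ^ 2) =
    X + C (s ^ (2 ^ n - 1)) * X ^ 2 ^ n := by
  induction n with
  | zero =>
    have : (X : K[X]) + X = 0 := CharTwo.add_self_eq_zero X
    simp [invPoly, this]
  | succ n ih =>
    have h1 : invPoly s (n + 1) = invPoly s n + C (s ^ (2 ^ n - 1)) * X ^ 2 ^ n := by
      rw [invPoly, Finset.sum_range_succ]; rfl
    have h2 : (X + C s * X ^ 2 : K[X]) ^ 2 ^ n = X ^ 2 ^ n + C (s ^ 2 ^ n) * X ^ 2 ^ (n + 1) := by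
      rw [add_pow_char_pow, mul_pow, ← C_pow, ← pow_mul, pow_succ' 2 n]
    have h3 := CharTwo.add_self_eq_zero (C (s ^ (2 ^ n - 1)) * X ^ 2 ^ n : K[X])
    have h4 : C (s ^ (2 ^ n - 1)) * (C (s ^ 2 ^ n) * X ^ 2 ^ (n + 1)) =
        C (s ^ (2 ^ (n + 1) - 1)) * X ^ 2 ^ (n + 1) := by
      have h3 : 1 ≤ 2 ^ n := Nat.one_le_two_pow
      rw [← mul_assoc, ← C_mul, ← pow_add,
        show 2 ^ n - 1 + 2 ^ n = 2 ^ (n + 1) - 1 by rw [pow_succ]; omega]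
    rw [h1, add_comp, ih, mul_comp, C_comp, X_pow_comp, h2, mul_add, h4]
    linear_combination h3

theorem invPoly_eq_X_mul (s : K) (n : ℕ) : ∃ q : K[X], invPoly s n = X * q := by
  have h : X ∣ invPoly s n := by
    refine Finset.dvd_sum fun k _ => ?_
    exact Dvd.dvd.mul_left (dvd_pow_self X (by positivity)) _
  exact h

theorem aeval_invPoly_add_sq {t : ℕ} {x : B} (hx : x ^ (t + 1) = 0) (s : K) :
    aeval x (invPoly s (t + 1)) + s • aeval x (invPoly s (t + 1)) ^ 2 = x := by
  have h := congrArg (aeval x) (invPoly_add_sq s (t + 1))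
  have h1 : x ^ 2 ^ (t + 1) = 0 := by
    have h2 : t + 1 < 2 ^ (t + 1) := Nat.lt_two_pow_self
    rw [show 2 ^ (t + 1) = (t + 1) + (2 ^ (t + 1) - (t + 1)) by omega, pow_add, hx, zero_mul]
  simp only [map_add, map_mul, map_pow, aeval_C, aeval_X, h1, mul_zero, add_zero] at h
  rw [Algebra.smul_def]
  exact h

theorem aeval_add_sq_invPoly {t : ℕ} {x : B} (hx : x ^ (t + 1) = 0) (s : K) :
    aeval (x + s • x ^ 2) (invPoly s (t + 1)) = x := by
  have h := congrArg (aeval x) (invPoly_comp s (t + 1))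
  have h1 : x ^ 2 ^ (t + 1) = 0 := by
    have h2 : t + 1 < 2 ^ (t + 1) := Nat.lt_two_pow_self
    rw [show 2 ^ (t + 1) = (t + 1) + (2 ^ (t + 1) - (t + 1)) by omega, pow_add, hx, zero_mul]
  rw [aeval_comp] at h
  simp only [map_add, map_mul, map_pow, aeval_C, aeval_X, h1, mul_zero, add_zero] at h
  rw [Algebra.smul_def]
  exact h

variable {t : ℕ} {r : K} {e₀ e₁ a b g h : B}

/-- For even `t` the exponent `t - 1` is odd, so `(h + s h²) ^ (t - 1)` gains exactly `s h ^ t`, the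
term that `deform` needs. -/
theorem IsDiscRep.deform_sq (H : IsDiscRep t 1 1 r e₀ e₁ a b g h) (ht : Even t) (ht3 : 3 ≤ t)
    (s : K) : IsDiscRep t 1 1 (r - s) e₀ e₁ a (b + s • (b * h)) g (h + s • h ^ 2) := by
  have hb : b * h ^ 2 = 0 := by rw [pow_two, ← mul_assoc, H.b_h_h]
  refine H.deform ht3 ?_ ?_ ?_ ?_ ?_ ?_
  · rw [mul_add, mul_smul_comm, pow_two, ← mul_assoc, H.e_h]
  · rw [add_mul, smul_mul_assoc, pow_two, mul_assoc, H.h_e]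
  · rw [mul_add, mul_smul_comm, hb, smul_zero, add_zero]
  · rw [mul_add, H.b_h_h, mul_smul_comm, pow_two, ← mul_assoc, H.b_h_h, zero_mul, smul_zero,
      add_zero]
  · rw [add_mul, smul_mul_assoc, pow_two, H.h_h_g, smul_zero, add_zero]
  · exact add_smul_sq_pow_sub_one ht (by omega) (H.h_pow one_ne_zero (by omega)) s

theorem IsDiscRep.b_h_invPoly (H : IsDiscRep t 1 1 r e₀ e₁ a b g h) (s : K) (n : ℕ) :
    b * h * aeval h (invPoly s n) = 0 := by
  obtain ⟨q, hq⟩ := invPoly_eq_X_mul s n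
  rw [hq, map_mul, aeval_X, ← mul_assoc, H.b_h_h, zero_mul]

theorem IsDiscRep.b_invPoly (H : IsDiscRep t 1 1 r e₀ e₁ a b g h) (ht3 : 3 ≤ t) (s : K) :
    b * aeval h (invPoly s (t + 1)) = b * h := by
  have hy := aeval_invPoly_add_sq (H.h_pow one_ne_zero (by omega)) s
  obtain ⟨q, hq⟩ := invPoly_eq_X_mul s (t + 1)
  have h1 : b * aeval h (invPoly s (t + 1)) ^ 2 = 0 := by
    have h2 : invPoly s (t + 1) ^ 2 = X * X * (q * q) := by rw [hq]; ring
    rw [← map_pow, h2, map_mul, map_mul, aeval_X, ← mul_assoc, ← mul_assoc, H.b_h_h, zero_mul]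
  conv_rhs => rw [← hy, mul_add, mul_smul_comm, h1, smul_zero, add_zero]

/-- The inverse substitution: here `y + s y² = h`, and `y ^ (t - 1) = h ^ (t - 1) + s h ^ t` because
the sign is irrelevant in characteristic two. -/
theorem IsDiscRep.deform_invPoly (H : IsDiscRep t 1 1 r e₀ e₁ a b g h) (ht : Even t)
    (ht3 : 3 ≤ t) (s : K) : IsDiscRep t 1 1 (r - s) e₀ e₁ a (b + s • (b * h)) g
      (aeval h (invPoly s (t + 1))) := by
  have hpow := H.h_pow one_ne_zero (by omega)
  obtain ⟨q, hq⟩ := invPoly_eq_X_mul s (t + 1)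
  have hy := aeval_invPoly_add_sq hpow s
  set y := aeval h (invPoly s (t + 1)) with hydef
  have hy1 : y = h * aeval h q := by rw [hydef, hq, map_mul, aeval_X]
  have hy2 : y = aeval h q * h := by rw [hydef, hq, mul_comm, map_mul, aeval_X]
  have hcomm : Commute h (aeval h q) := by rw [Commute, SemiconjBy, ← hy1, hy2]
  have hypow : y ^ (t + 1) = 0 := by rw [hy1, hcomm.mul_pow, hpow, zero_mul]
  have hyg : y ^ 2 * g = 0 := by
    have h1 : y ^ 2 * g = aeval h q * (h * (aeval h q)) * (h * g) := by
      rw [pow_two, hy2]; simp only [mul_assoc]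
    rw [h1, hcomm.eq, mul_assoc, mul_assoc, ← mul_assoc h, H.h_h_g, mul_zero, mul_zero]
  refine H.deform ht3 ?_ ?_ (H.b_invPoly ht3 s) (H.b_h_invPoly s _) ?_ ?_
  · rw [hy1, ← mul_assoc, H.e_h]
  · rw [hy2, mul_assoc, H.h_e]
  · conv_rhs => rw [← hy, add_mul, smul_mul_assoc, hyg, smul_zero, add_zero]
  · have h1 := add_smul_sq_pow_sub_one ht (by omega) hypow s
    have h2 := add_smul_sq_pow_self hypow s
    rw [hy] at h1 h2
    rw [h1, h2, add_assoc, ← add_smul, CharTwo.add_self_eq_zero, zero_smul, add_zero]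

end Substitution

/-! ### The algebras `Q(2B)₃ᵗ(b)` and their universal property -/

namespace TwoBAlgebra

variable (K : Type*) [Field K] (t : ℕ) (r : K)

/-- The idempotents of the vertices. -/
noncomputable def vertex (i : Fin 2) : TwoBAlgebra K t r :=
  RingQuot.mkAlgHom K _ (PathAlgebra.vertex K TwoBArrow.src TwoBArrow.tgt i)

/-- The arrows. -/
noncomputable def arrow (a : TwoBArrow) : TwoBAlgebra K t r :=
  RingQuot.mkAlgHom K _ (TwoBArrow.x K a)

open TwoBArrow in
theorem isDiscRep : IsDiscRep t 1 1 r (vertex K t r 0) (vertex K t r 1) (arrow K t r α)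
    (arrow K t r β) (arrow K t r γ) (arrow K t r η) := by
  have hs : ∀ a : TwoBArrow, vertex K t r a.src * arrow K t r a = arrow K t r a := fun a => by
    rw [vertex, arrow, ← map_mul, TwoBArrow.x, PathAlgebra.vertex_mul_arrow]
  have ht : ∀ a : TwoBArrow, arrow K t r a * vertex K t r a.tgt = arrow K t r a := fun a => by
    rw [vertex, arrow, ← map_mul, TwoBArrow.x, PathAlgebra.arrow_mul_vertex]
  have hv : ∀ i, vertex K t r i * vertex K t r i = vertex K t r i := fun i => by
    rw [vertex, ← map_mul, PathAlgebra.vertex_mul_self]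
  have hvn : ∀ i j, i ≠ j → vertex K t r i * vertex K t r j = 0 := fun i j h => by
    rw [vertex, vertex, ← map_mul, PathAlgebra.vertex_mul_ne h, map_zero]
  have h1 := RingQuot.mkAlgHom_rel K (TwoBRel.r1 (K := K) (t := t) (b := r))
  have h2 := RingQuot.mkAlgHom_rel K (TwoBRel.r2 (K := K) (t := t) (b := r))
  have h3 := RingQuot.mkAlgHom_rel K (TwoBRel.r3 (K := K) (t := t) (b := r))
  have h4 := RingQuot.mkAlgHom_rel K (TwoBRel.r4 (K := K) (t := t) (b := r))
  have h5 := RingQuot.mkAlgHom_rel K (TwoBRel.r5 (K := K) (t := t) (b := r))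
  have h7 := RingQuot.mkAlgHom_rel K (TwoBRel.r7 (K := K) (t := t) (b := r))
  have h8 := RingQuot.mkAlgHom_rel K (TwoBRel.r8 (K := K) (t := t) (b := r))
  simp only [map_mul, map_pow, map_add, map_smul, map_zero] at h1 h2 h3 h4 h5 h7 h8
  change arrow K t r α * arrow K t r β = arrow K t r β * arrow K t r η at h1
  change arrow K t r η * arrow K t r γ = arrow K t r γ * arrow K t r α at h2
  change arrow K t r α ^ 2 = arrow K t r β * arrow K t r γ + r • arrow K t r α ^ 3 at h3
  change arrow K t r γ * arrow K t r β = arrow K t r η ^ (t - 1) at h4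
  change arrow K t r α ^ 4 = 0 at h5
  change arrow K t r γ * arrow K t r α ^ 2 = 0 at h7
  change arrow K t r α ^ 2 * arrow K t r β = 0 at h8
  -- Multiplying `α² = βγ + r α³` by `α` kills the last term, as `α⁴ = 0`. So `r α³` takes the form
  -- `r βγα` of the socle deformation.
  have ha3 : arrow K t r α ^ 3 = arrow K t r β * arrow K t r γ * arrow K t r α := by
    have : arrow K t r α ^ 3 = arrow K t r α ^ 2 * arrow K t r α := pow_succ _ 2
    rw [this, h3, add_mul, smul_mul_assoc, ← pow_succ, h5, smul_zero, add_zero]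
  exact {
    e₀_e₀ := hv 0
    e₁_e₁ := hv 1
    e₀_e₁ := hvn 0 1 (by decide)
    e₁_e₀ := hvn 1 0 (by decide)
    sum := by
      rw [vertex, vertex, ← map_add]
      have := PathAlgebra.sum_vertex (K := K) (src := TwoBArrow.src) (tgt := TwoBArrow.tgt)
      rw [Fin.sum_univ_two] at this
      rw [this, map_one]
    e_a := hs α
    a_e := ht α
    e_b := hs β
    b_e := ht β
    e_g := hs γ
    g_e := ht γ
    e_h := hs η
    h_e := ht η
    b_h := by rw [one_smul, h1]
    h_g := by rw [one_smul, h2]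
    g_b := by rw [one_smul, h4]
    a_a := by rw [one_smul, ← ha3, ← h3, pow_two]
    a_a_b := by rw [← pow_two, h8]
    g_a_a := by rw [mul_assoc, ← pow_two, h7]
    b_g_b := by
      have h9 : arrow K t r α ^ 3 * arrow K t r β = 0 := by
        rw [pow_succ', mul_assoc, h8, mul_zero]
      have h10 := h8
      rw [h3, add_mul, smul_mul_assoc, h9, smul_zero, add_zero] at h10
      exact h10
    g_b_g := by
      have h9 : arrow K t r γ * arrow K t r α ^ 3 = 0 := by
        rw [pow_succ, ← mul_assoc, h7, zero_mul]
      have h10 := h7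
      rw [h3, mul_add, mul_smul_comm, h9, smul_zero, add_zero, ← mul_assoc] at h10
      exact h10 }

variable {K t r} {B : Type*} [Ring B] [Algebra K B] {e₀ e₁ a b g h : B}

open TwoBArrow in
theorem exists_lift (H : IsDiscRep t 1 1 r e₀ e₁ a b g h) (ht : 1 ≤ t) :
    ∃ φ : TwoBAlgebra K t r →ₐ[K] B, φ (vertex K t r 0) = e₀ ∧ φ (vertex K t r 1) = e₁ ∧
      φ (arrow K t r α) = a ∧ φ (arrow K t r β) = b ∧ φ (arrow K t r γ) = g ∧
      φ (arrow K t r η) = h := by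
  let x : TwoBArrow → B := fun y => match y with
    | α => a
    | β => b
    | γ => g
    | η => h
  obtain ⟨φ, hv, ha⟩ := PathAlgebra.exists_lift (K := K) (src := TwoBArrow.src)
    (tgt := TwoBArrow.tgt) (e := ![e₀, e₁]) (x := x)
    (by intro i; fin_cases i; exacts [H.e₀_e₀, H.e₁_e₁])
    (by
      intro i j hij
      fin_cases i <;> fin_cases j
      · exact absurd rfl hij
      · exact H.e₀_e₁
      · exact H.e₁_e₀
      · exact absurd rfl hij)
    (by rw [Fin.sum_univ_two]; exact H.sum)
    (by intro y; cases y; exacts [H.e_a, H.e_b, H.e_g, H.e_h])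
    (by intro y; cases y; exacts [H.a_e, H.b_e, H.g_e, H.h_e])
  have hα : φ (TwoBArrow.x K α) = a := ha α
  have hβ : φ (TwoBArrow.x K β) = b := ha β
  have hγ : φ (TwoBArrow.x K γ) = g := ha γ
  have hη : φ (TwoBArrow.x K η) = h := ha η
  have ha3 : a ^ 3 = b * g * a := by
    have h1 : a ^ 3 = a * a * a := by rw [pow_succ, pow_two]
    have h2 : b * g * a * a = 0 := by rw [mul_assoc b, mul_assoc b, H.g_a_a, mul_zero]
    rw [h1, H.a_a, add_mul, smul_mul_assoc, smul_mul_assoc, h2]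
    simp
  have hr : ∀ ⦃y z⦄, TwoBRel K t r y z → φ y = φ z := by
    rintro y z (_ | _ | _ | _ | _ | _ | _ | _)
    all_goals simp only [map_mul, map_pow, map_add, map_smul, map_zero, hα, hβ, hγ, hη]
    · rw [H.b_h, one_smul]
    · rw [H.h_g, one_smul]
    · rw [pow_two, H.a_a, one_smul, ha3]
    · rw [H.g_b, one_smul]
    · rw [pow_succ, ha3, mul_assoc, mul_assoc, ← mul_assoc g, H.g_a_a, mul_zero]
    · exact H.h_pow one_ne_zero ht
    · rw [pow_two, ← mul_assoc, H.g_a_a]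
    · rw [pow_two, H.a_a_b]
  refine ⟨RingQuot.liftAlgHom K ⟨φ, hr⟩, ?_, ?_, ?_, ?_, ?_, ?_⟩
  · rw [vertex, RingQuot.liftAlgHom_mkAlgHom_apply, hv]; rfl
  · rw [vertex, RingQuot.liftAlgHom_mkAlgHom_apply, hv]; rfl
  · rw [arrow, RingQuot.liftAlgHom_mkAlgHom_apply, hα]
  · rw [arrow, RingQuot.liftAlgHom_mkAlgHom_apply, hβ]
  · rw [arrow, RingQuot.liftAlgHom_mkAlgHom_apply, hγ]
  · rw [arrow, RingQuot.liftAlgHom_mkAlgHom_apply, hη]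

open TwoBArrow in
theorem algHom_ext {B : Type*} [Semiring B] [Algebra K B] {φ ψ : TwoBAlgebra K t r →ₐ[K] B}
    (h0 : φ (vertex K t r 0) = ψ (vertex K t r 0))
    (h1 : φ (vertex K t r 1) = ψ (vertex K t r 1)) (hα : φ (arrow K t r α) = ψ (arrow K t r α))
    (hβ : φ (arrow K t r β) = ψ (arrow K t r β)) (hγ : φ (arrow K t r γ) = ψ (arrow K t r γ))
    (hη : φ (arrow K t r η) = ψ (arrow K t r η)) : φ = ψ := by
  apply RingQuot.ringQuot_ext'
  refine PathAlgebra.algHom_ext (fun i => ?_) fun y => ?_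
  · fin_cases i
    exacts [h0, h1]
  · cases y
    exacts [hα, hβ, hγ, hη]

open TwoBArrow in
/-- In characteristic two the parameter `r` is irrelevant for even `t`. -/
theorem nonempty_algEquiv_zero [CharP K 2] (ht : Even t) (h4 : 4 ≤ t) (r : K) :
    Nonempty (TwoBAlgebra K t r ≃ₐ[K] TwoBAlgebra K t 0) := by
  have H := isDiscRep K t r
  have H0 := isDiscRep K t (0 : K)
  -- Taking `s = r` leads from the parameter `r` to `0`, and from `0` to `-r = r`. The resulting
  -- homomorphisms are inverse to each other by the two identities for `invPoly`.
  have D0 := H.deform_sq ht (by omega) r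
  have D := H0.deform_invPoly ht (by omega) r
  rw [sub_self] at D0
  rw [zero_sub, CharTwo.neg_eq] at D
  obtain ⟨φ, φ0, φ1, φα, φβ, φγ, φη⟩ := exists_lift D (by omega)
  obtain ⟨ψ, ψ0, ψ1, ψα, ψβ, ψγ, ψη⟩ := exists_lift D0 (by omega)
  have hp := H.h_pow one_ne_zero (by omega)
  have hp0 := H0.h_pow one_ne_zero (by omega)
  have hbb : ∀ {s : K} {b h y : TwoBAlgebra K t s}, b * h * y = 0 → b * y = b * h →
      b + r • (b * h) + r • ((b + r • (b * h)) * y) = b := by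
    intro s b h y h1 h2
    rw [add_mul, smul_mul_assoc, h1, h2, smul_zero, add_zero, add_assoc, ← add_smul,
      CharTwo.add_self_eq_zero, zero_smul, add_zero]
  have e1 : φ.comp ψ = AlgHom.id K _ := by
    refine algHom_ext (φ := φ.comp ψ) ?_ ?_ ?_ ?_ ?_ ?_ <;>
      simp only [AlgHom.comp_apply, AlgHom.id_apply]
    · rw [ψ0, φ0]
    · rw [ψ1, φ1]
    · rw [ψα, φα]
    · rw [ψβ, map_add, map_smul, map_mul, φβ, φη]
      exact hbb (H0.b_h_invPoly r _) (H0.b_invPoly (by omega) r)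
    · rw [ψγ, φγ]
    · rw [ψη, map_add, map_smul, map_pow, φη]
      exact aeval_invPoly_add_sq hp0 r
  have e2 : ψ.comp φ = AlgHom.id K _ := by
    refine algHom_ext (φ := ψ.comp φ) ?_ ?_ ?_ ?_ ?_ ?_ <;>
      simp only [AlgHom.comp_apply, AlgHom.id_apply]
    · rw [φ0, ψ0]
    · rw [φ1, ψ1]
    · rw [φα, ψα]
    · rw [φβ, map_add, map_smul, map_mul, ψβ, ψη]
      refine hbb ?_ ?_
      · rw [mul_add, H.b_h_h, mul_smul_comm, pow_two, ← mul_assoc, H.b_h_h, zero_mul, smul_zero,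
          add_zero]
      · rw [mul_add, mul_smul_comm, pow_two, ← mul_assoc, H.b_h_h, smul_zero, add_zero]
    · rw [φγ, ψγ]
    · rw [φη, ← Polynomial.aeval_algHom_apply, ψη]
      exact aeval_add_sq_invPoly hp r
  exact ⟨AlgEquiv.ofAlgHom φ ψ e1 e2⟩

end TwoBAlgebra

namespace TriangulationQuiver

/-! ### Disc algebras as algebras `Q(2B)₃ᵗ` -/

section DiscRep

variable {V E : Type*} [Fintype V] {Q : TriangulationQuiver V E} {K : Type*} [Field K]
variable {w : Q.WeightFunction} {c : Q.ParameterFunction K} {β : E → K} {α : E}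

theorem f_g_bar_ne_of_disc (hα : Q.f α = α) (h3 : w.len α = 3) :
    Q.f (Q.g (Q.bar α)) ≠ Q.g (Q.bar α) := by
  rw [f_g_bar_of_disc hα h3]
  intro h
  apply tgt_bar_of_border hα
  have h5 := congrArg Q.tgt h
  rwa [tgt_g_bar_of_disc hα h3] at h5

/-- In a disc no arrow is virtual, so none of the exceptions to the zero relations occurs. -/
theorem TraceModel.isDiscRep {A : Type*} [Ring A] [Algebra K A] (S : TraceModel w c β A)
    (hα : Q.f α = α) (h3 : w.len α = 3) :
    IsDiscRep (w.len (Q.f (Q.bar α))) (c.c α) (c.c (Q.f (Q.bar α))) (β α) (S.e (Q.src α))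
      (S.e (Q.tgt (Q.bar α))) (S.p [α]) (S.p [Q.bar α]) (S.p [Q.g (Q.bar α)])
      (S.p [Q.f (Q.bar α)]) := by
  classical
  have tα := Q.tgt_eq_of_f_eq hα
  have tγ := tgt_g_bar_of_disc hα h3
  have tη := tgt_f_bar_of_disc hα h3
  have hij := tgt_bar_of_border hα
  have hb := w.len_bar_of_border hα
  have ht := three_le_len_f_bar_of_disc hα h3
  have hfη := f_f_bar_of_disc hα h3
  have hfγ := f_g_bar_of_disc hα h3
  have hgη := g_f_bar_of_disc hα h3
  have hggβ := g_g_bar_of_disc hα h3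
  have hgα := g_of_border hα
  have hlen : ∀ x, w.len x ≠ 2 := fun x => by
    rcases len_of_disc hα h3 x with h | h
    · omega
    · rw [h]; omega
  have hnp : ∀ x, ¬ w.Pent x := fun x h => hlen _ h.1
  have hm : ∀ x y : E, S.p [x] * S.p [y] = S.p [x, y] := fun x y => (S.p_append [x] [y]).symm
  have hm' : ∀ x y z : E, S.p [x] * S.p [y] * S.p [z] = S.p [x, y, z] := fun x y z => by
    rw [hm, ← p_append]; rfl
  have hz1 : ∀ x, S.p [x, Q.f x, Q.g (Q.f x)] = 0 := fun x => S.p_zero_fg (by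
    rintro (h | h); exacts [hlen _ h, hnp _ h])
  have hz2 : ∀ x, S.p [x, Q.g x, Q.f (Q.g x)] = 0 := fun x => S.p_zero_gf (by
    rintro (h | h); exacts [hlen _ h, hnp _ h])
  exact {
    e₀_e₀ := S.e_mul_self _
    e₁_e₁ := S.e_mul_self _
    e₀_e₁ := S.e_mul_ne hij.symm
    e₁_e₀ := S.e_mul_ne hij
    sum := by
      have h1 : (Finset.univ : Finset V) = {Q.src α, Q.tgt (Q.bar α)} := by
        ext v; simpa using vertex_of_disc hα h3 v
      rw [← S.sum_e, h1, Finset.sum_pair hij.symm]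
    e_a := S.e_mul_x α
    a_e := by conv_lhs => rw [← tα, S.x_mul_e]
    e_b := by rw [← Q.src_bar, S.e_mul_x]
    b_e := S.x_mul_e _
    e_g := by rw [← Q.src_g, S.e_mul_x]
    g_e := by rw [← tγ, S.x_mul_e]
    e_h := by rw [← Q.src_f, S.e_mul_x]
    h_e := by rw [← tη, S.x_mul_e]
    b_h := by
      have := S.p_triangle_of_len_three (f_bar_of_border hα) (by rw [Q.bar_bar, h3])
      rw [Q.bar_bar, hgα] at this
      rw [hm, hm, this]
    h_g := by
      have h6 : Q.bar (Q.f (Q.bar α)) = Q.g (Q.bar α) := rfl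
      have := S.p_triangle_of_len_three (a := Q.f (Q.bar α)) (by rw [hfη]; exact Q.g_ne_f _)
        (by rw [h6, w.len_g]; omega)
      rw [hfη, h6, hggβ, c.c_g, c.c_bar_of_border hα] at this
      rw [hm, hm, this]
    g_b := by
      have := S.p_triangle (f_g_bar_ne_of_disc hα h3)
      rwa [hfγ, bar_g, S.p_gWord_of_g_eq hgη, ← hm] at this
    a_a := by
      have h1 : Q.gWord (Q.bar α) (3 - 1) = [Q.bar α, Q.g (Q.bar α)] := rfl
      have h2 : Q.gWord (Q.bar α) 3 = [Q.bar α, Q.g (Q.bar α), α] := by rw [gWord_three, hggβ]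
      rw [hm, S.p_border_border_eq hα, h3, h1, h2, hm, ← p_append]
      rfl
    a_a_b := by rw [hm', S.p_border_border_bar hα]
    g_a_a := by
      have := hz2 (Q.g (Q.bar α))
      rwa [hggβ, hα, ← hm'] at this
    b_g_b := by
      have := hz2 (Q.bar α)
      rwa [hfγ, ← hm'] at this
    g_b_g := by
      have := hz1 (Q.g (Q.bar α))
      rwa [hfγ, ← hm'] at this }

open PathAlgebra in
theorem algHom_ext_of_disc (hα : Q.f α = α) (h3 : w.len α = 3) {b : Q.border → K} {B : Type*}
    [Semiring B] [Algebra K B] {φ ψ : Q.DeformedAlgebra w c b →ₐ[K] B}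
    (h0 : φ ((deformedModel w c b).e (Q.src α)) = ψ ((deformedModel w c b).e (Q.src α)))
    (h1 : φ ((deformedModel w c b).e (Q.tgt (Q.bar α))) =
      ψ ((deformedModel w c b).e (Q.tgt (Q.bar α))))
    (ha : φ ((deformedModel w c b).p [α]) = ψ ((deformedModel w c b).p [α]))
    (hb : φ ((deformedModel w c b).p [Q.bar α]) = ψ ((deformedModel w c b).p [Q.bar α]))
    (hg : φ ((deformedModel w c b).p [Q.g (Q.bar α)]) =
      ψ ((deformedModel w c b).p [Q.g (Q.bar α)]))
    (hh : φ ((deformedModel w c b).p [Q.f (Q.bar α)]) =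
      ψ ((deformedModel w c b).p [Q.f (Q.bar α)])) : φ = ψ := by
  apply RingQuot.ringQuot_ext'
  refine PathAlgebra.algHom_ext (fun v => ?_) fun x => ?_
  · rcases vertex_of_disc hα h3 v with rfl | rfl
    exacts [h0, h1]
  · have key : ∀ y : E, φ ((deformedModel w c b).p [y]) = ψ ((deformedModel w c b).p [y]) →
        (φ.comp (RingQuot.mkAlgHom K _)) (arrow K Q.src Q.tgt y) =
        (ψ.comp (RingQuot.mkAlgHom K _)) (arrow K Q.src Q.tgt y) := by
      intro y hy
      have h2 : (deformedModel w c b).p [y] =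
          RingQuot.mkAlgHom K _ (arrow K Q.src Q.tgt y) := by
        change RingQuot.mkAlgHom K _ (word K Q.src Q.tgt [y]) = _
        rw [word_cons]; simp [word]
      rw [h2] at hy
      exact hy
    rcases arrow_of_disc hα h3 x with rfl | rfl | rfl | rfl
    exacts [key _ ha, key _ hb, key _ hg, key _ hh]

open PathAlgebra in
theorem exists_lift_of_disc (hα : Q.f α = α) (h3 : w.len α = 3) {b : Q.border → K} {B : Type*}
    [Ring B] [Algebra K B] {e₀ e₁ x₁ x₂ x₃ x₄ : B}
    (H : IsDiscRep (w.len (Q.f (Q.bar α))) (c.c α) (c.c (Q.f (Q.bar α))) (borderValue b α)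
      e₀ e₁ x₁ x₂ x₃ x₄) :
    ∃ φ : Q.DeformedAlgebra w c b →ₐ[K] B, φ ((deformedModel w c b).e (Q.src α)) = e₀ ∧
      φ ((deformedModel w c b).e (Q.tgt (Q.bar α))) = e₁ ∧ φ ((deformedModel w c b).p [α]) = x₁ ∧
      φ ((deformedModel w c b).p [Q.bar α]) = x₂ ∧
      φ ((deformedModel w c b).p [Q.g (Q.bar α)]) = x₃ ∧
      φ ((deformedModel w c b).p [Q.f (Q.bar α)]) = x₄ := by
  classical
  have tα := Q.tgt_eq_of_f_eq hα
  have tγ := tgt_g_bar_of_disc hα h3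
  have tη := tgt_f_bar_of_disc hα h3
  have hij := tgt_bar_of_border hα
  have hb := w.len_bar_of_border hα
  have ht := three_le_len_f_bar_of_disc hα h3
  have hfη := f_f_bar_of_disc hα h3
  have hfγ := f_g_bar_of_disc hα h3
  have hgη := g_f_bar_of_disc hα h3
  have hggβ := g_g_bar_of_disc hα h3
  have hgα := g_of_border hα
  have hbη : Q.bar (Q.f (Q.bar α)) = Q.g (Q.bar α) := rfl
  let e : V → B := fun v => if v = Q.src α then e₀ else e₁
  let x : E → B := fun y => if y = α then x₁ else if y = Q.bar α then x₂ else
    if y = Q.g (Q.bar α) then x₃ else x₄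
  have he0 : e (Q.src α) = e₀ := if_pos rfl
  have he1 : e (Q.tgt (Q.bar α)) = e₁ := if_neg hij
  have hx1 : x α = x₁ := if_pos rfl
  have hx2 : x (Q.bar α) = x₂ := by
    change (if _ then _ else _) = _
    rw [if_neg (Q.bar_ne α), if_pos rfl]
  have hsne : ∀ y, Q.src y = Q.tgt (Q.bar α) → y ≠ α ∧ y ≠ Q.bar α := by
    intro y hy
    constructor
    · rintro rfl; exact hij hy.symm
    · rintro rfl; rw [Q.src_bar] at hy; exact hij hy.symm
  have hx3 : x (Q.g (Q.bar α)) = x₃ := by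
    have := hsne (Q.g (Q.bar α)) (Q.src_g _)
    change (if _ then _ else _) = _
    rw [if_neg this.1, if_neg this.2, if_pos rfl]
  have hx4 : x (Q.f (Q.bar α)) = x₄ := by
    have := hsne (Q.f (Q.bar α)) (Q.src_f _)
    change (if _ then _ else _) = _
    rw [if_neg this.1, if_neg this.2, if_neg (Q.g_ne_f _).symm]
  have hv := vertex_of_disc hα h3
  have ha := arrow_of_disc hα h3
  obtain ⟨φ, φe, φx⟩ := PathAlgebra.exists_lift (K := K) (src := Q.src) (tgt := Q.tgt) (e := e)
    (x := x)
    (by intro v; rcases hv v with rfl | rfl; exacts [by rw [he0, H.e₀_e₀], by rw [he1, H.e₁_e₁]])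
    (by
      intro u v huv
      rcases hv u with rfl | rfl <;> rcases hv v with rfl | rfl
      · exact absurd rfl huv
      · rw [he0, he1, H.e₀_e₁]
      · rw [he0, he1, H.e₁_e₀]
      · exact absurd rfl huv)
    (by
      have h1 : (Finset.univ : Finset V) = {Q.src α, Q.tgt (Q.bar α)} := by
        ext v; simpa using hv v
      rw [h1, Finset.sum_pair hij.symm, he0, he1, H.sum])
    (by
      intro y
      rcases ha y with rfl | rfl | rfl | rfl
      · rw [he0, hx1, H.e_a]
      · rw [Q.src_bar, he0, hx2, H.e_b]
      · rw [Q.src_g, he1, hx3, H.e_g]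
      · rw [Q.src_f, he1, hx4, H.e_h])
    (by
      intro y
      rcases ha y with rfl | rfl | rfl | rfl
      · rw [tα, he0, hx1, H.a_e]
      · rw [he1, hx2, H.b_e]
      · rw [tγ, he0, hx3, H.g_e]
      · rw [tη, he1, hx4, H.h_e])
  have φw : ∀ l, φ (word K Q.src Q.tgt l) = (l.map x).prod := by
    intro l
    rw [word, map_list_prod, List.map_map]
    congr 1
    exact List.map_congr_left fun y _ => φx y
  have φpow : ∀ k, φ (word K Q.src Q.tgt (Q.gWord (Q.f (Q.bar α)) k)) = x₄ ^ k := by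
    intro k
    rw [φw]
    induction k with
    | zero => rw [gWord_zero, List.map_nil, List.prod_nil, pow_zero]
    | succ k ih => rw [gWord_succ, hgη, List.map_cons, List.prod_cons, ih, hx4, pow_succ']
  have φQ : ∀ y, φ (Q.x K y) = x y := φx
  have hr : ∀ ⦃y z⦄, DeformedRel Q w c b y z → φ y = φ z := by
    rintro y z (⟨y, h⟩ | ⟨y, h⟩ | ⟨y, h⟩ | ⟨y, h⟩)
    · rw [pathA_eq_word, map_mul, map_smul, φQ, φQ]
      rcases ha y with rfl | rfl | rfl | rfl
      · exact absurd hα h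
      · rw [Q.bar_bar, h3, hx2, hx4, H.b_h, φw]
        simp [gWord_succ, gWord_zero, hgα, hx1, hx2]
      · rw [hfγ, bar_g, φpow, hx3, hx2, H.g_b]
      · rw [hfη, hbη, c.c_g, c.c_bar_of_border hα, w.len_g, hb, h3, hx4, hx3, H.h_g, φw]
        simp [gWord_succ, gWord_zero, hggβ, hx1, hx3]
    · have hy : y = α := by
        rcases ha y with rfl | rfl | rfl | rfl
        · rfl
        · exact absurd h (f_bar_of_border hα)
        · exact absurd h (f_g_bar_ne_of_disc hα h3)
        · rw [hfη] at h; exact absurd h (Q.g_ne_f _)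
      subst hy
      have hbv : borderValue b y = b ⟨Q.src y, y, h, rfl⟩ := by rw [borderValue, dif_pos h]
      rw [← hbv, pathA_eq_word, pathB_eq_word, map_mul, map_add, map_smul, map_smul, φQ, hb, h3,
        hx1, H.a_a, φw, φw, c.c_bar_of_border hα]
      simp [gWord_succ, gWord_zero, hggβ, hx1, hx2, hx3, mul_assoc]
    · rw [map_mul, map_mul, map_zero, φQ, φQ, φQ]
      rcases ha y with rfl | rfl | rfl | rfl
      · rw [hα, hgα, hx1, hx2, H.a_a_b]
      · rw [hgη, hx2, hx4, H.b_h_h]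
      · rw [hfγ, hx2, hx3, H.g_b_g]
      · rw [hfη, hggβ, hx4, hx3, hx1, H.h_g_a]
    · rw [map_mul, map_mul, map_zero, φQ, φQ, φQ]
      rcases ha y with rfl | rfl | rfl | rfl
      · rw [hgα, hx1, hx2, hx4, H.a_b_h]
      · rw [hfγ, hx2, hx3, H.b_g_b]
      · rw [hggβ, hα, hx3, hx1, H.g_a_a]
      · rw [hgη, hfη, hx4, hx3, H.h_h_g]
  have φp : ∀ y, RingQuot.liftAlgHom K ⟨φ, hr⟩ ((deformedModel w c b).p [y]) = x y := by
    intro y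
    change RingQuot.liftAlgHom K ⟨φ, hr⟩ (RingQuot.mkAlgHom K _ (word K Q.src Q.tgt [y])) = x y
    rw [RingQuot.liftAlgHom_mkAlgHom_apply, φw]; simp
  have φv : ∀ v, RingQuot.liftAlgHom K ⟨φ, hr⟩ ((deformedModel w c b).e v) = e v := by
    intro v
    change RingQuot.liftAlgHom K ⟨φ, hr⟩ (RingQuot.mkAlgHom K _ _) = e v
    rw [RingQuot.liftAlgHom_mkAlgHom_apply, φe]
  refine ⟨RingQuot.liftAlgHom K ⟨φ, hr⟩, ?_, ?_, ?_, ?_, ?_, ?_⟩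
  · rw [φv, he0]
  · rw [φv, he1]
  · rw [φp, hx1]
  · rw [φp, hx2]
  · rw [φp, hx3]
  · rw [φp, hx4]

open TwoBArrow TwoBAlgebra in
/-- The socle deformed weighted surface algebra of a disc is one of the algebras `Q(2B)₃ᵗ`. -/
theorem nonempty_algEquiv_of_disc [IsAlgClosed K] (hα : Q.f α = α) (h3 : w.len α = 3)
    (h4 : 4 ≤ w.len (Q.f (Q.bar α))) (b : Q.border → K) :
    ∃ r : K, (r = 0 ↔ borderValue b α = 0) ∧
      Nonempty (Q.DeformedAlgebra w c b ≃ₐ[K] TwoBAlgebra K (w.len (Q.f (Q.bar α))) r) := by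
  set t := w.len (Q.f (Q.bar α)) with ht
  have hc := c.c_ne α
  have hd := c.c_ne (Q.f (Q.bar α))
  set k := c.c α with hk
  set d := c.c (Q.f (Q.bar α)) with hdd
  -- Rescaling both parameters to `1` requires `q = k s`, `u = d q ^ (t - 1)` and `s² = k u`.
  -- Elimination gives `s ^ (t - 3) = (d k ^ t)⁻¹`, which is solvable since `t > 3`.
  obtain ⟨s, hs⟩ := IsAlgClosed.exists_pow_nat_eq (d * k ^ t)⁻¹ (n := t - 3) (by omega)
  have hs0 : s ≠ 0 := by
    rintro rfl
    rw [zero_pow (by omega)] at hs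
    exact inv_ne_zero (mul_ne_zero hd (pow_ne_zero _ hc)) hs.symm
  set q := k * s with hq
  have hq0 : q ≠ 0 := mul_ne_zero hc hs0
  set u := d * q ^ (t - 1) with hu
  have hu0 : u ≠ 0 := mul_ne_zero hd (pow_ne_zero _ hq0)
  have hsu : s ^ 2 = k * u := by
    have h5 : s ^ (t - 1) = s ^ 2 * s ^ (t - 3) := by rw [← pow_add]; congr 1; omega
    have h6 : k ^ t = k * k ^ (t - 1) := by rw [← pow_succ']; congr 1; omega
    have h7 : k ^ (t - 1) ≠ 0 := pow_ne_zero _ hc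
    rw [hu, hq, mul_pow, h5, hs, h6]
    field_simp
  set r := borderValue b α * u / s with hr
  refine ⟨r, ?_, ?_⟩
  · rw [hr, div_eq_zero_iff, mul_eq_zero]
    tauto
  have H := (deformedModel w c b).isDiscRep hα h3
  rw [← ht, ← hk, ← hdd] at H
  have H' := TwoBAlgebra.isDiscRep K t r
  have D := H.smul (s := s⁻¹) (u := u⁻¹) (v := 1) (q := q⁻¹) (c' := 1) (d' := 1) (r' := r)
    (by rw [hq]; field_simp) (by rw [inv_pow, hu]; field_simp)
    (by rw [inv_pow, hsu]; field_simp) (by rw [hr]; field_simp)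
  have D' := H'.smul (s := s) (u := u) (v := 1) (q := q) (c' := k) (d' := d)
    (r' := borderValue b α) (by rw [hq]; ring) (by rw [hu]; ring) (by rw [hsu]; ring)
    (by rw [hr]; field_simp)
  obtain ⟨φ, φ0, φ1, φa, φb, φg, φh⟩ := exists_lift_of_disc (b := b) hα h3 D'
  obtain ⟨ψ, ψ0, ψ1, ψa, ψb, ψg, ψh⟩ := TwoBAlgebra.exists_lift D (by omega)
  have e1 : φ.comp ψ = AlgHom.id K _ := by
    refine TwoBAlgebra.algHom_ext (φ := φ.comp ψ) ?_ ?_ ?_ ?_ ?_ ?_ <;>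
      simp only [AlgHom.comp_apply, AlgHom.id_apply]
    · rw [ψ0, φ0]
    · rw [ψ1, φ1]
    · rw [ψa, map_smul, φa, smul_smul, inv_mul_cancel₀ hs0, one_smul]
    · rw [ψb, map_smul, φb, smul_smul, inv_mul_cancel₀ hu0, one_smul]
    · rw [ψg, map_smul, φg, smul_smul, one_mul, one_smul]
    · rw [ψh, map_smul, φh, smul_smul, inv_mul_cancel₀ hq0, one_smul]
  have e2 : ψ.comp φ = AlgHom.id K _ := by
    refine algHom_ext_of_disc (φ := ψ.comp φ) hα h3 ?_ ?_ ?_ ?_ ?_ ?_ <;>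
      simp only [AlgHom.comp_apply, AlgHom.id_apply]
    · rw [φ0, ψ0]
    · rw [φ1, ψ1]
    · rw [φa, map_smul, ψa, smul_smul, mul_inv_cancel₀ hs0, one_smul]
    · rw [φb, map_smul, ψb, smul_smul, mul_inv_cancel₀ hu0, one_smul]
    · rw [φg, map_smul, ψg, smul_smul, one_mul, one_smul]
    · rw [φh, map_smul, ψh, smul_smul, mul_inv_cancel₀ hq0, one_smul]
  exact ⟨AlgEquiv.ofAlgHom φ ψ e1 e2⟩

end DiscRep

end TriangulationQuiver

/-! ### The triangulation quiver of the disc -/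

namespace TwoBArrow

/-- The rotation `α ↦ α`, `β ↦ η ↦ γ ↦ β` of the arrows. -/
def rot : TwoBArrow → TwoBArrow
  | α => α
  | β => η
  | η => γ
  | γ => β

theorem rot_rot_rot (a : TwoBArrow) : rot (rot (rot a)) = a := by
  cases a <;> rfl

/-- The triangulation quiver of a disc whose boundary is one edge. -/
def disc : TriangulationQuiver (Fin 2) TwoBArrow where
  src := src
  tgt := tgt
  two_out v := by
    rw [Set.ncard_eq_two]
    fin_cases v
    · exact ⟨α, β, by simp, by ext a; cases a <;> simp [src]⟩
    · exact ⟨γ, η, by simp, by ext a; cases a <;> simp [src]⟩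
  two_in v := by
    rw [Set.ncard_eq_two]
    fin_cases v
    · exact ⟨α, γ, by simp, by ext a; cases a <;> simp [tgt]⟩
    · exact ⟨β, η, by simp, by ext a; cases a <;> simp [tgt]⟩
  connected u v := by
    have h01 : Relation.EqvGen (fun x y => ∃ a, src a = x ∧ tgt a = y) 0 1 := .rel _ _ ⟨β, rfl, rfl⟩
    fin_cases u <;> fin_cases v
    · exact .refl _
    · exact h01
    · exact .symm _ _ h01
    · exact .refl _
  two_vertices := ⟨0, 1, by simp⟩
  f := ⟨rot, fun a => rot (rot a), rot_rot_rot, rot_rot_rot⟩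
  src_f a := by cases a <;> rfl
  f_cubed := by ext a; exact rot_rot_rot a

theorem disc_bar (a : TwoBArrow) :
    disc.bar a = match a with | α => β | β => α | γ => η | η => γ := by
  have h1 := disc.bar_ne a
  have h2 : src (disc.bar a) = src a := disc.src_bar a
  generalize disc.bar a = b at *
  cases a <;> cases b <;> simp_all [src]

theorem disc_g (a : TwoBArrow) :
    disc.g a = match a with | α => β | β => γ | γ => α | η => η := by
  rw [TriangulationQuiver.g, disc_bar]
  cases a <;> rfl

theorem disc_n_eta : disc.n η = 1 :=
  Function.minimalPeriod_eq_one_iff_isFixedPt.2 (disc_g η)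

theorem disc_n_of_ne {a : TwoBArrow} (h : a ≠ η) : disc.n a = 3 := by
  have : Fact (Nat.Prime 3) := ⟨Nat.prime_three⟩
  refine Function.minimalPeriod_eq_prime ?_ ?_
  · cases a <;> simp_all [Function.IsPeriodicPt, Function.IsFixedPt, disc_g]
  · cases a <;> simp_all [Function.IsFixedPt, disc_g]

open Classical in
/-- The weight function of the disc with value `t` at the loop `η` and value `1` elsewhere. -/
noncomputable def discWeight (t : ℕ) (ht : 4 ≤ t) : disc.WeightFunction :=
  -- This rules out virtual arrows, so the bounds next to virtual arrows impose nothing further.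
  have key (a : TwoBArrow) : 3 ≤ (if a = η then t else 1) * disc.n a := by
    split_ifs with h
    · rw [h, disc_n_eta]; omega
    · rw [disc_n_of_ne h]
  { m := fun a => if a = η then t else 1
    m_g := fun a => by rw [disc_g]; cases a <;> simp
    m_pos := fun a => by split_ifs <;> omega
    two_le := fun a => (by omega : 2 ≤ 3).trans (key a)
    three_le := fun a _ _ => key a
    four_le := fun a h => absurd (key (disc.bar a)) (by omega) }

variable (K : Type*) [Field K]

/-- The parameter function of the disc with constant value `1`. -/
def discParameter : disc.ParameterFunction K where
  c _ := 1
  c_g _ := rfl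
  c_ne _ := one_ne_zero

end TwoBArrow

namespace TwoBAlgebra

open TwoBArrow TriangulationQuiver

variable (K : Type*) [Field K] [IsAlgClosed K]

/-- The algebra `Q(2B)₃ᵗ(0)` is the weighted surface algebra of a disc. -/
theorem nonempty_algEquiv_disc (t : ℕ) (ht : 4 ≤ t) :
    Nonempty (disc.DeformedAlgebra (discWeight t ht) (discParameter K) 0 ≃ₐ[K]
      TwoBAlgebra K t 0) := by
  have h3 : (discWeight t ht).len α = 3 := by
    rw [WeightFunction.len, disc_n_of_ne (by simp)]
    simp [discWeight]
  have ht' : (discWeight t ht).len (disc.f (disc.bar α)) = t := by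
    have h : disc.f (disc.bar α) = η := by rw [disc_bar]; rfl
    rw [h, WeightFunction.len, disc_n_eta]
    simp [discWeight]
  obtain ⟨r, hr, e⟩ := nonempty_algEquiv_of_disc (Q := disc) (w := discWeight t ht)
    (c := discParameter K) (α := α) rfl h3 (by rw [ht']; exact ht) 0
  rw [hr.2 (by simp [borderValue]), ht'] at e
  exact e

end TwoBAlgebra

/-! ### Conclusion -/

namespace TriangulationQuiver

variable {V E : Type*} [Fintype V] {Q : TriangulationQuiver V E} {K : Type*} [Field K]
variable {w : Q.WeightFunction} {c : Q.ParameterFunction K}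

theorem exists_borderValue_ne_zero {b : Q.border → K} (hb : b ≠ 0) :
    ∃ α, Q.f α = α ∧ borderValue b α ≠ 0 := by
  obtain ⟨⟨v, α, hα, rfl⟩, hv⟩ := Function.ne_iff.1 hb
  refine ⟨α, hα, ?_⟩
  rw [borderValue, dif_pos hα]
  exact hv

/-- If a socle deformed weighted surface algebra in characteristic two is a weighted surface algebra
and its border function does not vanish at the border loop `α`, then it belongs to a disc with an
even weight at the inner loop. -/
theorem disc_of_isWeightedSurfaceAlgebra [IsAlgClosed K] [CharP K 2] {b : Q.border → K} {α : E}
    (hα : Q.f α = α) (hb : borderValue b α ≠ 0)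
    (h : IsWeightedSurfaceAlgebra K (Q.DeformedAlgebra w c b)) :
    w.len α = 3 ∧ Even (w.len (Q.f (Q.bar α))) := by
  obtain ⟨V', E', _, Q', w', c', ⟨φ⟩⟩ := h
  obtain ⟨A, _, _, S, S', σ, he, hJ⟩ := exists_pair_of_algEquiv b 0 φ
  have hC : TraceModel.Compatible S S' σ := ⟨he, hJ⟩
  exact hC.disc_of_border_ne_zero hα hb fun ρ => by simp [borderValue]

end TriangulationQuiver

theorem theorem1p3 {K : Type*} [Field K] [IsAlgClosed K] [CharP K 2]
    {V E : Type*} [Fintype V] (Q : TriangulationQuiver V E)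
    (w : Q.WeightFunction) (c : Q.ParameterFunction K) (b : Q.border → K) (hb : b ≠ 0) :
    (3 ≤ Fintype.card V → ¬ IsWeightedSurfaceAlgebra K (Q.DeformedAlgebra w c b)) ∧
    (Fintype.card V = 2 →
      (IsWeightedSurfaceAlgebra K (Q.DeformedAlgebra w c b) ↔
        ∃ (t : ℕ) (b' : K), 4 ≤ t ∧ Even t ∧ b' ≠ 0 ∧
          Nonempty (Q.DeformedAlgebra w c b ≃ₐ[K] TwoBAlgebra K t b'))) := by
  obtain ⟨α, hα, hbα⟩ := TriangulationQuiver.exists_borderValue_ne_zero hb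
  refine ⟨fun hV h => ?_, fun _ => ⟨fun h => ?_, ?_⟩⟩
  · classical
    obtain ⟨h3, -⟩ := TriangulationQuiver.disc_of_isWeightedSurfaceAlgebra hα hbα h
    have hsub : (Finset.univ : Finset V) ⊆ {Q.src α, Q.tgt (Q.bar α)} := fun v _ => by
      simpa using TriangulationQuiver.vertex_of_disc hα h3 v
    have := (Finset.card_le_card hsub).trans Finset.card_le_two
    rw [Finset.card_univ] at this
    omega
  · obtain ⟨h3, ht⟩ := TriangulationQuiver.disc_of_isWeightedSurfaceAlgebra hα hbα h
    have h4 : 4 ≤ w.len (Q.f (Q.bar α)) := by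
      have := TriangulationQuiver.three_le_len_f_bar_of_disc hα h3
      obtain ⟨k, hk⟩ := ht
      omega
    obtain ⟨r, hr, e⟩ := TriangulationQuiver.nonempty_algEquiv_of_disc (c := c) hα h3 h4 b
    exact ⟨_, r, h4, ht, fun h0 => hbα (hr.1 h0), e⟩
  · rintro ⟨t, b', h4, ht, -, ⟨e⟩⟩
    obtain ⟨e'⟩ := TwoBAlgebra.nonempty_algEquiv_zero ht h4 b'
    obtain ⟨e''⟩ := TwoBAlgebra.nonempty_algEquiv_disc K t h4
    exact ⟨_, _, _, _, _, _, ⟨(e.trans e').trans e''.symm⟩⟩
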